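/- For lower-layer weights $b_1,\dots,b_n\in\mathbb{R}^d$ and top-layer weights $\alpha\in\mathbb{R}^n$ let $f_\alpha(x)=\sum_{j=1}^n\alpha_j\max(0,x^{T}b_j)$ be the function computed by a two-layer ReLU network with $n$ units. For examples $a_1,\dots,a_m\in\mathbb{R}^d$ with labels $y_1,\dots,y_m\in\{-1,1\}$ and a function $l:\mathbb{R}\to\mathbb{R}$, the empirical risk is $R(\alpha)=\sum_{i=1}^m l(y_i f_\alpha(a_i))$. Let $l$ be the logistic loss $l(x)=\frac{1}{\ln 2}\ln(1+e^{-x})$ or the hinge loss $l(x)=\max(0,1-x)$. 1. (Hardness.) Assume the Strong Exponential Time Hypothesis (SETH): for every $\delta'<1$ there is a $k$ such that no algorithm decides satisfiability of $k$-CNF formulas with $N$ variables and $M$ clauses in time $O(2^{\delta' N}\cdot\mathrm{poly}(N+M))$. Then computing the gradient $\nabla_\alpha R(\alpha)$ for $n$ units and $m$ examples takes time $(nm)^{1-o(1)}$ in every dimension $d=\omega(\log n)$. Precisely, let $m=m(n)\ge 1$ and $d=d(n)$ be arbitrary functions with $d(n)/\log n\to\infty$, let $K\ge 2$ be an integer and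 $0\le\delta\le\frac14$. Consider any algorithm that, given the sizes $n,m,d$ and integer data $\alpha$, $b_j$, $a_i$ with all entries in $\{-K,\dots,K\}$ and labels $y_i\in\{-1,1\}$ such that $R$ is differentiable at $\alpha$, outputs rational numbers (numerators and positive denominators) that approximate the entries of $\nabla R(\alpha)$ up to an additive error of at most $\delta$ each. Then for every $\varepsilon>0$ its worst-case running time on such inputs with $n$ units, $m(n)$ examples and dimension $d(n)$ is not $O((n\,m(n))^{1-\varepsilon})$ as $n\to\infty$. Algorithms, both here and in SETH, are deterministic programs of a random access machine over the integers whose running time is measured by the logarithmic cost criterion (a step is charged by the bit lengths of the numbers and addresses involved). 2. (Orthogonal pairs.) The function $l$ is differentiable at $0$ and $l'(0)\neq 0$. Moreover, for any binary vectors $a_1,\dots,a_m\in\{0,1\}^d$ and $b_1,\dots,b_n\in\{0,1\}^d$, consider the network in dimension $d+1$ with lower-layer weights $(-2b_j,1)$, so that its units compute $\max(0,1-2a^{T}b_j)$ on the input $(a,1)$, and the examples $(a_i,1)$ with labels $y_i=1$. At $\alpha=0$ the gradient of the empirical risk with respect to $\alpha$ exists, and the sum of its entries is $l'(0)$ times the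 number of pairs $(i,j)$ with $a_i^{T}b_j=0$. -/

import Mathlib

open Filter Topology

namespace FineGrained

/-! ### The machine model

A random access machine over the integers, programmed by while-programs, under the logarithmic cost
criterion: it has scalar registers and arrays (a program mentions only finitely many of each), and
every arithmetic operation, memory access and test is charged by the number of bits of the numbers
and addresses involved. -/

/-- The bit length of an integer, plus one. -/
def bits (z : ℤ) : ℕ := z.natAbs.size + 1

/-- Expressions: constants, registers, array cells, and integer arithmetic. -/
inductive Expr : Type
  | const (c : ℤ)
  | var (x : ℕ)
  | cell (a : ℕ) (i : Expr)
  | add (e f : Expr)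
  | sub (e f : Expr)
  | mul (e f : Expr)
  | div (e f : Expr)

/-- Programs. A test `e` succeeds when the value of `e` is positive. -/
inductive Prog : Type
  | skip
  | assign (x : ℕ) (e : Expr)
  | store (a : ℕ) (i e : Expr)
  | seq (p q : Prog)
  | ite (e : Expr) (p q : Prog)
  | while (e : Expr) (p : Prog)

/-- A memory: register `x` holds `reg x`, and the cell with index `i` of array `a` holds
`arr a i`. -/
structure Memory : Type where
  reg : ℕ → ℤ
  arr : ℕ → ℤ → ℤ

/-- The value of an expression (integer division, with `z / 0 = 0`). -/
def Expr.val (s : Memory) : Expr → ℤ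
  | .const c => c
  | .var x => s.reg x
  | .cell a i => s.arr a (i.val s)
  | .add e f => e.val s + f.val s
  | .sub e f => e.val s - f.val s
  | .mul e f => e.val s * f.val s
  | .div e f => e.val s / f.val s

/-- The cost of evaluating an expression: the bit lengths of all intermediate values, hence of all
operands, results and addresses. -/
def Expr.cost (s : Memory) : Expr → ℕ
  | .const c => bits c
  | .var x => bits (s.reg x)
  | .cell a i => i.cost s + bits (s.arr a (i.val s))
  | .add e f => e.cost s + f.cost s + bits (e.val s + f.val s)
  | .sub e f => e.cost s + f.cost s + bits (e.val s - f.val s)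
  | .mul e f => e.cost s + f.cost s + bits (e.val s * f.val s)
  | .div e f => e.cost s + f.cost s + bits (e.val s / f.val s)

/-- The memory after writing `z` to register `x`. -/
def Memory.setReg (s : Memory) (x : ℕ) (z : ℤ) : Memory :=
  { s with reg := Function.update s.reg x z }

/-- The memory after writing `z` to the cell with index `i` of array `a`. -/
def Memory.setCell (s : Memory) (a : ℕ) (i z : ℤ) : Memory :=
  { s with arr := Function.update s.arr a (Function.update (s.arr a) i z) }

/-- `Runs p s t s'`: the program `p`, started in memory `s`, halts with memory `s'` after time
`t`. -/
inductive Runs : Prog → Memory → ℕ → Memory → Prop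
  | skip (s : Memory) : Runs .skip s 1 s
  | assign (s : Memory) (x : ℕ) (e : Expr) :
      Runs (.assign x e) s (e.cost s + 1) (s.setReg x (e.val s))
  | store (s : Memory) (a : ℕ) (i e : Expr) :
      Runs (.store a i e) s (i.cost s + e.cost s + 1) (s.setCell a (i.val s) (e.val s))
  | seq {p q : Prog} {s s' s'' : Memory} {t t' : ℕ} :
      Runs p s t s' → Runs q s' t' s'' → Runs (.seq p q) s (t + t') s''
  | ite_pos {e : Expr} {p q : Prog} {s s' : Memory} {t : ℕ} :
      0 < e.val s → Runs p s t s' → Runs (.ite e p q) s (e.cost s + 1 + t) s'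
  | ite_neg {e : Expr} {p q : Prog} {s s' : Memory} {t : ℕ} :
      ¬ 0 < e.val s → Runs q s t s' → Runs (.ite e p q) s (e.cost s + 1 + t) s'
  | while_pos {e : Expr} {p : Prog} {s s' s'' : Memory} {t t' : ℕ} :
      0 < e.val s → Runs p s t s' → Runs (.while e p) s' t' s'' →
      Runs (.while e p) s (e.cost s + 1 + t + t') s''
  | while_neg {e : Expr} {p : Prog} {s : Memory} :
      ¬ 0 < e.val s → Runs (.while e p) s (e.cost s + 1) s

/-- The content of an array that stores a vector, zero outside the vector. -/
def storeVec {r : ℕ} (v : Fin r → ℤ) (t : ℤ) : ℤ :=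
  ∑ j : Fin r, if t = (j : ℤ) then v j else 0

/-- The content of an array that stores a matrix row by row, zero outside the matrix. -/
def storeMat {r c : ℕ} (X : Fin r → Fin c → ℤ) (t : ℤ) : ℤ :=
  ∑ j : Fin r, ∑ k : Fin c, if t = (j : ℤ) * c + k then X j k else 0

/-! ### The Strong Exponential Time Hypothesis -/

/-- A formula in conjunctive normal form with `N` variables and `M` clauses, each of them a
disjunction of `k` literals. A literal is a variable with a sign (`true` for the variable itself,
`false` for its negation); literals of a clause may coincide, so clauses with fewer than `k` distinct
literals are included. -/
structure KCNF (k : ℕ) : Type where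
  N : ℕ
  M : ℕ
  lit : Fin M → Fin k → Fin N × Bool

/-- Satisfiability: some assignment makes a literal of every clause true. -/
def KCNF.Satisfiable {k : ℕ} (φ : KCNF k) : Prop :=
  ∃ x : Fin φ.N → Bool, ∀ i : Fin φ.M, ∃ j : Fin k, x (φ.lit i j).1 = (φ.lit i j).2

/-- The `v`-th variable is encoded as `v + 1`, its negation as `-(v + 1)` (counting from zero). -/
def encodeLit {N : ℕ} (p : Fin N × Bool) : ℤ :=
  if p.2 then (p.1 : ℤ) + 1 else -((p.1 : ℤ) + 1)

/-- The input of a program that is run on a formula: the numbers of variables and clauses in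
registers `0` and `1`, the literals in array `0`, and zeros elsewhere. -/
def KCNF.input {k : ℕ} (φ : KCNF k) : Memory where
  reg x := match x with
    | 0 => φ.N
    | 1 => φ.M
    | _ => 0
  arr a := match a with
    | 0 => storeMat fun i j => encodeLit (φ.lit i j)
    | _ => fun _ => 0

/-- The Strong Exponential Time Hypothesis: for every `δ < 1` there is a `k` such that no algorithm
decides satisfiability of `k`-CNF formulas with `N` variables and `M` clauses in time
`O(2 ^ (δ N) · poly(N + M))`. The answer is yes if register `0` is positive in the end. -/
def SETH : Prop :=
  ∀ δ : ℝ, δ < 1 → ∃ k : ℕ, ¬ ∃ (p : Prog) (C : ℝ) (c : ℕ), ∀ φ : KCNF k,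
    ∃ (t : ℕ) (s : Memory), Runs p φ.input t s ∧ (0 < s.reg 0 ↔ φ.Satisfiable) ∧
      (t : ℝ) ≤ C * (2 : ℝ) ^ (δ * φ.N) * ((φ.N : ℝ) + φ.M + 1) ^ c

/-! ### Empirical risk of a two-layer ReLU network -/

/-- The logistic loss as a function of `y * f(a)`. -/
noncomputable def logisticLoss (x : ℝ) : ℝ := 1 / Real.log 2 * Real.log (1 + Real.exp (-x))

/-- The hinge loss as a function of `y * f(a)`. -/
noncomputable def hingeLoss (x : ℝ) : ℝ := max 0 (1 - x)

/-- The ReLU activation function. -/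
noncomputable def relu (z : ℝ) : ℝ := max 0 z

/-- The function computed by the network with `n` units, lower-layer weights `b` and top-layer
weights `α`. -/
noncomputable def network {n d : ℕ} (b : Fin n → Fin d → ℝ) (α : EuclideanSpace ℝ (Fin n))
    (a : Fin d → ℝ) : ℝ :=
  ∑ j : Fin n, α j * relu (∑ k : Fin d, a k * b j k)

/-- The empirical risk of the network on the examples `a i` with labels `y i`, as a function of the
top-layer weights. -/
noncomputable def empiricalRisk (l : ℝ → ℝ) {n m d : ℕ} (b : Fin n → Fin d → ℝ)
    (a : Fin m → Fin d → ℝ) (y : Fin m → ℝ) (α : EuclideanSpace ℝ (Fin n)) : ℝ :=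
  ∑ i : Fin m, l (y i * network b α (a i))

/-! ### The gradient problem -/

/-- Integer data for the gradient problem: a network with `n` units on `d` inputs, and `m` labelled
examples. -/
structure Instance (n m d : ℕ) : Type where
  α : Fin n → ℤ
  b : Fin n → Fin d → ℤ
  a : Fin m → Fin d → ℤ
  y : Fin m → ℤ
  label : ∀ i, y i = 1 ∨ y i = -1

namespace Instance

variable {n m d : ℕ}

/-- All entries of the data are at most `K` in absolute value. -/
def EntriesLE (I : Instance n m d) (K : ℕ) : Prop :=
  (∀ j, |I.α j| ≤ K) ∧ (∀ j k, |I.b j k| ≤ K) ∧ (∀ i k, |I.a i k| ≤ K)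

/-- `g` is the gradient of the empirical risk of the instance with respect to the top-layer weights,
at the top-layer weights of the instance. -/
def IsGradient (l : ℝ → ℝ) (I : Instance n m d) (g : EuclideanSpace ℝ (Fin n)) : Prop :=
  HasGradientAt
    (empiricalRisk l (fun j k => (I.b j k : ℝ)) (fun i k => (I.a i k : ℝ)) fun i => (I.y i : ℝ))
    g (WithLp.toLp 2 fun j => (I.α j : ℝ))

/-- The input of a program that is run on the instance: the sizes in registers `0`, `1`, `2`, the
data in arrays `0`, `1`, `2`, `3`, and zeros elsewhere. -/
def input (I : Instance n m d) : Memory where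
  reg x := match x with
    | 0 => n
    | 1 => m
    | 2 => d
    | _ => 0
  arr r := match r with
    | 0 => storeVec I.α
    | 1 => storeMat I.b
    | 2 => storeMat I.a
    | 3 => storeVec I.y
    | _ => fun _ => 0

end Instance

/-- In memory `s` the arrays `4` and `5` hold the numerators and the (positive) denominators of
rational numbers that approximate the entries of `g` up to an additive error `δ`. -/
def HoldsApprox {n : ℕ} (s : Memory) (g : EuclideanSpace ℝ (Fin n)) (δ : ℝ) : Prop :=
  ∀ j : Fin n, 0 < s.arr 5 (j : ℤ) ∧ |(s.arr 4 (j : ℤ) : ℝ) / (s.arr 5 (j : ℤ) : ℝ) - g j| ≤ δ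

/-- The program computes gradients of the empirical risk, with additive error at most `δ` in every
entry: it does so on all instances, of whatever size, whose entries are at most `K` in absolute value
and at which the empirical risk is differentiable. -/
def ComputesGradient (l : ℝ → ℝ) (K : ℕ) (δ : ℝ) (p : Prog) : Prop :=
  ∀ (n m d : ℕ) (I : Instance n m d) (g : EuclideanSpace ℝ (Fin n)),
    I.EntriesLE K → I.IsGradient l g → ∃ (t : ℕ) (s : Memory), Runs p I.input t s ∧ HoldsApprox s g δ

/-- `p` needs time `(n m) ^ (1 - o(1))` to compute the gradient for `n` units, `m n` examples and
dimension `d n`: its worst-case running time is not `O((n m) ^ (1 - ε))` for any `ε > 0`. The worst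
case is over the instances with entries at most `K` on which the gradient exists. -/
def NeedsAlmostProductTime (l : ℝ → ℝ) (K : ℕ) (m d : ℕ → ℕ) (p : Prog) : Prop :=
  ∀ ε : ℝ, 0 < ε → ∀ C : ℝ, ∃ᶠ n : ℕ in atTop,
    ∃ (I : Instance n (m n) (d n)) (g : EuclideanSpace ℝ (Fin n)) (t : ℕ) (s : Memory),
      I.EntriesLE K ∧ I.IsGradient l g ∧ Runs p I.input t s ∧
        C * ((n : ℝ) * m n) ^ (1 - ε) < t

/-! ### Orthogonal vectors -/

/-- The number of pairs of orthogonal vectors, one from each of two families of binary vectors. -/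
def orthogonalPairs {n m d : ℕ} (A : Fin m → Fin d → Bool) (B : Fin n → Fin d → Bool) : ℕ :=
  (Finset.univ.filter fun q : Fin m × Fin n =>
    ∑ k : Fin d, (A q.1 k).toNat * (B q.2 k).toNat = 0).card

/-- The instance with top-layer weights `0`, all labels `+1`, examples `(a, 1)` for `a` in `A`, and
lower-layer weights `(-2 b, 1)` for `b` in `B`, whose units compute `max 0 (1 - 2 aᵀb)`. -/
def ovInstance {n m d : ℕ} (A : Fin m → Fin d → Bool) (B : Fin n → Fin d → Bool) :
    Instance n m (d + 1) where
  α _ := 0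
  b j := Fin.snoc (α := fun _ => ℤ) (fun k => -2 * ((B j k).toNat : ℤ)) 1
  a i := Fin.snoc (α := fun _ => ℤ) (fun k => ((A i k).toNat : ℤ)) 1
  y _ := 1
  label _ := Or.inl rfl

end FineGrained

open FineGrained

namespace FineGrained

open Function Finset Memory

variable {L N K V F d k m n r a b c t t' w κ T T' X Y D x y q h C A v τ B cur cnt j R : ℕ}
  {s s' s₂ σ σ' : Memory} {p : Prog} {z : ℤ} {δ : ℝ} {l : ℝ → ℝ} {θ : ℕ → ℕ}
  {G : Finset (Multiset ℕ)} {Q : Memory → Prop} {ε : ℕ → ℤ} {M : ℕ → ℤ → ℤ} {H : Multiset ℕ}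

/-! ### Bit lengths -/

theorem bits_pos (z : ℤ) : 1 ≤ bits z := by unfold bits; omega

theorem bits_le_iff (z : ℤ) (v : ℕ) : bits z ≤ v + 1 ↔ z.natAbs < 2 ^ v := by
  unfold bits
  rw [Nat.add_le_add_iff_right, Nat.size_le]

theorem bits_mono {y : ℤ} (h : y.natAbs ≤ z.natAbs) : bits y ≤ bits z := by
  unfold bits
  exact Nat.add_le_add_right (Nat.size_le_size h) 1

theorem bits_of_abs_le (h : |z| < 2 ^ v) : bits z ≤ v + 1 :=
  (bits_le_iff z v).2 (by zify; exact h)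

theorem bits_zero : bits 0 = 1 := by simp [bits]

theorem bits_one : bits 1 = 2 := by simp [bits]

theorem two_le_bits (h : 0 < z) : 2 ≤ bits z :=
  bits_one ▸ bits_mono (by omega)

theorem bits_add (y z : ℤ) : bits (y + z) ≤ bits y + bits z := by
  have h1 : y.natAbs < 2 ^ y.natAbs.size := Nat.lt_size_self _
  have h2 : z.natAbs < 2 ^ z.natAbs.size := Nat.lt_size_self _
  have h3 : (y + z).natAbs < 2 ^ (y.natAbs.size + z.natAbs.size + 1) := by
    have h4 := Int.natAbs_add_le y z
    have h5 : 2 ^ y.natAbs.size ≤ 2 ^ (y.natAbs.size + z.natAbs.size) :=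
      Nat.pow_le_pow_right (by norm_num) (by omega)
    have h6 : 2 ^ z.natAbs.size ≤ 2 ^ (y.natAbs.size + z.natAbs.size) :=
      Nat.pow_le_pow_right (by norm_num) (by omega)
    rw [pow_succ]
    omega
  have := (bits_le_iff _ _).2 h3
  unfold bits at *
  omega

theorem bits_neg (z : ℤ) : bits (-z) = bits z := by simp [bits]

theorem bits_sub (y z : ℤ) : bits (y - z) ≤ bits y + bits z := by
  have := bits_add y (-z)
  rwa [bits_neg, ← sub_eq_add_neg] at this

theorem bits_mul (y z : ℤ) : bits (y * z) ≤ bits y + bits z := by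
  have h1 : y.natAbs < 2 ^ y.natAbs.size := Nat.lt_size_self _
  have h2 : z.natAbs < 2 ^ z.natAbs.size := Nat.lt_size_self _
  have h3 : (y * z).natAbs < 2 ^ (y.natAbs.size + z.natAbs.size) := by
    rw [Int.natAbs_mul, pow_add]
    exact Nat.mul_lt_mul'' h1 h2
  have := (bits_le_iff _ _).2 h3
  unfold bits at *
  omega

theorem bits_div (y z : ℤ) : bits (y / z) ≤ bits y :=
  bits_mono (Int.natAbs_ediv_le_natAbs y z)

theorem bits_natCast_le (n v : ℕ) (h : n < 2 ^ v) : bits (n : ℤ) ≤ v + 1 := by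
  rw [bits_le_iff]
  simpa using h

theorem bits_natCast_le_self (n : ℕ) : bits (n : ℤ) ≤ n + 1 :=
  bits_natCast_le n n Nat.lt_two_pow_self

/-! ### Costs of expressions -/

attribute [grind =] Expr.val Expr.cost

theorem Expr.bits_val_le_cost (s : Memory) (e : Expr) : bits (e.val s) ≤ e.cost s := by
  cases e <;> simp [Expr.val, Expr.cost]

/-- All registers and cells hold numbers of bit length at most `V`. -/
def Memory.BitsLE (s : Memory) (V : ℕ) : Prop :=
  (∀ x, bits (s.reg x) ≤ V) ∧ ∀ a i, bits (s.arr a i) ≤ V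

/-- A factor by which the cost of an expression may exceed the bit lengths in the memory. -/
def Expr.factor : Expr → ℕ
  | .const c => bits c
  | .var _ => 1
  | .cell _ i => i.factor + 1
  | .add e f => 2 * (e.factor + f.factor)
  | .sub e f => 2 * (e.factor + f.factor)
  | .mul e f => 2 * (e.factor + f.factor)
  | .div e f => 2 * (e.factor + f.factor)

theorem Expr.cost_le_factor (hV : 1 ≤ V) (h : s.BitsLE V) (e : Expr) :
    e.cost s ≤ e.factor * V := by
  induction e with
  | const c => exact Nat.le_mul_of_pos_right _ hV
  | var x => simpa [Expr.cost, Expr.factor] using h.1 x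
  | cell a i ih =>
    have := h.2 a (i.val s)
    simp only [Expr.cost, Expr.factor]
    nlinarith
  | add e f he hf | sub e f he hf | mul e f he hf | div e f he hf =>
    have := bits_add (e.val s) (f.val s)
    have := bits_sub (e.val s) (f.val s)
    have := bits_mul (e.val s) (f.val s)
    have := bits_div (e.val s) (f.val s)
    have := e.bits_val_le_cost s
    have := f.bits_val_le_cost s
    simp only [Expr.cost, Expr.factor]
    linarith

/-! ### Runs -/

theorem Runs.deterministic {s₁ : Memory} {t₁ t₂ : ℕ} (h₁ : Runs p s t₁ s₁)
    (h₂ : Runs p s t₂ s₂) : t₁ = t₂ ∧ s₁ = s₂ := by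
  induction h₁ generalizing t₂ s₂ <;> cases h₂ <;> grind

theorem Memory.setReg_reg (s : Memory) (x : ℕ) (z : ℤ) :
    (s.setReg x z).reg = update s.reg x z := rfl

@[simp, grind =]
theorem Memory.setReg_apply (s : Memory) (x : ℕ) (z : ℤ) (y : ℕ) :
    (s.setReg x z).reg y = if y = x then z else s.reg y := by
  rw [setReg_reg, update_apply]

theorem Memory.setReg_self (s : Memory) (x : ℕ) (z : ℤ) : (s.setReg x z).reg x = z :=
  update_self _ _ _

theorem Memory.setReg_of_ne (h : y ≠ x) :
    (s.setReg x z).reg y = s.reg y := update_of_ne h _ _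

@[grind =]
theorem Memory.setReg_arr (s : Memory) (x : ℕ) (z : ℤ) : (s.setReg x z).arr = s.arr := rfl

@[grind =]
theorem Memory.setCell_reg (s : Memory) (a : ℕ) (i z : ℤ) : (s.setCell a i z).reg = s.reg := rfl

@[grind =]
theorem Memory.setCell_arr (s : Memory) (a : ℕ) (i z : ℤ) (a' : ℕ) (i' : ℤ) :
    (s.setCell a i z).arr a' i' = if a' = a ∧ i' = i then z else s.arr a' i' := by
  by_cases h : a' = a <;> by_cases h' : i' = i <;> simp [setCell, h, h']

/-- In time `t` the bit lengths of the cells of an array grow by at most `t` in total. -/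
theorem Runs.sum_bits_le (h : Runs p s t s') (a : ℕ)
    (J : Finset ℤ) : ∑ j ∈ J, bits (s'.arr a j) ≤ ∑ j ∈ J, bits (s.arr a j) + t := by
  induction h with
  | assign s x e => simp only [setReg_arr]; omega
  | store s b i e =>
    have h1 := e.bits_val_le_cost s
    have h2 : ∀ j ∈ J, bits ((s.setCell b (i.val s) (e.val s)).arr a j) ≤
        bits (s.arr a j) + if j = i.val s then e.cost s else 0 := by
      intro j _
      rw [setCell_arr]
      grind
    have h3 := sum_le_sum h2
    rw [sum_add_distrib, sum_ite_eq'] at h3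
    split_ifs at h3 <;> omega
  | _ => omega

theorem Runs.sum_range_bits_le (h : Runs p s t s') (a n : ℕ) :
    ∑ j ∈ range n, bits (s'.arr a j) ≤ ∑ j ∈ range n, bits (s.arr a j) + t := by
  simpa using h.sum_bits_le a ((range n).map Nat.castEmbedding)

/-! ### Cells that are not read -/

/-- The cells that are read when an expression is evaluated. -/
def Expr.reads (s : Memory) : Expr → Finset (ℕ × ℤ)
  | .const _ => ∅
  | .var _ => ∅
  | .cell a i => insert (a, i.val s) (i.reads s)
  | .add e f => e.reads s ∪ f.reads s
  | .sub e f => e.reads s ∪ f.reads s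
  | .mul e f => e.reads s ∪ f.reads s
  | .div e f => e.reads s ∪ f.reads s

theorem Expr.card_reads_le (s : Memory) (e : Expr) : (e.reads s).card ≤ e.cost s := by
  induction e with
  | const c => simp [Expr.reads]
  | var x => simp [Expr.reads]
  | cell a i ih =>
    have := bits_pos (s.arr a (i.val s))
    have h := card_insert_le (a, i.val s) (i.reads s)
    simp only [Expr.reads, Expr.cost]
    omega
  | add e f he hf | sub e f he hf | mul e f he hf | div e f he hf =>
    have h := card_union_le (e.reads s) (f.reads s)
    simp only [Expr.reads, Expr.cost]
    omega

/-- The memories have the same registers and agree on a set of cells. -/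
def Memory.AgreeOn (s s' : Memory) (S : Finset (ℕ × ℤ)) : Prop :=
  s'.reg = s.reg ∧ ∀ q ∈ S, s'.arr q.1 q.2 = s.arr q.1 q.2

theorem Memory.AgreeOn.mono {S T : Finset (ℕ × ℤ)} (h : s.AgreeOn s' T)
    (hST : S ⊆ T) : s.AgreeOn s' S :=
  ⟨h.1, fun q hq => h.2 q (hST hq)⟩

theorem Expr.eval_congr (e : Expr) (h : s.AgreeOn s' (e.reads s)) :
    e.val s' = e.val s ∧ e.cost s' = e.cost s := by
  induction e with
  | const c => simp [Expr.val, Expr.cost]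
  | var x => simp [Expr.val, Expr.cost, h.1]
  | cell a i ih =>
    have h1 := ih (h.mono (by simp [Expr.reads]))
    have h2 := h.2 (a, i.val s) (by simp [Expr.reads])
    simp_all [Expr.val, Expr.cost]
  | add e f he hf | sub e f he hf | mul e f he hf | div e f he hf =>
    simp [Expr.val, Expr.cost, he (h.mono (by simp [Expr.reads])), hf (h.mono (by simp [Expr.reads]))]

/-- From `s` and `s₂` a program has reached `s'` and `s₂'`: every cell has the same content in
`s'` and `s₂'`, or has not been changed. -/
def Memory.SameChange (s s₂ s' s₂' : Memory) : Prop :=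
  s₂'.reg = s'.reg ∧ ∀ a i, s₂'.arr a i = s'.arr a i ∨
    (s₂'.arr a i = s₂.arr a i ∧ s'.arr a i = s.arr a i)

theorem Memory.SameChange.agreeOn {s₂' : Memory} {S : Finset (ℕ × ℤ)}
    (h : s.SameChange s₂ s' s₂') (hS : s.AgreeOn s₂ S) : s'.AgreeOn s₂' S :=
  ⟨h.1, fun q hq => by have := h.2 q.1 q.2; have := hS.2 q hq; grind⟩

theorem Memory.SameChange.trans {s₂' s'' s₂'' : Memory}
    (h : s.SameChange s₂ s' s₂') (h' : s'.SameChange s₂' s'' s₂'') :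
    s.SameChange s₂ s'' s₂'' :=
  ⟨h'.1, fun a i => by have := h.2 a i; have := h'.2 a i; grind⟩

theorem Memory.SameChange.refl (h : s₂.reg = s.reg) : s.SameChange s₂ s s₂ :=
  ⟨h, fun _ _ => Or.inr ⟨rfl, rfl⟩⟩

/-- A run of length `t` reads at most `t` cells, and does not depend on the others. -/
theorem Runs.exists_reads (h : Runs p s t s') :
    ∃ S : Finset (ℕ × ℤ), S.card ≤ t ∧ ∀ s₂, s.AgreeOn s₂ S →
      ∃ s₂', Runs p s₂ t s₂' ∧ s.SameChange s₂ s' s₂' := by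
  induction h with
  | skip s => exact ⟨∅, by simp, fun s₂ h => ⟨s₂, .skip s₂, .refl h.1⟩⟩
  | assign s x e =>
    refine ⟨e.reads s, (e.card_reads_le s).trans (by omega), fun s₂ h => ?_⟩
    obtain ⟨h1, h2⟩ := e.eval_congr h
    refine ⟨s₂.setReg x (e.val s₂), h2 ▸ Runs.assign s₂ x e, ?_, fun a i => Or.inr ⟨rfl, rfl⟩⟩
    simp only [setReg_reg, h1, h.1]
  | store s a i e =>
    refine ⟨i.reads s ∪ e.reads s, ?_, fun s₂ h => ?_⟩
    · have h1 := card_union_le (i.reads s) (e.reads s)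
      have h2 := i.card_reads_le s
      have h3 := e.card_reads_le s
      omega
    obtain ⟨h1, h2⟩ := i.eval_congr (h.mono subset_union_left)
    obtain ⟨h3, h4⟩ := e.eval_congr (h.mono subset_union_right)
    refine ⟨s₂.setCell a (i.val s₂) (e.val s₂), h4 ▸ h2 ▸ Runs.store s₂ a i e, h.1,
      fun b j => ?_⟩
    grind [setCell_arr]
  | @seq p q s s' s'' t t' _ _ ih ih' =>
    obtain ⟨S, hS, hS'⟩ := ih
    obtain ⟨T, hT, hT'⟩ := ih'
    refine ⟨S ∪ T, (card_union_le _ _).trans (by omega), fun s₂ h => ?_⟩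
    obtain ⟨s₂', r, c⟩ := hS' s₂ (h.mono subset_union_left)
    obtain ⟨s₂'', r', c'⟩ := hT' s₂' (c.agreeOn (h.mono subset_union_right))
    exact ⟨s₂'', .seq r r', c.trans c'⟩
  | @ite_pos e p q s s' t hp _ ih | @ite_neg e p q s s' t hp _ ih =>
    obtain ⟨S, hS, hS'⟩ := ih
    have hc := e.card_reads_le s
    refine ⟨e.reads s ∪ S, (card_union_le _ _).trans (by omega), fun s₂ h => ?_⟩
    obtain ⟨h1, h2⟩ := e.eval_congr (h.mono subset_union_left)
    obtain ⟨s₂', r, c⟩ := hS' s₂ (h.mono subset_union_right)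
    first
    | exact ⟨s₂', h2 ▸ .ite_pos (h1 ▸ hp) r, c⟩
    | exact ⟨s₂', h2 ▸ .ite_neg (h1 ▸ hp) r, c⟩
  | @while_pos e p s s' s'' t t' hp _ _ ih ih' =>
    obtain ⟨S, hS, hS'⟩ := ih
    obtain ⟨T, hT, hT'⟩ := ih'
    have hc := e.card_reads_le s
    refine ⟨e.reads s ∪ (S ∪ T), ?_, fun s₂ h => ?_⟩
    · have h1 := card_union_le (e.reads s) (S ∪ T)
      have h2 := card_union_le S T
      omega
    obtain ⟨h1, h2⟩ := e.eval_congr (h.mono subset_union_left)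
    have h' := h.mono subset_union_right
    obtain ⟨s₂', r, c⟩ := hS' s₂ (h'.mono subset_union_left)
    obtain ⟨s₂'', r', c'⟩ := hT' s₂' (c.agreeOn (h'.mono subset_union_right))
    exact ⟨s₂'', h2 ▸ .while_pos (h1 ▸ hp) r r', c.trans c'⟩
  | @while_neg e p s hn =>
    refine ⟨e.reads s, (e.card_reads_le s).trans (by omega), fun s₂ h => ?_⟩
    obtain ⟨h1, h2⟩ := e.eval_congr h
    exact ⟨s₂, h2 ▸ .while_neg (h1 ▸ hn), .refl h.1⟩

/-! ### The gradient at zero top-layer weights -/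

theorem hasDerivAt_logisticLoss : HasDerivAt logisticLoss (-(1 / (2 * Real.log 2))) 0 := by
  have h1 : HasDerivAt (fun x : ℝ => 1 + Real.exp (-x)) (-1) 0 := by
    have := ((hasDerivAt_neg (0 : ℝ)).exp).const_add 1
    simpa using this
  have h2 := (h1.log (by positivity)).const_mul (1 / Real.log 2)
  have h3 : 1 / Real.log 2 * (-1 / (1 + Real.exp (-0))) = -(1 / (2 * Real.log 2)) := by
    rw [neg_zero, Real.exp_zero]
    ring
  rw [h3] at h2
  exact h2

theorem hasDerivAt_hingeLoss : HasDerivAt hingeLoss (-1) 0 := by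
  have h1 : HasDerivAt (fun x : ℝ => 1 - x) (-1) 0 := by
    simpa using (hasDerivAt_id (0 : ℝ)).const_sub 1
  refine h1.congr_of_eventuallyEq ?_
  filter_upwards [gt_mem_nhds (show (0 : ℝ) < 1 by norm_num)] with x hx
  exact max_eq_right (by linarith)

/-- Both losses are differentiable at `0`, with a derivative below `-1 / 2`. -/
theorem exists_hasDerivAt_loss (hl : l = logisticLoss ∨ l = hingeLoss) :
    ∃ c : ℝ, HasDerivAt l c 0 ∧ c < -(1 / 2) := by
  rcases hl with rfl | rfl
  · refine ⟨_, hasDerivAt_logisticLoss, ?_⟩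
    have h1 : 0 < Real.log 2 := Real.log_pos (by norm_num)
    have h2 : Real.log 2 < 1 := by linarith [Real.log_two_lt_d9]
    have h3 : (1 : ℝ) / 2 < 1 / (2 * Real.log 2) := by apply one_div_lt_one_div_of_lt <;> linarith
    linarith
  · exact ⟨_, hasDerivAt_hingeLoss, by norm_num⟩

namespace Instance

variable {n m d : ℕ}

/-- The output of unit `j` on example `i`. -/
noncomputable def unitOut (I : Instance n m d) (i : Fin m) (j : Fin n) : ℝ :=
  relu (∑ k : Fin d, (I.a i k : ℝ) * (I.b j k : ℝ))

theorem isGradient_of_weights_eq_zero {c : ℝ} (hl : HasDerivAt l c 0)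
    (I : Instance n m d) (hα : ∀ j, I.α j = 0) :
    I.IsGradient l (WithLp.toLp 2 fun j => ∑ i, c * (I.y i * I.unitOut i j)) := by
  unfold IsGradient
  have h0 : (WithLp.toLp 2 fun j => (I.α j : ℝ)) = (0 : EuclideanSpace ℝ (Fin n)) := by
    ext j; simp [hα]
  rw [h0, hasGradientAt_iff_hasFDerivAt]
  let φ : Fin m → (EuclideanSpace ℝ (Fin n) →L[ℝ] ℝ) := fun i =>
    (I.y i : ℝ) • ∑ j, I.unitOut i j • (EuclideanSpace.proj j : EuclideanSpace ℝ (Fin n) →L[ℝ] ℝ)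
  have hφ : ∀ i (α : EuclideanSpace ℝ (Fin n)), φ i α =
      I.y i * network (fun j k => (I.b j k : ℝ)) α (fun k => (I.a i k : ℝ)) := by
    intro i α
    simp [φ, network, unitOut, mul_comm]
  have h1 : ∀ i ∈ (Finset.univ : Finset (Fin m)),
      HasFDerivAt (fun α : EuclideanSpace ℝ (Fin n) => l (φ i α)) (c • φ i) 0 := by
    intro i _
    refine HasDerivAt.comp_hasFDerivAt (0 : EuclideanSpace ℝ (Fin n)) ?_ (φ i).hasFDerivAt
    simpa using hl
  have h2 := HasFDerivAt.fun_sum h1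
  have h3 : (empiricalRisk l (fun j k => (I.b j k : ℝ)) (fun i k => (I.a i k : ℝ))
      fun i => (I.y i : ℝ)) = fun α => ∑ i, l (φ i α) := by
    funext α
    simp [empiricalRisk, hφ]
  have h4 : InnerProductSpace.toDual ℝ (EuclideanSpace ℝ (Fin n))
      (WithLp.toLp 2 fun j => ∑ i, c * (I.y i * I.unitOut i j)) = ∑ i, c • φ i := by
    ext v
    have h5 : (∑ i, c • φ i) v = ∑ i, c * φ i v := by simp
    have h6 : ∀ i, φ i v = I.y i * ∑ j, I.unitOut i j * v j := by
      intro i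
      simp [φ]
    rw [h5, InnerProductSpace.toDual_apply_apply, PiLp.inner_apply]
    simp only [h6, RCLike.inner_apply, conj_trivial, mul_sum]
    rw [sum_comm]
    refine sum_congr rfl fun i _ => sum_congr rfl fun j _ => ?_
    ring
  rw [h3, h4]
  exact h2

end Instance

theorem relu_ovInstance (A : Fin m → Fin d → Bool) (B : Fin n → Fin d → Bool)
    (i : Fin m) (j : Fin n) : (ovInstance A B).unitOut i j =
      if ∑ k : Fin d, (A i k).toNat * (B j k).toNat = 0 then 1 else 0 := by
  have h : ∑ k : Fin (d + 1), ((ovInstance A B).a i k : ℝ) * ((ovInstance A B).b j k : ℝ) =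
      1 - 2 * ((∑ k : Fin d, (A i k).toNat * (B j k).toNat : ℕ) : ℝ) := by
    rw [Fin.sum_univ_castSucc]
    simp only [ovInstance, Fin.snoc_castSucc, Fin.snoc_last]
    push_cast
    rw [mul_sum, sub_eq_add_neg, add_comm, ← sum_neg_distrib]
    congr 1
    · norm_num
    · grind
  unfold Instance.unitOut relu
  rw [h]
  split_ifs with h0
  · rw [h0]; norm_num
  · have h1 : (1 : ℝ) ≤ ((∑ k : Fin d, (A i k).toNat * (B j k).toNat : ℕ) : ℝ) := by
      exact_mod_cast Nat.one_le_iff_ne_zero.2 h0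
    exact max_eq_left (by linarith)

theorem sum_gradient_ovInstance {c : ℝ} (hl : HasDerivAt l c 0) (A : Fin m → Fin d → Bool) (B : Fin n → Fin d → Bool) :
    ∃ g : EuclideanSpace ℝ (Fin n), (ovInstance A B).IsGradient l g ∧
      ∑ j, g j = c * orthogonalPairs A B := by
  refine ⟨_, (ovInstance A B).isGradient_of_weights_eq_zero hl fun _ => rfl, ?_⟩
  simp only [relu_ovInstance]
  have h1 : ∀ i, (ovInstance A B).y i = 1 := fun _ => rfl
  simp only [h1, Int.cast_one, one_mul, ← mul_sum]
  congr 1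
  rw [sum_comm, ← sum_product', orthogonalPairs, card_filter]
  push_cast
  rfl

/-! ### Stored vectors and matrices -/

theorem storeVec_apply (v : Fin r → ℤ) (j : Fin r) : storeVec v (j : ℤ) = v j := by
  unfold storeVec
  rw [sum_eq_single j]
  · simp
  · omega
  · simp

theorem storeVec_eq_zero (v : Fin r → ℤ) {t : ℤ} (h : ∀ j : Fin r, t ≠ (j : ℤ)) :
    storeVec v t = 0 :=
  sum_eq_zero fun j _ => if_neg (h j)

theorem rowMajor_injective {j' : ℕ} {k' : ℕ} (hk : k < c) (hk' : k' < c)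
    (h : j * c + k = j' * c + k') : j = j' ∧ k = k' := by
  have h1 : (j * c + k) / c = (j' * c + k') / c := by rw [h]
  have h2 : (j * c + k) % c = (j' * c + k') % c := by rw [h]
  have hc : 0 < c := by omega
  rw [mul_comm j, mul_comm j'] at h1 h2
  rw [Nat.mul_add_div hc, Nat.mul_add_div hc, Nat.div_eq_of_lt hk, Nat.div_eq_of_lt hk'] at h1
  grind

theorem storeMat_apply (X : Fin r → Fin c → ℤ) (j : Fin r) (k : Fin c) :
    storeMat X ((j : ℤ) * c + k) = X j k := by
  have h : ∀ (j' : Fin r) (k' : Fin c), (j : ℤ) * c + k = (j' : ℤ) * c + k' →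
      j = j' ∧ k = k' := by
    intro j' k' h
    have h1 : (j : ℕ) * c + k = j' * c + k' := mod_cast h
    have h2 := rowMajor_injective k.2 k'.2 h1
    exact ⟨Fin.ext h2.1, Fin.ext h2.2⟩
  unfold storeMat
  rw [sum_eq_single j, sum_eq_single k]
  · simp
  · omega
  · simp
  · intro b _ hb
    exact sum_eq_zero fun b' _ => if_neg fun h' => hb (h _ _ h').1.symm
  · simp

theorem storeMat_eq_zero (X : Fin r → Fin c → ℤ) {t : ℤ}
    (h : ∀ (j : Fin r) (k : Fin c), t ≠ (j : ℤ) * c + k) : storeMat X t = 0 :=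
  sum_eq_zero fun j _ => sum_eq_zero fun k _ => if_neg (h j k)

theorem storeMat_congr {X Y : Fin r → Fin c → ℤ} {t : ℤ}
    (h : ∀ (j : Fin r) (k : Fin c), t = (j : ℤ) * c + k → X j k = Y j k) :
    storeMat X t = storeMat Y t := by
  unfold storeMat
  grind

/-! ### Lower bounds by output size and input size -/

/-- The instance with zero top-layer weights, labels `1`, lower-layer weights `1` and given
examples. -/
def onesInstance (a : Fin m → Fin d → ℤ) : Instance n m d where
  α _ := 0
  b _ _ := 1
  a := a
  y _ := 1
  label _ := Or.inl rfl

theorem card_le_time_of_holdsApprox {I : Instance n m d} {g : EuclideanSpace ℝ (Fin n)} (h : Runs p I.input t s)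
    (hs : HoldsApprox s g δ) : n ≤ t := by
  have h1 := h.sum_range_bits_le 5 n
  have h2 : ∀ j : ℕ, bits (I.input.arr 5 (j : ℤ)) = 1 := fun j => bits_zero
  have h3 : ∑ j ∈ range n, 2 ≤ ∑ j ∈ range n, bits (s.arr 5 (j : ℤ)) :=
    sum_le_sum fun j hj => two_le_bits (hs ⟨j, mem_range.1 hj⟩).1
  simp only [h2, sum_const, card_range, smul_eq_mul] at h1 h3
  omega

/-- The program `p` approximates gradients well enough to detect orthogonal pairs. -/
structure Detects (l : ℝ → ℝ) (K : ℕ) (δ c : ℝ) (p : Prog) : Prop where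
  hasDerivAt : HasDerivAt l c 0
  lt : c < -(1 / 2)
  two_le : 2 ≤ K
  le : δ ≤ 1 / 4
  computes : ComputesGradient l K δ p

theorem exists_slow_instance {c : ℝ} (hp : Detects l K δ c p) (hn : 1 ≤ n) :
    ∃ (I : Instance n m d) (g : EuclideanSpace ℝ (Fin n)) (t : ℕ) (s : Memory),
      I.EntriesLE K ∧ I.IsGradient l g ∧ Runs p I.input t s ∧ n ≤ t ∧ m * d ≤ t := by
  obtain ⟨hl, hc, hK, hδ, hp⟩ := hp
  have hent : ∀ a : Fin m → Fin d → ℤ, (∀ i k, a i k = 0 ∨ a i k = 1) →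
      (onesInstance a : Instance n m d).EntriesLE K := by
    intro a ha
    have h1 : (1 : ℤ) ≤ K := by omega
    refine ⟨fun j => ?_, fun j k => ?_, fun i k => ?_⟩
    · simp [onesInstance]
    · simpa [onesInstance] using h1
    · rcases ha i k with h | h <;> simp [onesInstance, h, h1]
  let I₀ : Instance n m d := onesInstance fun _ _ => 0
  have hg₀ := I₀.isGradient_of_weights_eq_zero hl fun _ => rfl
  have he₀ : I₀.EntriesLE K := hent _ fun _ _ => Or.inl rfl
  obtain ⟨t, s, hr, hs⟩ := hp n m d I₀ _ he₀ hg₀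
  refine ⟨I₀, _, t, s, he₀, hg₀, hr, card_le_time_of_holdsApprox hr hs, ?_⟩
  by_contra hlt
  push Not at hlt
  obtain ⟨S, hS, hS'⟩ := hr.exists_reads
  let f : Fin m × Fin d → ℕ × ℤ := fun q => (2, (q.1 : ℤ) * d + q.2)
  have hf : Function.Injective f := by
    intro q q' h
    simp only [f, Prod.mk.injEq, true_and] at h
    have h1 := rowMajor_injective q.2.2 q'.2.2 (mod_cast h)
    exact Prod.ext (Fin.ext h1.1) (Fin.ext h1.2)
  have hex : ∃ q, f q ∉ S := by
    by_contra hall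
    push Not at hall
    have h1 : (Finset.univ.map ⟨f, hf⟩).card ≤ S.card :=
      card_le_card fun x hx => by
        obtain ⟨q, _, rfl⟩ := mem_map.1 hx
        exact hall q
    rw [card_map, card_univ, Fintype.card_prod, Fintype.card_fin,
      Fintype.card_fin] at h1
    omega
  obtain ⟨q, hq⟩ := hex
  let a₁ : Fin m → Fin d → ℤ := fun i k => if i = q.1 ∧ k = q.2 then 1 else 0
  let I₁ : Instance n m d := onesInstance a₁
  have he₁ : I₁.EntriesLE K := hent _ fun i k => by grind
  have hg₁ := I₁.isGradient_of_weights_eq_zero hl fun _ => rfl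
  obtain ⟨t₁, s₁, hr₁, hs₁⟩ := hp n m d I₁ _ he₁ hg₁
  have hagree : I₀.input.AgreeOn I₁.input S := by
    refine ⟨rfl, fun x hx => ?_⟩
    obtain ⟨r, i⟩ := x
    match r, hx with
    | 0, _ => rfl
    | 1, _ => rfl
    | 3, _ => rfl
    | _ + 4, _ => rfl
    | 2, hx =>
      refine storeMat_congr fun j k hjk => ?_
      have hne : ¬ (j = q.1 ∧ k = q.2) := by
        rintro ⟨rfl, rfl⟩
        subst hjk
        exact hq hx
      simp [I₁, I₀, onesInstance, a₁, hne]
  obtain ⟨s₂, hr₂, hch⟩ := hS' _ hagree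
  obtain ⟨-, rfl⟩ := hr₁.deterministic hr₂
  have hsame : ∀ i, s₁.arr 4 i = s.arr 4 i ∧ s₁.arr 5 i = s.arr 5 i := by
    intro i
    constructor
    · rcases hch.2 4 i with h | ⟨h, h'⟩
      · exact h
      · rw [h, h']; rfl
    · rcases hch.2 5 i with h | ⟨h, h'⟩
      · exact h
      · rw [h, h']; rfl
  have h₀ := (hs ⟨0, hn⟩).2
  have h₁ := (hs₁ ⟨0, hn⟩).2
  rw [(hsame _).1, (hsame _).2] at h₁
  have hv₀ : ∀ i j, I₀.unitOut i j = 0 := by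
    intro i j
    simp [I₀, onesInstance, Instance.unitOut, relu]
  have hv₁ : ∀ i j, I₁.unitOut i j = if i = q.1 then 1 else 0 := by
    intro i j
    simp only [I₁, onesInstance, Instance.unitOut, relu, a₁]
    by_cases hi : i = q.1
    · simp [hi]
    · simp [hi]
  have hy : ∀ i, I₁.y i = 1 := fun _ => rfl
  simp only [hv₀, hv₁, hy, mul_zero, sum_const_zero, Int.cast_one, mul_ite,
    mul_one, sum_ite_eq', mem_univ, if_true] at h₀ h₁
  grind

/-! ### Expressions with bounded sums -/

/-- Registers from this number on are scratch space of compiled expressions. -/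
abbrev scratch : ℕ := 40

/-- Registers below this number may bound sums. -/
abbrev boundRegs : ℕ := 10

theorem boundRegs_lt : boundRegs < scratch := by decide

/-- Arrays below this number may be read by expressions with sums. -/
abbrev ownArrays : ℕ := 3

/-- Expressions with bounded sums: `sum y r e` is the sum of `e` for `y` from zero to the content of
register `r`, and `ind e` is `1` if `e` is positive and `0` otherwise. -/
inductive XExpr : Type
  | const (c : ℤ)
  | var (x : ℕ)
  | lv (y : ℕ)
  | cell (a : ℕ) (i : XExpr)
  | add (e f : XExpr)
  | sub (e f : XExpr)
  | mul (e f : XExpr)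
  | div (e f : XExpr)
  | ind (e : XExpr)
  | sum (y r : ℕ) (e : XExpr)

namespace XExpr

/-- The value of an expression under an assignment `ε` of its bound variables. -/
def eval (σ : Memory) : XExpr → (ℕ → ℤ) → ℤ
  | .const c, _ => c
  | .var x, _ => σ.reg x
  | .lv y, ε => ε y
  | .cell a i, ε => σ.arr a (i.eval σ ε)
  | .add e f, ε => e.eval σ ε + f.eval σ ε
  | .sub e f, ε => e.eval σ ε - f.eval σ ε
  | .mul e f, ε => e.eval σ ε * f.eval σ ε
  | .div e f, ε => e.eval σ ε / f.eval σ ε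
  | .ind e, ε => if 0 < e.eval σ ε then 1 else 0
  | .sum y r e, ε => ∑ v ∈ range (σ.reg r).toNat, e.eval σ (update ε y (v : ℤ))

/-- A program that writes the value of an expression to register `τ`, with scratch space from `τ`
on. Bound variables are in the registers given by `ρ`. -/
def compile : XExpr → ℕ → (ℕ → ℕ) → Prog
  | .const c, τ, _ => .assign τ (.const c)
  | .var x, τ, _ => .assign τ (.var x)
  | .lv y, τ, ρ => .assign τ (.var (ρ y))
  | .cell a i, τ, ρ => .seq (i.compile τ ρ) (.assign τ (.cell a (.var τ)))
  | .add e f, τ, ρ => .seq (e.compile τ ρ) (.seq (f.compile (τ + 1) ρ)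
      (.assign τ (.add (.var τ) (.var (τ + 1)))))
  | .sub e f, τ, ρ => .seq (e.compile τ ρ) (.seq (f.compile (τ + 1) ρ)
      (.assign τ (.sub (.var τ) (.var (τ + 1)))))
  | .mul e f, τ, ρ => .seq (e.compile τ ρ) (.seq (f.compile (τ + 1) ρ)
      (.assign τ (.mul (.var τ) (.var (τ + 1)))))
  | .div e f, τ, ρ => .seq (e.compile τ ρ) (.seq (f.compile (τ + 1) ρ)
      (.assign τ (.div (.var τ) (.var (τ + 1)))))
  | .ind e, τ, ρ => .seq (e.compile τ ρ) (.ite (.var τ) (.assign τ (.const 1))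
      (.assign τ (.const 0)))
  | .sum y r e, τ, ρ => .seq (.assign τ (.const 0)) (.seq (.assign (τ + 1) (.const 0))
      (.while (.sub (.var r) (.var (τ + 1)))
        (.seq (e.compile (τ + 2) (update ρ y (τ + 1)))
          (.seq (.assign τ (.add (.var τ) (.var (τ + 2))))
            (.assign (τ + 1) (.add (.var (τ + 1)) (.const 1)))))))

/-- Registers, arrays and bounds of sums are in the admissible ranges. -/
@[simp]
def WF : XExpr → Prop
  | .const _ => True
  | .var x => x < 40
  | .lv _ => True
  | .cell a i => a < 3 ∧ i.WF
  | .add e f => e.WF ∧ f.WF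
  | .sub e f => e.WF ∧ f.WF
  | .mul e f => e.WF ∧ f.WF
  | .div e f => e.WF ∧ f.WF
  | .ind e => e.WF
  | .sum _ r e => r < 10 ∧ e.WF

/-- The degree of a polynomial bound for the running time. -/
def deg : XExpr → ℕ
  | .const c => bits c
  | .var _ => 2
  | .lv _ => 2
  | .cell _ i => i.deg + 3
  | .add e f => e.deg + f.deg + 3
  | .sub e f => e.deg + f.deg + 3
  | .mul e f => e.deg + f.deg + 3
  | .div e f => e.deg + f.deg + 3
  | .ind e => e.deg + 2
  | .sum _ _ e => e.deg + 6

end XExpr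

/-- The registers, own arrays and bounds of sums have size at most `L`. -/
structure Memory.Good (L : ℕ) (σ : Memory) : Prop where
  two_le : 2 ≤ L
  reg : ∀ x < scratch, bits (σ.reg x) ≤ L
  arr : ∀ a < ownArrays, ∀ i, bits (σ.arr a i) ≤ L
  bound : ∀ r < boundRegs, σ.reg r ≤ L

/-- The memory `s` equals `σ` up to scratch registers. -/
def Memory.Equiv (s σ : Memory) : Prop :=
  s.arr = σ.arr ∧ ∀ x < scratch, s.reg x = σ.reg x

theorem Memory.Equiv.refl (s : Memory) : s.Equiv s := ⟨rfl, fun _ _ => rfl⟩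

theorem pow_four_le (hL : 2 ≤ L) : 4 * L ^ d ≤ L ^ (d + 2) := by
  rw [pow_add]
  nlinarith [Nat.pow_le_pow_left hL 2, Nat.zero_le (L ^ d)]

theorem pow_eight_le (hL : 2 ≤ L) : 8 * L ^ d ≤ L ^ (d + 3) := by
  rw [pow_add]
  nlinarith [Nat.pow_le_pow_left hL 3, Nat.zero_le (L ^ d)]

theorem le_pow_of_one_le (_ : 2 ≤ L) (hd : 1 ≤ d) : L ≤ L ^ d :=
  Nat.le_self_pow (by omega) L

theorem bits_sum_le (f : ℕ → ℤ) (B : ℕ) (n : ℕ) (h : ∀ v < n, bits (f v) ≤ B) :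
    bits (∑ v ∈ range n, f v) ≤ 1 + n * B := by
  induction n with
  | zero => simp [bits_zero]
  | succ n ih =>
    rw [sum_range_succ]
    have h1 := bits_add (∑ v ∈ range n, f v) (f n)
    have h2 := ih fun v hv => h v (by omega)
    have h3 := h n (by omega)
    linarith

namespace XExpr

theorem one_le_deg (e : XExpr) : 1 ≤ e.deg := by
  cases e <;> simp only [deg] <;> first | omega | exact bits_pos _

theorem binary_bound {e : ℕ} (hL : 2 ≤ L) :
    3 * (L ^ d + L ^ e) + 1 ≤ L ^ (d + e + 3) := by
  have h1 : L ^ d ≤ L ^ (d + e) := Nat.pow_le_pow_right (by omega) (by omega)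
  have h2 : L ^ e ≤ L ^ (d + e) := Nat.pow_le_pow_right (by omega) (by omega)
  have h3 := pow_eight_le (d := d + e) hL
  have h4 : 1 ≤ L ^ (d + e) := Nat.one_le_pow _ _ (by omega)
  omega

theorem toNat_le_of_good (hσ : σ.Good L) (hr : r < boundRegs) :
    (σ.reg r).toNat ≤ L := by
  have := hσ.bound r hr
  omega

theorem bits_index_le (hσ : σ.Good L) (hr : r < scratch) (hv : v ≤ (σ.reg r).toNat) : bits (v : ℤ) ≤ L :=
  (bits_mono (by omega)).trans (hσ.reg r hr)

theorem bits_update_le (hε : ∀ y, bits (ε y) ≤ L) {v : ℤ} (hv : bits v ≤ L)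
    (y : ℕ) : ∀ x, bits (update ε y v x) ≤ L := by
  grind

theorem bits_eval_le (hσ : σ.Good L) (e : XExpr) (he : e.WF) (hε : ∀ y, bits (ε y) ≤ L) : bits (e.eval σ ε) ≤ L ^ e.deg := by
  have hL := hσ.two_le
  induction e generalizing ε with
  | const c =>
    exact (Nat.lt_two_pow_self.le).trans (Nat.pow_le_pow_left hL _)
  | var x => exact (hσ.reg x he).trans (le_pow_of_one_le hL (by simp [deg]))
  | lv y => exact (hε y).trans (le_pow_of_one_le hL (by simp [deg]))
  | cell a i ih => exact (hσ.arr a he.1 _).trans (le_pow_of_one_le hL (by simp [deg]))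
  | add e f h1 h2 | sub e f h1 h2 | mul e f h1 h2 | div e f h1 h2 =>
    have := h1 he.1 hε
    have := h2 he.2 hε
    have := bits_add (e.eval σ ε) (f.eval σ ε)
    have := bits_sub (e.eval σ ε) (f.eval σ ε)
    have := bits_mul (e.eval σ ε) (f.eval σ ε)
    have := bits_div (e.eval σ ε) (f.eval σ ε)
    have := binary_bound (d := e.deg) (e := f.deg) hL
    simp only [eval, deg]
    omega
  | ind e ih =>
    have h := le_pow_of_one_le (d := e.deg + 2) hL (by omega)
    simp only [eval, deg]
    split_ifs <;> simp only [bits_one, bits_zero] <;> omega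
  | sum y r e ih =>
    have h1 : ∀ v < (σ.reg r).toNat, bits (e.eval σ (update ε y (v : ℤ))) ≤ L ^ e.deg :=
      fun v hv => ih he.2 (bits_update_le hε (bits_index_le hσ (he.1.trans boundRegs_lt) hv.le) y)
    have h2 := bits_sum_le _ _ _ h1
    have h3 : (σ.reg r).toNat * L ^ e.deg ≤ L * L ^ e.deg :=
      Nat.mul_le_mul_right _ (toNat_le_of_good hσ he.1)
    have h4 : 4 * L ^ (e.deg + 4) ≤ L ^ (e.deg + 6) := pow_four_le hL
    have h5 : L ^ (e.deg + 1) ≤ L ^ (e.deg + 4) := Nat.pow_le_pow_right (by omega) (by omega)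
    have h6 : 1 ≤ L ^ (e.deg + 4) := Nat.one_le_pow _ _ (by omega)
    rw [pow_succ, mul_comm] at h5
    simp only [eval, deg]
    omega

end XExpr

/-- A loop whose `v`-th iteration takes time at most `T v`, not counting tests, which take time at
most `T₁`. -/
theorem Runs.exists_while {e : Expr} (I : ℕ → Memory → Prop) (n : ℕ) (T : ℕ → ℕ)
    (T₁ : ℕ)
    (hpos : ∀ v < n, ∀ s, I v s → 0 < e.val s ∧ e.cost s + 1 ≤ T₁ ∧
      ∃ t s', Runs p s t s' ∧ t ≤ T v ∧ I (v + 1) s')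
    (hneg : ∀ s, I n s → ¬ 0 < e.val s ∧ e.cost s + 1 ≤ T₁) (s : Memory) (hs : I 0 s) :
    ∃ t s', Runs (.while e p) s t s' ∧ t ≤ ∑ v ∈ range n, (T v + T₁) + T₁ ∧ I n s' := by
  suffices h : ∀ k v, v + k = n → ∀ s, I v s →
      ∃ t s', Runs (.while e p) s t s' ∧ t ≤ ∑ v ∈ Ico v n, (T v + T₁) + T₁ ∧ I n s' by
    have := h n 0 (by omega) s hs
    rwa [← range_eq_Ico] at this
  intro k
  induction k with
  | zero =>
    intro v hv s hs
    obtain rfl : v = n := by omega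
    obtain ⟨h1, h2⟩ := hneg s hs
    exact ⟨_, s, .while_neg h1, by simpa using h2, hs⟩
  | succ k ih =>
    intro v hv s hs
    obtain ⟨h1, h2, t, s', r, ht, hs'⟩ := hpos v (by omega) s hs
    obtain ⟨t', s'', r', ht', hs''⟩ := ih (v + 1) (by omega) s' hs'
    exact ⟨_, s'', .while_pos h1 r r', by rw [sum_eq_sum_Ico_succ_bot (by omega)]; omega, hs''⟩

namespace XExpr

/-- In a memory equal to `σ` up to scratch registers, the compiled expression is evaluated in time
`L ^ deg`. -/
def CompilesIn (L : ℕ) (σ : Memory) (e : XExpr) : Prop :=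
  e.WF → ∀ {τ : ℕ} {ρ : ℕ → ℕ} {ε : ℕ → ℤ} {s : Memory}, scratch ≤ τ → (∀ y, ρ y < τ) →
    (∀ y, bits (ε y) ≤ L) → s.Equiv σ → (∀ y, s.reg (ρ y) = ε y) →
    ∃ t s', Runs (e.compile τ ρ) s t s' ∧ t ≤ L ^ e.deg ∧ s'.arr = s.arr ∧
      (∀ x < τ, s'.reg x = s.reg x) ∧ s'.reg τ = e.eval σ ε

theorem exists_runs_compile (hσ : σ.Good L) (e : XExpr) :
    CompilesIn L σ e := by
  have hL := hσ.two_le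
  have hassign : ∀ (s : Memory) (τ : ℕ) (e : Expr) (z : ℤ), e.val s = z →
      (s.setReg τ (e.val s)).arr = s.arr ∧
      (∀ x < τ, (s.setReg τ (e.val s)).reg x = s.reg x) ∧ (s.setReg τ (e.val s)).reg τ = z := by
    intro s τ e z hz
    refine ⟨rfl, fun x hx => ?_, ?_⟩ <;> grind
  have hbin : ∀ {e f : XExpr} {τ : ℕ} {ρ : ℕ → ℕ} {ε : ℕ → ℤ} {s : Memory}
      {op : Expr → Expr → Expr} {g : ℤ → ℤ → ℤ},
      (∀ s a b, (op (.var a) (.var b)).val s = g (s.reg a) (s.reg b)) →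
      (∀ s a b, (op (.var a) (.var b)).cost s =
        bits (s.reg a) + bits (s.reg b) + bits (g (s.reg a) (s.reg b))) →
      (∀ x y, bits (g x y) ≤ bits x + bits y) → CompilesIn L σ e → CompilesIn L σ f →
      e.WF ∧ f.WF → scratch ≤ τ → (∀ y, ρ y < τ) → (∀ y, bits (ε y) ≤ L) → s.Equiv σ →
      (∀ y, s.reg (ρ y) = ε y) →
      ∃ t s', Runs (.seq (e.compile τ ρ) (.seq (f.compile (τ + 1) ρ)
        (.assign τ (op (.var τ) (.var (τ + 1)))))) s t s' ∧ t ≤ L ^ (e.deg + f.deg + 3) ∧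
        s'.arr = s.arr ∧ (∀ x < τ, s'.reg x = s.reg x) ∧
        s'.reg τ = g (e.eval σ ε) (f.eval σ ε) := by
    intro e f τ ρ ε s op g hval hcost hg h1 h2 he hτ hρ hε hs hsε
    obtain ⟨t, s', r, ht, ha, hr, hv⟩ := h1 he.1 hτ hρ hε hs hsε
    obtain ⟨t', s'', r', ht', ha', hr', hv'⟩ := h2 he.2 (τ := τ + 1) (by omega)
      (fun y => (hρ y).trans (by omega)) hε
      ⟨ha.trans hs.1, fun x hx => (hr x (by omega)).trans (hs.2 x hx)⟩
      fun y => (hr _ (hρ y)).trans (hsε y)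
    have hv2 : s''.reg τ = e.eval σ ε := by rw [hr' τ (by omega), hv]
    refine ⟨_, _, .seq r (.seq r' (.assign s'' τ _)), ?_, by rw [setReg_arr, ha', ha],
      fun z hz => by grind, by rw [setReg_self, hval, hv2, hv']⟩
    rw [hcost, hv2, hv']
    have := hg (e.eval σ ε) (f.eval σ ε)
    have := binary_bound (d := e.deg) (e := f.deg) hL
    have := bits_eval_le hσ e he.1 hε
    have := bits_eval_le hσ f he.2 hε
    omega
  induction e with
  | const c =>
    intro he τ ρ ε s hτ hρ hε hs hsε
    refine ⟨_, _, .assign s τ _, ?_, hassign s τ _ _ rfl⟩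
    exact (Nat.lt_two_pow_self).trans_le (Nat.pow_le_pow_left hL _)
  | var x =>
    intro he τ ρ ε s hτ hρ hε hs hsε
    refine ⟨_, _, .assign s τ _, ?_, hassign s τ _ _ (hs.2 x he)⟩
    have h1 := hσ.reg x he
    rw [← hs.2 x he] at h1
    simp only [Expr.cost, deg]
    nlinarith
  | lv y =>
    intro he τ ρ ε s hτ hρ hε hs hsε
    refine ⟨_, _, .assign s τ _, ?_, hassign s τ _ _ (hsε y)⟩
    have h1 := hε y
    rw [← hsε y] at h1
    simp only [Expr.cost, deg]
    nlinarith
  | cell a i ih =>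
    intro he τ ρ ε s hτ hρ hε hs hsε
    obtain ⟨t, s', r, ht, ha, hr, hv⟩ := ih he.2 hτ hρ hε hs hsε
    have hv' : (Expr.cell a (.var τ)).val s' = (XExpr.cell a i).eval σ ε := by
      simp only [Expr.val, eval, hv, ha, hs.1]
    obtain ⟨h1, h2, h3⟩ := hassign s' τ _ _ hv'
    refine ⟨_, _, .seq r (.assign s' τ _), ?_, h1.trans ha, fun x hx => (h2 x hx).trans (hr x hx),
      h3⟩
    simp only [Expr.cost, Expr.val, deg, hv, ha, hs.1]
    have h4 := bits_eval_le hσ i he.2 hε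
    have h5 := hσ.arr a he.1 (i.eval σ ε)
    have h6 := pow_eight_le (d := i.deg) hL
    have h7 := le_pow_of_one_le hL i.one_le_deg
    omega
  | add e f h1 h2 =>
    exact fun he _ _ _ _ => hbin (fun _ _ _ => rfl) (fun _ _ _ => rfl) bits_add h1 h2 he
  | sub e f h1 h2 =>
    exact fun he _ _ _ _ => hbin (fun _ _ _ => rfl) (fun _ _ _ => rfl) bits_sub h1 h2 he
  | mul e f h1 h2 =>
    exact fun he _ _ _ _ => hbin (fun _ _ _ => rfl) (fun _ _ _ => rfl) bits_mul h1 h2 he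
  | div e f h1 h2 =>
    exact fun he _ _ _ _ => hbin (fun _ _ _ => rfl) (fun _ _ _ => rfl)
      (fun x y => (bits_div x y).trans (by omega)) h1 h2 he
  | ind e ih =>
    intro he τ ρ ε s hτ hρ hε hs hsε
    obtain ⟨t, s', r, ht, ha, hr, hv⟩ := ih he hτ hρ hε hs hsε
    have h4 := bits_eval_le hσ e he hε
    have h6 := pow_four_le (d := e.deg) hL
    have h7 := le_pow_of_one_le hL e.one_le_deg
    have hb := bits_pos (e.eval σ ε)
    have hd : L ^ e.deg = 2 → L ^ (e.deg + 2) = 8 := by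
      intro h
      obtain rfl : L = 2 := by omega
      rw [pow_add, h]
      rfl
    by_cases hp : 0 < e.eval σ ε
    · obtain ⟨h1, h2, h3⟩ := hassign s' τ (.const 1) 1 rfl
      refine ⟨_, _, .seq r (.ite_pos (by simpa [Expr.val, hv] using hp) (.assign s' τ (.const 1))),
        ?_, h1.trans ha, fun x hx => (h2 x hx).trans (hr x hx), by rw [h3]; simp [eval, hp]⟩
      simp only [Expr.cost, deg, hv, bits_one]
      omega
    · obtain ⟨h1, h2, h3⟩ := hassign s' τ (.const 0) 0 rfl
      refine ⟨_, _, .seq r (.ite_neg (by simpa [Expr.val, hv] using hp) (.assign s' τ (.const 0))),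
        ?_, h1.trans ha, fun x hx => (h2 x hx).trans (hr x hx), by rw [h3]; simp [eval, hp]⟩
      simp only [Expr.cost, deg, hv, bits_zero]
      omega
  | sum y r e ih =>
    intro he τ ρ ε s hτ hρ hε hs hsε
    have hrs : r < scratch := he.1.trans boundRegs_lt
    set n := (σ.reg r).toNat with hn
    let f : ℕ → ℤ := fun v => e.eval σ (update ε y (v : ℤ))
    have hf : ∀ v < n, bits (f v) ≤ L ^ e.deg := fun v hv =>
      bits_eval_le hσ e he.2 (bits_update_le hε (bits_index_le hσ hrs hv.le) y)
    let I : ℕ → Memory → Prop := fun v s' => s'.arr = s.arr ∧ (∀ x < τ, s'.reg x = s.reg x) ∧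
      s'.reg τ = ∑ w ∈ range v, f w ∧ s'.reg (τ + 1) = (v : ℤ)
    have hX2 : 2 * L ≤ L ^ (e.deg + 1) := by
      rw [pow_succ, mul_comm]
      exact Nat.mul_le_mul_left _ (hL.trans (le_pow_of_one_le hL e.one_le_deg)) |>.trans
        (by rw [mul_comm])
    have hX3 : 2 * L ^ e.deg ≤ L ^ (e.deg + 1) := by
      rw [pow_succ, mul_comm]
      exact Nat.mul_le_mul_left _ hL
    have hnL : n ≤ L := toNat_le_of_good hσ he.1
    have hacc : ∀ v ≤ n, bits (∑ w ∈ range v, f w) ≤ 1 + L ^ (e.deg + 1) := by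
      intro v hv
      have h1 := bits_sum_le f (L ^ e.deg) v fun w hw => hf w (by omega)
      have h2 : v * L ^ e.deg ≤ L * L ^ e.deg := Nat.mul_le_mul_right _ (by omega)
      rw [pow_succ, mul_comm]
      omega
    have htest : ∀ v ≤ n, ∀ s', I v s' →
        (Expr.sub (.var r) (.var (τ + 1))).val s' = σ.reg r - v ∧
        (Expr.sub (.var r) (.var (τ + 1))).cost s' + 1 ≤ 4 * L + 1 := by
      intro v hv s' hI
      have h1 : s'.reg r = σ.reg r := by rw [hI.2.1 r (by omega), hs.2 r hrs]
      have h2 := bits_index_le hσ hrs hv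
      have h3 := hσ.reg r hrs
      have h4 := bits_sub (σ.reg r) v
      simp only [Expr.val, Expr.cost, h1, hI.2.2.2]
      exact ⟨trivial, by omega⟩
    have h0 : Runs (.assign τ (.const 0)) s _ _ := .assign s τ (.const 0)
    have h0' : Runs (.assign (τ + 1) (.const 0)) (s.setReg τ 0) _ _ :=
      .assign (s.setReg τ 0) (τ + 1) (.const 0)
    have hpos : ∀ v < n, ∀ s', I v s' → 0 < (Expr.sub (.var r) (.var (τ + 1))).val s' ∧
        (Expr.sub (.var r) (.var (τ + 1))).cost s' + 1 ≤ 4 * L + 1 ∧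
        ∃ t s'', Runs (.seq (e.compile (τ + 2) (update ρ y (τ + 1)))
          (.seq (.assign τ (.add (.var τ) (.var (τ + 2))))
            (.assign (τ + 1) (.add (.var (τ + 1)) (.const 1))))) s' t s'' ∧
          t ≤ 2 * L ^ e.deg + 2 * L ^ (e.deg + 1) + 2 * L + 8 ∧ I (v + 1) s'' := by
      intro v hv s' hI
      obtain ⟨h1, h2⟩ := htest v hv.le s' hI
      refine ⟨by rw [h1]; omega, h2, ?_⟩
      have hρ' : ∀ y', update ρ y (τ + 1) y' < τ + 2 := fun y' => by
        have := hρ y'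
        rw [update_apply]
        split_ifs <;> omega
      have hε' : ∀ y', s'.reg (update ρ y (τ + 1) y') = update ε y (v : ℤ) y' := fun y' => by
        rw [update_apply, update_apply]
        split_ifs
        · exact hI.2.2.2
        · rw [hI.2.1 _ (hρ y'), hsε]
      obtain ⟨t, s'', hr, ht, ha, hreg, hval⟩ := ih he.2 (τ := τ + 2) (by omega) hρ'
        (bits_update_le hε (bits_index_le hσ hrs hv.le) y)
        ⟨hI.1.trans hs.1, fun x hx => (hI.2.1 x (by omega)).trans (hs.2 x hx)⟩ hε'
      change s''.reg (τ + 2) = f v at hval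
      have hr1 : s''.reg τ = ∑ w ∈ range v, f w := by rw [hreg τ (by omega), hI.2.2.1]
      have hr2 : s''.reg (τ + 1) = (v : ℤ) := by rw [hreg (τ + 1) (by omega), hI.2.2.2]
      refine ⟨_, _, .seq hr (.seq (.assign _ _ _) (.assign _ _ _)), ?_, ?_, fun x hx => ?_, ?_, ?_⟩
      · have h3 := hacc v hv.le
        have h4 := hacc (v + 1) hv
        rw [sum_range_succ] at h4
        have h5 := hf v hv
        have h6 := bits_index_le hσ hrs (v := v + 1) hv
        have h7 := bits_index_le hσ hrs (v := v) hv.le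
        push_cast at h6
        have h8 : update s''.reg τ ((Expr.add (.var τ) (.var (τ + 2))).val s'')
            (τ + 1) = (v : ℤ) := by rw [update_of_ne (by omega), hr2]
        simp only [Expr.cost, Expr.val, setReg_reg, bits_one] at *
        rw [h8, hr1, hval]
        omega
      · simp only [setReg_arr, ha, hI.1]
      · simp [show x ≠ τ by omega, show x ≠ τ + 1 by omega, hreg x (by omega), hI.2.1 x hx]
      · simp [Expr.val, hr1, hval, sum_range_succ]
      · simp [Expr.val, hr2]
    have hneg : ∀ s', I n s' → ¬ 0 < (Expr.sub (.var r) (.var (τ + 1))).val s' ∧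
        (Expr.sub (.var r) (.var (τ + 1))).cost s' + 1 ≤ 4 * L + 1 := by
      intro s' hI
      obtain ⟨h1, h2⟩ := htest n le_rfl s' hI
      exact ⟨by rw [h1]; omega, h2⟩
    have hinit : I 0 ((s.setReg τ 0).setReg (τ + 1) 0) := by
      exact ⟨rfl, fun x hx => by simp [show x ≠ τ by omega, show x ≠ τ + 1 by omega], by simp, by simp⟩
    obtain ⟨t, s', hrun, ht, hI⟩ := Runs.exists_while I n
      (fun _ => 2 * L ^ e.deg + 2 * L ^ (e.deg + 1) + 2 * L + 8) (4 * L + 1) hpos hneg _ hinit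
    refine ⟨_, _, .seq h0 (.seq h0' hrun), ?_, hI.1, hI.2.1, hI.2.2.1⟩
    rw [sum_const, card_range, smul_eq_mul] at ht
    have h1 : n * (2 * L ^ e.deg + 2 * L ^ (e.deg + 1) + 2 * L + 8 + (4 * L + 1)) ≤
        L * (9 * L ^ (e.deg + 1)) := Nat.mul_le_mul hnL (by omega)
    have h2 : L * L ^ (e.deg + 1) = L ^ (e.deg + 2) := by ring
    have h3 : 4 * L ^ (e.deg + 2) ≤ L ^ (e.deg + 4) := pow_four_le hL
    have h4 : 4 * L ^ (e.deg + 4) ≤ L ^ (e.deg + 6) := pow_four_le hL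
    have h5 : L ^ (e.deg + 1) * 2 ≤ L ^ (e.deg + 2) := by
      rw [pow_succ L (e.deg + 1)]
      exact Nat.mul_le_mul_left _ hL
    have h6 : L * (9 * L ^ (e.deg + 1)) = 9 * L ^ (e.deg + 2) := by ring
    rw [h6] at h1
    simp only [Expr.cost, bits_zero, deg]
    omega

end XExpr

variable {e f i : XExpr}

/-! ### Total correctness with time bounds, up to scratch registers -/

/-- Started in any memory that equals `σ` up to scratch registers, the program halts in time at most
`T` in a memory that equals, up to scratch registers, a memory with property `Q`. -/
def Ter (p : Prog) (σ : Memory) (T : ℕ) (Q : Memory → Prop) : Prop :=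
  ∀ s : Memory, s.Equiv σ → ∃ t s' σ', Runs p s t s' ∧ t ≤ T ∧ s'.Equiv σ' ∧ Q σ'

theorem Ter.mono {Q' : Memory → Prop} (h : Ter p σ T Q)
    (hT : T ≤ T') (hQ : ∀ σ', Q σ' → Q' σ') : Ter p σ T' Q' := by
  intro s hs
  obtain ⟨t, s', σ', h1, h2, h3, h4⟩ := h s hs
  exact ⟨t, s', σ', h1, h2.trans hT, h3, hQ _ h4⟩

theorem Ter.mono_left (h : Ter p σ T Q) (hT : T ≤ T') : Ter p σ T' Q :=
  h.mono hT fun _ h => h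

theorem Ter.seq {q : Prog} {R : Memory → Prop} (h : Ter p σ T R)
    (h' : ∀ σ', R σ' → Ter q σ' T' Q) : Ter (.seq p q) σ (T + T') Q := by
  intro s hs
  obtain ⟨t, s', σ', h1, h2, h3, h4⟩ := h s hs
  obtain ⟨t', s'', σ'', h1', h2', h3', h4'⟩ := h' σ' h4 s' h3
  exact ⟨_, s'', σ'', .seq h1 h1', by omega, h3', h4'⟩

theorem four_mul_add_one_le_pow (hL : 2 ≤ L) : 4 * L + 1 ≤ L ^ 4 := by
  have h1 := pow_eight_le (d := 1) hL
  rw [pow_one] at h1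
  exact (by omega : 4 * L + 1 ≤ L ^ (1 + 3))

/-- The initial assignment of bound variables. -/
def XExpr.val (e : XExpr) (σ : Memory) : ℤ := e.eval σ fun _ => σ.reg 0

theorem XExpr.bits_val_le (hσ : σ.Good L) (he : e.WF) :
    bits (e.val σ) ≤ L ^ e.deg :=
  XExpr.bits_eval_le hσ e he fun _ => hσ.reg 0 (by decide)

theorem XExpr.exists_runs (hσ : σ.Good L) (he : e.WF) (hτ : scratch ≤ τ) (hs : s.Equiv σ) :
    ∃ t s', Runs (e.compile τ fun _ => 0) s t s' ∧ t ≤ L ^ e.deg ∧ s'.arr = s.arr ∧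
      (∀ x < τ, s'.reg x = s.reg x) ∧ s'.reg τ = e.val σ :=
  XExpr.exists_runs_compile hσ e he hτ (fun _ => by grind)
    (fun _ => hσ.reg 0 (by decide)) hs fun _ => hs.2 0 (by decide)

/-- Assign the value of an expression to a register. -/
def Prog.set (x : ℕ) (e : XExpr) : Prog :=
  .seq (e.compile scratch fun _ => 0) (.assign x (.var scratch))

/-- Store the value of an expression in a cell. -/
def Prog.put (a : ℕ) (i e : XExpr) : Prog :=
  .seq (i.compile scratch fun _ => 0) (.seq (e.compile (scratch + 1) fun _ => 0)
    (.store a (.var scratch) (.var (scratch + 1))))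

/-- Branch on the value of an expression. -/
def Prog.cond (e : XExpr) (p q : Prog) : Prog :=
  .seq (e.compile scratch fun _ => 0) (.ite (.var scratch) p q)

theorem Ter.set (hσ : σ.Good L) (he : e.WF) (hQ : Q (σ.setReg x (e.val σ))) :
    Ter (.set x e) σ (L ^ (e.deg + 2)) Q := by
  intro s hs
  obtain ⟨t, s', r, ht, ha, hr, hv⟩ := XExpr.exists_runs hσ he le_rfl hs
  refine ⟨_, _, _, .seq r (.assign _ _ _), ?_, ⟨?_, fun y hy => ?_⟩, hQ⟩
  · have h1 := XExpr.bits_val_le hσ he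
    have h2 := pow_four_le (d := e.deg) hσ.two_le
    have h3 : 1 ≤ L ^ e.deg := Nat.one_le_pow _ _ (by have := hσ.two_le; omega)
    simp only [Expr.cost, hv]
    omega
  · exact ha.trans hs.1
  · simp only [setReg_reg, Expr.val, hv, update_apply]
    split_ifs
    · rfl
    · rw [hr y hy, hs.2 y hy]

theorem Ter.set_seq {q : Prog} (hσ : σ.Good L) (he : e.WF) (hz : e.val σ = z)
    (h : Ter q (σ.setReg x z) T Q) : Ter (.seq (.set x e) q) σ (L ^ (e.deg + 2) + T) Q :=
  (Ter.set (Q := fun σ' => σ' = σ.setReg x z) hσ he (by rw [hz])).seq fun _ h' => h' ▸ h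

theorem Ter.put (hσ : σ.Good L) (hi : i.WF) (he : e.WF) (hQ : Q (σ.setCell a (i.val σ) (e.val σ))) :
    Ter (.put a i e) σ (L ^ (i.deg + e.deg + 3)) Q := by
  intro s hs
  obtain ⟨t, s', r, ht, ha, hr, hv⟩ := XExpr.exists_runs hσ hi le_rfl hs
  obtain ⟨t', s'', r', ht', ha', hr', hv'⟩ := XExpr.exists_runs hσ he
    (Nat.le_succ scratch) (s := s') ⟨ha.trans hs.1, fun x hx => (hr x hx).trans (hs.2 x hx)⟩
  have hv2 : s''.reg scratch = i.val σ := by rw [hr' _ (by omega), hv]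
  refine ⟨_, _, _, .seq r (.seq r' (.store _ _ _ _)), ?_, ⟨?_, fun y hy => ?_⟩, hQ⟩
  · have h1 := XExpr.bits_val_le hσ he
    have h1' := XExpr.bits_val_le hσ hi
    have h2 := XExpr.binary_bound (d := i.deg) (e := e.deg) hσ.two_le
    simp only [Expr.cost, hv2]
    grind
  · simp only [Nat.succ_eq_add_one] at hv'
    simp only [setCell, Expr.val, hv2, hv', ha', ha, hs.1]
  · simp only [setCell_reg]
    rw [hr' y (by omega), hr y hy, hs.2 y hy]

theorem Ter.cond (hσ : σ.Good L) (he : e.WF) {q : Prog} (hp : 0 < e.val σ → Ter p σ T Q) (hq : ¬ 0 < e.val σ → Ter q σ T Q) :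
    Ter (.cond e p q) σ (L ^ (e.deg + 2) + T) Q := by
  intro s hs
  obtain ⟨t, s', r, ht, ha, hr, hv⟩ := XExpr.exists_runs hσ he le_rfl hs
  have hs' : s'.Equiv σ := ⟨ha.trans hs.1, fun x hx => (hr x hx).trans (hs.2 x hx)⟩
  have h1 := XExpr.bits_val_le hσ he
  have h2 := pow_four_le (d := e.deg) hσ.two_le
  have h3 : 1 ≤ L ^ e.deg := Nat.one_le_pow _ _ (by have := hσ.two_le; omega)
  by_cases h : 0 < e.val σ
  · obtain ⟨t', s'', σ', r', ht', hs'', hQ⟩ := hp h s' hs'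
    refine ⟨_, s'', σ', .seq r (.ite_pos (by simpa [Expr.val, hv] using h) r'), ?_, hs'', hQ⟩
    simp only [Expr.cost, hv]
    omega
  · obtain ⟨t', s'', σ', r', ht', hs'', hQ⟩ := hq h s' hs'
    refine ⟨_, s'', σ', .seq r (.ite_neg (by simpa [Expr.val, hv] using h) r'), ?_, hs'', hQ⟩
    simp only [Expr.cost, hv]
    omega

/-- The rule for loops that run while register `y` is less than register `x`. The invariant has a time
budget. -/
theorem Ter.while_lt (hx : x < scratch) (hy : y < scratch) (I : Memory → ℕ → Prop) (T₁ : ℕ)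
    (htest : ∀ σ n, I σ n → 2 * (bits (σ.reg x) + bits (σ.reg y)) + 1 ≤ T₁)
    (hpos : ∀ σ n, I σ n → σ.reg y < σ.reg x → ∃ T, T + T₁ ≤ n ∧
      Ter p σ T fun σ' => ∃ n', n' + T + T₁ ≤ n ∧ I σ' n')
    (hneg : ∀ σ n, I σ n → σ.reg x ≤ σ.reg y → Q σ ∧ T₁ ≤ n) (h : I σ n) :
    Ter (.while (.sub (.var x) (.var y)) p) σ n Q := by
  induction n using Nat.strong_induction_on generalizing σ with
  | _ n ih =>
    intro s hs
    have ht := htest σ n h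
    have hsub := bits_sub (σ.reg x) (σ.reg y)
    have hval : (Expr.sub (.var x) (.var y)).val s = σ.reg x - σ.reg y := by
      simp only [Expr.val, hs.2 x hx, hs.2 y hy]
    have hcost : (Expr.sub (.var x) (.var y)).cost s + 1 ≤ T₁ := by
      simp only [Expr.cost, Expr.val, hs.2 x hx, hs.2 y hy]
      omega
    by_cases hlt : σ.reg y < σ.reg x
    · obtain ⟨T, hT, hter⟩ := hpos σ n h hlt
      obtain ⟨t, s', σ', r, ht', hs', n', hn', hI⟩ := hter s hs
      obtain ⟨t', s'', σ'', r', ht'', hs'', hQ⟩ := ih n' (by omega) hI s' hs'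
      exact ⟨_, s'', σ'', .while_pos (by rw [hval]; omega) r r', by omega, hs'', hQ⟩
    · obtain ⟨hQ, hn⟩ := hneg σ n h (not_lt.1 hlt)
      exact ⟨_, s, σ, .while_neg (by rw [hval]; omega), by omega, hs, hQ⟩

/-- The memory after the content of an array has been replaced. -/
def Memory.setArr (s : Memory) (a : ℕ) (A : ℤ → ℤ) : Memory :=
  { s with arr := update s.arr a A }

theorem Memory.setArr_reg (s : Memory) (a : ℕ) (A : ℤ → ℤ) : (s.setArr a A).reg = s.reg := rfl

theorem Memory.setArr_arr (s : Memory) (a : ℕ) (A : ℤ → ℤ) :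
    (s.setArr a A).arr = update s.arr a A := rfl

theorem Memory.Good.setReg (hσ : σ.Good L) (hz : bits z ≤ L) (hz' : x < boundRegs → z ≤ L := by exact fun h => absurd h (by first | decide | omega)) :
    (σ.setReg x z).Good L := by
  refine ⟨hσ.two_le, fun y hy => ?_, hσ.arr, fun r hr => ?_⟩
  · simp only [setReg_reg, update_apply]
    split_ifs
    · exact hz
    · exact hσ.reg y hy
  · simp only [setReg_reg, update_apply]
    split_ifs with h
    · exact hz' (h ▸ hr)
    · exact hσ.bound r hr

theorem Memory.Good.setArr (hσ : σ.Good L) {A : ℤ → ℤ}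
    (hA : a < ownArrays → ∀ i, bits (A i) ≤ L := by exact fun h => absurd h (by decide)) : (σ.setArr a A).Good L := by
  refine ⟨hσ.two_le, hσ.reg, fun b hb i => ?_, hσ.bound⟩
  simp only [setArr_arr, update_apply]
  split_ifs with h
  · exact hA (h ▸ hb) i
  · exact hσ.arr b hb i

/-- Fill the cells `i` of array `a` with the values `e`, where register `x` runs from zero to the
content of register `r`. -/
def Prog.fill (a x r : ℕ) (i e : XExpr) : Prog :=
  .seq (.set x (.const 0)) (.while (.sub (.var r) (.var x))
    (.seq (.put a i e) (.set x (.add (.var x) (.const 1)))))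

/-- The exponent of the time bound for an iteration of `Prog.fill`. -/
def XExpr.fillDeg (i e : XExpr) : ℕ := i.deg + e.deg + 12

theorem Ter.fill (hσ : σ.Good L) (hx : x < scratch)
    (hx' : boundRegs ≤ x) (hr : r < scratch) (hxr : x ≠ r) (hi : i.WF) (he : e.WF) (hn : σ.reg r = n) (g f : ℕ → ℤ) (hg : ∀ v < n, ∀ w < n, g v = g w → v = w)
    (hf : a < ownArrays → ∀ v < n, bits (f v) ≤ L)
    (hval : ∀ v < n, ∀ A : ℤ → ℤ, (∀ w < v, A (g w) = f w) →
      (∀ j, (∀ w < n, j ≠ g w) → A j = σ.arr a j) →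
      i.val ((σ.setReg x (v : ℤ)).setArr a A) = g v ∧
      e.val ((σ.setReg x (v : ℤ)).setArr a A) = f v) (hQ : ∀ A : ℤ → ℤ, (∀ v < n, A (g v) = f v) →
      (∀ j, (∀ w < n, j ≠ g w) → A j = σ.arr a j) → Q ((σ.setReg x (n : ℤ)).setArr a A)) :
    Ter (.fill a x r i e) σ ((n + 1) * L ^ XExpr.fillDeg i e) Q := by
  have hL := hσ.two_le
  have hbx : ∀ v ≤ n, bits (v : ℤ) ≤ L := fun v hv =>
    (bits_mono (by omega)).trans (hσ.reg r hr)
  let P : ℕ → (ℤ → ℤ) → Prop := fun v A => (∀ w < v, A (g w) = f w) ∧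
    (∀ j, (∀ w < v, j ≠ g w) → A j = σ.arr a j)
  have hgood : ∀ v ≤ n, ∀ A, P v A → ((σ.setReg x (v : ℤ)).setArr a A).Good L := by
    intro v hv A hA
    refine (hσ.setReg (hbx v hv)).setArr fun ha j => ?_
    by_cases h : ∀ w < v, j ≠ g w
    · rw [hA.2 j h]
      exact hσ.arr a ha j
    · grind
  have hb1 : bits 1 ≤ L := by rw [bits_one]; exact hL
  let D := L ^ XExpr.fillDeg i e
  let I : Memory → ℕ → Prop := fun σ' b => ∃ v ≤ n, ∃ A, P v A ∧
    σ' = (σ.setReg x (v : ℤ)).setArr a A ∧ b = (n - v) * D + L ^ 4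
  have hpow : L ^ (i.deg + e.deg + 3) + L ^ 9 + L ^ 4 ≤ D := by
    have h1 : L ^ (i.deg + e.deg + 3) ≤ L ^ (i.deg + e.deg + 10) :=
      Nat.pow_le_pow_right (by omega) (by omega)
    have h2 : L ^ 9 ≤ L ^ (i.deg + e.deg + 10) := Nat.pow_le_pow_right (by omega) (by omega)
    have h3 : L ^ 4 ≤ L ^ (i.deg + e.deg + 10) := Nat.pow_le_pow_right (by omega) (by omega)
    have h4 : 4 * L ^ (i.deg + e.deg + 10) ≤ D := pow_four_le hL
    omega
  have hL4 := four_mul_add_one_le_pow hL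
  have hloop : ∀ A, P 0 A → Ter (.while (.sub (.var r) (.var x))
      (.seq (.put a i e) (.set x (.add (.var x) (.const 1)))))
      ((σ.setReg x 0).setArr a A) (n * D + L ^ 4) Q := by
    intro A hA
    refine Ter.while_lt hr hx I (L ^ 4) ?_ ?_ ?_ (σ := (σ.setReg x 0).setArr a A)
      ⟨0, Nat.zero_le _, A, hA, by simp, by simp⟩
    · rintro σ' b ⟨v, hv, A, hA, rfl, -⟩
      have h1 := (hgood v hv A hA).reg r hr
      have h2 := (hgood v hv A hA).reg x hx
      omega
    · rintro σ' b ⟨v, hv, A, hA, rfl, rfl⟩ hlt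
      have h1 : ((σ.setReg x (v : ℤ)).setArr a A).reg x = v := by simp [setArr_reg]
      have h2 : ((σ.setReg x (v : ℤ)).setArr a A).reg r = n := by
        simp only [setArr_reg, setReg_reg]
        rw [update_of_ne (Ne.symm hxr), hn]
      rw [h1, h2] at hlt
      have hvn : v < n := mod_cast hlt
      have hA' : ∀ j, (∀ w < n, j ≠ g w) → A j = σ.arr a j := fun j hj =>
        hA.2 j fun w hw => hj w (by omega)
      obtain ⟨hvi, hve⟩ := hval v hvn A hA.1 hA'
      have hG := hgood v hv A hA
      have hP : P (v + 1) (update A (g v) (f v)) := by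
        refine ⟨fun w hw => ?_, fun j hj => ?_⟩
        · by_cases hwv : w = v
          · rw [hwv, update_self]
          · grind
        · rw [update_of_ne (hj v (by omega))]
          exact hA.2 j fun w hw => hj w (by omega)
      have hstate : (((σ.setReg x (v : ℤ)).setArr a A).setCell a (g v) (f v)) =
          (σ.setReg x (v : ℤ)).setArr a (update A (g v) (f v)) := by
        simp [setCell, setArr, update_idem]
      have hG' : ((σ.setReg x (v : ℤ)).setArr a (update A (g v) (f v))).Good L := by
        refine Good.setArr (hσ.setReg (hbx v hv)) ?_
        intro ha j
        rw [update_apply]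
        split_ifs
        · exact hf ha v hvn
        · have := hG.arr a ha j
          simpa [setArr_arr] using this
      have hnv : (n - v) * D = (n - (v + 1)) * D + D := by
        rw [show n - v = n - (v + 1) + 1 by omega]
        ring
      refine ⟨L ^ (i.deg + e.deg + 3) + L ^ 9, ?_, ?_⟩
      · omega
      refine Ter.seq (R := fun σ' => σ' =
        (σ.setReg x (v : ℤ)).setArr a (update A (g v) (f v))) ?_ ?_
      · refine Ter.put hG hi he ?_
        rw [hvi, hve, hstate]
      · rintro _ rfl
        have hset : ((XExpr.var x).add (.const 1)).val
            ((σ.setReg x (v : ℤ)).setArr a (update A (g v) (f v))) =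
            ((v + 1 : ℕ) : ℤ) := by simp [XExpr.val, XExpr.eval, setArr_reg]
        have hT := Ter.set hG' (x := x) (e := (XExpr.var x).add (.const 1)) ⟨hx, trivial⟩
          (Q := fun σ' => ∃ n', n' + (L ^ (i.deg + e.deg + 3) + L ^ 9) + L ^ 4 ≤
            (n - v) * D + L ^ 4 ∧ I σ' n') ?_
        · simpa [XExpr.deg, bits_one] using hT
        · refine ⟨(n - (v + 1)) * D + L ^ 4, by omega, v + 1, hvn, _, hP, ?_, rfl⟩
          rw [hset]
          simp [setReg, setArr, update_idem]
    · rintro σ' b ⟨v, hv, A, hA, rfl, rfl⟩ hle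
      have h1 : ((σ.setReg x (v : ℤ)).setArr a A).reg x = v := by simp [setArr_reg]
      have h2 : ((σ.setReg x (v : ℤ)).setArr a A).reg r = n := by
        simp only [setArr_reg, setReg_reg]
        rw [update_of_ne (Ne.symm hxr), hn]
      rw [h1, h2] at hle
      obtain rfl : v = n := by omega
      exact ⟨hQ A hA.1 hA.2, by omega⟩
  have h0 := Ter.set hσ (x := x) (e := .const 0) trivial
    (Q := fun σ' => σ' = (σ.setReg x 0).setArr a (σ.arr a)) (by
      simp [XExpr.val, XExpr.eval, setArr, setReg])
  have h1 := Ter.seq h0 (T' := n * D + L ^ 4) (Q := Q) (q := (.while (.sub (.var r) (.var x))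
      (.seq (.put a i e) (.set x (.add (.var x) (.const 1)))))) (by grind)
  refine h1.mono ?_ fun _ h => h
  simp only [XExpr.deg, bits_zero]
  have h2 : L ^ (1 + 2) ≤ L ^ 9 := Nat.pow_le_pow_right (by omega) (by omega)
  grind

/-! ### Metered simulation of a program

The simulated memory lives in pairs of arrays, one for values and one for stamps. A value counts only
if its stamp is the current one, so a new simulation starts with an empty memory. Every value that
the simulated program computes is charged to the fuel register. -/

/-- The register with the remaining fuel. -/
abbrev fuelReg : ℕ := 38

/-- The register with the current stamp. -/
abbrev stampReg : ℕ := 39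

/-- The array with the values of simulated array `a`; simulated array `0` holds the registers. -/
abbrev simVal (a : ℕ) : ℕ := 3 + 2 * a

/-- The array with the stamps of simulated array `a`. -/
abbrev simStamp (a : ℕ) : ℕ := 4 + 2 * a

/-- The content of a simulated cell. -/
def Memory.rd (s : Memory) (a : ℕ) (i : ℤ) : ℤ :=
  if s.arr (simStamp a) i = s.reg stampReg then s.arr (simVal a) i else 0

/-- All stamps are between zero and the current stamp. -/
def Memory.Stamped (s : Memory) : Prop :=
  ∀ a i, 0 ≤ s.arr (simStamp a) i ∧ s.arr (simStamp a) i ≤ s.reg stampReg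

/-- The memory `s` holds the simulated memory `m`. -/
structure Memory.Simulates (s m : Memory) : Prop where
  reg : ∀ x : ℕ, s.rd 0 x = m.reg x
  arr : ∀ a i, s.rd (a + 1) i = m.arr a i
  stamped : s.Stamped

theorem Memory.Simulates.congr {m : Memory} (h : s.Simulates m) (ha : s'.arr = s.arr)
    (hr : s'.reg stampReg = s.reg stampReg) : s'.Simulates m := by
  constructor
  · intro x; rw [← h.reg x]; simp only [rd, ha, hr]
  · intro a i; rw [← h.arr a i]; simp only [rd, ha, hr]
  · intro a i; rw [ha, hr]; exact h.stamped a i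

/-- The charge for a number: the bit length up to a constant factor. -/
def charge (z : ℤ) : ℕ := 2 ^ Nat.clog 2 (z * z).natAbs.size

theorem charge_pos (z : ℤ) : 1 ≤ charge z := Nat.one_le_two_pow

theorem bits_le_charge (z : ℤ) : bits z ≤ 1 + charge z := by
  have h1 : (z * z).natAbs.size ≤ charge z := Nat.le_pow_clog (by norm_num) _
  have h2 : z.natAbs ≤ (z * z).natAbs := by
    rw [Int.natAbs_mul]
    exact Nat.le_mul_self _
  have := Nat.size_le_size h2
  unfold bits
  omega

theorem charge_le (z : ℤ) : charge z ≤ 4 * bits z := by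
  have h1 := bits_mul z z
  unfold charge
  rcases Nat.lt_or_ge 1 (z * z).natAbs.size with h | h
  · have h2 := Nat.pow_pred_clog_lt_self (b := 2) (by norm_num) h
    have h3 : 0 < Nat.clog 2 (z * z).natAbs.size := Nat.clog_pos (by norm_num) h
    obtain ⟨k, hk⟩ : ∃ k, Nat.clog 2 (z * z).natAbs.size = k + 1 := ⟨_, (Nat.succ_pred h3.ne').symm⟩
    rw [hk] at h2 ⊢
    simp only [Nat.pred_succ] at h2
    rw [pow_succ]
    unfold bits at *
    omega
  · rw [Nat.clog_of_right_le_one h]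
    have := bits_pos z
    omega

/-- The test whether the square of register `τ` is at least register `τ + 1`. -/
def chargeTest (τ : ℕ) : Expr :=
  .sub (.mul (.var τ) (.var τ)) (.sub (.var (τ + 1)) (.const 1))

/-- Charge the number in register `τ`. -/
def chargeProg (τ : ℕ) : Prog :=
  .seq (.assign (τ + 1) (.const 2)) (.seq (.assign (τ + 2) (.const 1))
    (.seq (.while (chargeTest τ)
      (.seq (.assign (τ + 1) (.mul (.var (τ + 1)) (.var (τ + 1))))
        (.assign (τ + 2) (.add (.var (τ + 2)) (.var (τ + 2))))))
      (.assign fuelReg (.sub (.var fuelReg) (.var (τ + 2))))))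

theorem bits_two_pow (m : ℕ) : bits ((2 : ℤ) ^ m) = m + 2 := by
  unfold bits
  rw [Int.natAbs_pow]
  change (2 ^ m).size + 1 = m + 2
  rw [Nat.size_pow]

theorem two_pow_ge_succ (m : ℕ) : m + 1 ≤ 2 ^ m := Nat.lt_two_pow_self

theorem exists_runs_chargeProg (hL : 1 ≤ L) (hτ : scratch ≤ τ) (s : Memory) (hz : s.reg τ = z) (hf : |s.reg fuelReg| < 2 ^ L)
    (hf' : |s.reg fuelReg - charge z| < 2 ^ L) :
    ∃ t s', Runs (chargeProg τ) s t s' ∧ t ≤ 80 * (L * charge z) ∧ s'.arr = s.arr ∧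
      (∀ x ≤ τ, x ≠ fuelReg → s'.reg x = s.reg x) ∧
      s'.reg fuelReg = s.reg fuelReg - charge z := by
  set n := Nat.clog 2 (z * z).natAbs.size with hn
  set c := charge z with hc
  have hcn : c = 2 ^ n := rfl
  have hbz : bits z ≤ 1 + c := bits_le_charge z
  have hc1 : 1 ≤ c := charge_pos z
  have hfτ : fuelReg < τ := lt_of_lt_of_le (by decide) hτ
  have hnL : n ≤ L := by
    have h1 : (c : ℤ) < 2 ^ (L + 1) := by
      rw [abs_lt] at hf hf'
      rw [pow_succ]
      linarith [hf.2, hf'.1]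
    have h2 : 2 ^ n < 2 ^ (L + 1) := by
      rw [← hcn]
      exact_mod_cast h1
    have := (Nat.pow_lt_pow_iff_right (by norm_num : 1 < 2)).1 h2
    omega
  let I : ℕ → Memory → Prop := fun v s' => s'.arr = s.arr ∧ (∀ x ≤ τ, s'.reg x = s.reg x) ∧
    s'.reg (τ + 1) = 2 ^ 2 ^ v ∧ s'.reg (τ + 2) = 2 ^ v
  have htest : ∀ v ≤ n, ∀ s', I v s' →
      (chargeTest τ).val s' = z * z - (2 ^ 2 ^ v - 1) ∧ (chargeTest τ).cost s' + 1 ≤ 24 * c := by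
    intro v hv s' hI
    have h1 : s'.reg τ = z := by rw [hI.2.1 τ le_rfl, hz]
    have h2 : 2 ^ v ≤ c := by rw [hcn]; exact Nat.pow_le_pow_right (by norm_num) hv
    have h3 := bits_two_pow (2 ^ v)
    have h4 := bits_mul z z
    have h5 := bits_sub (2 ^ 2 ^ v) 1
    have h6 := bits_sub (z * z) (2 ^ 2 ^ v - 1)
    have h7 : bits ((2 : ℤ) ^ 2 ^ v - 1) ≤ 2 ^ v + 2 := by
      rw [← h3]
      apply bits_mono
      have : (1 : ℤ) ≤ 2 ^ 2 ^ v := one_le_pow₀ (by norm_num)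
      omega
    have h8 := bits_one
    simp only [chargeTest, Expr.val, Expr.cost, h1, hI.2.2.1]
    exact ⟨trivial, by omega⟩
  have hpos : ∀ v < n, ∀ s', I v s' →
      0 < (chargeTest τ).val s' ∧ (chargeTest τ).cost s' + 1 ≤ 24 * c ∧
      ∃ t s'', Runs (.seq (.assign (τ + 1) (.mul (.var (τ + 1)) (.var (τ + 1))))
        (.assign (τ + 2) (.add (.var (τ + 2)) (.var (τ + 2))))) s' t s'' ∧ t ≤ 17 * c ∧
        I (v + 1) s'' := by
    intro v hv s' hI
    obtain ⟨h1, h2⟩ := htest v hv.le s' hI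
    refine ⟨?_, h2, _, _, .seq (.assign _ _ _) (.assign _ _ _), ?_, hI.1, fun x hx => ?_, ?_, ?_⟩
    · have h3 : 2 ^ v < (z * z).natAbs.size := (Nat.lt_clog_iff_pow_lt (by norm_num)).1 hv
      have h4 : 2 ^ 2 ^ v ≤ (z * z).natAbs := Nat.lt_size.1 h3
      have h5 : ((2 ^ 2 ^ v : ℕ) : ℤ) ≤ z * z := by
        rw [← Int.natAbs_of_nonneg (mul_self_nonneg z)]
        exact_mod_cast h4
      push_cast at h5
      rw [h1]
      linarith
    · have h3 : 2 ^ (v + 1) ≤ c := by rw [hcn]; exact Nat.pow_le_pow_right (by norm_num) hv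
      have h4 := bits_two_pow (2 ^ v)
      have h5 := bits_two_pow (2 ^ (v + 1))
      have h6 := bits_two_pow v
      have h7 := bits_two_pow (v + 1)
      have h8 := two_pow_ge_succ (v + 1)
      have h9 : (2 : ℤ) ^ 2 ^ v * 2 ^ 2 ^ v = 2 ^ 2 ^ (v + 1) := by rw [← pow_add]; congr 1; ring
      have h10 : (2 : ℤ) ^ v + 2 ^ v = 2 ^ (v + 1) := by ring
      have : 2 ^ v ≤ 2 ^ (v + 1) := Nat.pow_le_pow_right (by norm_num) (by omega)
      simp [Expr.cost, Expr.val, hI.2.2.1, hI.2.2.2, h4, h5, h6, h7, h9, h10]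
      omega
    · simp [show x ≠ τ + 1 by omega, show x ≠ τ + 2 by omega, hI.2.1 x hx]
    · simp [Expr.val, hI.2.2.1, ← pow_add, pow_succ, mul_two]
    · simp [Expr.val, hI.2.2.2, pow_succ, mul_two]
  have hneg : ∀ s', I n s' →
      ¬ 0 < (chargeTest τ).val s' ∧ (chargeTest τ).cost s' + 1 ≤ 24 * c := by
    intro s' hI
    obtain ⟨h1, h2⟩ := htest n le_rfl s' hI
    refine ⟨?_, h2⟩
    have h3 : (z * z).natAbs.size ≤ 2 ^ n := Nat.le_pow_clog (by norm_num) _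
    have h4 : (z * z).natAbs < 2 ^ 2 ^ n := Nat.size_le.1 h3
    have h5 : z * z < ((2 ^ 2 ^ n : ℕ) : ℤ) := by
      rw [← Int.natAbs_of_nonneg (mul_self_nonneg z)]
      exact_mod_cast h4
    push_cast at h5
    rw [h1]
    linarith
  have hinit : I 0 ((s.setReg (τ + 1) 2).setReg (τ + 2) 1) := by
    exact ⟨rfl, fun x hx => by simp [show x ≠ τ + 1 by omega, show x ≠ τ + 2 by omega], by simp, by simp⟩
  obtain ⟨t, s', hrun, ht, hI⟩ := Runs.exists_while I n (fun _ => 17 * c) (24 * c) hpos hneg _ hinit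
  have hr1 : s'.reg (τ + 2) = c := by rw [hI.2.2.2, hcn]; push_cast; rfl
  have hr2 : s'.reg fuelReg = s.reg fuelReg := hI.2.1 _ hfτ.le
  refine ⟨_, _, .seq (.assign s _ _) (.seq (.assign _ _ _) (.seq hrun (.assign s' _ _))), ?_, hI.1,
    fun x hx hx' => ?_, ?_⟩
  · rw [sum_const, card_range, smul_eq_mul] at ht
    have h1 := bits_of_abs_le hf
    have h2 := bits_of_abs_le hf'
    have h3 : bits (c : ℤ) ≤ c + 1 := bits_natCast_le_self c
    have h4 : bits 2 = 3 := bits_two_pow 1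
    simp only [Expr.cost, Expr.val, hr1, hr2, bits_one, h4]
    have h5 : n * (17 * c + 24 * c) ≤ L * (41 * c) := Nat.mul_le_mul hnL (by omega)
    have h6 : c ≤ L * c := Nat.le_mul_of_pos_left _ hL
    have h7 : L ≤ L * c := Nat.le_mul_of_pos_right _ hc1
    grind
  · simp [hx', hI.2.1 x hx]
  · simp [Expr.val, hr1, hr2]

/-- Replace the index in register `τ` by the content of the simulated cell. -/
def loadProg (a τ : ℕ) : Prog :=
  .ite (.sub (.cell (simStamp a) (.var τ)) (.sub (.var stampReg) (.const 1)))
    (.assign τ (.cell (simVal a) (.var τ))) (.assign τ (.const 0))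

theorem exists_runs_loadProg (a : ℕ) (hs : s.Stamped) (hst : bits (s.reg stampReg) ≤ L) :
    ∃ t s', Runs (loadProg a τ) s t s' ∧
      t ≤ 2 * bits (s.reg τ) + bits (s.rd a (s.reg τ)) + 6 * L + 8 ∧ s'.arr = s.arr ∧
      (∀ x ≠ τ, s'.reg x = s.reg x) ∧ s'.reg τ = s.rd a (s.reg τ) := by
  obtain ⟨h0, h1⟩ := hs a (s.reg τ)
  have hcost : (Expr.sub (.cell (simStamp a) (.var τ)) (.sub (.var stampReg) (.const 1))).cost s ≤
      bits (s.reg τ) + 6 * L + 4 := by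
    have h2 : bits (s.arr (simStamp a) (s.reg τ)) ≤ L := (bits_mono (by omega)).trans hst
    have h3 := bits_sub (s.reg stampReg) 1
    have h4 := bits_sub (s.arr (simStamp a) (s.reg τ)) (s.reg stampReg - 1)
    have h5 := bits_one
    simp only [Expr.cost, Expr.val]
    have h6 : 1 ≤ L := (bits_pos _).trans hst
    have h7 : bits (s.arr (simStamp a) (s.reg τ) - (s.reg stampReg - 1)) ≤ L + 1 := by
      rcases Int.lt_or_le (s.reg stampReg) 2 with h | h
      · grind
      · exact ((bits_mono (by omega)).trans hst).trans (by omega)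
    omega
  by_cases h : s.arr (simStamp a) (s.reg τ) = s.reg stampReg
  · have hrd : s.rd a (s.reg τ) = s.arr (simVal a) (s.reg τ) := if_pos h
    refine ⟨_, _, .ite_pos (by simp only [Expr.val]; omega) (.assign s _ _), ?_, rfl,
      fun x hx => by simp [hx], by simp [Expr.val, hrd]⟩
    simp only [hrd, Expr.cost, Expr.val] at hcost ⊢
    omega
  · have hrd : s.rd a (s.reg τ) = 0 := if_neg h
    refine ⟨_, _, .ite_neg (by simp only [Expr.val]; omega) (.assign s _ _), ?_, rfl,
      fun x hx => by simp [hx], by simp [Expr.val, hrd]⟩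
    have h2 := bits_zero
    simp only [Expr.cost, Expr.val] at hcost ⊢
    omega

namespace Expr

/-- The total charge for the evaluation of an expression. -/
def charged (m : Memory) : Expr → ℕ
  | .const c => charge c
  | .var x => charge (m.reg x)
  | .cell a i => i.charged m + charge (m.arr a (i.val m))
  | .add e f => e.charged m + f.charged m + charge (e.val m + f.val m)
  | .sub e f => e.charged m + f.charged m + charge (e.val m - f.val m)
  | .mul e f => e.charged m + f.charged m + charge (e.val m * f.val m)
  | .div e f => e.charged m + f.charged m + charge (e.val m / f.val m)

theorem charge_val_le_charged (m : Memory) (e : Expr) : charge (e.val m) ≤ e.charged m := by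
  cases e <;> simp [charged, val]

theorem charged_pos (m : Memory) (e : Expr) : 1 ≤ e.charged m :=
  (charge_pos _).trans (e.charge_val_le_charged m)

theorem charged_le (m : Memory) (e : Expr) : e.charged m ≤ 4 * e.cost m := by
  induction e with
  | const c => exact charge_le c
  | var x => exact charge_le _
  | cell a i ih =>
    have := charge_le (m.arr a (i.val m))
    simp only [charged, cost]; omega
  | add | sub | mul | div =>
    simp only [charged, cost]
    grind [charge_le]

/-- A bound for the bit lengths of the register numbers in an expression. -/
def regBits : Expr → ℕ
  | .const _ => 0
  | .var x => bits x
  | .cell _ i => i.regBits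
  | .add e f => e.regBits + f.regBits
  | .sub e f => e.regBits + f.regBits
  | .mul e f => e.regBits + f.regBits
  | .div e f => e.regBits + f.regBits

/-- Evaluate an expression in the simulated memory, and charge all intermediate values. -/
def meter : Expr → ℕ → Prog
  | .const c, τ => .seq (.assign τ (.const c)) (chargeProg τ)
  | .var x, τ => .seq (.assign τ (.const x)) (.seq (loadProg 0 τ) (chargeProg τ))
  | .cell a i, τ => .seq (i.meter τ) (.seq (loadProg (a + 1) τ) (chargeProg τ))
  | .add e f, τ => .seq (e.meter τ) (.seq (f.meter (τ + 1))
      (.seq (.assign τ (.add (.var τ) (.var (τ + 1)))) (chargeProg τ)))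
  | .sub e f, τ => .seq (e.meter τ) (.seq (f.meter (τ + 1))
      (.seq (.assign τ (.sub (.var τ) (.var (τ + 1)))) (chargeProg τ)))
  | .mul e f, τ => .seq (e.meter τ) (.seq (f.meter (τ + 1))
      (.seq (.assign τ (.mul (.var τ) (.var (τ + 1)))) (chargeProg τ)))
  | .div e f, τ => .seq (e.meter τ) (.seq (f.meter (τ + 1))
      (.seq (.assign τ (.div (.var τ) (.var (τ + 1)))) (chargeProg τ)))

/-- The program computes `z` in register `τ` at the expense of `c` units of fuel. -/
def Meters (q : Prog) (τ : ℕ) (s : Memory) (L c : ℕ) (z : ℤ) : Prop :=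
  ∃ t s', Runs q s t s' ∧ t + 6 * bits z ≤ 150 * (L * c) ∧ s'.arr = s.arr ∧
    (∀ x < τ, x ≠ fuelReg → s'.reg x = s.reg x) ∧ s'.reg fuelReg = s.reg fuelReg - c ∧
    s'.reg τ = z

/-- The metered evaluation of an expression succeeds if there is enough fuel. -/
def MetersIn (L : ℕ) (m : Memory) (e : Expr) : Prop :=
  ∀ {τ : ℕ} {s : Memory}, scratch ≤ τ → s.Simulates m → bits (s.reg stampReg) ≤ L →
    |s.reg fuelReg| < 2 ^ L → |s.reg fuelReg - e.charged m| < 2 ^ L →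
    Meters (e.meter τ) τ s L (e.charged m) (e.val m)

theorem meters_binary {op : Expr → Expr → Expr} {g : ℤ → ℤ → ℤ}
    (hval : ∀ s a b, (op (.var a) (.var b)).val s = g (s.reg a) (s.reg b))
    (hcost : ∀ s a b, (op (.var a) (.var b)).cost s =
      bits (s.reg a) + bits (s.reg b) + bits (g (s.reg a) (s.reg b))) {m : Memory} {e f : Expr} (hL : 1 ≤ L) (ihe : MetersIn L m e) (ihf : MetersIn L m f)
    (hτ : scratch ≤ τ) (hs : s.Simulates m) (hst : bits (s.reg stampReg) ≤ L)
    (h1 : |s.reg fuelReg| < 2 ^ L) (h2 : |s.reg fuelReg -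
      (e.charged m + f.charged m + charge (g (e.val m) (f.val m)) : ℕ)| < 2 ^ L) :
    Meters (.seq (e.meter τ) (.seq (f.meter (τ + 1))
      (.seq (.assign τ (op (.var τ) (.var (τ + 1)))) (chargeProg τ)))) τ s L
      (e.charged m + f.charged m + charge (g (e.val m) (f.val m))) (g (e.val m) (f.val m)) := by
  have hfτ : fuelReg < scratch := by decide
  have hsτ : stampReg < scratch := by decide
  set z := g (e.val m) (f.val m) with hz
  have hlt : ∀ c : ℕ, c ≤ e.charged m + f.charged m + charge z → |s.reg fuelReg - c| < 2 ^ L := by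
    intro c hc
    rw [abs_lt] at h1 h2 ⊢
    omega
  obtain ⟨t, s', r, ht, ha, hr, hf, hx⟩ := ihe hτ hs hst h1 (hlt _ (by omega))
  have hst' : s'.reg stampReg = s.reg stampReg := hr _ (by omega) (by decide)
  obtain ⟨t', s'', r', ht', ha', hr', hf', hy⟩ := ihf (τ := τ + 1) (s := s') (by omega)
    (hs.congr ha hst') (by rwa [hst']) (hf ▸ hlt _ (by omega))
    (by rw [hf, sub_sub]; exact_mod_cast hlt _ (by omega))
  have hx' : s''.reg τ = e.val m := by rw [hr' τ (by omega) (by omega), hx]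
  have hrun : Runs (.assign τ (op (.var τ) (.var (τ + 1)))) s'' _ _ := .assign s'' _ _
  have hcst : (op (.var τ) (.var (τ + 1))).cost s'' = bits (e.val m) + bits (f.val m) + bits z := by
    rw [hcost, hx', hy]
  have hv : (op (.var τ) (.var (τ + 1))).val s'' = z := by rw [hval, hx', hy]
  have hfuel : (s''.setReg τ z).reg fuelReg = s.reg fuelReg - (e.charged m + f.charged m : ℕ) := by
    rw [setReg_apply, if_neg (by omega), hf', hf, sub_sub, Nat.cast_add]
  rw [hv] at hrun
  obtain ⟨t₃, s₃, r₃, ht₃, ha₃, hr₃, hf₃⟩ := exists_runs_chargeProg hL hτ (s''.setReg τ z) (z := z)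
    (by simp) (hfuel ▸ hlt _ (by omega))
    (by rw [hfuel, sub_sub]; exact_mod_cast hlt _ (by omega))
  refine ⟨_, s₃, .seq r (.seq r' (.seq hrun r₃)), ?_, by rw [ha₃, setReg_arr, ha', ha],
    fun y hy hy' => by rw [hr₃ y hy.le hy', setReg_apply, if_neg (by omega), hr' y (by omega) hy',
      hr y hy hy'], by rw [hf₃, hfuel]; push_cast; ring,
    by rw [hr₃ τ le_rfl (by omega)]; simp⟩
  have h3 := bits_le_charge z
  have h4 := charge_pos z
  have h5 : charge z ≤ L * charge z := Nat.le_mul_of_pos_left _ hL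
  simp only [hcst, mul_add]
  omega

theorem meters_load {i : ℤ} (hL : 1 ≤ L)
    (hτ : scratch ≤ τ) (hs : s.Stamped) (hst : bits (s.reg stampReg) ≤ L)
    (hp : |s.reg fuelReg - c| < 2 ^ L → ∃ t s', Runs p s t s' ∧
      t + 2 * bits i ≤ 150 * (L * c) + 3 * L + 1 ∧ s'.arr = s.arr ∧
      (∀ x < τ, x ≠ fuelReg → s'.reg x = s.reg x) ∧ s'.reg fuelReg = s.reg fuelReg - c ∧
      s'.reg τ = i)
    (h1 : |s.reg fuelReg| < 2 ^ L)
    (h2 : |s.reg fuelReg - (c + charge (s.rd a i) : ℕ)| < 2 ^ L) :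
    Meters (.seq p (.seq (loadProg a τ) (chargeProg τ))) τ s L (c + charge (s.rd a i))
      (s.rd a i) := by
  have hfτ : fuelReg < scratch := by decide
  have hsτ : stampReg < scratch := by decide
  obtain ⟨t, s', r, ht, ha, hr, hf, hi⟩ := hp (by rw [abs_lt] at *; omega)
  have hst' : s'.reg stampReg = s.reg stampReg := hr _ (by omega) (by decide)
  have hstamped : s'.Stamped := by
    intro b j
    rw [ha, hst']
    exact hs b j
  obtain ⟨t', s'', r', ht', ha', hr', hv⟩ := exists_runs_loadProg (L := L) a hstamped
    (by rw [hst']; exact hst)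
  have hrd : s'.rd a (s'.reg τ) = s.rd a i := by simp only [rd, ha, hst', hi]
  rw [hrd, hi] at ht'
  rw [hrd] at hv
  have hf' : s''.reg fuelReg = s.reg fuelReg - c := by rw [hr' _ (by omega), hf]
  obtain ⟨t₃, s₃, r₃, ht₃, ha₃, hr₃, hf₃⟩ := exists_runs_chargeProg hL hτ s'' hv
    (by rw [hf', abs_lt] at *; omega) (by rw [hf', abs_lt] at *; omega)
  refine ⟨_, s₃, .seq r (.seq r' r₃), ?_, ?_, fun z hz hz' => ?_, ?_, ?_⟩
  · have h3 := bits_le_charge (s.rd a i)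
    have h4 := charge_pos (s.rd a i)
    have h5 : charge (s.rd a i) ≤ L * charge (s.rd a i) := Nat.le_mul_of_pos_left _ hL
    have h6 : L ≤ L * charge (s.rd a i) := Nat.le_mul_of_pos_right _ h4
    rw [mul_add]
    omega
  · rw [ha₃, ha', ha]
  · grind
  · rw [hf₃, hf']; push_cast; ring
  · rw [hr₃ τ le_rfl (by omega), hv]

theorem meters_meter {m : Memory} (hL : 1 ≤ L) (e : Expr) (he : e.regBits ≤ L) :
    MetersIn L m e := by
  have hfs : fuelReg < scratch := by decide
  have hss : stampReg < scratch := by decide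
  induction e with
  | const c =>
    intro τ s hτ hs hst h1 h2
    have hne : fuelReg ≠ τ := by omega
    obtain ⟨t, s', r, ht, ha, hr, hf⟩ := exists_runs_chargeProg hL hτ (s.setReg τ c) (z := c)
      (by simp) (by simpa [hne] using h1) (by simpa [hne, charged] using h2)
    have h0 : Runs (.assign τ (.const c)) s _ _ := .assign s τ (.const c)
    refine ⟨_, s', .seq h0 r, ?_, ha, fun x hx hx' => by simp [hr x hx.le hx', hx.ne],
      by simp [hf, hne, charged], by simp [hr τ le_rfl hne.symm, val]⟩
    have h3 := bits_le_charge c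
    have h4 := charge_pos c
    have h5 : charge c ≤ L * charge c := Nat.le_mul_of_pos_left _ hL
    simp only [cost, val, charged]
    omega
  | var x =>
    intro τ s hτ hs hst h1 h2
    have hx : s.rd 0 x = m.reg x := hs.reg x
    have key := meters_load (p := .assign τ (.const x)) (a := 0) (c := 0) (i := (x : ℤ)) hL hτ
      hs.stamped hst (fun _ => ⟨_, _, .assign s τ (.const x), ?_, rfl, fun y hy _ => ?_, ?_, ?_⟩) h1
      (by rw [hx, zero_add]; exact h2)
    · rw [hx, zero_add] at key
      exact key
    · simp only [regBits] at he
      simp only [cost]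
      omega
    · simp [hy.ne]
    · simp [show fuelReg ≠ τ by omega]
    · simp [val]
  | cell a i ih =>
    intro τ s hτ hs hst h1 h2
    have hx : s.rd (a + 1) (i.val m) = m.arr a (i.val m) := hs.arr a _
    have key := meters_load (p := i.meter τ) (a := a + 1) (c := i.charged m) (i := i.val m) hL hτ
      hs.stamped hst (fun h => ?_) h1 (by rw [hx]; exact h2)
    · rw [hx] at key
      exact key
    · obtain ⟨t, s', r, ht, h3⟩ := ih he hτ hs hst h1 h
      exact ⟨t, s', r, by omega, h3⟩
  | add e f h1 h2 =>
    exact fun {_ _} hτ hs hst h3 h4 => meters_binary (op := .add) (g := (· + ·)) (fun _ _ _ => rfl) (fun _ _ _ => rfl) hL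
      (h1 ((Nat.le_add_right _ _).trans he)) (h2 ((Nat.le_add_left _ _).trans he)) hτ hs hst h3 h4
  | sub e f h1 h2 =>
    exact fun {_ _} hτ hs hst h3 h4 => meters_binary (op := .sub) (g := (· - ·)) (fun _ _ _ => rfl) (fun _ _ _ => rfl) hL
      (h1 ((Nat.le_add_right _ _).trans he)) (h2 ((Nat.le_add_left _ _).trans he)) hτ hs hst h3 h4
  | mul e f h1 h2 =>
    exact fun {_ _} hτ hs hst h3 h4 => meters_binary (op := .mul) (g := (· * ·)) (fun _ _ _ => rfl) (fun _ _ _ => rfl) hL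
      (h1 ((Nat.le_add_right _ _).trans he)) (h2 ((Nat.le_add_left _ _).trans he)) hτ hs hst h3 h4
  | div e f h1 h2 =>
    exact fun {_ _} hτ hs hst h3 h4 => meters_binary (op := .div) (g := (· / ·)) (fun _ _ _ => rfl) (fun _ _ _ => rfl) hL
      (h1 ((Nat.le_add_right _ _).trans he)) (h2 ((Nat.le_add_left _ _).trans he)) hτ hs hst h3 h4

end Expr

theorem Memory.rd_store (a : ℕ) (i z : ℤ) (b : ℕ) (j : ℤ) :
    ((s.setCell (simVal a) i z).setCell (simStamp a) i (s.reg stampReg)).rd b j =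
      if b = a ∧ j = i then z else s.rd b j := by
  have h1 : simStamp b ≠ simVal a := by unfold simStamp simVal; omega
  have h2 : simVal b ≠ simStamp a := by unfold simStamp simVal; omega
  have h3 : simVal b = simVal a ↔ b = a := by unfold simVal; omega
  have h4 : simStamp b = simStamp a ↔ b = a := by unfold simStamp; omega
  simp only [rd, setCell_arr, setCell_reg, h1, h2, h3, h4, false_and,
    if_false]
  by_cases h : b = a ∧ j = i
  · simp [h]
  · simp [h]

theorem Memory.Stamped.store (h : s.Stamped) (a : ℕ) (i z : ℤ) :
    ((s.setCell (simVal a) i z).setCell (simStamp a) i (s.reg stampReg)).Stamped := by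
  intro b j
  have h1 : simStamp b ≠ simVal a := by unfold simStamp simVal; omega
  have h2 := h b j
  simp only [setCell_arr, setCell_reg, h1, false_and, if_false]
  split_ifs
  · exact ⟨h2.1.trans h2.2, le_rfl⟩
  · exact h2

theorem Memory.Simulates.store_reg {m : Memory} (h : s.Simulates m) (x : ℕ) (z : ℤ) :
    ((s.setCell (simVal 0) x z).setCell (simStamp 0) x (s.reg stampReg)).Simulates
      (m.setReg x z) := by
  refine ⟨fun y => ?_, fun a i => ?_, h.stamped.store _ _ _⟩
  · rw [rd_store, setReg_reg, update_apply]
    by_cases hy : y = x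
    · simp [hy]
    · simp [hy, h.reg]
  · rw [rd_store, setReg_arr, if_neg (by omega), h.arr]

theorem Memory.Simulates.store_arr {m : Memory} (h : s.Simulates m) (a : ℕ) (i z : ℤ) :
    ((s.setCell (simVal (a + 1)) i z).setCell (simStamp (a + 1)) i (s.reg stampReg)).Simulates
      (m.setCell a i z) := by
  refine ⟨fun y => ?_, fun b j => ?_, h.stamped.store _ _ _⟩
  · rw [rd_store, setCell_reg, if_neg (by omega), h.reg]
  · rw [rd_store, setCell_arr]
    by_cases hb : b = a ∧ j = i
    · simp [hb]
    · rw [if_neg hb, if_neg (by omega), h.arr]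

theorem Memory.BitsLE.setReg {m : Memory} (h : m.BitsLE V) (x : ℕ) (hz : bits z ≤ V) : (m.setReg x z).BitsLE V := by
  refine ⟨fun y => ?_, h.2⟩
  rw [setReg_reg, update_apply]
  split_ifs
  · exact hz
  · exact h.1 y

theorem Memory.BitsLE.setCell {m : Memory} (h : m.BitsLE V) (a : ℕ) (i : ℤ) (hz : bits z ≤ V) : (m.setCell a i z).BitsLE V := by
  refine ⟨h.1, fun b j => ?_⟩
  rw [setCell_arr]
  split_ifs
  · exact hz
  · exact h.2 b j

namespace Prog

/-- Run a program if there is fuel left, and otherwise set the fuel to zero. -/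
def guard (q : Prog) : Prog := .ite (.var fuelReg) q (.assign fuelReg (.const 0))

/-- Evaluate the test of a loop; the result is zero if the fuel is used up. -/
def meterTest (e : Expr) : Prog :=
  .ite (.var fuelReg) (.seq (e.meter scratch) (.ite (.var fuelReg) .skip
    (.seq (.assign fuelReg (.const 0)) (.assign scratch (.const 0))))) (.assign scratch (.const 0))

/-- Simulate a program as long as there is fuel. -/
def meter : Prog → Prog
  | .skip => .skip
  | .assign x e => .ite (.var fuelReg) (.seq (e.meter scratch)
      (guard (.seq (.store (simVal 0) (.const x) (.var scratch))
        (.store (simStamp 0) (.const x) (.var stampReg))))) .skip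
  | .store a i e => .ite (.var fuelReg) (.seq (.seq (i.meter scratch) (e.meter (scratch + 1)))
      (guard (.seq (.store (simVal (a + 1)) (.var scratch) (.var (scratch + 1)))
        (.store (simStamp (a + 1)) (.var scratch) (.var stampReg))))) .skip
  | .seq p q => .seq p.meter q.meter
  | .ite e p q => .ite (.var fuelReg) (.seq (e.meter scratch)
      (guard (.ite (.var scratch) p.meter q.meter))) .skip
  | .while e p => .seq (meterTest e) (.while (.var scratch) (.seq p.meter (meterTest e)))

/-- A constant that bounds the constants of the expressions of a program. -/
def weight : Prog → ℕ
  | .skip => 1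
  | .assign x e => bits x + e.regBits + e.factor
  | .store _ i e => i.regBits + e.regBits + i.factor + e.factor + 1
  | .seq p q => p.weight + q.weight
  | .ite e p q => e.regBits + e.factor + p.weight + q.weight + 1
  | .while e p => e.regBits + e.factor + p.weight + 1

theorem meterTest_dead {e : Expr} (hs : s.reg fuelReg = 0) :
    ∃ s', Runs (meterTest e) s 4 s' ∧ s'.arr = s.arr ∧ (∀ x < scratch, s'.reg x = s.reg x) ∧
      s'.reg scratch = 0 := by
  have h := Runs.ite_neg (e := .var fuelReg)
    (p := .seq (e.meter scratch) (.ite (.var fuelReg) .skip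
      (.seq (.assign fuelReg (.const 0)) (.assign scratch (.const 0)))))
    (s := s) (by simp [Expr.val, hs]) (.assign s scratch (.const 0))
  simp only [Expr.cost, hs, bits_zero] at h
  refine ⟨_, h, rfl, fun x hx => ?_, ?_⟩
  · rw [setReg_of_ne (by omega)]
  · rw [setReg_self]; rfl

/-- Without fuel the simulation does nothing, in constant time. -/
theorem exists_runs_meter_dead (p : Prog) : ∃ K, ∀ s : Memory, s.reg fuelReg = 0 →
    ∃ t s', Runs p.meter s t s' ∧ t ≤ K ∧ s'.arr = s.arr ∧
      ∀ x < scratch, s'.reg x = s.reg x := by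
  have hf : fuelReg < scratch := by decide
  have hite : ∀ q : Prog, ∀ s : Memory, s.reg fuelReg = 0 →
      ∃ t s', Runs (.ite (.var fuelReg) q .skip) s t s' ∧ t ≤ 3 ∧ s'.arr = s.arr ∧
      ∀ x < scratch, s'.reg x = s.reg x := by
    intro q s hs
    have h := Runs.ite_neg (e := .var fuelReg) (p := q) (s := s) (by simp [Expr.val, hs]) (.skip s)
    simp only [Expr.cost, hs, bits_zero] at h
    exact ⟨_, s, h, le_rfl, rfl, fun _ _ => rfl⟩
  induction p with
  | skip => exact ⟨1, fun s _ => ⟨1, s, .skip s, le_rfl, rfl, fun _ _ => rfl⟩⟩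
  | assign x e => exact ⟨3, hite _⟩
  | store a i e => exact ⟨3, hite _⟩
  | seq p q ihp ihq =>
    obtain ⟨K, hK⟩ := ihp
    obtain ⟨K', hK'⟩ := ihq
    refine ⟨K + K', fun s hs => ?_⟩
    obtain ⟨t, s', r, ht, ha, hr⟩ := hK s hs
    obtain ⟨t', s'', r', ht', ha', hr'⟩ := hK' s' (by rw [hr _ hf, hs])
    exact ⟨_, s'', .seq r r', by omega, ha'.trans ha, fun x hx => (hr' x hx).trans (hr x hx)⟩
  | ite e p q _ _ => exact ⟨3, hite _⟩
  | _ e p _ =>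
    refine ⟨6, fun s hs => ?_⟩
    obtain ⟨s', r, ha, hr, h0⟩ := meterTest_dead (e := e) hs
    have h := Runs.while_neg (e := .var scratch) (p := .seq p.meter (meterTest e)) (s := s')
      (by simp [Expr.val, h0])
    simp only [Expr.cost, h0, bits_zero] at h
    exact ⟨_, s', .seq r h, le_rfl, ha, hr⟩

/-- The simulation `q` of `p` from memory `m`, with `F` units of fuel, halts. If fuel is left it has
simulated a run of `p`, otherwise every run of `p` is long. -/
def Metered (p : Prog) (m : Memory) (V L K b c : ℕ) (q : Prog) (s : Memory) (F : ℕ) : Prop :=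
  ∃ t s', ∃ F' : ℕ, Runs q s t s' ∧ (∀ a < ownArrays, s'.arr a = s.arr a) ∧
    (∀ x < scratch, x ≠ fuelReg → s'.reg x = s.reg x) ∧ s'.Stamped ∧
    s'.reg fuelReg = F' ∧ F' ≤ F ∧
    ((0 < F' ∧ ∃ t₀ m', Runs p m t₀ m' ∧ s'.Simulates m' ∧ m'.BitsLE V ∧
        F + c ≤ F' + 4 * t₀ ∧ t ≤ b + K * (L * (F - F'))) ∨
      (F' = 0 ∧ (∀ t₀ m', Runs p m t₀ m' → F + c ≤ 4 * t₀) ∧ t ≤ b + K * (L * (V + F))))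

/-- The memory `s` is ready for a simulation from memory `m` with `F` units of fuel. -/
structure Ready (s m : Memory) (V L F : ℕ) : Prop where
  sim : s.Simulates m
  fuel : s.reg fuelReg = F
  pos : 0 < F
  bitsLE : m.BitsLE V
  le : F ≤ V
  stamp : bits (s.reg stampReg) ≤ L

theorem Ready.bits_fuel_le {m : Memory} (h : Ready s m V L F)
    (hV : V * (4 * w + 1) < 2 ^ L) : bits (s.reg fuelReg) ≤ L + 1 := by
  rw [h.fuel]
  refine bits_natCast_le _ _ ?_
  have := h.le
  nlinarith

theorem Ready.meters {m : Memory} (h : Ready s m V L F)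
    (hV : V * (4 * w + 1) < 2 ^ L) (e : Expr) (hr : e.regBits ≤ L) (hw : e.factor ≤ w)
    (hL : 1 ≤ L) (hτ : scratch ≤ τ) :
    Expr.Meters (e.meter τ) τ s L (e.charged m) (e.val m) ∧ e.charged m ≤ 4 * w * V := by
  have hV1 : 1 ≤ V := by have := h.le; have := h.pos; omega
  have h1 : e.charged m ≤ 4 * w * V := by
    have h2 := e.charged_le m
    have h3 := Expr.cost_le_factor hV1 h.bitsLE e
    have h4 : e.factor * V ≤ w * V := Nat.mul_le_mul_right _ hw
    nlinarith
  have h2 := h.le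
  have h3 : ((V * (4 * w + 1) : ℕ) : ℤ) < 2 ^ L := mod_cast hV
  have h4 : ((e.charged m : ℕ) : ℤ) ≤ ((4 * w * V : ℕ) : ℤ) := mod_cast h1
  have h5 : (F : ℤ) ≤ V := mod_cast h2
  have h6 : (0 : ℤ) ≤ (w : ℤ) * V := by positivity
  have h7 : (0 : ℤ) ≤ (e.charged m : ℤ) := Int.natCast_nonneg _
  push_cast at h3 h4
  refine ⟨Expr.meters_meter hL e hr hτ h.sim h.stamp ?_ ?_, h1⟩ <;>
  · rw [h.fuel, abs_lt]
    constructor <;> nlinarith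

theorem bits_lt_of_charged_lt {m : Memory} {e : Expr} (h : e.charged m < F) :
    bits (e.val m) ≤ F := by
  have h1 := bits_le_charge (e.val m)
  have h2 := e.charge_val_le_charged m
  omega

theorem fail_bound (hA : A ≤ 4 * w * V) (hK : 1000 * w ≤ K)
    (ht : t ≤ 250 * (L * A)) : t ≤ K * (L * (V + F)) := by
  calc t ≤ 250 * (L * A) := ht
    _ ≤ 250 * (L * (4 * w * V)) := by gcongr
    _ = (1000 * w) * (L * V) := by ring
    _ ≤ K * (L * (V + F)) := by gcongr; omega

theorem runs_guard_fail {q : Prog} (h : s.reg fuelReg ≤ 0) :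
    Runs (guard q) s (bits (s.reg fuelReg) + 3) (s.setReg fuelReg 0) := by
  have h1 := Runs.ite_neg (e := .var fuelReg) (p := q) (s := s) (by simpa [Expr.val] using h)
    (.assign s fuelReg (.const 0))
  simpa [Expr.cost, Expr.val, bits_zero, guard, add_assoc] using h1

/-- The part of a statement after the evaluation of its expressions, which cost `A`: a program `q`
runs if fuel is left. -/
theorem metered_of_eval {m : Memory} {K' : ℕ} {P q : Prog} (hready : Ready s m V L F) (hV : V * (4 * w + 1) < 2 ^ L) (hL : 1 ≤ L) (hA1 : 1 ≤ A)
    (hA : A ≤ 4 * w * V) (hK : 1000 * w + K' + 250 ≤ K)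
    (hA' : ∀ t₀ m', Runs p m t₀ m' → A ≤ 4 * t₀)
    (hP : ∃ t s', Runs P s t s' ∧ t + 2 * B ≤ 150 * (L * A) ∧ s'.arr = s.arr ∧
      (∀ x < scratch, x ≠ fuelReg → s'.reg x = s.reg x) ∧ s'.reg fuelReg = s.reg fuelReg - A ∧
      (A < F → Metered p m V L K (2 * B + 6 * L + 20 + K' * L) A q s' (F - A))) :
    Metered p m V L K 0 0 (.ite (.var fuelReg) (.seq P (guard q)) .skip) s F := by
  obtain ⟨t, s', r, ht, ha, hr, hf, hq⟩ := hP
  have hLA : L ≤ L * A := Nat.le_mul_of_pos_right _ hA1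
  have hbF := hready.bits_fuel_le hV
  have h0 : 0 < (Expr.var fuelReg).val s := by
    have := hready.pos
    simp only [Expr.val, hready.fuel]
    omega
  rcases Nat.lt_or_ge A F with hlt | hge
  · obtain ⟨t', s'', F', r', ha', hr', hst, hf', hle, hout⟩ := hq hlt
    have hb' : bits (s'.reg fuelReg) ≤ L + 1 := by
      refine (bits_mono ?_).trans hbF
      rw [hf, hready.fuel]
      omega
    have h1 : 0 < (Expr.var fuelReg).val s' := by
      simp only [Expr.val, hf, hready.fuel]
      omega
    refine ⟨_, s'', F', .ite_pos h0 (.seq r (.ite_pos h1 r')), fun a h => by rw [ha' a h, ha],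
      fun x h h' => by rw [hr' x h h', hr x h h'], hst, hf', by omega, ?_⟩
    simp only [Expr.cost]
    rcases hout with ⟨hpos, t₀, m', r₀, hsim, hb, hFt, htime⟩ | ⟨h0', hall, htime⟩
    · refine Or.inl ⟨hpos, t₀, m', r₀, hsim, hb, by omega, ?_⟩
      have h2 : K * (L * (F - F')) = K * (L * A) + K * (L * (F - A - F')) := by
        rw [show F - F' = A + (F - A - F') by omega]
        ring
      have h3 : (250 + K') * (L * A) ≤ K * (L * A) := Nat.mul_le_mul_right _ (by omega)
      have h4 : K' * L ≤ K' * (L * A) := Nat.mul_le_mul_left _ hLA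
      rw [add_mul] at h3
      omega
    · refine Or.inr ⟨h0', fun t₀ m' h => ?_, ?_⟩
      · have := hall t₀ m' h
        omega
      · have h2 : K * (L * (V + F)) = K * (L * A) + K * (L * (V + (F - A))) := by
          rw [show V + F = A + (V + (F - A)) by omega]
          ring
        have h3 : (250 + K') * (L * A) ≤ K * (L * A) := Nat.mul_le_mul_right _ (by omega)
        have h4 : K' * L ≤ K' * (L * A) := Nat.mul_le_mul_left _ hLA
        rw [add_mul] at h3
        omega
  · have hf1 : s'.reg fuelReg ≤ 0 := by
      rw [hf, hready.fuel]
      omega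
    have hb' : bits (s'.reg fuelReg) ≤ L + 1 := by
      refine bits_of_abs_le ?_
      have h3 : ((V * (4 * w + 1) : ℕ) : ℤ) < 2 ^ L := mod_cast hV
      have h4 : (A : ℤ) ≤ ((4 * w * V : ℕ) : ℤ) := mod_cast hA
      have h5 : (F : ℤ) ≤ V := mod_cast hready.le
      push_cast at h3 h4
      rw [hf, hready.fuel, abs_lt]
      constructor <;> nlinarith
    refine ⟨_, _, 0, .ite_pos h0 (.seq r (runs_guard_fail hf1)), fun a _ => ?_, fun x h h' => ?_,
      ?_, ?_, Nat.zero_le _, Or.inr ⟨rfl, fun t₀ m' h => ?_, ?_⟩⟩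
    · rw [setReg_arr, ha]
    · rw [setReg_reg, update_of_ne h', hr x h h']
    · intro a i
      have := hready.sim.stamped a i
      rw [setReg_arr, setReg_of_ne (by decide), ha,
        hr stampReg (by decide) (by decide)]
      exact this
    · rw [setReg_self]; rfl
    · have := hA' t₀ m' h
      omega
    · rw [zero_add]
      refine fail_bound (A := A) hA (by omega) ?_
      simp only [Expr.cost]
      omega

end Prog

namespace Prog

theorem weight_pos (p : Prog) : 1 ≤ p.weight := by
  induction p with
  | assign x e =>
    have := bits_pos (x : ℤ)
    simp only [weight]; omega
  | _ => simp only [weight]; omega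

theorem mul_mul_eq_add (h : c = a + b) :
    K * (L * c) = K * (L * a) + K * (L * b) := by rw [h]; ring

theorem Metered.mono {m : Memory} {K' b' : ℕ} {q : Prog} (h : Metered p m V L K b c q s F) (hK : K ≤ K') (hb : b ≤ b') :
    Metered p m V L K' b' c q s F := by
  obtain ⟨t, s', F', r, h1, h2, h3, h4, h5, h6⟩ := h
  refine ⟨t, s', F', r, h1, h2, h3, h4, h5, ?_⟩
  rcases h6 with ⟨h7, t₀, m', h8, h9, h10, h11, h12⟩ | ⟨h7, h8, h9⟩
  · have : K * (L * (F - F')) ≤ K' * (L * (F - F')) := Nat.mul_le_mul_right _ hK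
    exact Or.inl ⟨h7, t₀, m', h8, h9, h10, h11, by omega⟩
  · have : K * (L * (V + F)) ≤ K' * (L * (V + F)) := Nat.mul_le_mul_right _ hK
    exact Or.inr ⟨h7, h8, by omega⟩

/-- Transfer to a program that runs like another one after some steps of cost at least `c'`. -/
theorem Metered.of_runs {p' : Prog} {m : Memory} {c' : ℕ} {q : Prog} (h : Metered p m V L K b c q s F)
    (hp : ∃ k, c' ≤ c + 4 * k ∧ (∀ t₀ m', Runs p m t₀ m' → Runs p' m (k + t₀) m') ∧
      ∀ t₀ m', Runs p' m t₀ m' → ∃ t₁, t₀ = k + t₁ ∧ Runs p m t₁ m') :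
    Metered p' m V L K b c' q s F := by
  obtain ⟨k, hk, hp1, hp2⟩ := hp
  obtain ⟨t, s', F', r, h1, h2, h3, h4, h5, h6⟩ := h
  refine ⟨t, s', F', r, h1, h2, h3, h4, h5, ?_⟩
  grind

theorem metered_assign (x : ℕ) (e : Expr) {m : Memory} (hr : Ready s m V L F)
    (hV : V * (4 * (Prog.assign x e).weight + 1) < 2 ^ L) (hL : (Prog.assign x e).weight ≤ L) :
    Metered (.assign x e) m V L (1000 * (Prog.assign x e).weight + 250) 0 0
      (Prog.assign x e).meter s F := by
  have hb := bits_pos (x : ℤ)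
  have hw : (Prog.assign x e).weight = bits x + e.regBits + e.factor := rfl
  have hL1 : 1 ≤ L := by omega
  obtain ⟨⟨t, s', r, ht, ha, hreg, hf, hv⟩, hA⟩ :=
    hr.meters hV e (by omega) (by omega : e.factor ≤ _) hL1 (le_refl scratch)
  have hst : s'.reg stampReg = s.reg stampReg := hreg _ (by decide) (by decide)
  refine metered_of_eval (K' := 0) (B := bits (e.val m)) hr hV hL1 (e.charged_pos m) hA (by omega)
    (fun t₀ m' h => ?_) ⟨t, s', r, by omega, ha, hreg, hf, fun hlt => ?_⟩
  · cases h
    have := e.charged_le m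
    omega
  · have hsim := hr.sim.congr ha hst
    have hcost := e.charged_le m
    have hb' := bits_lt_of_charged_lt hlt
    have hfuel := hr.fuel
    have hsb := hr.stamp
    refine ⟨_, _, F - e.charged m, .seq (.store s' (simVal 0) (.const x) (.var scratch))
      (.store _ (simStamp 0) (.const x) (.var stampReg)), fun a h => ?_, fun y _ _ => rfl,
      ?_, ?_, le_rfl, Or.inl ⟨by omega, _, _, .assign m x e, ?_, ?_, ?_, ?_⟩⟩
    · simp only [setCell]
      grind
    · exact hsim.stamped.store 0 x _
    · simp only [setCell_reg, hf, hfuel]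
      omega
    · have := hsim.store_reg x (e.val m)
      simpa only [Expr.val, hv, setCell_reg] using this
    · exact hr.bitsLE.setReg x (hb'.trans hr.le)
    · omega
    · simp only [Expr.cost, hv, setCell_reg, hst]
      omega

theorem metered_store (a : ℕ) (i e : Expr) {m : Memory} (hr : Ready s m V L F)
    (hV : V * (4 * (Prog.store a i e).weight + 1) < 2 ^ L) (hL : (Prog.store a i e).weight ≤ L) :
    Metered (.store a i e) m V L (1000 * (Prog.store a i e).weight + 250) 0 0
      (Prog.store a i e).meter s F := by
  have hw : (Prog.store a i e).weight = i.regBits + e.regBits + i.factor + e.factor + 1 := rfl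
  have hL1 : 1 ≤ L := by omega
  obtain ⟨⟨t, s', r, ht, ha, hreg, hf, hv⟩, -⟩ :=
    hr.meters hV i (by omega) (by omega : i.factor ≤ _) hL1 (le_refl scratch)
  have hst : s'.reg stampReg = s.reg stampReg := hreg _ (by decide) (by decide)
  have hsim := hr.sim.congr ha hst
  have hV1 : 1 ≤ V := hr.pos.trans_le hr.le
  have hA : i.charged m + e.charged m ≤ 4 * (Prog.store a i e).weight * V := by
    have h1 := i.charged_le m
    have h2 := e.charged_le m
    have h3 := Expr.cost_le_factor hV1 hr.bitsLE i
    have h4 := Expr.cost_le_factor hV1 hr.bitsLE e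
    have h5 : (i.factor + e.factor) * V ≤ (Prog.store a i e).weight * V :=
      Nat.mul_le_mul_right _ (by omega)
    rw [add_mul] at h5
    rw [mul_assoc]
    omega
  have habs : ∀ c : ℕ, c ≤ i.charged m + e.charged m → |(F : ℤ) - c| < 2 ^ L := by
    intro c hc
    have h3 : ((V * (4 * (Prog.store a i e).weight + 1) : ℕ) : ℤ) < 2 ^ L := mod_cast hV
    have h4 : (c : ℤ) ≤ ((4 * (Prog.store a i e).weight * V : ℕ) : ℤ) := by
      exact_mod_cast hc.trans hA
    have h5 : (F : ℤ) ≤ V := mod_cast hr.le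
    push_cast at h3 h4
    rw [abs_lt]
    constructor <;> nlinarith
  obtain ⟨t', s'', r', ht', ha', hreg', hf', hv'⟩ := Expr.meters_meter hL1 e (by omega)
    (Nat.le_succ scratch) hsim (by rw [hst]; exact hr.stamp)
    (by rw [hf, hr.fuel]; exact habs _ (by omega))
    (by
      have := habs (i.charged m + e.charged m) le_rfl
      rw [hf, hr.fuel]
      push_cast at this
      rwa [sub_sub])
  simp only [Nat.succ_eq_add_one] at hv' hreg'
  have hvi : s''.reg scratch = i.val m := by rw [hreg' _ (by omega) (by decide), hv]
  have hst' : s''.reg stampReg = s'.reg stampReg := hreg' _ (by decide) (by decide)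
  have hfuel : s''.reg fuelReg = s.reg fuelReg - (i.charged m + e.charged m : ℕ) := by
    rw [hf', hf]
    push_cast
    ring
  have hLc : L * (i.charged m + e.charged m) = L * i.charged m + L * e.charged m := by ring
  refine metered_of_eval (K' := 0) (B := bits (i.val m) + bits (e.val m)) hr hV hL1
    ((i.charged_pos m).trans (Nat.le_add_right _ _)) hA (by omega) (fun t₀ m' h => ?_)
    ⟨_, s'', .seq r r', by omega, ha'.trans ha,
      fun x hx h => by rw [hreg' x (by omega) h, hreg x hx h], hfuel, fun hlt => ?_⟩
  · cases h
    have := e.charged_le m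
    have := i.charged_le m
    omega
  · have hsim' := hsim.congr ha' hst'
    have hcost := e.charged_le m
    have hcost' := i.charged_le m
    have hb' : bits (e.val m) ≤ F := bits_lt_of_charged_lt (by omega)
    have hF := hr.fuel
    have hsb := hr.stamp
    refine ⟨_, _, F - (i.charged m + e.charged m),
      .seq (.store s'' (simVal (a + 1)) (.var scratch) (.var (scratch + 1)))
      (.store _ (simStamp (a + 1)) (.var scratch) (.var stampReg)), fun b h => ?_, fun y _ _ => rfl,
      ?_, ?_, le_rfl, Or.inl ⟨by omega, _, _, .store m a i e, ?_, ?_, ?_, ?_⟩⟩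
    · simp only [setCell]
      unfold ownArrays at h
      rw [update_of_ne (by unfold simStamp; omega),
        update_of_ne (by unfold simVal; omega)]
    · exact hsim'.stamped.store (a + 1) _ _
    · simp only [setCell_reg, hfuel, hF]
      omega
    · have := hsim'.store_arr a (i.val m) (e.val m)
      simpa only [Expr.val, hvi, hv', setCell_reg] using this
    · exact hr.bitsLE.setCell a _ (hb'.trans hr.le)
    · omega
    · simp only [Expr.cost, hvi, hv', setCell_reg, hst', hst]
      omega

/-- The metered test of a loop, followed by a loop that tests the result. -/
theorem metered_test {e : Expr} {m : Memory} {K' : ℕ} (q : Prog)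
    (hr : Ready s m V L F) (hV : V * (4 * w + 1) < 2 ^ L) (hL : 1 ≤ L) (hrb : e.regBits ≤ L)
    (hw : e.factor ≤ w) (hK : 1000 * w + K' + 250 ≤ K)
    (hq : ∀ s' F', F' < F → Ready s' m V L F' → s'.reg scratch = e.val m →
      Metered (.while e p) m V L K (bits (e.val m) + 1 + K' * L) (4 * e.cost m)
        (.while (.var scratch) q) s' F') :
    Metered (.while e p) m V L K 0 0 (.seq (meterTest e) (.while (.var scratch) q)) s F := by
  obtain ⟨⟨t, s', r, ht, ha, hreg, hf, hv⟩, hA⟩ := hr.meters hV e hrb hw hL (le_refl scratch)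
  have hst : s'.reg stampReg = s.reg stampReg := hreg _ (by decide) (by decide)
  have hA1 := e.charged_pos m
  have hLA : L ≤ L * e.charged m := Nat.le_mul_of_pos_right _ hA1
  have hbF := hr.bits_fuel_le hV
  have hcost := e.charged_le m
  have hsim := hr.sim.congr ha hst
  have hF := hr.fuel
  have h0 : 0 < (Expr.var fuelReg).val s := by
    have := hr.pos
    simp only [Expr.val, hF]
    omega
  rcases Nat.lt_or_ge (e.charged m) F with hlt | hge
  · have hb' : bits (s'.reg fuelReg) ≤ L + 1 := by
      refine (bits_mono ?_).trans hbF
      rw [hf, hF]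
      omega
    have h1 : 0 < (Expr.var fuelReg).val s' := by
      simp only [Expr.val, hf, hF]
      omega
    have hready : Ready s' m V L (F - e.charged m) := by
      refine ⟨hsim, ?_, by omega, hr.bitsLE, by have := hr.le; omega, ?_⟩
      · rw [hf, hF]; omega
      · rw [hst]; exact hr.stamp
    obtain ⟨t', s'', F', r', ha', hr', hst', hf', hle, hout⟩ :=
      hq s' (F - e.charged m) (by omega) hready hv
    refine ⟨_, s'', F', .seq (.ite_pos h0 (.seq r (.ite_pos h1 (.skip _)))) r',
      fun a h => by rw [ha' a h, ha], fun x h h' => by rw [hr' x h h', hreg x h h'], hst', hf',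
      by omega, ?_⟩
    simp only [Expr.cost]
    rcases hout with ⟨hpos, t₀, m', r₀, hsim, hb, hFt, htime⟩ | ⟨h0', hall, htime⟩
    · refine Or.inl ⟨hpos, t₀, m', r₀, hsim, hb, by omega, ?_⟩
      have h2 := mul_mul_eq_add (K := K) (L := L)
              (show F - F' = e.charged m + (F - e.charged m - F') by omega)
      have h3 : (250 + K') * (L * e.charged m) ≤ K * (L * e.charged m) :=
        Nat.mul_le_mul_right _ (by omega)
      have h4 : K' * L ≤ K' * (L * e.charged m) := Nat.mul_le_mul_left _ hLA
      rw [add_mul] at h3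
      omega
    · refine Or.inr ⟨h0', fun t₀ m' h => ?_, ?_⟩
      · have := hall t₀ m' h
        omega
      · have h2 := mul_mul_eq_add (K := K) (L := L)
              (show V + F = e.charged m + (V + (F - e.charged m)) by omega)
        have h3 : (250 + K') * (L * e.charged m) ≤ K * (L * e.charged m) :=
          Nat.mul_le_mul_right _ (by omega)
        have h4 : K' * L ≤ K' * (L * e.charged m) := Nat.mul_le_mul_left _ hLA
        rw [add_mul] at h3
        omega
  · have hb' : bits (s'.reg fuelReg) ≤ L + 1 := by
      refine bits_of_abs_le ?_
      have h3 : ((V * (4 * w + 1) : ℕ) : ℤ) < 2 ^ L := mod_cast hV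
      have h4 : (e.charged m : ℤ) ≤ ((4 * w * V : ℕ) : ℤ) := mod_cast hA
      have h5 : (F : ℤ) ≤ V := mod_cast hr.le
      push_cast at h3 h4
      rw [hf, hF, abs_lt]
      constructor <;> nlinarith
    have h1 : ¬ 0 < (Expr.var fuelReg).val s' := by
      simp only [Expr.val, hf, hF]
      omega
    have rw' := Runs.while_neg (e := .var scratch) (p := q)
      (s := (s'.setReg fuelReg 0).setReg scratch 0)
      (by simp [Expr.val])
    refine ⟨_, _, 0, .seq (.ite_pos h0 (.seq r (.ite_neg h1 (.seq (.assign _ _ _)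
      (.assign _ _ _))))) rw', fun a _ => ?_, fun x h h' => ?_,
      ?_, ?_, Nat.zero_le _, Or.inr ⟨rfl, fun t₀ m' h => ?_, ?_⟩⟩
    · rw [setReg_arr, setReg_arr, ha]
    · rw [setReg_of_ne (by omega), setReg_reg,
        update_of_ne h', hreg x h h']
    · intro a i
      have := hr.sim.stamped a i
      rw [setReg_arr, setReg_of_ne (by decide),
        setReg_arr, setReg_of_ne (by decide), ha,
        hreg stampReg (by decide) (by decide)]
      exact this
    · rw [setReg_of_ne (by decide), setReg_self]
      rfl
    · have : e.cost m ≤ t₀ := by cases h <;> omega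
      omega
    · rw [zero_add]
      refine fail_bound (A := e.charged m) hA (by omega) ?_
      simp only [Expr.cost, bits_zero, setReg_self]
      omega

theorem metered_loop {e : Expr} {Kp : ℕ} (hV : V * (4 * w + 1) < 2 ^ L)
    (hL : 1 ≤ L) (hrb : e.regBits ≤ L) (hw : e.factor ≤ w) (hK : 1000 * w + 2 * Kp + 260 ≤ K)
    (hp : ∀ {s m F}, Ready s m V L F → Metered p m V L Kp (Kp * L) 0 p.meter s F) :
    ∀ F s m, Ready s m V L F → s.reg scratch = e.val m →
      Metered (.while e p) m V L K (bits (e.val m) + 1 + Kp * L) (4 * e.cost m)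
        (.while (.var scratch) (.seq p.meter (meterTest e))) s F := by
  intro F
  induction F using Nat.strong_induction_on with
  | _ F ih =>
    intro s m hr hs
    have hKV : Kp * L + Kp * (L * (V + F)) + 6 ≤ K * (L * (V + F)) := by
      have h1 : 1 ≤ V := hr.pos.trans_le hr.le
      have h2 : (Kp + Kp + 6) * (L * (V + F)) ≤ K * (L * (V + F)) :=
        Nat.mul_le_mul_right _ (by omega)
      have h3 : L ≤ L * (V + F) := Nat.le_mul_of_pos_right _ (by omega)
      have h4 : Kp * L ≤ Kp * (L * (V + F)) := Nat.mul_le_mul_left _ h3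
      rw [add_mul, add_mul] at h2
      omega
    by_cases hpos : 0 < e.val m
    · have hpos' : 0 < (Expr.var scratch).val s := by simpa [Expr.val, hs] using hpos
      obtain ⟨t, s', F', r, ha, hreg, hst, hf, hle, hout⟩ := hp hr
      have hst' : s'.reg stampReg = s.reg stampReg := hreg _ (by decide) (by decide)
      rcases hout with ⟨hF', t₀, m', r₀, hsim, hb, hFt, htime⟩ | ⟨h0', hall, htime⟩
      · have hready : Ready s' m' V L F' := ⟨hsim, hf, hF', hb, hle.trans hr.le, by
          rw [hst']; exact hr.stamp⟩
        obtain ⟨t', s'', F'', r', ha', hreg', hst'', hf', hle', hout'⟩ :=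
          metered_test (.seq p.meter (meterTest e)) hready hV hL hrb hw (K := K) (K' := Kp) (by omega)
            fun s₁ F₁ hlt h₁ h₂ => ih F₁ (by omega) s₁ m' h₁ h₂
        cases r' with
        | seq r₁ r₂ =>
        refine ⟨_, s'', F'', .while_pos hpos' (.seq r r₁) r₂, fun a h => by rw [ha' a h, ha a h],
          fun x h h' => by rw [hreg' x h h', hreg x h h'], hst'', hf', hle'.trans hle, ?_⟩
        simp only [Expr.cost, hs]
        rcases hout' with ⟨hF'', t₁, m'', r₁', hsim', hb', hFt', htime'⟩ | ⟨h0'', hall', htime'⟩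
        · refine Or.inl ⟨hF'', _, m'', .while_pos hpos r₀ r₁', hsim', hb', by omega, ?_⟩
          have h1 := mul_mul_eq_add (K := K) (L := L)
              (show F - F'' = (F - F') + (F' - F'') by omega)
          have h2 : Kp * (L * (F - F')) ≤ K * (L * (F - F')) := Nat.mul_le_mul_right _ (by omega)
          omega
        · refine Or.inr ⟨h0'', fun t₁ m₁ h => ?_, ?_⟩
          · cases h with
            | while_neg h => exact absurd hpos h
            | while_pos _ h₁ h₂ =>
              obtain ⟨rfl, rfl⟩ := h₁.deterministic r₀
              have := hall' _ _ h₂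
              omega
          · have h1 := mul_mul_eq_add (K := K) (L := L)
              (show V + F = (F - F') + (V + F') by omega)
            have h2 : Kp * (L * (F - F')) ≤ K * (L * (F - F')) := Nat.mul_le_mul_right _ (by omega)
            omega
      · obtain ⟨s'', r', ha', hreg', hsc⟩ := meterTest_dead (e := e) (s := s') (by rw [hf, h0']; rfl)
        have r'' := Runs.while_neg (e := .var scratch) (p := .seq p.meter (meterTest e)) (s := s'')
          (by simp [Expr.val, hsc])
        refine ⟨_, s'', 0, .while_pos hpos' (.seq r r') r'', fun a h => by rw [ha', ha a h],
          fun x h h' => by rw [hreg' x h, hreg x h h'], ?_, ?_, Nat.zero_le _,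
          Or.inr ⟨rfl, fun t₁ m₁ h => ?_, ?_⟩⟩
        · intro a i
          have := hst a i
          rwa [ha', hreg' _ (by decide)]
        · rw [hreg' _ (by decide), hf, h0']
        · cases h with
          | while_neg h => exact absurd hpos h
          | while_pos _ h₁ h₂ =>
            have := hall _ _ h₁
            omega
        · simp only [Expr.cost, hs, hsc, bits_zero]
          omega
    · refine ⟨_, s, F, .while_neg (by simpa [Expr.val, hs] using hpos), fun _ _ => rfl,
        fun _ _ _ => rfl, hr.sim.stamped, hr.fuel, le_rfl,
        Or.inl ⟨hr.pos, _, m, .while_neg hpos, hr.sim, hr.bitsLE, by omega, ?_⟩⟩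
      simp only [Expr.cost, hs]
      omega

/-- The simulation halts in the time of the fuel, up to a factor, and tells whether the fuel
suffices for the simulated program. -/
theorem exists_metered_meter (p : Prog) : ∃ K, ∀ (V L F : ℕ) (s m : Memory), Ready s m V L F →
    V * (4 * p.weight + 1) < 2 ^ L → p.weight ≤ L →
    Metered p m V L K (K * L) 0 p.meter s F := by
  have hVmono : ∀ {V L w w' : ℕ}, w ≤ w' → V * (4 * w' + 1) < 2 ^ L → V * (4 * w + 1) < 2 ^ L :=
    fun h h' => (Nat.mul_le_mul_left _ (by omega)).trans_lt h'
  induction p with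
  | skip =>
    refine ⟨1, fun V L F s m hr _ hL => ?_⟩
    have hL1 : 1 ≤ L := hL
    exact ⟨1, s, F, .skip s, fun _ _ => rfl, fun _ _ _ => rfl, hr.sim.stamped, hr.fuel, le_rfl,
      Or.inl ⟨hr.pos, 1, m, .skip m, hr.sim, hr.bitsLE, by omega, by omega⟩⟩
  | assign x e =>
    exact ⟨_, fun V L F s m hr hV hL => (metered_assign x e hr hV hL).mono le_rfl (Nat.zero_le _)⟩
  | store a i e =>
    exact ⟨_, fun V L F s m hr hV hL => (metered_store a i e hr hV hL).mono le_rfl (Nat.zero_le _)⟩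
  | seq p q ihp ihq =>
    obtain ⟨K₁, h₁⟩ := ihp
    obtain ⟨K₂, h₂⟩ := ihq
    obtain ⟨K₃, h₃⟩ := exists_runs_meter_dead q
    refine ⟨K₁ + K₂ + K₃, fun V L F s m hr hV hL => ?_⟩
    have hw : (Prog.seq p q).weight = p.weight + q.weight := rfl
    have hq1 : 1 ≤ L := by
      have := p.weight_pos
      omega
    obtain ⟨t, s', F', r, ha, hreg, hst, hf, hle, hout⟩ :=
      h₁ V L F s m hr (hVmono (by omega) hV) (by omega)
    have hst' : s'.reg stampReg = s.reg stampReg := hreg _ (by decide) (by decide)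
    rcases hout with ⟨hF', t₀, m', r₀, hsim, hb, hFt, htime⟩ | ⟨h0', hall, htime⟩
    · have hready : Ready s' m' V L F' := ⟨hsim, hf, hF', hb, hle.trans hr.le, by
        rw [hst']; exact hr.stamp⟩
      obtain ⟨t', s'', F'', r', ha', hreg', hst'', hf', hle', hout'⟩ :=
        h₂ V L F' s' m' hready (hVmono (by omega) hV) (by omega)
      refine ⟨_, s'', F'', .seq r r', fun a h => by rw [ha' a h, ha a h],
        fun x h h' => by rw [hreg' x h h', hreg x h h'], hst'', hf', hle'.trans hle, ?_⟩
      have h4 : K₁ * (L * (F - F')) ≤ (K₁ + K₂ + K₃) * (L * (F - F')) :=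
        Nat.mul_le_mul_right _ (by omega)
      rw [add_mul, add_mul]
      rcases hout' with ⟨hF'', t₁, m'', r₁', hsim', hb', hFt', htime'⟩ | ⟨h0'', hall', htime'⟩
      · refine Or.inl ⟨hF'', _, m'', .seq r₀ r₁', hsim', hb', by omega, ?_⟩
        have h1 := mul_mul_eq_add (K := K₁ + K₂ + K₃) (L := L)
              (show F - F'' = (F - F') + (F' - F'') by omega)
        grind
      · refine Or.inr ⟨h0'', fun t₁ m₁ h => ?_, ?_⟩
        · cases h with
          | seq h₁ h₂ =>
            obtain ⟨rfl, rfl⟩ := h₁.deterministic r₀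
            have := hall' _ _ h₂
            omega
        · have h1 := mul_mul_eq_add (K := K₁ + K₂ + K₃) (L := L)
              (show V + F = (F - F') + (V + F') by omega)
          grind
    · obtain ⟨t', s'', r', ht', ha', hreg'⟩ := h₃ s' (by rw [hf, h0']; rfl)
      refine ⟨_, s'', 0, .seq r r', fun a h => by rw [ha', ha a h],
        fun x h h' => by rw [hreg' x h, hreg x h h'], ?_, ?_, Nat.zero_le _,
        Or.inr ⟨rfl, fun t₁ m₁ h => ?_, ?_⟩⟩
      · intro a i
        have := hst a i
        rwa [ha', hreg' _ (by decide)]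
      · rw [hreg' _ (by decide), hf, h0']
      · cases h with
        | seq h₁ h₂ =>
          have := hall _ _ h₁
          omega
      · have h5 : K₁ * (L * (V + F)) ≤ (K₁ + K₂ + K₃) * (L * (V + F)) :=
          Nat.mul_le_mul_right _ (by omega)
        have h6 : K₃ ≤ K₃ * L := Nat.le_mul_of_pos_right _ hq1
        rw [add_mul, add_mul]
        omega
  | ite e p q ihp ihq =>
    obtain ⟨K₁, h₁⟩ := ihp
    obtain ⟨K₂, h₂⟩ := ihq
    set W := (Prog.ite e p q).weight with hW
    have hw : W = e.regBits + e.factor + p.weight + q.weight + 1 := rfl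
    refine ⟨1000 * W + (K₁ + K₂) + 250, fun V L F s m hr hV hL => ?_⟩
    have hL1 : 1 ≤ L := by omega
    obtain ⟨⟨t, s', r, ht, ha, hreg, hf, hv⟩, hA⟩ :=
      hr.meters hV e (by omega) (by omega : e.factor ≤ _) hL1 (le_refl scratch)
    have hst : s'.reg stampReg = s.reg stampReg := hreg _ (by decide) (by decide)
    have hcost := e.charged_le m
    refine Metered.mono (metered_of_eval (K' := K₁ + K₂) (B := 3 * bits (e.val m)) hr hV hL1
      (e.charged_pos m) hA (le_refl (1000 * W + (K₁ + K₂) + 250)) (fun t₀ m' h => ?_)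
      ⟨t, s', r, by omega, ha, hreg, hf, fun hlt => ?_⟩) le_rfl (Nat.zero_le _)
    · have : e.cost m ≤ t₀ := by cases h <;> omega
      omega
    · have hF := hr.fuel
      have hready : Ready s' m V L (F - e.charged m) := by
        refine ⟨hr.sim.congr ha hst, ?_, by omega, hr.bitsLE, by have := hr.le; omega, ?_⟩
        · rw [hf, hF]; omega
        · rw [hst]; exact hr.stamp
      obtain ⟨p', K', hK', h, h1, h2, h3⟩ : ∃ p' K', K' ≤ K₁ + K₂ ∧
          Metered p' m V L K' (K' * L) 0 p'.meter s' (F - e.charged m) ∧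
          (∀ t₀ m', Runs p' m t₀ m' → Runs (.ite e p q) m (e.cost m + 1 + t₀) m') ∧
          (∀ t₀ m', Runs (.ite e p q) m t₀ m' → ∃ t₁, t₀ = e.cost m + 1 + t₁ ∧ Runs p' m t₁ m') ∧
          ∀ t s'', Runs p'.meter s' t s'' → Runs (.ite (.var scratch) p.meter q.meter) s'
            ((Expr.var scratch).cost s' + 1 + t) s'' := by
        by_cases hpos : 0 < e.val m
        · exact ⟨p, K₁, by omega, h₁ V L _ s' m hready (hVmono (by omega) hV) (by omega),
            fun _ _ h => .ite_pos hpos h, fun _ _ h => by cases h <;> grind,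
            fun _ _ h => .ite_pos (by simpa [Expr.val, hv] using hpos) h⟩
        · exact ⟨q, K₂, by omega, h₂ V L _ s' m hready (hVmono (by omega) hV) (by omega),
            fun _ _ h => .ite_neg hpos h, fun _ _ h => by cases h <;> grind,
            fun _ _ h => .ite_neg (by simpa [Expr.val, hv] using hpos) h⟩
      have hKL' : K' * L ≤ (K₁ + K₂) * L := Nat.mul_le_mul_right _ hK'
      obtain ⟨t', s'', F', r', h⟩ := (h.of_runs (p' := .ite e p q) (c' := e.charged m)
        ⟨e.cost m + 1, by omega, h1, h2⟩).mono
        (by omega : K' ≤ 1000 * W + (K₁ + K₂) + 250) (le_refl _)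
      refine ⟨_, s'', F', h3 _ _ r', h.1, h.2.1, h.2.2.1, h.2.2.2.1, h.2.2.2.2.1, ?_⟩
      simp only [Expr.cost, hv]
      grind
  | _ e p ih =>
    obtain ⟨K₁, h₁⟩ := ih
    set W := (Prog.while e p).weight with hW
    have hw : W = e.regBits + e.factor + p.weight + 1 := rfl
    refine ⟨1000 * W + 2 * K₁ + 260, fun V L F s m hr hV hL => ?_⟩
    have hp : ∀ {s m F}, Ready s m V L F → Metered p m V L K₁ (K₁ * L) 0 p.meter s F :=
      fun h => h₁ V L _ _ _ h (hVmono (by omega) hV) (by omega)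
    exact Metered.mono (metered_test (.seq p.meter (meterTest e)) hr hV (by omega) (by omega)
      (by omega) (K := 1000 * W + 2 * K₁ + 260) (K' := K₁) (by omega) fun s₁ F₁ _ h₁ h₂ =>
        metered_loop hV (by omega) (by omega) (by omega) le_rfl hp F₁ s₁ m h₁ h₂) le_rfl
      (Nat.zero_le _)

end Prog

/-! ### Sparsification

Clauses are multisets of literals, and literals are natural numbers. -/

/-- An assignment of truth values to the literals satisfies a family of clauses. -/
def Satisfies (x : ℕ → Prop) (G : Finset (Multiset ℕ)) : Prop := ∀ C ∈ G, ∃ l ∈ C, x l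

/-- The minimal clauses of a family. -/
def minimals (G : Finset (Multiset ℕ)) : Finset (Multiset ℕ) :=
  G.filter fun C => ∀ D ∈ G, D ≤ C → D = C

/-- The number of minimal clauses of size `c` that contain `H`. -/
def degree (G : Finset (Multiset ℕ)) (c : ℕ) (H : Multiset ℕ) : ℕ :=
  ((minimals G).filter fun C => C.card = c ∧ H ≤ C).card

/-- Many minimal clauses of size `c` contain `H`, whose size is `c - i`. -/
structure Heavy (θ : ℕ → ℕ) (G : Finset (Multiset ℕ)) (c i : ℕ) (H : Multiset ℕ) : Prop where
  pos : 1 ≤ i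
  lt : i < c
  card : H.card = c - i
  le : θ i ≤ degree G c H

/-- The petals of a flower with heart `H`. -/
def petals (G : Finset (Multiset ℕ)) (c : ℕ) (H : Multiset ℕ) : Finset (Multiset ℕ) :=
  ((minimals G).filter fun C => C.card = c ∧ H ≤ C).image fun C => C - H

theorem mem_minimals {C : Multiset ℕ} :
    C ∈ minimals G ↔ C ∈ G ∧ ∀ D ∈ G, D ≤ C → D = C := mem_filter

theorem exists_minimal_le {C : Multiset ℕ} (hC : C ∈ G) :
    ∃ D ∈ minimals G, D ≤ C := by
  obtain ⟨D, hD, hmin⟩ := exists_min_image (G.filter (· ≤ C)) Multiset.card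
    ⟨C, mem_filter.2 ⟨hC, le_rfl⟩⟩
  rw [mem_filter] at hD
  refine ⟨D, mem_minimals.2 ⟨hD.1, fun D' hD' hle => ?_⟩, hD.2⟩
  exact Multiset.eq_of_le_of_card_le hle (hmin D' (mem_filter.2 ⟨hD', hle.trans hD.2⟩))

theorem satisfies_minimals {x : ℕ → Prop} :
    Satisfies x (minimals G) ↔ Satisfies x G := by
  refine ⟨fun h C hC => ?_, fun h C hC => h C (mem_minimals.1 hC).1⟩
  obtain ⟨D, hD, hle⟩ := exists_minimal_le hC
  obtain ⟨l, hl, hx⟩ := h D hD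
  exact ⟨l, Multiset.mem_of_le hle hl, hx⟩

/-- Branching on a flower: either its heart or all of its petals are satisfied. -/
theorem satisfies_branch {x : ℕ → Prop} :
    Satisfies x G ↔ Satisfies x (G ∪ {H}) ∨ Satisfies x (G ∪ petals G c H) := by
  constructor
  · intro h
    by_cases hH : ∃ l ∈ H, x l
    · left
      intro C hC
      rcases mem_union.1 hC with hC | hC
      · exact h C hC
      · rw [mem_singleton.1 hC]
        exact hH
    · right
      intro C hC
      rcases mem_union.1 hC with hC | hC
      · exact h C hC
      · obtain ⟨D, hD, rfl⟩ := mem_image.1 hC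
        rw [mem_filter] at hD
        obtain ⟨l, hl, hx⟩ := h D (mem_minimals.1 hD.1).1
        refine ⟨l, ?_, hx⟩
        by_contra hl'
        rw [← Multiset.sub_add_cancel hD.2.2, Multiset.mem_add] at hl
        exact hH ⟨l, hl.resolve_left hl', hx⟩
  · rintro (h | h) C hC <;> exact h C (mem_union_left _ hC)

theorem card_petals (G : Finset (Multiset ℕ)) (c : ℕ) (H : Multiset ℕ) :
    (petals G c H).card = degree G c H := by
  refine card_image_of_injOn fun C hC D hD h => ?_
  have hC := (mem_filter.1 hC).2.2
  have hD := (mem_filter.1 hD).2.2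
  rw [← Multiset.sub_add_cancel hC, ← Multiset.sub_add_cancel hD]
  exact congrArg (· + H) h

theorem card_petals_filter_le (G : Finset (Multiset ℕ)) (c : ℕ) (H S : Multiset ℕ) :
    ((petals G c H).filter fun P => S ≤ P).card ≤ degree G c (H + S) := by
  rw [← card_petals G c (H + S)]
  refine card_le_card_of_injOn (fun P => P - S) (fun P hP => ?_) fun P hP P' hP' h => ?_
  · obtain ⟨h1, h2⟩ := mem_filter.1 hP
    obtain ⟨C, hC, rfl⟩ := mem_image.1 h1
    rw [mem_filter] at hC
    refine mem_image.2 ⟨C, mem_filter.2 ⟨hC.1, hC.2.1, ?_⟩, ?_⟩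
    · rw [← Multiset.sub_add_cancel hC.2.2, add_comm H]
      exact Multiset.add_le_add_right h2
    · rw [Multiset.sub_add_eq_sub_sub]
  · have h1 := (mem_filter.1 hP).2
    have h2 := (mem_filter.1 hP').2
    rw [← Multiset.sub_add_cancel h1, ← Multiset.sub_add_cancel h2]
    exact congrArg (· + S) h

/-- The number of minimal clauses of size `i`. -/
def minCount (G : Finset (Multiset ℕ)) (i : ℕ) : ℕ :=
  ((minimals G).filter fun C => C.card = i).card

/-- All clauses have size at most `k` and literals less than `q`. -/
def Bounded (k q : ℕ) (G : Finset (Multiset ℕ)) : Prop :=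
  ∀ C ∈ G, C.card ≤ k ∧ ∀ l ∈ C, l < q

theorem minCount_le {i : ℕ} (hG : Bounded k q G) (hi : 1 ≤ i)
    (hD : ∀ l < q, degree G i {l} ≤ D) : minCount G i ≤ q * D := by
  have h1 : ((minimals G).filter fun C => C.card = i) ⊆ (range q).biUnion fun l =>
      (minimals G).filter fun C => C.card = i ∧ {l} ≤ C := by
    intro C hC
    obtain ⟨h1, h2⟩ := mem_filter.1 hC
    obtain ⟨l, hl⟩ := Multiset.card_pos_iff_exists_mem.1 (by omega : 0 < C.card)
    exact mem_biUnion.2 ⟨l, mem_range.2 ((hG C (mem_minimals.1 h1).1).2 l hl),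
      mem_filter.2 ⟨h1, h2, Multiset.singleton_le.2 hl⟩⟩
  refine (card_le_card h1).trans (card_biUnion_le.trans ?_)
  calc ∑ l ∈ range q, degree G i {l} ≤ ∑ l ∈ range q, D :=
        sum_le_sum fun l hl => hD l (mem_range.1 hl)
    _ = q * D := by simp

theorem degree_one_le (G : Finset (Multiset ℕ)) (l : ℕ) : degree G 1 {l} ≤ 1 := by
  refine card_le_one.2 fun C hC D hD => ?_
  have hC := (mem_filter.1 hC).2
  have hD := (mem_filter.1 hD).2
  rw [← Multiset.eq_of_le_of_card_le hC.2 (by simp [hC.1]),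
    ← Multiset.eq_of_le_of_card_le hD.2 (by simp [hD.1])]

/-- Without flowers there are few minimal clauses. -/
theorem card_minimals_le (hG : Bounded k q G)
    (h : ∀ c i H, c ≤ k → ¬ Heavy θ G c i H) :
    (minimals G).card ≤ 1 + q * (1 + ∑ i ∈ range k, θ i) := by
  have h1 : minimals G ⊆ (range (k + 1)).biUnion fun i =>
      (minimals G).filter fun C => C.card = i := by
    intro C hC
    have := (hG C (mem_minimals.1 hC).1).1
    exact mem_biUnion.2 ⟨C.card, mem_range.2 (by omega),
      mem_filter.2 ⟨hC, rfl⟩⟩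
  have h0 : minCount G 0 ≤ 1 := by
    refine card_le_one.2 fun C hC D hD => ?_
    rw [Multiset.card_eq_zero.1 (mem_filter.1 hC).2,
      Multiset.card_eq_zero.1 (mem_filter.1 hD).2]
  have hstep : ∀ i < k, minCount G (i + 1) ≤ if i = 0 then q else q * θ i := by
    intro i hi
    split_ifs with h0
    · subst h0
      simpa using minCount_le hG le_rfl fun l _ => degree_one_le G l
    · refine minCount_le hG (by omega) fun l hl => ?_
      by_contra hlt
      exact h (i + 1) i {l} hi ⟨by omega, by omega, by simp, by omega⟩
  refine (card_le_card h1).trans (card_biUnion_le.trans ?_)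
  change ∑ i ∈ range (k + 1), minCount G i ≤ _
  rw [sum_range_succ']
  have h2 : ∑ i ∈ range k, minCount G (i + 1) ≤
      ∑ i ∈ range k, ((if i = 0 then q else 0) + q * θ i) := by
    refine sum_le_sum fun i hi => (hstep i (mem_range.1 hi)).trans ?_
    split_ifs <;> omega
  have h3 : ∑ i ∈ range k, (if i = 0 then q else 0) ≤ q := by
    rw [sum_ite_eq']
    split_ifs <;> omega
  rw [sum_add_distrib, ← mul_sum] at h2
  rw [mul_add, mul_one]
  omega

/-- A family of clauses that arises from a formula by `X` hearts and `Y` sets of petals. -/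
def Node (θ : ℕ → ℕ) (k q : ℕ) (G : Finset (Multiset ℕ)) (X Y : ℕ) : Prop :=
  Bounded k q G ∧ ∃ a y : ℕ → ℕ,
    (∀ i, a i ≤ minCount G i + ∑ j ∈ range i, 2 * θ (i - j) * a j) ∧ a 0 = 0 ∧
    (∀ i, a i = 0 ∨ ∀ S : Multiset ℕ, 0 < S.card → S.card < i →
      degree G i S ≤ 2 * θ (i - S.card)) ∧
    X ≤ ∑ i ∈ range (k + 1), a i ∧ (∀ i, y i * θ i ≤ a i) ∧
    Y ≤ ∑ i ∈ range (k + 1), y i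

theorem Node.root (h : Bounded k q G) :
    Node θ k q G 0 0 :=
  ⟨h, 0, 0, fun _ => Nat.zero_le _, rfl, fun _ => Or.inl rfl, Nat.zero_le _,
    fun _ => by simp, Nat.zero_le _⟩

section Step

variable {G Q : Finset (Multiset ℕ)} {h : ℕ}

theorem minimals_union (hQ : ∀ P ∈ Q, P.card = h) (hnew : ∀ P ∈ Q, ∀ D ∈ G, ¬ D ≤ P) :
    minimals (G ∪ Q) = ((minimals G).filter fun C => ∀ P ∈ Q, ¬ P ≤ C) ∪ Q := by
  ext C
  simp only [mem_union, mem_filter, mem_minimals]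
  constructor
  · grind
  · rintro (⟨⟨hC, hmin⟩, hle⟩ | hC)
    · grind
    · refine ⟨Or.inr hC, ?_⟩
      rintro D (hD | hD) hDC
      · exact absurd hDC (hnew C hC D hD)
      · exact Multiset.eq_of_le_of_card_le hDC (by rw [hQ C hC, hQ D hD])

theorem degree_union_le (hQ : ∀ P ∈ Q, P.card = h) (hnew : ∀ P ∈ Q, ∀ D ∈ G, ¬ D ≤ P)
    (i : ℕ) (S : Multiset ℕ) :
    degree (G ∪ Q) i S ≤ degree G i S +
      if i = h then (Q.filter fun P => S ≤ P).card else 0 := by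
  unfold degree
  rw [minimals_union hQ hnew, filter_union]
  refine (card_union_le _ _).trans (Nat.add_le_add (card_le_card ?_) ?_)
  · grind
  · split_ifs with hi
    · refine card_le_card fun P => ?_
      simp only [mem_filter]
      tauto
    · rw [Nat.le_zero, card_eq_zero, filter_eq_empty_iff]
      grind

theorem minCount_le_union (hQ : ∀ P ∈ Q, P.card = h) (hnew : ∀ P ∈ Q, ∀ D ∈ G, ¬ D ≤ P)
    (i : ℕ) : minCount G i + (if i = h then Q.card else 0) ≤
      minCount (G ∪ Q) i + if h < i then ∑ P ∈ Q, degree G i P else 0 := by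
  unfold minCount
  rw [minimals_union hQ hnew, filter_union, card_union_of_disjoint, filter_filter]
  · have h1 : ((minimals G).filter fun C => C.card = i) ⊆
        ((minimals G).filter fun C => (∀ P ∈ Q, ¬ P ≤ C) ∧ C.card = i) ∪
          if h < i then Q.biUnion fun P => (minimals G).filter fun C => C.card = i ∧ P ≤ C
            else ∅ := by
      intro C hC
      obtain ⟨hC, hi⟩ := mem_filter.1 hC
      by_cases hle : ∃ P ∈ Q, P ≤ C
      · obtain ⟨P, hP, hle⟩ := hle
        have hlt : h < i := by
          have h1 := Multiset.card_le_card hle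
          rw [hQ P hP, hi] at h1
          refine lt_of_le_of_ne h1 fun he => hnew P hP C (mem_minimals.1 hC).1 ?_
          rw [Multiset.eq_of_le_of_card_le hle (by rw [hQ P hP, hi, he])]
        grind
      · grind
    have h2 := (card_le_card h1).trans (card_union_le _ _)
    have h3 : (if h < i then Q.biUnion fun P => (minimals G).filter fun C => C.card = i ∧ P ≤ C
            else ∅).card ≤ if h < i then ∑ P ∈ Q, degree G i P else 0 := by
      split_ifs
      · exact card_biUnion_le
      · simp
    have h4 : (Q.filter fun C => C.card = i).card = if i = h then Q.card else 0 := by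
      split_ifs with hi
      · rw [filter_true_of_mem fun P hP => (hQ P hP).trans hi.symm]
      · rw [card_eq_zero, filter_eq_empty_iff]
        exact fun P hP h1 => hi (h1.symm.trans (hQ P hP))
    omega
  · rw [disjoint_left]
    grind

theorem Node.union {X' Y' : ℕ} (hG : Node θ k q G X Y)
    (hQ : ∀ P ∈ Q, P.card = h) (hnew : ∀ P ∈ Q, ∀ D ∈ G, ¬ D ≤ P) (hQb : Bounded k q Q)
    (h1 : 1 ≤ h) (hk : h ≤ k)
    (hdeg : ∀ S : Multiset ℕ, 0 < S.card → S.card < h →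
      degree G h S + (Q.filter fun P => S ≤ P).card ≤ 2 * θ (h - S.card))
    (hX : X' ≤ X + Q.card) (hY : Y' ≤ Y + if θ h ≤ Q.card then 1 else 0) :
    Node θ k q (G ∪ Q) X' Y' := by
  obtain ⟨hb, a, y, ha, ha0, hd, hXa, hy, hYy⟩ := hG
  have hb' : Bounded k q (G ∪ Q) := fun C hC =>
    (mem_union.1 hC).elim (hb C) (hQb C)
  have hsum : ∀ (f : ℕ → ℕ) (n : ℕ), ∑ i ∈ range (k + 1), update f h (f h + n) i =
      ∑ i ∈ range (k + 1), f i + n := by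
    intro f n
    have hh : h ∈ range (k + 1) := mem_range.2 (by omega)
    rw [sum_update_of_mem hh, ← sum_sdiff (singleton_subset_iff.2 hh),
      sum_singleton]
    omega
  refine ⟨hb', update a h (a h + Q.card),
    update y h (y h + if θ h ≤ Q.card then 1 else 0), fun i => ?_, ?_, fun i => ?_, ?_,
    fun i => ?_, ?_⟩
  · have hi := minCount_le_union hQ hnew i
    have hai := ha i
    rcases lt_trichotomy i h with hlt | rfl | hgt
    · rw [update_of_ne hlt.ne]
      have : ∑ j ∈ range i, 2 * θ (i - j) * update a h (a h + Q.card) j =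
          ∑ j ∈ range i, 2 * θ (i - j) * a j := by
        refine sum_congr rfl fun j hj => ?_
        rw [update_of_ne (by have := mem_range.1 hj; omega)]
      grind
    · rw [update_self]
      have : ∑ j ∈ range i, 2 * θ (i - j) * update a i (a i + Q.card) j =
          ∑ j ∈ range i, 2 * θ (i - j) * a j := by
        refine sum_congr rfl fun j hj => ?_
        rw [update_of_ne (by have := mem_range.1 hj; omega)]
      grind
    · rw [update_of_ne hgt.ne']
      rcases hd i with h0 | hd
      · rw [h0]; exact Nat.zero_le _
      have : ∑ j ∈ range i, 2 * θ (i - j) * update a h (a h + Q.card) j =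
          ∑ j ∈ range i, 2 * θ (i - j) * a j + 2 * θ (i - h) * Q.card := by
        have hh : h ∈ range i := mem_range.2 hgt
        rw [← sum_erase_add _ _ hh, ← sum_erase_add (range i) _ hh,
          update_self]
        rw [sum_congr rfl fun j hj => by rw [update_of_ne (ne_of_mem_erase hj)]]
        ring
      rw [this]
      have hsumle : ∑ P ∈ Q, degree G i P ≤ 2 * θ (i - h) * Q.card := by
        calc ∑ P ∈ Q, degree G i P ≤ ∑ P ∈ Q, 2 * θ (i - h) := by
              refine sum_le_sum fun P hP => ?_
              grind
          _ = 2 * θ (i - h) * Q.card := by rw [sum_const, smul_eq_mul, mul_comm]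
      grind
  · rw [update_of_ne (by omega)]
    exact ha0
  · by_cases hi : i = h
    · subst hi
      right
      intro S h0 h1
      refine (degree_union_le hQ hnew i S).trans ?_
      rw [if_pos rfl]
      exact hdeg S h0 h1
    · rw [update_of_ne hi]
      refine (hd i).imp id fun hd S h0 h1 => (degree_union_le hQ hnew i S).trans ?_
      grind
  · rw [hsum]
    omega
  · by_cases hi : i = h
    · subst hi
      rw [update_self, update_self, add_mul]
      grind
    · grind
  · rw [hsum]
    omega

end Step

/-- No flower comes before the flowers with clauses of size `c` and petals of size `i`. -/
def NoHeavyBefore (θ : ℕ → ℕ) (G : Finset (Multiset ℕ)) (c i : ℕ) : Prop :=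
  ∀ c' i' H', c' < c ∨ c' = c ∧ i' < i → ¬ Heavy θ G c' i' H'

theorem NoHeavyBefore.degree_lt {i : ℕ}
    (h : NoHeavyBefore θ G c i) {c' : ℕ} {S : Multiset ℕ} (h0 : 0 < S.card) (h1 : S.card < c')
    (hlt : c' < c ∨ c' = c ∧ c' - S.card < i) : degree G c' S < θ (c' - S.card) := by
  by_contra hle
  exact h c' (c' - S.card) S hlt ⟨by omega, by omega, by omega, by omega⟩

theorem not_le_of_lt_minimal {C P : Multiset ℕ}
    (hC : C ∈ minimals G) (hP : P < C) : ∀ D ∈ G, ¬ D ≤ P := by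
  intro D hD hle
  have := (mem_minimals.1 hC).2 D hD (hle.trans hP.le)
  exact absurd (this ▸ hle) (not_le_of_gt hP)

theorem Node.heart (hθ : ∀ i, 1 ≤ θ i) {i : ℕ} (hG : Node θ k q G X Y) (hH : Heavy θ G c i H)
    (hfirst : NoHeavyBefore θ G c i) : Node θ k q (G ∪ {H}) (X + 1) Y := by
  have hi := hH.pos
  have hc := hH.lt
  have hcard := hH.card
  obtain ⟨C, hC⟩ := card_pos.1 ((hθ i).trans hH.le)
  rw [mem_filter] at hC
  have hCb := hG.1 C (mem_minimals.1 hC.1).1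
  have hlt : H < C := lt_of_le_of_ne hC.2.2 fun h => by
    rw [h] at hcard
    omega
  have hf : ∀ S : Multiset ℕ, (({H} : Finset (Multiset ℕ)).filter fun P => S ≤ P).card ≤ 1 :=
    fun S => (card_filter_le _ _).trans (by simp)
  refine hG.union (h := c - i) (by simpa using hcard) (fun P hP => ?_) (fun P hP => ?_)
    (by omega) (by omega) (fun S h0 h1 => ?_) (by simp) (Nat.le_add_right _ _)
  · rw [mem_singleton.1 hP]
    exact not_le_of_lt_minimal hC.1 hlt
  · rw [mem_singleton.1 hP]
    exact ⟨by omega, fun l hl => hCb.2 l (Multiset.mem_of_le hC.2.2 hl)⟩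
  · have h2 := hfirst.degree_lt h0 h1 (Or.inl (by omega))
    have h3 := hf S
    omega

theorem Node.petals (hθ : ∀ i, 1 ≤ θ i) {i : ℕ} (hG : Node θ k q G X Y) (hH : Heavy θ G c i H)
    (hfirst : NoHeavyBefore θ G c i) : Node θ k q (G ∪ petals G c H) X (Y + 1) := by
  have hi := hH.pos
  have hc := hH.lt
  have hcard := hH.card
  have hpet : ∀ P ∈ FineGrained.petals G c H, ∃ C ∈ minimals G, C.card = c ∧ H ≤ C ∧ P = C - H := by
    intro P hP
    obtain ⟨C, hC, rfl⟩ := mem_image.1 hP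
    rw [mem_filter] at hC
    exact ⟨C, hC.1, hC.2.1, hC.2.2, rfl⟩
  have hck : c ≤ k := by
    obtain ⟨C, hC⟩ := card_pos.1 ((hθ i).trans hH.le)
    rw [mem_filter] at hC
    have := (hG.1 C (mem_minimals.1 hC.1).1).1
    omega
  have hPcard : ∀ P ∈ FineGrained.petals G c H, P.card = i := by
    intro P hP
    obtain ⟨C, -, h1, h2, rfl⟩ := hpet P hP
    rw [Multiset.card_sub h2]
    omega
  refine hG.union (h := i) hPcard (fun P hP => ?_) (fun P hP => ?_)
    (by omega) (by omega) (fun S h0 h1 => ?_) (Nat.le_add_right _ _) ?_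
  · obtain ⟨C, hC, h1, h2, rfl⟩ := hpet P hP
    have h3 := hPcard _ hP
    exact not_le_of_lt_minimal hC
      (lt_of_le_of_ne (Multiset.sub_le_self _ _) fun h => by rw [h] at h3; omega)
  · refine ⟨by rw [hPcard P hP]; omega, fun l hl => ?_⟩
    obtain ⟨C, hC, h1, h2, rfl⟩ := hpet P hP
    exact (hG.1 C (mem_minimals.1 hC).1).2 l (Multiset.mem_of_le (Multiset.sub_le_self _ _) hl)
  · have h2 := hfirst.degree_lt h0 h1 (Or.inl (by omega))
    have h3 := card_petals_filter_le G c H S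
    have h4 : (H + S).card = c - i + S.card := by rw [Multiset.card_add, hcard]
    have h5 := hfirst.degree_lt (c' := c) (S := H + S) (by omega) (by omega)
      (Or.inr ⟨rfl, by omega⟩)
    grind
  · rw [card_petals, if_pos hH.le]

/-- The weight of a clause of size `i` in the analysis of the branching. -/
def sizeWeight (E i : ℕ) : ℕ := E ^ (2 * i - 1)

theorem Node.bounds {Z E : ℕ} (hZ : 1 ≤ Z)
    (hE : (2 * k + 2) * Z ≤ E) (hG : Node (fun i => Z * sizeWeight E i) k q G X Y) :
    X ≤ (∑ i ∈ range (k + 1), sizeWeight E i) * q ∧ Y * Z ≤ (k + 1) * q := by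
  obtain ⟨hb, a, y, ha, ha0, hd, hX, hy, hY⟩ := hG
  have hE1 : 1 ≤ E := by nlinarith
  have hw1 : ∀ i, 1 ≤ sizeWeight E i := fun i => Nat.one_le_pow _ _ hE1
  have key : ∀ i ≤ k, a i ≤ sizeWeight E i * q := by
    intro i
    induction i using Nat.strong_induction_on with
    | _ i ih =>
      intro hi
      rcases hd i with h0 | hd
      · rw [h0]; exact Nat.zero_le _
      rcases Nat.lt_or_ge i 2 with h2 | h2
      · rcases (by omega : i = 0 ∨ i = 1) with rfl | rfl
        · rw [ha0]; exact Nat.zero_le _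
        · have h1 := ha 1
          have h3 := minCount_le hb le_rfl fun l _ => degree_one_le G l
          have h4 : q ≤ sizeWeight E 1 * q := Nat.le_mul_of_pos_left _ (hw1 1)
          simp [ha0] at h1
          omega
      · obtain ⟨j, rfl⟩ : ∃ j, i = j + 2 := ⟨i - 2, by omega⟩
        have hm : minCount G (j + 2) ≤ q * (2 * (Z * E ^ (2 * j + 2))) := by
          refine (minCount_le hb (by omega) fun l _ => ?_).trans le_rfl
          have := hd {l} (by simp) (by simp)
          refine this.trans ?_
          simp only [Multiset.card_singleton, sizeWeight]
          gcongr
          omega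
        have hs : ∑ i ∈ range (j + 2), 2 * (Z * sizeWeight E (j + 2 - i)) * a i ≤
            ∑ i ∈ range (j + 2), q * (2 * (Z * E ^ (2 * j + 2))) := by
          refine sum_le_sum fun i hi' => ?_
          have hi' := mem_range.1 hi'
          rcases Nat.eq_zero_or_pos i with rfl | hpos
          · rw [ha0, mul_zero]; exact Nat.zero_le _
          · have h1 := ih i hi' (by omega)
            calc 2 * (Z * sizeWeight E (j + 2 - i)) * a i
                ≤ 2 * (Z * sizeWeight E (j + 2 - i)) * (sizeWeight E i * q) := by gcongr
              _ = q * (2 * (Z * (sizeWeight E (j + 2 - i) * sizeWeight E i))) := by ring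
              _ = q * (2 * (Z * E ^ (2 * j + 2))) := by
                unfold sizeWeight
                rw [← pow_add]
                congr 4
                omega
        rw [sum_const, card_range, smul_eq_mul] at hs
        have h3 : sizeWeight E (j + 2) = E * E ^ (2 * j + 2) := by
          unfold sizeWeight
          rw [← pow_succ']
          congr 1
        have h4 : (2 * (j + 2) + 2) * Z ≤ E := le_trans (Nat.mul_le_mul_right _ (by omega)) hE
        calc a (j + 2) ≤ _ := ha (j + 2)
          _ ≤ q * (2 * (Z * E ^ (2 * j + 2))) + (j + 2) * (q * (2 * (Z * E ^ (2 * j + 2)))) :=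
            Nat.add_le_add hm hs
          _ = ((2 * (j + 2) + 2) * Z) * E ^ (2 * j + 2) * q := by ring
          _ ≤ E * E ^ (2 * j + 2) * q := by gcongr
          _ = sizeWeight E (j + 2) * q := by rw [h3]
  have hyq : ∀ i ∈ range (k + 1), y i * Z ≤ q := by
    intro i hi
    have h1 := key i (by have := mem_range.1 hi; omega)
    have h2 := hy i
    have h3 : sizeWeight E i * (y i * Z) ≤ sizeWeight E i * q := by
      calc sizeWeight E i * (y i * Z) = y i * (Z * sizeWeight E i) := by ring
        _ ≤ _ := h2.trans h1
    exact Nat.le_of_mul_le_mul_left h3 (hw1 i)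
  constructor
  · refine hX.trans ?_
    rw [sum_mul]
    exact sum_le_sum fun i hi => key i (by have := mem_range.1 hi; omega)
  · refine (Nat.mul_le_mul_right _ hY).trans ?_
    rw [sum_mul]
    exact (sum_le_sum hyq).trans (by simp)

theorem exists_poly_le_two_pow (c d : ℕ) : ∃ s : ℕ, 1 ≤ s ∧ c * s ^ d ≤ 2 ^ s := by
  have h := tendsto_pow_const_div_const_pow_of_one_lt d (by norm_num : (1 : ℝ) < 2)
  have h1 : (0 : ℝ) < 1 / ((c : ℝ) + 1) := by positivity
  obtain ⟨s, hs, hs1⟩ := ((h.eventually_lt_const h1).and (eventually_ge_atTop 1)).exists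
  refine ⟨s, hs1, ?_⟩
  rw [div_lt_div_iff₀ (by positivity) (by positivity), one_mul] at hs
  have h2 : (s : ℝ) ^ d * c ≤ 2 ^ s := by
    have : (0 : ℝ) ≤ (s : ℝ) ^ d := by positivity
    nlinarith
  have h3 : (c : ℝ) * (s : ℝ) ^ d ≤ 2 ^ s := by linarith
  exact_mod_cast h3

/-- Thresholds for which the tree of branchings is small: there is a potential that exceeds the sum of
the potentials of the children of a node by at least one. -/
theorem exists_thresholds (k r : ℕ) (hr : 1 ≤ r) : ∃ θ : ℕ → ℕ, (∀ i, 1 ≤ θ i) ∧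
    ∀ q : ℕ, ∃ φ : ℕ → ℕ → ℝ, (∀ X Y, φ (X + 1) Y + φ X (Y + 1) + 1 ≤ φ X Y) ∧
      (∀ G X Y, Node θ k q G X Y → 1 ≤ φ X Y) ∧ φ 0 0 ≤ 2 * (2 : ℝ) ^ ((q : ℝ) / r) := by
  obtain ⟨s, hs1, hs⟩ := exists_poly_le_two_pow
    (8 * r * ((k + 1) * ((2 * k + 2) * (2 * r * (k + 1))) ^ (2 * k))) (2 * k)
  set Z := s * (2 * r * (k + 1)) with hZ
  set E := (2 * k + 2) * Z with hE
  set B := ∑ i ∈ range (k + 1), sizeWeight E i with hB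
  have hZ1 : 1 ≤ Z := Nat.mul_pos hs1 (by positivity)
  have hE1 : 1 ≤ E := Nat.mul_pos (by omega) hZ1
  have hBs : 8 * r * B ≤ 2 ^ s := by
    refine le_trans ?_ hs
    have h1 : B ≤ (k + 1) * E ^ (2 * k) := by
      have : ∀ i ∈ range (k + 1), sizeWeight E i ≤ E ^ (2 * k) := fun i hi =>
        Nat.pow_le_pow_right hE1 (by have := mem_range.1 hi; omega)
      exact (sum_le_sum this).trans (by simp)
    calc 8 * r * B ≤ 8 * r * ((k + 1) * E ^ (2 * k)) := by gcongr
      _ = _ := by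
        rw [hE, hZ, show (2 * k + 2) * (s * (2 * r * (k + 1))) =
          ((2 * k + 2) * (2 * r * (k + 1))) * s by ring, mul_pow]
        ring
  refine ⟨fun i => Z * sizeWeight E i, fun i => Nat.mul_pos hZ1 (Nat.one_le_pow _ _ hE1),
    fun q => ?_⟩
  set w : ℝ := 1 / 2 ^ s with hw
  have hw0 : 0 < w := by positivity
  have hw2 : w ≤ 1 / 2 := by
    rw [hw]
    refine one_div_le_one_div_of_le (by norm_num) ?_
    calc (2 : ℝ) = 2 ^ 1 := (pow_one _).symm
      _ ≤ 2 ^ s := pow_le_pow_right₀ (by norm_num) hs1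
  have hu0 : 0 < 1 - w := by linarith
  set y := (k + 1) * q / Z with hy
  refine ⟨fun X Y => 2 * (((1 - w) ^ X * w ^ Y) / ((1 - w) ^ (B * q) * w ^ y)) - 1,
    fun X Y => ?_, fun G X Y hG => ?_, ?_⟩
  · refine le_of_eq ?_
    field_simp
    ring
  · obtain ⟨hX, hY⟩ := hG.bounds hZ1 le_rfl
    have hY' : Y ≤ y := (Nat.le_div_iff_mul_le hZ1).2 hY
    have h1 : (1 - w) ^ (B * q) ≤ (1 - w) ^ X := pow_le_pow_of_le_one hu0.le (by linarith) hX
    have h2 : w ^ y ≤ w ^ Y := pow_le_pow_of_le_one hw0.le (by linarith) hY'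
    have h3 : 1 ≤ ((1 - w) ^ X * w ^ Y) / ((1 - w) ^ (B * q) * w ^ y) := by
      rw [one_le_div (by positivity)]
      gcongr
    dsimp only
    linarith
  · have h1 : (1 - w)⁻¹ ≤ Real.exp (2 * w) := by
      have h2 := Real.add_one_le_exp (2 * w)
      rw [inv_le_iff_one_le_mul₀ hu0]
      nlinarith
    have h2 : ((1 - w) ^ (B * q))⁻¹ ≤ (2 : ℝ) ^ ((q : ℝ) / (2 * r)) := by
      rw [← inv_pow]
      refine (pow_le_pow_left₀ (by positivity) h1 _).trans ?_
      rw [← Real.exp_nat_mul, Real.rpow_def_of_pos (by norm_num), Real.exp_le_exp]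
      have h3 : (8 * r * B : ℝ) ≤ 2 ^ s := mod_cast hBs
      have h4 : 8 * r * (B * w) ≤ 1 := by
        rw [hw, ← mul_div_assoc, ← mul_div_assoc, div_le_one (by positivity), mul_one]
        exact h3
      have h5 := Real.log_two_gt_d9
      have h6 : (0 : ℝ) < r := mod_cast hr
      have h7 : 2 * (B * w) ≤ 1 / 2 / (2 * r) := by
        rw [le_div_iff₀ (by positivity)]
        linarith
      push_cast
      have h8 : (1 : ℝ) / 2 / (2 * r) ≤ Real.log 2 / (2 * r) := by
        gcongr
        linarith
      calc (B : ℝ) * q * (2 * w) = q * (2 * (B * w)) := by ring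
        _ ≤ q * (Real.log 2 / (2 * r)) := by gcongr; linarith
        _ = _ := by ring
    have h3 : (w ^ y)⁻¹ ≤ (2 : ℝ) ^ ((q : ℝ) / (2 * r)) := by
      rw [hw, one_div, inv_pow, inv_inv, ← pow_mul, ← Real.rpow_natCast]
      refine Real.rpow_le_rpow_of_exponent_le (by norm_num) ?_
      have h4 : y * Z ≤ (k + 1) * q := Nat.div_mul_le_self _ _
      have h5 : s * y * (2 * r) * (k + 1) ≤ q * (k + 1) := by
        calc s * y * (2 * r) * (k + 1) = y * Z := by rw [hZ]; ring
          _ ≤ _ := h4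
          _ = _ := by ring
      have h6 := Nat.le_of_mul_le_mul_right h5 (by omega)
      have h7 : (0 : ℝ) < r := mod_cast hr
      rw [le_div_iff₀ (by positivity)]
      exact_mod_cast h6
    have h4 : (2 : ℝ) ^ ((q : ℝ) / r) =
        (2 : ℝ) ^ ((q : ℝ) / (2 * r)) * (2 : ℝ) ^ ((q : ℝ) / (2 * r)) := by
      rw [← Real.rpow_add (by norm_num)]
      congr 1
      have h7 : (0 : ℝ) < r := mod_cast hr
      field_simp
      norm_num
    dsimp only
    rw [pow_zero, pow_zero, one_mul, one_div, mul_inv, h4]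
    have h5 : ((1 - w) ^ (B * q))⁻¹ * (w ^ y)⁻¹ ≤
        (2 : ℝ) ^ ((q : ℝ) / (2 * r)) * (2 : ℝ) ^ ((q : ℝ) / (2 * r)) := by gcongr
    linarith

/-! ### Logical expressions -/

open Classical in
/-- The truth value of a proposition as an integer. -/
noncomputable def bit (p : Prop) : ℤ := if p then 1 else 0

theorem bit_pos {p : Prop} : 0 < bit p ↔ p := by unfold bit; split_ifs with h <;> simp [h]

theorem bit_and (p q : Prop) : bit p * bit q = bit (p ∧ q) := by unfold bit; grind

theorem bit_not (p : Prop) : 1 - bit p = bit (¬ p) := by unfold bit; by_cases hp : p <;> simp [hp]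

theorem bit_of_not {p : Prop} (h : ¬ p) : bit p = 0 := if_neg h

theorem bit_of_pos {p : Prop} (h : p) : bit p = 1 := if_pos h

theorem bit_congr {p q : Prop} (h : p ↔ q) : bit p = bit q := by rw [propext h]

theorem bit_nonneg (p : Prop) : 0 ≤ bit p := by unfold bit; split_ifs <;> simp

theorem bits_bit_le (p : Prop) : bits (bit p) ≤ 2 := by
  unfold bit; split_ifs
  · rw [bits_one]
  · rw [bits_zero]; norm_num

theorem bit_eq_ite (p : Prop) [Decidable p] : bit p = if p then 1 else 0 := by unfold bit; congr

theorem sum_bit (s : Finset ℕ) (p : ℕ → Prop) [DecidablePred p] :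
    ∑ v ∈ s, bit (p v) = ((s.filter p).card : ℤ) := by
  rw [← sum_boole]
  exact sum_congr rfl fun v _ => bit_eq_ite _

namespace XExpr

/-- In every environment that agrees with `ε` on the bound variables from `n` on, the value of the
expression is `z`. -/
def Is (σ : Memory) (n : ℕ) (e : XExpr) (ε : ℕ → ℤ) (z : ℤ) : Prop :=
  ∀ ε' : ℕ → ℤ, (∀ y, n ≤ y → ε' y = ε y) → e.eval σ ε' = z

/-- The truth value of `e ≤ f`. -/
def le (e f : XExpr) : XExpr := .ind (.sub (.add f (.const 1)) e)

/-- The negation of a truth value. -/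
def neg (e : XExpr) : XExpr := .sub (.const 1) e

/-- The truth value of `e = f`. -/
def eq (e f : XExpr) : XExpr := .mul (e.le f) (f.le e)

/-- Existential quantification over the numbers less than register `r`. -/
def ex (y r : ℕ) (e : XExpr) : XExpr := .ind (.sum y r e)

/-- Universal quantification over the numbers less than register `r`. -/
def all (y r : ℕ) (e : XExpr) : XExpr := .neg (.ex y r e.neg)

section Is

variable {σ : Memory} {n : ℕ} {e f : XExpr} {ε : ℕ → ℤ} {a c : ℤ}

theorem Is.eval_eq (h : Is σ n e ε a) : e.eval σ ε = a := h ε fun _ _ => rfl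

theorem Is.val_eq (h : Is σ n e (fun _ => σ.reg 0) a) : e.val σ = a := h.eval_eq

theorem Is.mono (h : Is σ n e ε a) (hm : m ≤ n) : Is σ m e ε a :=
  fun ε' h' => h ε' fun y hy => h' y (hm.trans hy)

theorem Is.bind (h : Is σ n e ε a) (hy : y < n) (z : ℤ) :
    Is σ n e (update ε y z) a :=
  fun ε' h' => h ε' fun x hx => by rw [h' x hx, update_of_ne (by omega)]

theorem Is.rebase (h : Is σ n e ε a) {ε' : ℕ → ℤ} (h' : ∀ y, n ≤ y → ε' y = ε y) :
    Is σ n e ε' a :=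
  fun ε'' h'' => h ε'' fun y hy => (h'' y hy).trans (h' y hy)

theorem Is.const (z : ℤ) : Is σ n (.const z) ε z := fun _ _ => rfl

theorem Is.var (h : σ.reg x = a) : Is σ n (.var x) ε a := fun _ _ => h

theorem Is.lv (y : ℕ) (z : ℤ) : Is σ y (.lv y) (update ε y z) z := fun ε' h => by
  rw [eval, h y le_rfl, update_self]

theorem Is.cell (h : Is σ n e ε a) (h' : σ.arr b a = c) : Is σ n (.cell b e) ε c :=
  fun ε' hε => by rw [eval, h ε' hε, h']

theorem Is.add (he : Is σ n e ε a) (hf : Is σ n f ε c) : Is σ n (.add e f) ε (a + c) :=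
  fun ε' h => by rw [eval, he ε' h, hf ε' h]

theorem Is.sub (he : Is σ n e ε a) (hf : Is σ n f ε c) : Is σ n (.sub e f) ε (a - c) :=
  fun ε' h => by rw [eval, he ε' h, hf ε' h]

theorem Is.mul (he : Is σ n e ε a) (hf : Is σ n f ε c) : Is σ n (.mul e f) ε (a * c) :=
  fun ε' h => by rw [eval, he ε' h, hf ε' h]

theorem Is.div (he : Is σ n e ε a) (hf : Is σ n f ε c) : Is σ n (.div e f) ε (a / c) :=
  fun ε' h => by rw [eval, he ε' h, hf ε' h]

theorem Is.congr (h : Is σ n e ε a) (h' : a = c) : Is σ n e ε c := h' ▸ h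

theorem Is.ind (he : Is σ n e ε a) : Is σ n (.ind e) ε (bit (0 < a)) :=
  fun ε' h => by
    rw [eval, he ε' h]
    unfold bit
    split_ifs <;> rfl

theorem Is.le (he : Is σ n e ε a) (hf : Is σ n f ε c) : Is σ n (e.le f) ε (bit (a ≤ c)) :=
  ((hf.add (.const 1)).sub he).ind.congr (bit_congr (by omega))

theorem Is.eq (he : Is σ n e ε a) (hf : Is σ n f ε c) : Is σ n (e.eq f) ε (bit (a = c)) :=
  ((he.le hf).mul (hf.le he)).congr ((bit_and _ _).trans (bit_congr le_antisymm_iff.symm))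

theorem Is.and {p q : Prop} (he : Is σ n e ε (bit p)) (hf : Is σ n f ε (bit q)) :
    Is σ n (.mul e f) ε (bit (p ∧ q)) :=
  (he.mul hf).congr (bit_and _ _)

theorem Is.neg {p : Prop} (he : Is σ n e ε (bit p)) : Is σ n e.neg ε (bit (¬ p)) :=
  ((Is.const 1).sub he).congr (bit_not _)

theorem Is.sum (hr : σ.reg r = N) {g : ℕ → ℤ}
    (h : ∀ v < N, Is σ y e (update ε y (v : ℤ)) (g v)) :
    Is σ (y + 1) (.sum y r e) ε (∑ v ∈ range N, g v) := fun ε' h' => by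
  rw [eval, hr, Int.toNat_natCast]
  refine sum_congr rfl fun v hv => h v (mem_range.1 hv) _ fun x hx => ?_
  grind

theorem Is.ex (hr : σ.reg r = N) {p : ℕ → Prop}
    (h : ∀ v < N, Is σ y e (update ε y (v : ℤ)) (bit (p v))) :
    Is σ (y + 1) (.ex y r e) ε (bit (∃ v < N, p v)) := by
  refine (Is.sum hr h).ind.congr (bit_congr ?_)
  constructor
  · intro h
    obtain ⟨v, hv, hp⟩ := exists_lt_of_sum_lt (s := range N) (f := fun _ => (0 : ℤ))
      (g := fun v => bit (p v)) (by simpa using h)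
    exact ⟨v, mem_range.1 hv, bit_pos.1 hp⟩
  · rintro ⟨v, hv, hp⟩
    exact sum_pos' (fun v _ => bit_nonneg _)
      ⟨v, mem_range.2 hv, bit_pos.2 hp⟩

theorem Is.all (hr : σ.reg r = N) {p : ℕ → Prop}
    (h : ∀ v < N, Is σ y e (update ε y (v : ℤ)) (bit (p v))) :
    Is σ (y + 1) (.all y r e) ε (bit (∀ v < N, p v)) :=
  (Is.ex hr fun v hv => (h v hv).neg).neg.congr (bit_congr (by push Not; rfl))

end Is

end XExpr

/-! ### Clauses as numbers -/

/-- The clause with code `z`: the digits of `z` to the base `b`, where the digit `l + 1` stands for the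
literal `l`. -/
def clause (b : ℕ) : ℕ → ℕ → Multiset ℕ
  | 0, _ => 0
  | k + 1, z => (if z % b = 0 then 0 else {z % b - 1}) + clause b k (z / b)

theorem lt_of_mem_clause {z l : ℕ} (h : l ∈ clause (q + 1) k z) : l < q := by
  induction k generalizing z with
  | zero => simp [clause] at h
  | succ k ih =>
    rw [clause, Multiset.mem_add] at h
    rcases h with h | h
    · have := Nat.mod_lt z (by omega : 0 < q + 1)
      split_ifs at h
      · simp at h
      · rw [Multiset.mem_singleton] at h
        omega
    · exact ih h

theorem exists_clause {C : Multiset ℕ} (hC : C.card ≤ k) (hq : ∀ l ∈ C, l < q) :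
    ∃ z < (q + 1) ^ k, clause (q + 1) k z = C := by
  induction k generalizing C with
  | zero => exact ⟨0, by simp, (Multiset.card_eq_zero.1 (by omega)).symm⟩
  | succ k ih =>
    have key : ∀ d < q + 1, ∀ C' : Multiset ℕ, C'.card ≤ k → (∀ l ∈ C', l < q) →
        ∃ z < (q + 1) ^ (k + 1),
          clause (q + 1) (k + 1) z = (if d = 0 then 0 else {d - 1}) + C' := by
      intro d hd C' h1 h2
      obtain ⟨z, hz, rfl⟩ := ih h1 h2
      refine ⟨(q + 1) * z + d, ?_, ?_⟩
      · rw [pow_succ]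
        nlinarith
      · rw [clause, Nat.mul_add_mod, Nat.mod_eq_of_lt hd, Nat.mul_add_div (by omega),
          Nat.div_eq_of_lt hd, add_zero]
    induction C using Multiset.induction_on with
    | empty =>
      obtain ⟨z, hz, h⟩ := key 0 (by omega) 0 (by simp) (by simp)
      exact ⟨z, hz, by simpa using h⟩
    | cons l C _ =>
      rw [Multiset.card_cons] at hC
      have hl := hq l (Multiset.mem_cons_self l C)
      obtain ⟨z, hz, h⟩ := key (l + 1) (by omega) C (by omega)
        fun l' h' => hq l' (Multiset.mem_cons_of_mem h')
      exact ⟨z, hz, by simpa using h⟩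

/-- A code is canonical if it is the least code of its clause. -/
def Canonical (b k z : ℕ) : Prop := ¬ ∃ z' < z, clause b k z' = clause b k z

theorem exists_canonical {C : Multiset ℕ} (hC : C.card ≤ k) (hq : ∀ l ∈ C, l < q) :
    ∃ z < (q + 1) ^ k, Canonical (q + 1) k z ∧ clause (q + 1) k z = C := by
  classical
  obtain ⟨z, hz, h⟩ := exists_clause hC hq
  have hex : ∃ z, clause (q + 1) k z = C := ⟨z, h⟩
  refine ⟨Nat.find hex, (Nat.find_min' hex h).trans_lt hz, ?_, Nat.find_spec hex⟩
  rintro ⟨z', hz', h'⟩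
  exact Nat.find_min hex hz' (h'.trans (Nat.find_spec hex))

theorem Canonical.eq {z z' : ℕ} (h : Canonical b k z) (h' : Canonical b k z')
    (he : clause b k z = clause b k z') : z = z' := by
  rcases lt_trichotomy z z' with hlt | heq | hlt
  · exact absurd ⟨z, hlt, he⟩ h'
  · exact heq
  · exact absurd ⟨z', hlt, he.symm⟩ h

/-- Counting clauses by their codes. -/
theorem sum_bit_canonical (hG : Bounded k q G) :
    ∑ z ∈ range ((q + 1) ^ k),
      bit (Canonical (q + 1) k z ∧ clause (q + 1) k z ∈ G) = (G.card : ℤ) := by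
  classical
  rw [sum_bit]
  norm_cast
  refine card_bij (fun z _ => clause (q + 1) k z) (fun z hz => ?_) (fun z hz z' hz' h => ?_)
    fun C hC => ?_
  · exact (mem_filter.1 hz).2.2
  · exact (mem_filter.1 hz).2.1.eq (mem_filter.1 hz').2.1 h
  · obtain ⟨z, hz, hc, rfl⟩ := exists_canonical (hG C hC).1 (hG C hC).2
    exact ⟨z, mem_filter.2 ⟨mem_range.2 hz, hc, hC⟩, rfl⟩

namespace XExpr

/-- The remainder modulo register `5`. -/
def mod (z : XExpr) : XExpr := .sub z (.mul (.var 5) (.div z (.var 5)))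

/-- The multiplicity of the literal `l` in the clause with code `z`. -/
def count (l : XExpr) : ℕ → XExpr → XExpr
  | 0, _ => .const 0
  | k + 1, z => .add (z.mod.eq (l.add (.const 1))) (count l k (.div z (.var 5)))

/-- The size of the clause with code `z`. -/
def size : ℕ → XExpr → XExpr
  | 0, _ => .const 0
  | k + 1, z => .add ((XExpr.const 1).le z.mod) (size k (.div z (.var 5)))

/-- Inclusion of clauses. -/
def sub_ (k : ℕ) (z w : XExpr) : XExpr :=
  .all 0 2 ((count (.lv 0) k z).le (count (.lv 0) k w))

/-- Equality of clauses. -/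
def same (k : ℕ) (z w : XExpr) : XExpr :=
  .all 0 2 ((count (.lv 0) k z).eq (count (.lv 0) k w))

/-- The third clause is the sum of two others. -/
def join (k : ℕ) (z h w : XExpr) : XExpr :=
  .all 0 2 (((count (.lv 0) k z).add (count (.lv 0) k h)).eq (count (.lv 0) k w))

/-- Membership in the family with index `i`. -/
def fam (i z : XExpr) : XExpr := .cell 1 (.add (.mul i (.var 3)) z)

/-- Membership in the minimal clauses of the family with index `i`. -/
def minimal (k : ℕ) (i z : XExpr) : XExpr :=
  .mul (fam i z) (.neg (.ex 1 3 (.mul (fam i (.lv 1))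
    (.mul (sub_ k (.lv 1) z) (.neg (sub_ k z (.lv 1)))))))

/-- Canonical codes. -/
def canonical (k : ℕ) (z : XExpr) : XExpr :=
  .neg (.ex 1 3 (.mul (((XExpr.lv 1).add (.const 1)).le z) (same k (.lv 1) z)))

/-- Canonical codes of minimal clauses. -/
def canonicalMin (k : ℕ) (i z : XExpr) : XExpr := .mul (canonical k z) (minimal k i z)

/-- The number of minimal clauses of size `c` that contain `h`. -/
def degreeX (k : ℕ) (i c h : XExpr) : XExpr :=
  .sum 2 3 (.mul (canonicalMin k i (.lv 2)) (.mul ((size k (.lv 2)).eq c) (sub_ k h (.lv 2))))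

/-- A finite table of constants. -/
def table (θ : ℕ → ℕ) (i : XExpr) : ℕ → XExpr
  | 0 => .const 0
  | n + 1 => .add (table θ i n) (.mul (.const (θ n)) (i.eq (.const n)))

/-- The first digit of the code `f` of a possible flower: the size of the clauses. -/
def flowerSize (k : ℕ) (f : XExpr) : XExpr := .div f (.mul (.const (k + 1)) (.var 3))

/-- The second digit of the code of a possible flower: the size of the petals. -/
def flowerPetal (k : ℕ) (f : XExpr) : XExpr :=
  .sub (.div f (.var 3)) (.mul (.const (k + 1)) (flowerSize k f))

/-- The last digit of the code of a possible flower: the code of the heart. -/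
def flowerHeart (f : XExpr) : XExpr := .sub f (.mul (.var 3) (.div f (.var 3)))

/-- The truth value of the existence of the flower with code `f`. -/
def heavy (θ : ℕ → ℕ) (k : ℕ) (i f : XExpr) : XExpr :=
  .mul (.mul ((XExpr.const 1).le (flowerPetal k f))
    ((((flowerPetal k f)).add (.const 1)).le (flowerSize k f)))
  (.mul ((size k (flowerHeart f)).eq (.sub (flowerSize k f) (flowerPetal k f)))
    ((table θ (flowerPetal k f) (k + 1)).le (degreeX k i (flowerSize k f) (flowerHeart f))))

/-- The code of the first flower. -/
def firstFlower (θ : ℕ → ℕ) (k : ℕ) (i : XExpr) : XExpr :=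
  .sum 4 4 (.neg (.ex 3 4 (.mul ((XExpr.lv 3).le (.lv 4)) (heavy θ k i (.lv 3)))))

/-- Registers `2` to `5` hold the number of literals, the number of codes of clauses, the number of
codes of flowers, and the base of the codes. -/
structure Tables (k q : ℕ) (σ : Memory) : Prop where
  literals : σ.reg 2 = q
  codes : σ.reg 3 = ((q + 1) ^ k : ℕ)
  flowers : σ.reg 4 = ((k + 1) * (k + 1) * (q + 1) ^ k : ℕ)
  base : σ.reg 5 = (q + 1 : ℕ)

/-- Array `1` holds a family of clauses with index `i`. -/
def HoldsFamily (k q : ℕ) (σ : Memory) (i : ℕ) (G : Finset (Multiset ℕ)) : Prop :=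
  ∀ z < (q + 1) ^ k, σ.arr 1 ((i * (q + 1) ^ k + z : ℕ) : ℤ) = bit (clause (q + 1) k z ∈ G)

section

variable {σ : Memory} {k q n : ℕ} {e f i : XExpr} {ε : ℕ → ℤ} {l z w h I : ℕ}
  {G : Finset (Multiset ℕ)} {θ : ℕ → ℕ}

theorem Is.mod (ht : Tables k q σ) (he : Is σ n e ε (z : ℕ)) :
    Is σ n e.mod ε ((z % (q + 1) : ℕ) : ℤ) := by
  refine (he.sub ((Is.var ht.base).mul (he.div (Is.var ht.base)))).congr ?_
  push_cast
  rw [Int.emod_def]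

theorem Is.divBase (ht : Tables k q σ) (he : Is σ n e ε (z : ℕ)) :
    Is σ n (.div e (.var 5)) ε ((z / (q + 1) : ℕ) : ℤ) := by
  refine (he.div (Is.var ht.base)).congr ?_
  push_cast
  rfl

theorem Is.count (ht : Tables k q σ) (he : Is σ n e ε (l : ℕ)) (j : ℕ)
    (hf : Is σ n f ε (z : ℕ)) :
    Is σ n (count e j f) ε (((clause (q + 1) j z).count l : ℕ) : ℤ) := by
  induction j generalizing f z with
  | zero => exact (Is.const 0).congr (by simp [clause])
  | succ j ih =>
    refine (((hf.mod ht).eq (he.add (.const 1))).add (ih (hf.divBase ht))).congr ?_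
    rw [clause, Multiset.count_add, Nat.cast_add, bit_eq_ite]
    congr 1
    by_cases h0 : z % (q + 1) = 0
    · rw [h0, if_pos rfl, if_neg (by push_cast; omega)]
      simp
    · rw [if_neg h0, Multiset.count_singleton]
      grind

theorem Is.size (ht : Tables k q σ) (j : ℕ) (hf : Is σ n f ε (z : ℕ)) :
    Is σ n (size j f) ε (((clause (q + 1) j z).card : ℕ) : ℤ) := by
  induction j generalizing f z with
  | zero => exact (Is.const 0).congr (by simp [clause])
  | succ j ih =>
    refine (((Is.const 1).le (hf.mod ht)).add (ih (hf.divBase ht))).congr ?_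
    rw [clause, Multiset.card_add, Nat.cast_add, bit_eq_ite]
    congr 1
    by_cases h0 : z % (q + 1) = 0
    · rw [h0]; simp
    · rw [if_neg h0, if_pos (mod_cast Nat.one_le_iff_ne_zero.2 h0)]
      simp

theorem clause_ext {C D : Multiset ℕ} (hC : ∀ l ∈ C, l < q) (hD : ∀ l ∈ D, l < q) :
    (∀ l < q, C.count l = D.count l) ↔ C = D := by
  refine ⟨fun h => Multiset.ext.2 fun l => ?_, fun h l _ => by rw [h]⟩
  by_cases hl : l < q
  · exact h l hl
  · rw [Multiset.count_eq_zero_of_notMem fun h => hl (hC l h),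
      Multiset.count_eq_zero_of_notMem fun h => hl (hD l h)]

theorem Is.bound {a : ℤ} (he : Is σ n e ε a) (hy : y < n) {ε' : ℕ → ℤ}
    (h' : ∀ x, n ≤ x → ε' x = ε x) (v : ℤ) : Is σ y e (update ε' y v) a :=
  ((he.rebase h').bind hy v).mono hy.le

theorem Is.sub_ (ht : Tables k q σ) (hn : 0 < n) (he : Is σ n e ε (z : ℕ))
    (hf : Is σ n f ε (w : ℕ)) :
    Is σ n (XExpr.sub_ k e f) ε (bit (clause (q + 1) k z ≤ clause (q + 1) k w)) := by
  intro ε' h'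
  refine (Is.all (N := q) ht.literals fun v _ =>
    (Is.count ht (Is.lv 0 (v : ℤ)) k (he.bound hn h' _)).le
      (Is.count ht (Is.lv 0 (v : ℤ)) k (hf.bound hn h' _))).eval_eq.trans (bit_congr ?_)
  rw [Multiset.le_iff_count]
  refine ⟨fun h l => ?_, fun h l _ => mod_cast h l⟩
  by_cases hl : l < q
  · exact_mod_cast h l hl
  · rw [Multiset.count_eq_zero_of_notMem fun h => hl (lt_of_mem_clause h)]
    exact Nat.zero_le _

theorem Is.same (ht : Tables k q σ) (hn : 0 < n) (he : Is σ n e ε (z : ℕ))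
    (hf : Is σ n f ε (w : ℕ)) :
    Is σ n (XExpr.same k e f) ε (bit (clause (q + 1) k z = clause (q + 1) k w)) := by
  intro ε' h'
  refine (Is.all (N := q) ht.literals fun v _ =>
    (Is.count ht (Is.lv 0 (v : ℤ)) k (he.bound hn h' _)).eq
      (Is.count ht (Is.lv 0 (v : ℤ)) k (hf.bound hn h' _))).eval_eq.trans (bit_congr ?_)
  rw [← clause_ext (fun l => lt_of_mem_clause) fun l => lt_of_mem_clause]
  norm_cast

theorem Is.join (ht : Tables k q σ) (hn : 0 < n) (he : Is σ n e ε (z : ℕ))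
    (hf : Is σ n f ε (h : ℕ)) {g : XExpr} (hg : Is σ n g ε (w : ℕ)) :
    Is σ n (XExpr.join k e f g) ε
      (bit (clause (q + 1) k z + clause (q + 1) k h = clause (q + 1) k w)) := by
  intro ε' h'
  refine (Is.all (N := q) ht.literals fun v _ =>
    ((Is.count ht (Is.lv 0 (v : ℤ)) k (he.bound hn h' _)).add
      (Is.count ht (Is.lv 0 (v : ℤ)) k (hf.bound hn h' _))).eq
      (Is.count ht (Is.lv 0 (v : ℤ)) k (hg.bound hn h' _))).eval_eq.trans (bit_congr ?_)
  rw [← clause_ext (q := q) (fun l hl => (Multiset.mem_add.1 hl).elim lt_of_mem_clause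
    lt_of_mem_clause) fun l => lt_of_mem_clause]
  simp only [Multiset.count_add]
  norm_cast

theorem Is.fam (ht : Tables k q σ) (hG : HoldsFamily k q σ I G) (hi : Is σ n i ε (I : ℕ))
    (he : Is σ n e ε (z : ℕ)) (hz : z < (q + 1) ^ k) :
    Is σ n (XExpr.fam i e) ε (bit (clause (q + 1) k z ∈ G)) :=
  Is.cell ((hi.mul (Is.var ht.codes)).add he) (by rw [← hG z hz]; push_cast; rfl)

theorem Is.minimal (ht : Tables k q σ) (hn : 1 < n) (hG : HoldsFamily k q σ I G)
    (hb : Bounded k q G) (hi : Is σ n i ε (I : ℕ))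
    (he : Is σ n e ε (z : ℕ)) (hz : z < (q + 1) ^ k) :
    Is σ n (XExpr.minimal k i e) ε (bit (clause (q + 1) k z ∈ minimals G)) := by
  refine ((hi.fam ht hG he hz).and (Is.neg (p := ∃ w < (q + 1) ^ k,
    clause (q + 1) k w ∈ G ∧ clause (q + 1) k w ≤ clause (q + 1) k z ∧
      ¬ clause (q + 1) k z ≤ clause (q + 1) k w) fun ε' h' => ?_)).congr (bit_congr ?_)
  · refine (Is.ex ht.codes fun v hv => ?_).eval_eq
    have hv1 : Is σ 1 (.lv 1) (update ε' 1 (v : ℤ)) (v : ℕ) := Is.lv 1 (v : ℤ)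
    exact ((hi.bound hn h' _).fam ht hG hv1 hv).and
      ((Is.sub_ ht one_pos hv1 (he.bound hn h' _)).and
        (Is.sub_ ht one_pos (he.bound hn h' _) hv1).neg)
  · rw [mem_minimals]
    refine and_congr_right fun _ => ⟨fun h D hD hle => ?_, ?_⟩
    · obtain ⟨w, hw, rfl⟩ := exists_clause (hb D hD).1 (hb D hD).2
      grind
    · grind

theorem Is.canonical (ht : Tables k q σ) (hn : 1 < n) (he : Is σ n e ε (z : ℕ))
    (hz : z < (q + 1) ^ k) :
    Is σ n (XExpr.canonical k e) ε (bit (Canonical (q + 1) k z)) := by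
  refine (Is.neg (p := ∃ w < (q + 1) ^ k, w + 1 ≤ z ∧
    clause (q + 1) k w = clause (q + 1) k z) fun ε' h' => ?_).congr (bit_congr ?_)
  · refine (Is.ex ht.codes fun v hv => ?_).eval_eq
    have hv1 : Is σ 1 (.lv 1) (update ε' 1 (v : ℤ)) (v : ℕ) := Is.lv 1 (v : ℤ)
    exact (((hv1.add (Is.const 1)).le (he.bound hn h' _)).congr
      (bit_congr (by norm_cast))).and (Is.same ht one_pos hv1 (he.bound hn h' _))
  · unfold Canonical
    grind

theorem Is.canonicalMin (ht : Tables k q σ) (hn : 1 < n) (hG : HoldsFamily k q σ I G)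
    (hb : Bounded k q G) (hi : Is σ n i ε (I : ℕ))
    (he : Is σ n e ε (z : ℕ)) (hz : z < (q + 1) ^ k) :
    Is σ n (XExpr.canonicalMin k i e) ε
      (bit (Canonical (q + 1) k z ∧ clause (q + 1) k z ∈ minimals G)) :=
  (Is.canonical ht hn he hz).and (Is.minimal ht hn hG hb hi he hz)

theorem Is.degree (ht : Tables k q σ) (hn : 2 < n) (hG : HoldsFamily k q σ I G)
    (hb : Bounded k q G) (hi : Is σ n i ε (I : ℕ)) (he : Is σ n e ε (c : ℕ))
    (hf : Is σ n f ε (h : ℕ)) :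
    Is σ n (degreeX k i e f) ε ((degree G c (clause (q + 1) k h) : ℕ) : ℤ) := by
  intro ε' h'
  refine (Is.sum ht.codes (g := fun v => bit (Canonical (q + 1) k v ∧ clause (q + 1) k v ∈
    (minimals G).filter fun C => C.card = c ∧ clause (q + 1) k h ≤ C))
      fun v hv => ?_).eval_eq.trans ?_
  · have hv1 : Is σ 2 (.lv 2) (update ε' 2 (v : ℤ)) (v : ℕ) := Is.lv 2 (v : ℤ)
    refine ((Is.canonicalMin ht (by omega) hG hb (hi.bound hn h' _) hv1 hv).and
      (((Is.size ht k hv1).eq (he.bound hn h' _)).and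
        (Is.sub_ ht (by omega) (hf.bound hn h' _) hv1))).congr (bit_congr ?_)
    rw [mem_filter]
    norm_cast
    tauto
  · exact sum_bit_canonical fun C hC => hb C (mem_minimals.1 (mem_filter.1 hC).1).1

theorem Is.table (hi : Is σ n i ε (I : ℕ)) (m : ℕ) :
    Is σ n (XExpr.table θ i m) ε ((if I < m then θ I else 0 : ℕ) : ℤ) := by
  induction m with
  | zero => exact (Is.const 0).congr (by simp)
  | succ m ih =>
    refine (ih.add ((Is.const (θ m : ℤ)).mul (hi.eq (Is.const (m : ℤ))))).congr ?_
    rw [bit_eq_ite]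
    grind

/-- The code of a possible flower. -/
def flowerCode (k q c i h : ℕ) : ℕ := (c * (k + 1) + i) * (q + 1) ^ k + h

theorem exists_flowerCode {f : ℕ} (hf : f < (k + 1) * (k + 1) * (q + 1) ^ k) :
    ∃ c ≤ k, ∃ i ≤ k, ∃ h < (q + 1) ^ k, f = flowerCode k q c i h := by
  have hP : 0 < (q + 1) ^ k := by positivity
  have h1 : f / (q + 1) ^ k < (k + 1) * (k + 1) := Nat.div_lt_of_lt_mul (by rwa [mul_comm])
  refine ⟨f / (q + 1) ^ k / (k + 1), ?_, f / (q + 1) ^ k % (k + 1), ?_, f % (q + 1) ^ k,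
    Nat.mod_lt _ hP, ?_⟩
  · have := Nat.div_lt_of_lt_mul h1; omega
  · have := Nat.mod_lt (f / (q + 1) ^ k) (by omega : 0 < k + 1); omega
  · unfold flowerCode
    rw [Nat.div_add_mod', Nat.div_add_mod']

theorem flowerCode_lt {i : ℕ} (hc : c ≤ k) (hi : i ≤ k) (hh : h < (q + 1) ^ k) :
    flowerCode k q c i h < (k + 1) * (k + 1) * (q + 1) ^ k := by
  unfold flowerCode
  have h1 : c * (k + 1) + i + 1 ≤ (k + 1) * (k + 1) := by nlinarith
  have := Nat.mul_le_mul_right ((q + 1) ^ k) h1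
  rw [add_mul, one_mul] at this
  omega

theorem flowerCode_lex {i c' i' h' : ℕ} (hi : i ≤ k) (hh : h < (q + 1) ^ k)
    (hlt : c < c' ∨ c = c' ∧ i < i') :
    flowerCode k q c i h < flowerCode k q c' i' h' := by
  unfold flowerCode
  have h1 : c * (k + 1) + i + 1 ≤ c' * (k + 1) + i' := by
    rcases hlt with h | ⟨rfl, h⟩
    · have : (c + 1) * (k + 1) ≤ c' * (k + 1) := Nat.mul_le_mul_right _ h
      nlinarith
    · omega
  have := Nat.mul_le_mul_right ((q + 1) ^ k) h1
  rw [add_mul, one_mul] at this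
  omega

variable {c j : ℕ}

theorem Is.flower (ht : Tables k q σ) (hj : j ≤ k)
    (hh : h < (q + 1) ^ k) (hf : Is σ n f ε (flowerCode k q c j h : ℕ)) :
    Is σ n (flowerSize k f) ε (c : ℕ) ∧ Is σ n (flowerPetal k f) ε (j : ℕ) ∧
      Is σ n (flowerHeart f) ε (h : ℕ) := by
  have hP : 0 < (q + 1) ^ k := by positivity
  have h1 : flowerCode k q c j h / (q + 1) ^ k = c * (k + 1) + j := by
    unfold flowerCode
    rw [mul_comm, Nat.mul_add_div hP, Nat.div_eq_of_lt hh, add_zero]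
  have h2 : flowerCode k q c j h / ((k + 1) * (q + 1) ^ k) = c := by
    rw [mul_comm (k + 1), ← Nat.div_div_eq_div_mul, h1, mul_comm,
      Nat.mul_add_div (Nat.succ_pos k), Nat.div_eq_of_lt (by omega), add_zero]
  have hsize : Is σ n (flowerSize k f) ε (c : ℕ) :=
    (hf.div ((Is.const _).mul (Is.var ht.codes))).congr (by grind)
  refine ⟨hsize, ?_, ?_⟩
  · refine ((hf.div (Is.var ht.codes)).sub ((Is.const _).mul hsize)).congr ?_
    grind
  · refine (hf.sub ((Is.var ht.codes).mul (hf.div (Is.var ht.codes)))).congr ?_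
    have : ((flowerCode k q c j h : ℕ) : ℤ) / (((q + 1) ^ k : ℕ) : ℤ) =
        ((c * (k + 1) + j : ℕ) : ℤ) := by rw [← h1]; push_cast; rfl
    rw [this]
    unfold flowerCode
    push_cast
    ring

theorem Is.heavy (ht : Tables k q σ) (hn : 2 < n) (hG : HoldsFamily k q σ I G)
    (hb : Bounded k q G) (hi : Is σ n i ε (I : ℕ)) (hj : j ≤ k)
    (hh : h < (q + 1) ^ k) (hf : Is σ n f ε (flowerCode k q c j h : ℕ)) :
    Is σ n (XExpr.heavy θ k i f) ε (bit (Heavy θ G c j (clause (q + 1) k h))) := by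
  obtain ⟨h1, h2, h3⟩ := hf.flower ht hj hh
  refine ((((Is.const 1).le h2).and ((h2.add (Is.const 1)).le h1)).and
    (((Is.size ht k h3).eq (h1.sub h2)).and
      ((Is.table h2 (k + 1)).le (Is.degree ht hn hG hb hi h1 h3)))).congr (bit_congr ?_)
  rw [if_pos (by omega)]
  constructor
  · rintro ⟨⟨h4, h5⟩, h6, h7⟩
    exact ⟨by omega, by omega, by omega, by omega⟩
  · rintro ⟨h4, h5, h6, h7⟩
    exact ⟨⟨by omega, by omega⟩, by omega, by omega⟩

/-- The first flower, or the number of codes of flowers if there is none. -/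
theorem Is.firstFlower (hθ : ∀ i, 1 ≤ θ i) (ht : Tables k q σ) (hn : 4 < n) (hG : HoldsFamily k q σ I G)
    (hb : Bounded k q G) (hi : Is σ n i ε (I : ℕ)) :
    ∃ F : ℕ, Is σ n (XExpr.firstFlower θ k i) ε (F : ℕ) ∧
      ((F = (k + 1) * (k + 1) * (q + 1) ^ k ∧ ∀ c i H, c ≤ k → ¬ Heavy θ G c i H) ∨
      ∃ c ≤ k, ∃ j ≤ k, ∃ h < (q + 1) ^ k, F = flowerCode k q c j h ∧
        F < (k + 1) * (k + 1) * (q + 1) ^ k ∧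
        Heavy θ G c j (clause (q + 1) k h) ∧ NoHeavyBefore θ G c j) := by
  classical
  set Q := (k + 1) * (k + 1) * (q + 1) ^ k with hQ
  let p : ℕ → Prop := fun f => ∃ c ≤ k, ∃ j ≤ k, ∃ h < (q + 1) ^ k, f = flowerCode k q c j h ∧
    Heavy θ G c j (clause (q + 1) k h)
  have hp : ∀ {c j H}, c ≤ k → Heavy θ G c j H → ∃ h < (q + 1) ^ k,
      clause (q + 1) k h = H ∧ p (flowerCode k q c j h) ∧ flowerCode k q c j h < Q := by
    intro c j H hc hH
    have hcard := hH.card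
    have hpos := hH.pos
    have hlt := hH.lt
    have hHq : ∀ l ∈ H, l < q := by
      intro l hl
      obtain ⟨C, hC⟩ := card_pos.1 ((hθ j).trans hH.le)
      rw [mem_filter] at hC
      exact (hb C (mem_minimals.1 hC.1).1).2 l (Multiset.mem_of_le hC.2.2 hl)
    obtain ⟨h, hh, rfl⟩ := exists_clause (k := k) (by omega : H.card ≤ k) hHq
    exact ⟨h, hh, rfl, ⟨c, hc, j, by omega, h, hh, rfl, hH⟩, flowerCode_lt hc (by omega) hh⟩
  have hval : Is σ n (XExpr.firstFlower θ k i) ε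
      ((((range Q).filter fun f => ¬ ∃ f' < Q, f' ≤ f ∧ p f').card : ℕ) : ℤ) := by
    intro ε' h'
    refine (Is.sum (N := Q) (g := fun f => bit (¬ ∃ f' < Q, f' ≤ f ∧ p f')) ht.flowers
      fun v hv => ?_).eval_eq.trans (sum_bit _ _)
    refine Is.neg (fun ε'' h'' => (Is.ex ht.flowers fun v' hv' => ?_).eval_eq)
    have h3 : Is σ 3 (.lv 3) (update ε'' 3 (v' : ℤ)) (v' : ℕ) := Is.lv 3 (v' : ℤ)
    have h4 : Is σ 3 (.lv 4) (update ε'' 3 (v' : ℤ)) (v : ℕ) :=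
      (Is.lv 4 (v : ℤ)).bound (by omega) h'' _
    have h5 : Is σ 3 i (update ε'' 3 (v' : ℤ)) (I : ℕ) :=
      (hi.bound hn h' _).bound (by omega) h'' _
    obtain ⟨c, hc, j, hj, h, hh, rfl⟩ := exists_flowerCode hv'
    refine ((h3.le h4).congr (bit_congr (by norm_cast))).and
      ((Is.heavy ht (by omega) hG hb h5 hj hh h3).congr (bit_congr ⟨fun hH => ?_, ?_⟩))
    · exact ⟨c, hc, j, hj, h, hh, rfl, hH⟩
    · rintro ⟨c', hc', j', hj', h', hh', he, hH⟩
      have h6 := flowerCode_lex (k := k) (q := q) (c := c) (i := j) (h := h) (c' := c') (i' := j')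
        (h' := h') hj hh
      have h7 := flowerCode_lex (k := k) (q := q) (c := c') (i := j') (h := h') (c' := c) (i' := j)
        (h' := h) hj' hh'
      obtain rfl : c = c' := by omega
      obtain rfl : j = j' := by omega
      obtain rfl : h = h' := by unfold flowerCode at he; omega
      exact hH
  refine ⟨_, hval, ?_⟩
  by_cases hex : ∃ f, f < Q ∧ p f
  · obtain ⟨hlt, hpf⟩ := Nat.find_spec hex
    set F := Nat.find hex with hF
    have hmin : ∀ f, f < Q → p f → F ≤ f := fun f h1 h2 => Nat.find_min' hex ⟨h1, h2⟩
    have hcard : ((range Q).filter fun f => ¬ ∃ f' < Q, f' ≤ f ∧ p f').card = F := by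
      have : ((range Q).filter fun f => ¬ ∃ f' < Q, f' ≤ f ∧ p f') = range F := by
        ext f
        rw [mem_filter, mem_range, mem_range]
        constructor
        · rintro ⟨h1, h2⟩
          by_contra h3
          exact h2 ⟨F, hlt, by omega, hpf⟩
        · grind
      rw [this, card_range]
    rw [hcard]
    right
    obtain ⟨c, hc, j, hj, h, hh, he, hH⟩ := hpf
    refine ⟨c, hc, j, hj, h, hh, he, hlt, hH, fun c' j' H' hlt' hH' => ?_⟩
    obtain ⟨h', hh', rfl, hp', hl'⟩ := hp (by omega : c' ≤ k) hH'
    have h1 := hmin _ hl' hp'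
    have h2 := flowerCode_lex (k := k) (q := q) (c := c') (i := j') (h := h') (c' := c) (i' := j)
        (h' := h) (by have := hH'.lt; omega) hh' hlt'
    omega
  · left
    constructor
    · rw [filter_true_of_mem, card_range]
      rintro f - ⟨f', h1, h2, h3⟩
      exact hex ⟨f', h1, h3⟩
    · intro c i H hc hH
      obtain ⟨h, -, -, h1, h2⟩ := hp hc hH
      exact hex ⟨_, h2, h1⟩

end

end XExpr

open XExpr

/-! ### Assignments as pairs of numbers -/

/-- The assignment given by the bits of two numbers: `j` determines the variables less than `v₀`, and
`e` the others. The literal `2 v + 1` is the variable `v`, and the literal `2 v` its negation. -/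
def LitTrue (v₀ j e l : ℕ) : Prop :=
  if l / 2 < v₀ then j / 2 ^ (l / 2) % 2 = l % 2 else e / 2 ^ (l / 2 - v₀) % 2 = l % 2

/-- The rank of a code among the canonical codes of minimal clauses. -/
noncomputable def rank (b k : ℕ) (G : Finset (Multiset ℕ)) (z : ℕ) : ℕ := by
  classical
  exact ((range z).filter fun w => Canonical b k w ∧ clause b k w ∈ minimals G).card

/-- The minimal clause with rank `t` exists, and none of its literals satisfies `T`. -/
def ClauseFails (b k : ℕ) (G : Finset (Multiset ℕ)) (T : ℕ → Prop) (t : ℕ) : Prop :=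
  ∃ z < b ^ k, (Canonical b k z ∧ clause b k z ∈ minimals G) ∧ rank b k G z = t ∧
    ¬ ∃ l ∈ clause b k z, T l

theorem rank_lt_rank {z z' : ℕ} (hlt : z < z')
    (hz : Canonical b k z ∧ clause b k z ∈ minimals G) : rank b k G z < rank b k G z' := by
  classical
  unfold rank
  refine card_lt_card (ssubset_iff.2 ⟨z, by simp, fun w hw => ?_⟩)
  grind

theorem rank_lt_card {z : ℕ} (hz : Canonical (q + 1) k z ∧ clause (q + 1) k z ∈ minimals G) :
    rank (q + 1) k G z < (minimals G).card := by
  classical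
  unfold rank
  calc _ < ((range (z + 1)).filter fun w =>
        Canonical (q + 1) k w ∧ clause (q + 1) k w ∈ minimals G).card := by
        have := rank_lt_rank (Nat.lt_succ_self z) hz
        unfold rank at this
        convert this
    _ ≤ (minimals G).card := by
        refine card_le_card_of_injOn (clause (q + 1) k) (fun w hw => ?_)
          fun w hw w' hw' h => ?_
        · exact (mem_filter.1 hw).2.2
        · exact (mem_filter.1 hw).2.1.eq (mem_filter.1 hw').2.1 h

/-- Satisfaction in terms of pairs of orthogonal vectors. -/
theorem satisfies_iff_not_clauseFails (hb : Bounded k q G)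
    (hD : (minimals G).card ≤ D) {T T₁ T₂ : ℕ → Prop} (hT : ∀ l, T l ↔ T₁ l ∨ T₂ l) :
    Satisfies T G ↔ ∀ t < D,
      ¬ (ClauseFails (q + 1) k G T₁ t ∧ ClauseFails (q + 1) k G T₂ t) := by
  rw [← satisfies_minimals]
  constructor
  · rintro h t - ⟨⟨z, hz, hzm, hr, hf⟩, ⟨z', hz', hzm', hr', hf'⟩⟩
    obtain rfl : z = z' := by
      rcases lt_trichotomy z z' with hlt | heq | hlt
      · have := rank_lt_rank hlt hzm; omega
      · exact heq
      · have := rank_lt_rank hlt hzm'; omega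
    obtain ⟨l, hl, hx⟩ := h _ hzm.2
    grind
  · intro h C hC
    have hC' := hb C (mem_minimals.1 hC).1
    obtain ⟨z, hz, hzc, rfl⟩ := exists_canonical hC'.1 hC'.2
    by_contra hno
    refine h _ ((rank_lt_card ⟨hzc, hC⟩).trans_le hD)
      ⟨⟨z, hz, ⟨hzc, hC⟩, rfl, ?_⟩, ⟨z, hz, ⟨hzc, hC⟩, rfl, ?_⟩⟩
    · grind
    grind

namespace XExpr

/-- The bit with number `v` of `j`. -/
def bitX (j v : XExpr) : XExpr :=
  .sub (.div j (.cell 2 v)) (.mul (.const 2) (.div (.div j (.cell 2 v)) (.const 2)))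

/-- The variable of a literal. -/
def variable_ (l : XExpr) : XExpr := .div l (.const 2)

/-- The sign of a literal. -/
def sign (l : XExpr) : XExpr := .sub l (.mul (.const 2) (.div l (.const 2)))

/-- The literal is true for the left half of the assignment. -/
def litLeft (j l : XExpr) : XExpr :=
  .mul (((variable_ l).add (.const 1)).le (.var 17)) ((bitX j (variable_ l)).eq (sign l))

/-- The literal is true for the right half of the assignment. -/
def litRight (e l : XExpr) : XExpr :=
  .mul ((XExpr.var 17).le (variable_ l)) ((bitX e (.sub (variable_ l) (.var 17))).eq (sign l))

/-- Some literal of the clause is true. -/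
def someTrue (T : XExpr → XExpr) : ℕ → XExpr → XExpr
  | 0, _ => .const 0
  | k + 1, z => .ind (.add (.mul ((XExpr.const 1).le z.mod) (T (.sub z.mod (.const 1))))
      (someTrue T k (.div z (.var 5))))

/-- The minimal clause with rank `t - 1` has no true literal. -/
def clauseFails (T : XExpr → XExpr) (k : ℕ) (i t : XExpr) : XExpr :=
  .ex 3 3 (.mul (canonicalMin k i (.lv 3))
    (.mul ((XExpr.add (.sum 2 3 (.mul (((XExpr.lv 2).add (.const 1)).le (.lv 3))
      (canonicalMin k i (.lv 2)))) (.const 1)).eq t) (someTrue T k (.lv 3)).neg))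

section

variable {σ : Memory} {k q n v₀ : ℕ} {e f i : XExpr} {ε : ℕ → ℤ} {l z j I : ℕ}
  {G : Finset (Multiset ℕ)}

theorem Is.someTrue (ht : Tables k q σ) {T : XExpr → XExpr} {p : ℕ → Prop}
    (hT : ∀ {f : XExpr} {l : ℕ}, l < q → Is σ n f ε (l : ℕ) → Is σ n (T f) ε (bit (p l)))
    (hT' : ∀ {f : XExpr} {a : ℤ}, Is σ n f ε a → ∃ c, Is σ n (T f) ε c)
    (m : ℕ) (hf : Is σ n f ε (z : ℕ)) :
    Is σ n (XExpr.someTrue T m f) ε (bit (∃ l ∈ clause (q + 1) m z, p l)) := by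
  induction m generalizing f z with
  | zero => exact (Is.const 0).congr (by simp [clause, bit])
  | succ m ih =>
    have h1 := hf.mod ht
    have h2 := ih (hf.divBase ht)
    have hlt := Nat.mod_lt z (by omega : 0 < q + 1)
    by_cases h0 : z % (q + 1) = 0
    · obtain ⟨c, hc⟩ := hT' (h1.sub (Is.const 1))
      refine ((((Is.const 1).le h1).mul hc).add h2).ind.congr (bit_congr ?_)
      rw [clause, h0]
      simp only [Nat.cast_zero, if_true, zero_add]
      rw [show bit ((1 : ℤ) ≤ 0) = 0 by simp [bit], zero_mul, zero_add, bit_pos]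
    · have h3 : Is σ n (T (.sub f.mod (.const 1))) ε (bit (p (z % (q + 1) - 1))) :=
        hT (by omega) ((h1.sub (Is.const 1)).congr (by omega))
      refine ((((Is.const 1).le h1).mul h3).add h2).ind.congr (bit_congr ?_)
      rw [clause, if_neg h0, show bit ((1 : ℤ) ≤ ((z % (q + 1) : ℕ) : ℤ)) = 1 by
        unfold bit; rw [if_pos (by omega)], one_mul]
      simp only [Multiset.mem_add, Multiset.mem_singleton, or_and_right, exists_or, exists_eq_left]
      have h4 := bit_nonneg (p (z % (q + 1) - 1))
      have h5 := bit_nonneg (∃ l ∈ clause (q + 1) m (z / (q + 1)), p l)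
      have h6 : 0 < bit (p (z % (q + 1) - 1)) + bit (∃ l ∈ clause (q + 1) m (z / (q + 1)), p l) ↔
          0 < bit (p (z % (q + 1) - 1)) ∨
            0 < bit (∃ l ∈ clause (q + 1) m (z / (q + 1)), p l) := by omega
      rw [h6, bit_pos, bit_pos]

theorem Is.variable_ (h : Is σ n f ε (l : ℕ)) : Is σ n (XExpr.variable_ f) ε ((l / 2 : ℕ) : ℤ) :=
  (h.div (Is.const 2)).congr (by push_cast; rfl)

theorem Is.sign (h : Is σ n f ε (l : ℕ)) : Is σ n (XExpr.sign f) ε ((l % 2 : ℕ) : ℤ) :=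
  (h.sub ((Is.const 2).mul (h.div (Is.const 2)))).congr (by omega)

theorem Is.bitX (he : Is σ n e ε (j : ℕ)) (hf : Is σ n f ε (v : ℕ))
    (hv : σ.arr 2 v = 2 ^ v) : Is σ n (XExpr.bitX e f) ε ((j / 2 ^ v % 2 : ℕ) : ℤ) := by
  have h1 : Is σ n (.div e (.cell 2 f)) ε ((j / 2 ^ v : ℕ) : ℤ) :=
    (he.div (Is.cell hf hv)).congr (by push_cast; rfl)
  exact (h1.sub ((Is.const 2).mul (h1.div (Is.const 2)))).congr (by omega)

theorem Is.exists_bitX {a c : ℤ} (he : Is σ n e ε a) (hf : Is σ n f ε c) :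
    ∃ c, Is σ n (XExpr.bitX e f) ε c :=
  ⟨_, (he.div (Is.cell hf rfl)).sub
    ((Is.const 2).mul ((he.div (Is.cell hf rfl)).div (Is.const 2)))⟩

theorem Is.litLeft (hv₀ : σ.reg 17 = v₀) (hpow : ∀ v : ℕ, v < v₀ → σ.arr 2 v = 2 ^ v)
    (he : Is σ n e ε (j : ℕ)) (hf : Is σ n f ε (l : ℕ)) :
    Is σ n (XExpr.litLeft e f) ε (bit (l / 2 < v₀ ∧ j / 2 ^ (l / 2) % 2 = l % 2)) := by
  by_cases hlt : l / 2 < v₀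
  · exact (((hf.variable_.add (Is.const 1)).le (Is.var hv₀)).and
      ((he.bitX hf.variable_ (hpow _ hlt)).eq hf.sign)).congr (bit_congr (by norm_cast))
  · obtain ⟨c, hc⟩ := he.exists_bitX hf.variable_
    refine (((hf.variable_.add (Is.const 1)).le (Is.var hv₀)).and (hc.eq hf.sign)).congr
      (bit_congr ?_)
    omega

theorem Is.litRight (hv₀ : σ.reg 17 = v₀) (hpow : ∀ v : ℕ, v < N → σ.arr 2 v = 2 ^ v)
    (he : Is σ n e ε (j : ℕ)) (hl : l < 2 * N) (hf : Is σ n f ε (l : ℕ)) :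
    Is σ n (XExpr.litRight e f) ε
      (bit (v₀ ≤ l / 2 ∧ j / 2 ^ (l / 2 - v₀) % 2 = l % 2)) := by
  by_cases hlt : v₀ ≤ l / 2
  · have h1 : Is σ n (.sub (XExpr.variable_ f) (.var 17)) ε ((l / 2 - v₀ : ℕ) : ℤ) :=
      (hf.variable_.sub (Is.var hv₀)).congr (by omega)
    exact (((Is.var hv₀).le hf.variable_).and
      ((he.bitX h1 (hpow _ (by omega))).eq hf.sign)).congr (bit_congr (by norm_cast))
  · obtain ⟨c, hc⟩ := he.exists_bitX (hf.variable_.sub (Is.var hv₀))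
    refine (((Is.var hv₀).le hf.variable_).and (hc.eq hf.sign)).congr (bit_congr ?_)
    omega

theorem Is.clauseFails (ht : Tables k q σ) (hn : 3 < n) (hG : HoldsFamily k q σ I G)
    (hb : Bounded k q G) {T : XExpr → XExpr} {p : ℕ → Prop}
    (hT : ∀ {ε' : ℕ → ℤ} {f : XExpr} {l : ℕ}, (∀ y, n ≤ y → ε' y = ε y) → l < q →
      Is σ 3 f ε' (l : ℕ) → Is σ 3 (T f) ε' (bit (p l)))
    (hT' : ∀ {ε' : ℕ → ℤ} {f : XExpr} {a : ℤ}, (∀ y, n ≤ y → ε' y = ε y) →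
      Is σ 3 f ε' a → ∃ c, Is σ 3 (T f) ε' c)
    (hi : Is σ n i ε (I : ℕ)) {t : ℤ} (hf : Is σ n f ε t) :
    Is σ n (XExpr.clauseFails T k i f) ε (bit (∃ z < (q + 1) ^ k,
      (Canonical (q + 1) k z ∧ clause (q + 1) k z ∈ minimals G) ∧
        (rank (q + 1) k G z : ℤ) + 1 = t ∧ ¬ ∃ l ∈ clause (q + 1) k z, p l)) := by
  classical
  intro ε' h'
  refine (Is.ex ht.codes fun v hv => ?_).eval_eq
  have h3 : Is σ 3 (.lv 3) (update ε' 3 (v : ℤ)) (v : ℕ) := Is.lv 3 (v : ℤ)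
  have hagree : ∀ y, n ≤ y → update ε' 3 (v : ℤ) y = ε y := fun y hy => by
    rw [update_of_ne (by omega), h' y hy]
  have hrank : Is σ 3 (.sum 2 3 (.mul (((XExpr.lv 2).add (.const 1)).le (.lv 3))
      (XExpr.canonicalMin k i (.lv 2)))) (update ε' 3 (v : ℤ))
      ((rank (q + 1) k G v : ℕ) : ℤ) := by
    refine (Is.sum ht.codes (g := fun w => bit (w + 1 ≤ v ∧
      (Canonical (q + 1) k w ∧ clause (q + 1) k w ∈ minimals G))) fun w hw => ?_).congr ?_
    · have h2 : Is σ 2 (.lv 2) (update (update ε' 3 (v : ℤ)) 2 (w : ℤ))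
        (w : ℕ) := Is.lv 2 (w : ℤ)
      exact (((h2.add (Is.const 1)).le (h3.bound (by omega) (fun _ _ => rfl) _)).congr
        (bit_congr (by norm_cast))).and (Is.canonicalMin ht (by omega) hG hb
          ((hi.bound hn h' _).bound (by omega) (fun _ _ => rfl) _) h2 hw)
    · rw [sum_bit]
      unfold rank
      congr 2
      grind
  exact (Is.canonicalMin ht (by omega) hG hb (hi.bound hn h' _) h3 hv).and
    (((hrank.add (Is.const 1)).eq (hf.bound hn h' _)).and
      (Is.someTrue ht (hT hagree) (hT' hagree) k h3).neg)

end

end XExpr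

/-! ### The instance that searches for orthogonal pairs -/

/-- The entries of the lower-layer weights and of the examples: a leading entry and `D` entries given
by truth values. -/
noncomputable def entry (z c : ℤ) (D : ℕ) (p : ℕ → Prop) (k : ℕ) : ℤ :=
  if k = 0 then z else if k ≤ D then c * bit (p (k - 1)) else 0

/-- Unit `j` and example `i` interact if `V i` holds and there is no `t < D` with `A i t` and
`B j t`. -/
noncomputable def searchInstance (n m d D : ℕ) (V : ℕ → Prop) (A B : ℕ → ℕ → Prop) :
    Instance n m d where
  α _ := 0
  b j k := entry 1 (-2) D (B j) k
  a i k := entry (bit (V i)) 1 D (A i) k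
  y _ := 1
  label _ := Or.inl rfl

theorem sum_entry_mul (hD : D < d) (V : Prop) (A B : ℕ → Prop) :
    ∑ k : Fin d, entry (bit V) 1 D A k * entry 1 (-2) D B k =
      bit V - 2 * ∑ t ∈ range D, bit (A t ∧ B t) := by
  rw [Fin.sum_univ_eq_sum_range (fun k => entry (bit V) 1 D A k * entry 1 (-2) D B k) d]
  rw [← sum_subset (range_subset_range.2 hD) fun k _ hk => ?_]
  · rw [sum_range_succ', mul_sum, sub_eq_add_neg, ← sum_neg_distrib, add_comm]
    congr 1
    · simp [entry]
    · refine sum_congr rfl fun t ht => ?_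
      have := mem_range.1 ht
      simp only [entry, Nat.succ_ne_zero, if_false, if_pos (by omega : t + 1 ≤ D),
        Nat.add_sub_cancel]
      rw [← bit_and]
      ring
  · have h1 : ¬ k ≤ D := fun h => hk (mem_range.2 (by omega))
    have h2 : k ≠ 0 := by omega
    simp [entry, h1, h2]

theorem unitOut_searchInstance (hD : D < d) (V : ℕ → Prop) (A B : ℕ → ℕ → Prop)
    (i : Fin m) (j : Fin n) : (searchInstance n m d D V A B).unitOut i j =
      (bit (V i ∧ ∀ t < D, ¬ (A i t ∧ B j t)) : ℤ) := by
  have h1 := sum_entry_mul hD (V i) (A i) (B j)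
  have h2 : (∑ k : Fin d, ((searchInstance n m d D V A B).a i k : ℝ) *
      ((searchInstance n m d D V A B).b j k : ℝ)) =
      ((bit (V i) - 2 * ∑ t ∈ range D, bit (A i t ∧ B j t) : ℤ) : ℝ) := by
    rw [← h1]
    push_cast
    rfl
  unfold Instance.unitOut relu
  rw [h2]
  by_cases hex : ∃ t < D, A i t ∧ B j t
  · obtain ⟨t, ht, hAB⟩ := hex
    have h3 : (1 : ℤ) ≤ ∑ t ∈ range D, bit (A i t ∧ B j t) := by
      have := single_le_sum (f := fun t => bit (A i t ∧ B j t)) (fun t _ => bit_nonneg _)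
        (mem_range.2 ht)
      have h4 := bit_pos.2 hAB
      omega
    have h5 : bit (V i) ≤ 1 := by unfold bit; split_ifs <;> norm_num
    have h6 : bit (V i) - 2 * ∑ t ∈ range D, bit (A i t ∧ B j t) ≤ 0 := by omega
    rw [max_eq_left (mod_cast h6)]
    have h7 : ¬ (V i ∧ ∀ t < D, ¬ (A i t ∧ B j t)) := fun h => h.2 t ht hAB
    rw [bit_of_not h7]; simp
  · have h3 : ∑ t ∈ range D, bit (A i t ∧ B j t) = 0 :=
      sum_eq_zero fun t ht => by
        have : ¬ (A i t ∧ B j t) := fun h => hex ⟨t, mem_range.1 ht, h⟩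
        rw [bit_of_not this]
    rw [h3, mul_zero, sub_zero, max_eq_right (mod_cast bit_nonneg _)]
    congr 1
    refine bit_congr ⟨fun h => ⟨h, fun t ht hAB => hex ⟨t, ht, hAB⟩⟩, fun h => h.1⟩

theorem entriesLE_searchInstance (hK : 2 ≤ K) (V : ℕ → Prop)
    (A B : ℕ → ℕ → Prop) : (searchInstance n m d D V A B).EntriesLE K := by
  have h1 : (2 : ℤ) ≤ K := mod_cast hK
  have h2 : ∀ p : Prop, bit p = 0 ∨ bit p = 1 := fun p => by unfold bit; split_ifs <;> simp
  refine ⟨fun j => ?_, fun j k => ?_, fun i k => ?_⟩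
  · simp [searchInstance]
  · simp only [searchInstance, entry]
    grind
  · simp only [searchInstance, entry]
    grind

/-- An approximate gradient shows which units interact with some example. -/
theorem exists_gradient_searchInstance {c : ℝ} (hl : HasDerivAt l c 0)
    (hc : c < -(1 / 2)) (hD : D < d) (V : ℕ → Prop) (A B : ℕ → ℕ → Prop) :
    ∃ g : EuclideanSpace ℝ (Fin n), (searchInstance n m d D V A B).IsGradient l g ∧
      ∀ (s : Memory) (δ : ℝ), δ ≤ 1 / 4 → HoldsApprox s g δ → ∀ j < n,
        (0 < 16 * (s.arr 4 (j : ℤ) * s.arr 4 (j : ℤ)) - s.arr 5 (j : ℤ) * s.arr 5 (j : ℤ) ↔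
          ∃ i < m, V i ∧ ∀ t < D, ¬ (A i t ∧ B j t)) := by
  refine ⟨_, Instance.isGradient_of_weights_eq_zero hl _ fun j => rfl, fun s δ hδ hs j hj => ?_⟩
  obtain ⟨hden, happ⟩ := hs ⟨j, hj⟩
  have hden' : (0 : ℝ) < (s.arr 5 (j : ℤ) : ℝ) := mod_cast hden
  set x : ℝ := (s.arr 4 (j : ℤ) : ℝ) / (s.arr 5 (j : ℤ) : ℝ) with hx
  have hkey : (0 < 16 * (s.arr 4 (j : ℤ) * s.arr 4 (j : ℤ)) - s.arr 5 (j : ℤ) * s.arr 5 (j : ℤ)) ↔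
      1 / 4 < |x| := by
    have h1 : (s.arr 4 (j : ℤ) : ℝ) = x * (s.arr 5 (j : ℤ) : ℝ) := by
      rw [hx, div_mul_cancel₀ _ hden'.ne']
    have h2 : (0 < 16 * (s.arr 4 (j : ℤ) * s.arr 4 (j : ℤ)) -
        s.arr 5 (j : ℤ) * s.arr 5 (j : ℤ)) ↔ (0 : ℝ) < (16 * x ^ 2 - 1) * (s.arr 5 (j : ℤ)) ^ 2 := by
      rw [← Int.cast_pos (R := ℝ)]
      push_cast
      rw [h1]
      ring_nf
    rw [h2, mul_pos_iff_of_pos_right (by positivity), ← abs_of_pos (by norm_num : (0 : ℝ) < 1 / 4),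
      ← sq_lt_sq]
    constructor <;> intro h <;> linarith
  rw [hkey]
  have hsum : (∑ i : Fin m, c * (((searchInstance n m d D V A B).y i : ℝ) *
      (searchInstance n m d D V A B).unitOut i ⟨j, hj⟩)) =
      c * ((∑ i ∈ range m, bit (V i ∧ ∀ t < D, ¬ (A i t ∧ B j t)) : ℤ) : ℝ) := by
    rw [← mul_sum, ← Fin.sum_univ_eq_sum_range
      (fun i => bit (V i ∧ ∀ t < D, ¬ (A i t ∧ B j t))) m]
    push_cast
    congr 1
    refine sum_congr rfl fun i _ => ?_
    rw [unitOut_searchInstance hD]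
    simp [searchInstance]
  rw [PiLp.toLp_apply, hsum, abs_le] at happ
  constructor
  · intro h
    by_contra hno
    have h0 : ∑ i ∈ range m, bit (V i ∧ ∀ t < D, ¬ (A i t ∧ B j t)) = 0 := by
      refine sum_eq_zero fun i hi => ?_
      have : ¬ (V i ∧ ∀ t < D, ¬ (A i t ∧ B j t)) := fun h => hno ⟨i, mem_range.1 hi, h⟩
      exact bit_of_not this
    rw [h0, Int.cast_zero, mul_zero, sub_zero] at happ
    grind
  · rintro ⟨i, hi, h⟩
    have h1 : (1 : ℤ) ≤ ∑ i ∈ range m, bit (V i ∧ ∀ t < D, ¬ (A i t ∧ B j t)) := by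
      have := single_le_sum (f := fun i => bit (V i ∧ ∀ t < D, ¬ (A i t ∧ B j t)))
        (fun t _ => bit_nonneg _) (mem_range.2 hi)
      have h4 := bit_pos.2 h
      omega
    have h2 : (1 : ℝ) ≤ ((∑ i ∈ range m, bit (V i ∧ ∀ t < D, ¬ (A i t ∧ B j t)) : ℤ) : ℝ) := by
      exact_mod_cast h1
    rw [lt_abs]
    right
    nlinarith [happ.2]

/-! ### Writing to the simulated memory -/

theorem XExpr.eval_congr (he : e.WF)
    (hr : ∀ x < scratch, σ'.reg x = σ.reg x) (ha : ∀ a < ownArrays, σ'.arr a = σ.arr a)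
    (ε : ℕ → ℤ) : e.eval σ' ε = e.eval σ ε := by
  induction e generalizing ε with
  | const c => rfl
  | var x => exact hr x he
  | lv y => rfl
  | cell a i ih => rw [XExpr.eval, XExpr.eval, ih he.2, ha a he.1]
  | add e f h1 h2 => rw [XExpr.eval, XExpr.eval, h1 he.1, h2 he.2]
  | sub e f h1 h2 => rw [XExpr.eval, XExpr.eval, h1 he.1, h2 he.2]
  | mul e f h1 h2 => rw [XExpr.eval, XExpr.eval, h1 he.1, h2 he.2]
  | div e f h1 h2 => rw [XExpr.eval, XExpr.eval, h1 he.1, h2 he.2]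
  | ind e h => rw [XExpr.eval, XExpr.eval, h he]
  | sum y r e h =>
    rw [XExpr.eval, XExpr.eval, hr r (he.1.trans boundRegs_lt)]
    exact sum_congr rfl fun v _ => h he.2 _

theorem XExpr.val_setArr (he : e.WF) (ha : ownArrays ≤ a)
    (A : ℤ → ℤ) : e.val (σ.setArr a A) = e.val σ :=
  XExpr.eval_congr (σ := σ) (σ' := σ.setArr a A) he (fun _ _ => rfl)
    (fun b hb => by rw [setArr_arr, update_of_ne (by omega)]) fun _ => σ.reg 0

/-- Filling an array that expressions do not read. -/
theorem Ter.fill_foreign (hσ : σ.Good L) (ha : ownArrays ≤ a)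
    (hx : x < scratch) (hx' : boundRegs ≤ x) (hr : r < scratch) (hxr : x ≠ r) (hi : i.WF) (he : e.WF) (hn : σ.reg r = n) (g f : ℕ → ℤ)
    (hg : ∀ v < n, ∀ w < n, g v = g w → v = w)
    (hval : ∀ v < n, i.val (σ.setReg x (v : ℤ)) = g v ∧ e.val (σ.setReg x (v : ℤ)) = f v) (hQ : ∀ A : ℤ → ℤ, (∀ v < n, A (g v) = f v) →
      (∀ j, (∀ w < n, j ≠ g w) → A j = σ.arr a j) → Q ((σ.setReg x (n : ℤ)).setArr a A)) :
    Ter (.fill a x r i e) σ ((n + 1) * L ^ fillDeg i e) Q :=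
  Ter.fill hσ hx hx' hr hxr hi he hn g f hg (fun h => absurd h (by omega))
    (fun v hv A _ _ => by
      rw [XExpr.val_setArr hi ha, XExpr.val_setArr he ha]
      exact hval v hv) hQ

/-- The content of the simulated memory is `M`. -/
def Memory.Sim (σ : Memory) (M : ℕ → ℤ → ℤ) : Prop := (∀ a i, σ.rd a i = M a i) ∧ σ.Stamped

theorem Memory.Sim.simulates {m : Memory} (h : σ.Sim M)
    (hr : ∀ x : ℕ, M 0 x = m.reg x) (ha : ∀ a i, M (a + 1) i = m.arr a i) : σ.Simulates m :=
  ⟨fun x => (h.1 0 x).trans (hr x), fun a i => (h.1 (a + 1) i).trans (ha a i), h.2⟩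

theorem Memory.Sim.congr (h : σ.Sim M)
    (ha : ∀ a, ownArrays ≤ a → σ'.arr a = σ.arr a) (hr : σ'.reg stampReg = σ.reg stampReg) :
    σ'.Sim M := by
  have h1 : ∀ a, σ'.arr (simVal a) = σ.arr (simVal a) := fun a =>
    ha _ (by unfold simVal ownArrays; omega)
  have h2 : ∀ a, σ'.arr (simStamp a) = σ.arr (simStamp a) := fun a =>
    ha _ (by unfold simStamp ownArrays; omega)
  refine ⟨fun a i => ?_, fun a i => ?_⟩
  · rw [← h.1 a i]
    unfold rd
    rw [h1, h2, hr]
  · rw [h2, hr]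
    exact h.2 a i

theorem Memory.Stamped.fresh (h : σ.Stamped)
    (ha : ∀ a, ownArrays ≤ a → σ'.arr a = σ.arr a)
    (hr : σ'.reg stampReg = σ.reg stampReg + 1) : σ'.Sim fun _ _ => 0 := by
  have h2 : ∀ a, σ'.arr (simStamp a) = σ.arr (simStamp a) := fun a =>
    ha _ (by unfold simStamp ownArrays; omega)
  refine ⟨fun a i => ?_, fun a i => ?_⟩
  · unfold rd
    rw [h2, hr, if_neg]
    have := (h a i).2
    omega
  · rw [h2, hr]
    have := h a i
    omega

/-- The simulated memory after writing to an array `a` the values `f v` at the indices `g v`. -/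
def Writes (M M' : ℕ → ℤ → ℤ) (a n : ℕ) (g f : ℕ → ℤ) : Prop :=
  (∀ b, b ≠ a → M' b = M b) ∧ (∀ v < n, M' a (g v) = f v) ∧
    ∀ j, (∀ v < n, j ≠ g v) → M' a j = M a j

/-- Fill a simulated array. -/
def Prog.fillSim (a x r : ℕ) (i e : XExpr) : Prog :=
  .seq (.fill (simVal a) x r i e) (.fill (simStamp a) x r i (.var stampReg))

/-- The exponent of the time bound for an iteration of `Prog.fillSim`. -/
def XExpr.fillSimDeg (i e : XExpr) : ℕ :=
  fillDeg i e + fillDeg i (.var stampReg) + 1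

theorem pow_add_pow_le (hL : 2 ≤ L) : L ^ a + L ^ b ≤ L ^ (a + b + 1) := by
  have h1 : 1 ≤ L ^ a := Nat.one_le_pow _ _ (by omega)
  have h2 : 1 ≤ L ^ b := Nat.one_le_pow _ _ (by omega)
  have h3 : L ^ a + L ^ b ≤ 2 * (L ^ a * L ^ b) := by nlinarith
  calc L ^ a + L ^ b ≤ 2 * (L ^ a * L ^ b) := h3
    _ ≤ L * (L ^ a * L ^ b) := Nat.mul_le_mul_right _ hL
    _ = L ^ (a + b + 1) := by rw [pow_succ, pow_add]; ring

theorem Ter.seq_pow {q : Prog} {R : Memory → Prop} (hL : 2 ≤ L)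
    (h : Ter p σ (X * L ^ a) R) (h' : ∀ σ', R σ' → Ter q σ' (X * L ^ b) Q) :
    Ter (.seq p q) σ (X * L ^ (a + b + 1)) Q :=
  (h.seq h').mono_left (by
    rw [← mul_add]
    exact Nat.mul_le_mul_left _ (pow_add_pow_le hL))

theorem Ter.set_seq_pow {q : Prog} (hσ : σ.Good L) (he : e.WF) (hX : 1 ≤ X) (hz : e.val σ = z)
    (h : Ter q (σ.setReg x z) (X * L ^ b) Q) :
    Ter (.seq (.set x e) q) σ (X * L ^ (e.deg + 2 + b + 1)) Q :=
  Ter.seq_pow (R := fun σ' => σ' = σ.setReg x z) hσ.two_le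
    ((Ter.set hσ he (by rw [hz])).mono_left (Nat.le_mul_of_pos_left _ hX)) fun _ h' => h' ▸ h

theorem Ter.fillSim (hσ : σ.Good L) (hx : x < 38) (hx' : boundRegs ≤ x) (hr : r < scratch) (hxr : x ≠ r) (hi : i.WF) (he : e.WF) (hn : σ.reg r = n) (g f : ℕ → ℤ)
    (hg : ∀ v < n, ∀ w < n, g v = g w → v = w)
    (hval : ∀ v < n, i.val (σ.setReg x (v : ℤ)) = g v ∧ e.val (σ.setReg x (v : ℤ)) = f v)
    (hi' : ∀ v < n, i.val ((σ.setReg x (n : ℤ)).setReg x (v : ℤ)) = g v) (hM : σ.Sim M) :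
    Ter (.fillSim a x r i e) σ ((n + 1) * L ^ XExpr.fillSimDeg i e) fun σ' =>
      σ'.reg = (σ.setReg x n).reg ∧ (∀ b, b ≠ simVal a → b ≠ simStamp a → σ'.arr b = σ.arr b) ∧
      ∃ M', Writes M M' a n g f ∧ σ'.Sim M' := by
  classical
  have hxs : x < scratch := by unfold scratch; omega
  have hbn : bits (n : ℤ) ≤ L := hn ▸ hσ.reg r hr
  have hstx : stampReg ≠ x := by unfold stampReg; omega
  refine Ter.seq_pow hσ.two_le (R := fun σ' => ∃ A : ℤ → ℤ, (∀ v < n, A (g v) = f v) ∧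
      (∀ j, (∀ w < n, j ≠ g w) → A j = σ.arr (simVal a) j) ∧
      σ' = (σ.setReg x (n : ℤ)).setArr (simVal a) A)
    (Ter.fill_foreign hσ (by unfold simVal ownArrays; omega) hxs hx' hr hxr hi he hn g f hg hval
      fun A h1 h2 => ⟨A, h1, h2, rfl⟩) ?_
  rintro _ ⟨A, hA1, hA2, rfl⟩
  have hgood : ((σ.setReg x (n : ℤ)).setArr (simVal a) A).Good L :=
    (hσ.setReg hbn).setArr fun h =>
      absurd h (by unfold simVal ownArrays; omega)
  have hsv : ownArrays ≤ simVal a := by unfold simVal ownArrays; omega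
  have hreg : ∀ B : ℤ → ℤ, ∀ z : ℤ,
      (((σ.setReg x (n : ℤ)).setArr (simVal a) B).setReg x z) =
        ((σ.setReg x (n : ℤ)).setReg x z).setArr (simVal a) B := fun _ _ => rfl
  refine Ter.fill_foreign hgood (by unfold simStamp ownArrays; omega) hxs hx' hr hxr hi
    (by show stampReg < scratch; decide) (n := n) ?_ g (fun _ => σ.reg stampReg) hg (fun v hv => ⟨?_, ?_⟩)
    fun B hB1 hB2 => ⟨?_, fun b h1 h2 => ?_,
      ((((σ.setReg x (n : ℤ)).setArr (simVal a) A).setReg x n).setArr (simStamp a) B).rd, ⟨fun b hb => ?_, fun v hv => ?_,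
      fun j hj => ?_⟩, ⟨fun b j => rfl, fun b j => ?_⟩⟩
  · rw [setArr_reg, setReg_of_ne (Ne.symm hxr), hn]
  · rw [hreg, XExpr.val_setArr hi hsv]
    exact hi' v hv
  · simp only [XExpr.val, XExpr.eval, setReg_reg, setArr_reg]
    rw [update_of_ne hstx, update_of_ne hstx]
  · simp only [setArr_reg, setReg_reg, update_idem]
  · simp only [setArr_arr]
    rw [update_of_ne h2, setReg_arr, setArr_arr, update_of_ne h1,
      setReg_arr]
  all_goals
    have hne : simVal a ≠ simStamp a := by unfold simVal simStamp; omega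
    have e1 : ∀ b, b ≠ a → simVal b ≠ simVal a := fun b h => by unfold simVal; omega
    have e2 : ∀ b, simVal b ≠ simStamp a := fun b => by unfold simVal simStamp; omega
    have e3 : ∀ b, simStamp b ≠ simVal a := fun b => by unfold simVal simStamp; omega
    have e4 : ∀ b, b ≠ a → simStamp b ≠ simStamp a := fun b h => by unfold simStamp; omega
    have hst : update (update σ.reg x (n : ℤ)) x (n : ℤ) stampReg =
      σ.reg stampReg := by rw [update_of_ne hstx, update_of_ne hstx]
  · funext j
    rw [← hM.1 b j]
    simp only [rd, setArr_arr, setArr_reg, setReg_reg,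
      setReg_arr, hst]
    rw [update_of_ne (e4 b hb), update_of_ne (e3 b), update_of_ne (e2 b),
      update_of_ne (e1 b hb)]
  · simp only [rd, setArr_arr, setArr_reg, setReg_reg,
      setReg_arr, hst]
    rw [update_self, update_of_ne hne, update_self, hB1 v hv,
      if_pos rfl, hA1 v hv]
  · rw [← hM.1 a j]
    simp only [rd, setArr_arr, setArr_reg, setReg_reg,
      setReg_arr, hst]
    have hBj : B j = σ.arr (simStamp a) j := by
      rw [hB2 j hj, setArr_arr, update_of_ne hne.symm, setReg_arr]
    rw [update_self, update_of_ne hne, update_self, hA2 j hj, hBj]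
  · simp only [setArr_arr, setArr_reg, setReg_reg,
      setReg_arr, hst]
    by_cases hb : b = a
    · subst hb
      rw [update_self]
      by_cases hj : ∀ w < n, j ≠ g w
      · rw [hB2 j hj]
        simp only [setArr_arr, setReg_arr]
        rw [update_of_ne hne.symm]
        exact hM.2 b j
      · push Not at hj
        obtain ⟨w, hw, rfl⟩ := hj
        rw [hB1 w hw]
        exact ⟨(hM.2 0 0).1.trans (hM.2 0 0).2, le_rfl⟩
    · rw [update_of_ne (e4 b hb), update_of_ne (e3 b)]
      exact hM.2 b j

/-- Write a simulated cell. -/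
def Prog.putSim (a : ℕ) (i e : XExpr) : Prog :=
  .seq (.put (simVal a) i e) (.put (simStamp a) i (.var stampReg))

/-- The exponent of the time bound for `Prog.putSim`. -/
def XExpr.putSimDeg (i e : XExpr) : ℕ := (i.deg + e.deg + 3) + (i.deg + 2 + 3) + 1

theorem Memory.setCell_eq (σ : Memory) (a : ℕ) (i z : ℤ) :
    σ.setCell a i z = σ.setArr a (update (σ.arr a) i z) := rfl

theorem Ter.putSim (hσ : σ.Good L) (hi : i.WF) (he : e.WF) (hM : σ.Sim M) :
    Ter (.putSim a i e) σ (L ^ XExpr.putSimDeg i e) fun σ' =>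
      σ'.reg = σ.reg ∧ (∀ b, b ≠ simVal a → b ≠ simStamp a → σ'.arr b = σ.arr b) ∧
      ∃ M', Writes M M' a 1 (fun _ => i.val σ) (fun _ => e.val σ) ∧ σ'.Sim M' := by
  have hL := hσ.two_le
  have hsv : ownArrays ≤ simVal a := by unfold simVal ownArrays; omega
  have hsim : ((σ.setCell (simVal a) (i.val σ) (e.val σ)).setCell (simStamp a)
      (i.val σ) (σ.reg stampReg)).Sim
        fun b j => if b = a ∧ j = i.val σ then e.val σ else M b j := by
    refine ⟨fun b j => ?_, hM.2.store a (i.val σ) (e.val σ)⟩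
    have := rd_store (s := σ) a (i.val σ) (e.val σ) b j
    rw [this, hM.1]
  refine (Ter.seq (R := fun σ' => σ' = σ.setCell (simVal a) (i.val σ) (e.val σ))
    (Ter.put hσ hi he rfl) (T' := L ^ (i.deg + 2 + 3)) ?_).mono_left (pow_add_pow_le hL)
  rintro _ rfl
  have hgood : (σ.setCell (simVal a) (i.val σ) (e.val σ)).Good L := by
    rw [setCell_eq]
    exact hσ.setArr fun h => absurd h (by omega)
  have hst : (XExpr.var stampReg).WF := by show stampReg < scratch; decide
  refine Ter.put hgood hi hst ?_
  have h1 : i.val (σ.setCell (simVal a) (i.val σ) (e.val σ)) = i.val σ := by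
    rw [setCell_eq, XExpr.val_setArr hi hsv]
  have h2 : (XExpr.var stampReg).val (σ.setCell (simVal a) (i.val σ) (e.val σ)) =
      σ.reg stampReg := rfl
  rw [h1, h2]
  refine ⟨rfl, fun b hb hb' => ?_, _, ⟨fun b hb => ?_, fun v hv => ?_, fun j hj => ?_⟩, hsim⟩
  · rw [setCell_eq, setArr_arr, update_of_ne hb', setCell_eq,
      setArr_arr, update_of_ne hb]
  · funext j
    simp [hb]
  · simp
  · simp [hj 0 one_pos]

/-! ### Loading an instance into the simulated memory -/

/-- The literal is true if the first variables are the bits of `j`. -/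
def LeftTrue (v₀ j l : ℕ) : Prop := l / 2 < v₀ ∧ j / 2 ^ (l / 2) % 2 = l % 2

/-- The literal is true if the other variables are the bits of `e`. -/
def RightTrue (v₀ e l : ℕ) : Prop := v₀ ≤ l / 2 ∧ e / 2 ^ (l / 2 - v₀) % 2 = l % 2

theorem litTrue_iff (v₀ j e l : ℕ) :
    LitTrue v₀ j e l ↔ LeftTrue v₀ j l ∨ RightTrue v₀ e l := by
  unfold LitTrue LeftTrue RightTrue
  grind

/-- The sizes of the search: `n` and `E` assignments of the two halves of the variables, of which the
first has `v₀` variables; at least `w` examples at a time; the fuel per example; the number of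
dimensions to try; and the number `D` of clauses. -/
structure Params : Type where
  n : ℕ
  E : ℕ
  w : ℕ
  fuel : ℕ
  range : ℕ
  D : ℕ
  v₀ : ℕ

/-- The constants of the search are in their registers and arrays. -/
structure Setup (k N : ℕ) (P : Params) (σ : Memory) : Prop where
  tables : Tables k (2 * N) σ
  n : σ.reg 10 = P.n
  E : σ.reg 11 = P.E
  w : σ.reg 12 = P.w
  fuel : σ.reg 14 = P.fuel
  range : σ.reg 15 = P.range
  D : σ.reg 16 = (P.D + 1 : ℕ)
  v₀ : σ.reg 17 = P.v₀
  pow : ∀ v : ℕ, v < N ∨ v < P.v₀ → σ.arr 2 v = 2 ^ v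

theorem Setup.congr {P : Params} (h : Setup k N P σ)
    (hr : ∀ x, 2 ≤ x → x < 20 → σ'.reg x = σ.reg x) (ha : σ'.arr 2 = σ.arr 2) :
    Setup k N P σ' := by
  refine ⟨⟨?_, ?_, ?_, ?_⟩, ?_, ?_, ?_, ?_, ?_, ?_, ?_, fun v hv => ?_⟩
  any_goals rw [hr _ (by norm_num) (by norm_num)]
  · exact h.tables.literals
  · exact h.tables.codes
  · exact h.tables.flowers
  · exact h.tables.base
  · exact h.n
  · exact h.E
  · exact h.w
  · exact h.fuel
  · exact h.range
  · exact h.D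
  · exact h.v₀
  · rw [ha]; exact h.pow v hv

theorem is_entry {P : Params} {I : ℕ} {c : ℤ} (hs : Setup k N P σ) (hn : 3 < n)
    (hG : HoldsFamily k (2 * N) σ I G) (hb : Bounded k (2 * N) G) {T : XExpr → XExpr} {p : ℕ → Prop}
    (hT : ∀ {ε' : ℕ → ℤ} {f : XExpr} {l : ℕ}, (∀ y, n ≤ y → ε' y = ε y) → l < 2 * N →
      Is σ 3 f ε' (l : ℕ) → Is σ 3 (T f) ε' (bit (p l)))
    (hT' : ∀ {ε' : ℕ → ℤ} {f : XExpr} {a : ℤ}, (∀ y, n ≤ y → ε' y = ε y) →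
      Is σ 3 f ε' a → ∃ c, Is σ 3 (T f) ε' c)
    {g : XExpr}
    (hi : Is σ n i ε (I : ℕ)) (hf : Is σ n f ε (t : ℕ)) (hg : Is σ n g ε z) (ht : t ≤ D) :
    Is σ n (.add (.mul (f.eq (.const 0)) g) (.mul (.mul (.const c) ((XExpr.const 1).le f))
      (XExpr.clauseFails T k i f))) ε (entry z c D (ClauseFails (2 * N + 1) k G p) t) := by
  refine (((hf.eq (Is.const 0)).mul hg).add
    (((Is.const c).mul ((Is.const 1).le hf)).mul
      (Is.clauseFails hs.tables hn hG hb hT hT' hi hf))).congr ?_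
  unfold entry
  by_cases h0 : t = 0
  · subst h0
    rw [if_pos rfl, bit_of_pos (by norm_num), bit_of_not (by norm_num)]
    ring
  · rw [if_neg h0, if_pos ht, bit_of_not (mod_cast h0), bit_of_pos (by omega)]
    rw [zero_mul, zero_add, mul_one]
    congr 1
    refine bit_congr ?_
    unfold ClauseFails
    grind

/-- Row and column of the entry that register `30` refers to. -/
def XExpr.row : XExpr := .div (.var 30) (.var 16)

/-- The column of the entry that register `30` refers to. -/
def XExpr.col : XExpr := .sub (.var 30) (.mul (.var 16) (.div (.var 30) (.var 16)))

/-- The position of an entry in a matrix. -/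
def XExpr.position : XExpr := .add (.mul XExpr.row (.var 25)) XExpr.col

/-- The entries of the lower-layer weights. -/
def XExpr.weightEntry (k : ℕ) : XExpr :=
  .add (.mul (XExpr.col.eq (.const 0)) (.const 1))
    (.mul (.mul (.const (-2)) ((XExpr.const 1).le XExpr.col))
      (XExpr.clauseFails (XExpr.litLeft XExpr.row) k (.var 20) XExpr.col))

/-- The entries of the examples. -/
def XExpr.exampleEntry (k : ℕ) : XExpr :=
  .add (.mul (XExpr.col.eq (.const 0))
      ((XExpr.add (.add (.var 23) XExpr.row) (.const 1)).le (.var 11)))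
    (.mul (.mul (.const 1) ((XExpr.const 1).le XExpr.col))
      (XExpr.clauseFails (XExpr.litRight (.add (.var 23) XExpr.row)) k (.var 20) XExpr.col))

section Values

variable {k N n : ℕ} {P : Params} {σ : Memory} {ε : ℕ → ℤ} {v : ℕ}

theorem is_row (hs : Setup k N P σ) (hv : σ.reg 30 = v) :
    Is σ n XExpr.row ε ((v / (P.D + 1) : ℕ) : ℤ) :=
  ((Is.var hv).div (Is.var hs.D)).congr (by push_cast; rfl)

theorem is_col (hs : Setup k N P σ) (hv : σ.reg 30 = v) :
    Is σ n XExpr.col ε ((v % (P.D + 1) : ℕ) : ℤ) := by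
  refine ((Is.var hv).sub ((Is.var hs.D).mul
    ((Is.var hv).div (Is.var hs.D)))).congr ?_
  push_cast
  rw [Int.emod_def]

theorem is_position (hs : Setup k N P σ) (hv : σ.reg 30 = v) {dd : ℕ} (hd : σ.reg 25 = dd) :
    Is σ n XExpr.position ε
      (((v / (P.D + 1) * dd + v % (P.D + 1) : ℕ)) : ℤ) :=
  (((is_row hs hv).mul (Is.var hd)).add (is_col hs hv)).congr (by push_cast; rfl)

variable {I : ℕ} {G : Finset (Multiset ℕ)}

theorem is_weightEntry (hs : Setup k N P σ) (hG : HoldsFamily k (2 * N) σ I G)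
    (hb : Bounded k (2 * N) G) (hI : σ.reg 20 = I) (hv : σ.reg 30 = v) :
    Is σ 4 (XExpr.weightEntry k) ε (entry 1 (-2) P.D
      (ClauseFails (2 * N + 1) k G (LeftTrue P.v₀ (v / (P.D + 1)))) (v % (P.D + 1))) :=
  is_entry hs (by norm_num) hG hb
    (fun _ _ hf => Is.litLeft hs.v₀ (fun v hv => hs.pow v (Or.inr hv)) (is_row hs hv) hf)
    (fun _ hf => by
      obtain ⟨c, hc⟩ := (is_row (n := 3) hs hv).exists_bitX (hf.div (Is.const 2))
      exact ⟨_, (((hf.div (Is.const 2)).add (Is.const 1)).le (Is.var hs.v₀)).mul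
        (hc.eq (hf.sub ((Is.const 2).mul (hf.div (Is.const 2)))))⟩)
    (Is.var hI) (is_col hs hv) (Is.const 1)
    (Nat.le_of_lt_succ (Nat.mod_lt _ (by omega)))

theorem is_exampleEntry (hs : Setup k N P σ) (hG : HoldsFamily k (2 * N) σ I G)
    (hb : Bounded k (2 * N) G) (hI : σ.reg 20 = I) (hv : σ.reg 30 = v) {e₀ : ℕ}
    (he : σ.reg 23 = e₀) :
    Is σ 4 (XExpr.exampleEntry k) ε (entry (bit (e₀ + v / (P.D + 1) < P.E)) 1 P.D
      (ClauseFails (2 * N + 1) k G (RightTrue P.v₀ (e₀ + v / (P.D + 1)))) (v % (P.D + 1))) := by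
  have hrow : ∀ {n ε}, Is σ n (.add (.var 23) XExpr.row) ε
      ((e₀ + v / (P.D + 1) : ℕ) : ℤ) := fun {n ε} =>
    ((Is.var he).add (is_row (n := n) (ε := ε) hs hv)).congr (by push_cast; rfl)
  exact is_entry hs (by norm_num) hG hb
    (fun _ hl hf => Is.litRight hs.v₀ (fun v hv => hs.pow v (Or.inl hv)) hrow hl hf)
    (fun _ hf => by
      obtain ⟨c, hc⟩ := (hrow (n := 3)).exists_bitX
        ((hf.div (Is.const 2)).sub (Is.var hs.v₀))
      exact ⟨_, ((Is.var hs.v₀).le (hf.div (Is.const 2))).mul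
        (hc.eq (hf.sub ((Is.const 2).mul (hf.div (Is.const 2)))))⟩)
    (Is.var hI) (is_col hs hv)
    (((hrow.add (Is.const 1)).le (Is.var hs.E)).congr (bit_congr (by norm_cast)))
    (Nat.le_of_lt_succ (Nat.mod_lt _ (by omega)))

end Values

namespace XExpr

attribute [local simp] XExpr.eq XExpr.le neg ex all mod

variable {g : XExpr}

theorem wf_lv (y : ℕ) : (lv y).WF := trivial

theorem wf_var (h : x < scratch) : (var x).WF := h

theorem WF.div_base (h : e.WF) : (div e (.var 5)).WF := ⟨h, by simp⟩

theorem WF.count (h : e.WF) (k : ℕ) (hf : f.WF) : (count e k f).WF := by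
  induction k generalizing f with
  | zero => trivial
  | succ k ih => simp [XExpr.count, h, hf, ih hf.div_base]

theorem WF.size (k : ℕ) (hf : f.WF) : (size k f).WF := by
  induction k generalizing f with
  | zero => trivial
  | succ k ih => simp [XExpr.size, hf, ih hf.div_base]

theorem WF.sub_ (k : ℕ) (hf : f.WF) (hg : g.WF) : (sub_ k f g).WF := by
  simp [XExpr.sub_, (wf_lv 0).count k hf, (wf_lv 0).count k hg]

theorem WF.same (k : ℕ) (hf : f.WF) (hg : g.WF) : (same k f g).WF := by
  simp [XExpr.same, (wf_lv 0).count k hf, (wf_lv 0).count k hg]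

theorem WF.join (k : ℕ) (hf : f.WF) (hg : g.WF) (he : e.WF) : (join k f g e).WF := by
  simp [XExpr.join, (wf_lv 0).count k hf, (wf_lv 0).count k hg, (wf_lv 0).count k he]

theorem WF.fam (hi : i.WF) (hf : f.WF) : (fam i f).WF := by simp [XExpr.fam, hi, hf]

theorem WF.minimal (k : ℕ) (hi : i.WF) (hf : f.WF) : (minimal k i f).WF := by
  simp [XExpr.minimal, hi.fam hf, hi.fam (wf_lv 1), (wf_lv 1).sub_ k hf, hf.sub_ k (wf_lv 1)]

theorem WF.canonicalMin (k : ℕ) (hi : i.WF) (hf : f.WF) : (canonicalMin k i f).WF := by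
  simp [XExpr.canonicalMin, canonical, hi.minimal k hf, (wf_lv 1).same k hf, hf]

theorem WF.degreeX (k : ℕ) (hi : i.WF) (he : e.WF) (hf : f.WF) : (degreeX k i e f).WF := by
  simp [XExpr.degreeX, hi.canonicalMin k (wf_lv 2), (wf_lv 2).size k, hf.sub_ k (wf_lv 2), he]

theorem WF.table (θ : ℕ → ℕ) (hi : i.WF) (m : ℕ) : (table θ i m).WF := by
  induction m <;> simp_all [XExpr.table]

theorem WF.flower (k : ℕ) (hf : f.WF) :
    (flowerSize k f).WF ∧ (flowerPetal k f).WF ∧ (flowerHeart f).WF := by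
  simp [flowerSize, flowerPetal, flowerHeart, hf]

theorem WF.heavy (θ : ℕ → ℕ) (k : ℕ) (hi : i.WF) (hf : f.WF) : (heavy θ k i f).WF := by
  obtain ⟨h1, h2, h3⟩ := hf.flower k
  simp [XExpr.heavy, h1, h2, h3.size k, h2.table θ (k + 1), hi.degreeX k h1 h3]

theorem WF.firstFlower (θ : ℕ → ℕ) (k : ℕ) (hi : i.WF) : (firstFlower θ k i).WF := by
  simp [XExpr.firstFlower, hi.heavy θ k (wf_lv 3)]

theorem WF.someTrue {T : XExpr → XExpr} (hT : ∀ {f : XExpr}, f.WF → (T f).WF) (k : ℕ)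
    (hf : f.WF) : (someTrue T k f).WF := by
  induction k generalizing f with
  | zero => trivial
  | succ k ih =>
    have h : (XExpr.sub (mod f) (.const 1)).WF := by simp [hf]
    simp [-mod, XExpr.someTrue, h.1, hT h, ih hf.div_base]

theorem WF.clauseFails {T : XExpr → XExpr} (hT : ∀ {f : XExpr}, f.WF → (T f).WF) (k : ℕ)
    (hi : i.WF) (hf : f.WF) : (clauseFails T k i f).WF := by
  simp [XExpr.clauseFails, hi.canonicalMin k (wf_lv 2), hi.canonicalMin k (wf_lv 3),
    (wf_lv 3).someTrue hT k, hf]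

theorem WF.litLeft (he : e.WF) (hf : f.WF) : (litLeft e f).WF := by
  simp [XExpr.litLeft, bitX, variable_, sign, he, hf]

theorem WF.litRight (he : e.WF) (hf : f.WF) : (litRight e f).WF := by
  simp [XExpr.litRight, bitX, variable_, sign, he, hf]

theorem wf_position : position.WF := by simp [position, row, col]

theorem wf_weightEntry (k : ℕ) : (weightEntry k).WF := by
  have h : row.WF ∧ col.WF := by simp [row, col]
  simp [weightEntry, h, WF.clauseFails h.1.litLeft k (i := .var 20) (by simp) h.2]

theorem wf_exampleEntry (k : ℕ) : (exampleEntry k).WF := by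
  have h : (XExpr.add (.var 23) row).WF ∧ col.WF := by simp [row, col]
  simp [exampleEntry, h, h.1.2, WF.clauseFails h.1.litRight k (i := .var 20) (by simp) h.2]

end XExpr

variable {P : Params}

/-- The registers that change while an instance is loaded. -/
abbrev loadRegs : List ℕ := [24, 25, 30, 31, 39]

/-- A stage in loading an instance with `mm` examples of dimension `dd`: the content of the simulated
memory is `M`, and the cells of the output are cleared. -/
structure Loading (L : ℕ) (P : Params) (σ₀ σ : Memory) (mm dd : ℕ) (M : ℕ → ℤ → ℤ) : Prop where
  good : σ.Good L
  own : ∀ a < ownArrays, σ.arr a = σ₀.arr a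
  reg : ∀ x < scratch, x ∉ loadRegs → σ.reg x = σ₀.reg x
  rows : σ.reg 24 = mm
  cols : σ.reg 25 = dd
  stamp : σ.reg stampReg = σ₀.reg stampReg + 1
  num : ∀ j : ℕ, j < P.n → σ.arr (simVal 5) j = 0
  den : ∀ j : ℕ, j < P.n → σ.arr (simVal 6) j = 0
  sim : σ.Sim M

section

variable {L : ℕ} {P : Params} {σ₀ σ σ' : Memory} {mm dd : ℕ} {M M' : ℕ → ℤ → ℤ}

theorem Loading.next (h : Loading L P σ₀ σ mm dd M) (h5 : a ≠ 5) (h6 : a ≠ 6)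
    (hr : ∀ x < scratch, x ≠ 30 → σ'.reg x = σ.reg x) (h30 : bits (σ'.reg 30) ≤ L)
    (ha : ∀ b, b ≠ simVal a → b ≠ simStamp a → σ'.arr b = σ.arr b) (hM : σ'.Sim M') :
    Loading L P σ₀ σ' mm dd M' := by
  have hown : ∀ b < ownArrays, σ'.arr b = σ.arr b := fun b hb =>
    ha b (by grind)
      (by grind)
  refine ⟨⟨h.good.two_le, fun x hx => ?_, fun b hb i => ?_, fun r hb => ?_⟩, fun b hb => ?_,
    fun x hx hx' => ?_, ?_, ?_, ?_, fun j hj => ?_, fun j hj => ?_, hM⟩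
  · by_cases h : x = 30
    · rw [h]; exact h30
    · rw [hr x hx h]
      exact Loading.good ‹_› |>.reg x hx
  · rw [hown b hb]; exact h.good.arr b hb i
  · rw [hr r (hb.trans boundRegs_lt) (by unfold boundRegs at hb; omega)]
    exact h.good.bound r hb
  · rw [hown b hb, h.own b hb]
  · rw [hr x hx (by rintro rfl; simp at hx'), h.reg x hx hx']
  · rw [hr 24 (by decide) (by decide), h.rows]
  · rw [hr 25 (by decide) (by decide), h.cols]
  · rw [hr stampReg (by decide) (by decide), h.stamp]
  · rw [ha _ (by unfold simVal; omega) (by unfold simVal simStamp; omega), h.num j hj]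
  · rw [ha _ (by unfold simVal; omega) (by unfold simVal simStamp; omega), h.den j hj]

theorem Loading.fillSim (h : Loading L P σ₀ σ mm dd M) (h5 : a ≠ 5) (h6 : a ≠ 6) (hr : r < scratch) (hr' : 30 ≠ r) (hi : i.WF) (he : e.WF) (hn : σ.reg r = n) (g f : ℕ → ℤ) (hg : ∀ v < n, ∀ w < n, g v = g w → v = w)
    (hval : ∀ v < n, ∀ σ' : Memory, (∀ x < scratch, x ≠ 30 → σ'.reg x = σ.reg x) →
      σ'.reg 30 = v → (∀ a < ownArrays, σ'.arr a = σ.arr a) → i.val σ' = g v ∧ e.val σ' = f v) :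
    Ter (.fillSim a 30 r i e) σ ((n + 1) * L ^ XExpr.fillSimDeg i e) fun σ' =>
      ∃ M', Writes M M' a n g f ∧ Loading L P σ₀ σ' mm dd M' := by
  refine (Ter.fillSim h.good (by norm_num) (by decide) hr hr' hi he hn g f hg
    (fun v hv => hval v hv _ (fun x _ hx => ?_) ?_ fun _ _ => rfl)
    (fun v hv => (hval v hv ((σ.setReg 30 (n : ℤ)).setReg 30 (v : ℤ)) (fun x _ hx => ?_) ?_
      fun _ _ => rfl).1) h.sim).mono le_rfl ?_
  · rw [setReg_reg, update_of_ne hx]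
  · rw [setReg_self]
  · rw [setReg_reg, update_of_ne hx, setReg_reg, update_of_ne hx]
  · rw [setReg_self]
  · rintro σ' ⟨h1, h2, M', hM', hsim⟩
    refine ⟨M', hM', h.next h5 h6 (fun x _ hx => ?_) ?_ h2 hsim⟩
    · rw [h1, setReg_reg, update_of_ne hx]
    · rw [h1, setReg_self, ← hn]
      exact h.good.reg r hr

theorem Loading.putSim (h : Loading L P σ₀ σ mm dd M) (h5 : a ≠ 5) (h6 : a ≠ 6) (hi : i.WF) (he : e.WF) :
    Ter (.putSim a i e) σ (L ^ XExpr.putSimDeg i e) fun σ' =>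
      ∃ M', Writes M M' a 1 (fun _ => i.val σ) (fun _ => e.val σ) ∧
        Loading L P σ₀ σ' mm dd M' := by
  refine (Ter.putSim h.good hi he h.sim).mono le_rfl ?_
  rintro σ' ⟨h1, h2, M', hM', hsim⟩
  exact ⟨M', hM', h.next h5 h6 (fun x _ _ => by rw [h1])
    (by rw [h1]; exact h.good.reg 30 (by decide)) h2 hsim⟩

theorem Loading.set (h : Loading L P σ₀ σ mm dd M) (he : e.WF)
    (hz : bits (e.val σ) ≤ L) :
    Ter (.set 31 e) σ (L ^ (e.deg + 2)) fun σ' => σ'.reg 31 = e.val σ ∧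
      Loading L P σ₀ σ' mm dd M := by
  refine Ter.set h.good he ⟨?_, h.good.setReg hz, h.own,
    fun x hx hx' => ?_, ?_, ?_, ?_, h.num, h.den, h.sim.congr (fun _ _ => rfl) ?_⟩
  · rw [setReg_self]
  · rw [setReg_of_ne (by rintro rfl; simp at hx')]
    exact h.reg x hx hx'
  · rw [setReg_of_ne (by decide)]; exact h.rows
  · rw [setReg_of_ne (by decide)]; exact h.cols
  · rw [setReg_of_ne (by decide)]; exact h.stamp
  · rw [setReg_of_ne (by decide)]

end

/-- Choose the numbers of examples and dimensions, and start with an empty simulated memory. -/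
def Prog.prepare : Prog :=
  .seq (.set 24 (.add (.var 12) (.div (.var 22) (.var 15))))
  (.seq (.set 25 (.add (.var 16) (.sub (.var 22) (.mul (.var 15) (.div (.var 22) (.var 15))))))
  (.seq (.set stampReg (.add (.var stampReg) (.const 1)))
  (.seq (.fill (simVal 5) 30 10 (.var 30) (.const 0))
    (.fill (simVal 6) 30 10 (.var 30) (.const 0)))))

theorem Memory.Sim.setVal (h : σ.Sim fun _ _ => 0) (a : ℕ) (A : ℤ → ℤ)
    (hA : ∀ j, A j = 0 ∨ A j = σ.arr (simVal a) j) (x : ℕ) (hx : stampReg ≠ x) (z : ℤ) :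
    ((σ.setReg x z).setArr (simVal a) A).Sim fun _ _ => 0 := by
  have h2 : ∀ b, simStamp b ≠ simVal a := fun b => by unfold simStamp simVal; omega
  refine ⟨fun b j => ?_, fun b j => ?_⟩
  · have h1 := h.1 b j
    unfold rd at h1 ⊢
    simp only [setArr_arr, setArr_reg, setReg_reg, setReg_arr,
      update_of_ne hx, update_of_ne (h2 b)]
    by_cases hb : b = a
    · subst hb
      rw [update_self]
      grind
    · rw [update_of_ne (by unfold simVal; omega)]
      exact h1
  · have := h.2 b j
    rw [setArr_arr, setArr_reg, setReg_reg, setReg_arr,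
      update_of_ne hx, update_of_ne (h2 b)]
    exact this

theorem Ter.prepare : ∃ w, ∀ {L X k N γ : ℕ} {P : Params} {σ : Memory}, σ.Good L →
    Setup k N P σ → σ.Stamped → σ.reg 22 = γ → 1 ≤ X → P.n ≤ X →
    bits ((P.w + γ / P.range : ℕ) : ℤ) ≤ L → bits ((P.D + 1 + γ % P.range : ℕ) : ℤ) ≤ L →
    bits (σ.reg stampReg + 1) ≤ L →
    Ter .prepare σ (X * L ^ w) fun σ' =>
      Loading L P σ σ' (P.w + γ / P.range) (P.D + 1 + γ % P.range) fun _ _ => 0 := by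
  apply Exists.intro
  intro L X k N γ P σ hσ hs hst hγ hX hn hb1 hb2 hb3
  have hL := hσ.two_le
  have hone : ∀ {T : ℕ}, T ≤ X * T := fun {T} => Nat.le_mul_of_pos_left _ hX
  have hwf1 : (XExpr.add (.var 12) (.div (.var 22) (.var 15))).WF := by simp
  have hwf2 : (XExpr.add (.var 16)
      (.sub (.var 22) (.mul (.var 15) (.div (.var 22) (.var 15))))).WF := by simp
  have hwf3 : (XExpr.add (.var stampReg) (.const 1)).WF := by simp
  have hwf4 : (XExpr.var 30).WF := by simp
  set mm := P.w + γ / P.range with hmm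
  set dd := P.D + 1 + γ % P.range with hdd
  have v1 : (XExpr.add (.var 12) (.div (.var 22) (.var 15))).val σ = mm := by
    refine (((Is.var hs.w).add ((Is.var hγ).div (Is.var hs.range))).val_eq
      (n := 0)).trans ?_
    push_cast [hmm]; rfl
  have v2 : (XExpr.add (.var 16)
      (.sub (.var 22) (.mul (.var 15) (.div (.var 22) (.var 15))))).val
        (σ.setReg 24 mm) = dd := by
    have e1 : (σ.setReg 24 mm).reg 16 = (P.D + 1 : ℕ) := hs.D
    have e2 : (σ.setReg 24 mm).reg 22 = γ := hγ
    have e3 : (σ.setReg 24 mm).reg 15 = P.range := hs.range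
    refine (((Is.var e1).add ((Is.var e2).sub ((Is.var e3).mul
      ((Is.var e2).div (Is.var e3))))).val_eq (n := 0)).trans ?_
    push_cast [hdd]
    rw [Int.emod_def]
  set σ₁ := σ.setReg 24 mm with hσ₁
  set σ₂ := σ₁.setReg 25 dd with hσ₂
  set σ₃ := σ₂.setReg stampReg (σ.reg stampReg + 1) with hσ₃
  have g1 : σ₁.Good L := hσ.setReg hb1
  have g2 : σ₂.Good L := g1.setReg hb2
  have g3 : σ₃.Good L := g2.setReg hb3
  have s3 : σ₃.Sim fun _ _ => 0 := hst.fresh (fun _ _ => rfl) rfl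
  have hn3 : ∀ z z' : ℤ, ((σ₃.setReg 30 z).setReg 30 z').reg 10 = P.n := fun z z' => hs.n
  have hcount : ∀ {d : ℕ}, (P.n + 1) * L ^ d ≤ X * L ^ (d + 1) := fun {d} => by
    calc (P.n + 1) * L ^ d ≤ (X * L) * L ^ d := Nat.mul_le_mul_right _ (by nlinarith)
      _ = X * L ^ (d + 1) := by rw [pow_succ]; ring
  have hzero : ∀ {A B : ℤ → ℤ}, (∀ v < P.n, A (v : ℕ) = 0) →
      (∀ j, (∀ w < P.n, j ≠ ((w : ℕ) : ℤ)) → A j = B j) → ∀ j, A j = 0 ∨ A j = B j := by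
    intro A B h1 h2 j
    by_cases hj : ∀ w < P.n, j ≠ ((w : ℕ) : ℤ)
    · exact Or.inr (h2 j hj)
    · grind
  apply Ter.set_seq_pow hσ hwf1 hX v1
  apply Ter.set_seq_pow g1 hwf2 hX v2
  apply Ter.set_seq_pow g2 hwf3 hX rfl
  apply Ter.seq_pow hL (R := fun σ' => ∃ A : ℤ → ℤ, (∀ v < P.n, A (v : ℕ) = 0) ∧
      (∀ j, A j = 0 ∨ A j = σ₃.arr (simVal 5) j) ∧
      σ' = (σ₃.setReg 30 (P.n : ℤ)).setArr (simVal 5) A)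
    ((Ter.fill_foreign (a := simVal 5) (x := 30) (r := 10) g3 (by decide) (by decide) (by decide) (by decide) (by decide) hwf4
      (e := .const 0) trivial (n := P.n) hs.n (fun v => v) (fun _ => 0)
      (fun v _ w _ h => mod_cast h) (fun v _ => ⟨rfl, rfl⟩)
      fun A h1 h2 => ⟨A, h1, hzero h1 h2, rfl⟩).mono_left hcount)
  rintro _ ⟨A, hA1, hA2, rfl⟩
  have hbn : bits (P.n : ℤ) ≤ L := hs.n ▸ hσ.reg 10 (by decide)
  have g4 : ((σ₃.setReg 30 (P.n : ℤ)).setArr (simVal 5) A).Good L :=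
    (g3.setReg hbn).setArr
  have s4 := s3.setVal 5 A hA2 30 (by decide) P.n
  refine ((Ter.fill_foreign (a := simVal 6) (x := 30) (r := 10) g4 (by decide) (by decide) (by decide) (by decide) (by decide) hwf4
    (e := .const 0) trivial (n := P.n) hs.n (fun v => v) (fun _ => 0)
    (fun v _ w _ h => mod_cast h) (fun v _ => ⟨rfl, rfl⟩)
    fun B h1 h2 => ?_).mono_left hcount)
  have hB := hzero h1 h2
  refine ⟨(g4.setReg hbn).setArr,
    fun a ha => ?_, fun x hx hx' => ?_, rfl, rfl, rfl, fun j hj => hA1 j hj,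
    fun j hj => h1 j hj, s4.setVal 6 B hB 30 (by decide) P.n⟩
  · have h5 : a ≠ simVal 5 := by unfold simVal; unfold ownArrays at ha; omega
    have h6 : a ≠ simVal 6 := by unfold simVal; unfold ownArrays at ha; omega
    rw [setArr_arr, update_of_ne h6, setReg_arr, setArr_arr,
      update_of_ne h5]
    rfl
  · simp at hx'
    obtain ⟨n1, n2, n3, -, n5⟩ := hx'
    simp [setArr_reg, hσ₃, hσ₂, hσ₁, n1, n2, n3, n5]

theorem storeMat_of_writes (hD : D + 1 ≤ c) (f : ℕ → ℕ → ℤ)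
    (hf : ∀ j k, D < k → f j k = 0) {A : ℤ → ℤ}
    (hA : ∀ v < r * (D + 1), A ((v / (D + 1) * c + v % (D + 1) : ℕ) : ℤ) =
      f (v / (D + 1)) (v % (D + 1)))
    (hA' : ∀ t, (∀ v < r * (D + 1), t ≠ ((v / (D + 1) * c + v % (D + 1) : ℕ) : ℤ)) → A t = 0)
    (t : ℤ) : A t = storeMat (fun (j : Fin r) (k : Fin c) => f j k) t := by
  by_cases h : ∃ (j : Fin r) (k : Fin c), t = (j : ℤ) * c + k
  · obtain ⟨j, k, rfl⟩ := h
    rw [storeMat_apply]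
    by_cases hk : (k : ℕ) ≤ D
    · have h1 : (j * (D + 1) + k : ℕ) / (D + 1) = j := by
        rw [mul_comm, Nat.mul_add_div (by omega), Nat.div_eq_of_lt (by omega), add_zero]
      have h2 : (j * (D + 1) + k : ℕ) % (D + 1) = k := by
        rw [mul_comm, Nat.mul_add_mod, Nat.mod_eq_of_lt (by omega)]
      have := hA (j * (D + 1) + k) (by
        calc _ < j * (D + 1) + (D + 1) := by omega
          _ = (j + 1) * (D + 1) := by ring
          _ ≤ r * (D + 1) := Nat.mul_le_mul_right _ j.2)
      rw [h1, h2] at this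
      grind
    · rw [hf _ _ (by omega)]
      refine hA' _ fun v hv h => ?_
      have hm : v % (D + 1) < D + 1 := Nat.mod_lt _ (by omega)
      have := (rowMajor_injective (c := c) (k := k) (k' := v % (D + 1)) k.2 (hm.trans_le hD)
        (j := j) (j' := v / (D + 1)) (mod_cast h)).2
      omega
  · rw [storeMat_eq_zero _ fun j k hjk => h ⟨j, k, hjk⟩]
    refine hA' _ fun v hv ht => h ⟨⟨v / (D + 1), Nat.div_lt_of_lt_mul (by rwa [mul_comm])⟩,
      ⟨v % (D + 1), (Nat.mod_lt _ (by omega)).trans_le hD⟩, ?_⟩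
    rw [ht]
    push_cast
    rfl

theorem storeVec_of_writes (z : ℤ) {A : ℤ → ℤ} (hA : ∀ v < r, A (v : ℕ) = z)
    (hA' : ∀ t, (∀ v < r, t ≠ ((v : ℕ) : ℤ)) → A t = 0) (t : ℤ) :
    A t = storeVec (fun _ : Fin r => z) t := by
  by_cases h : ∃ j : Fin r, t = (j : ℤ)
  · obtain ⟨j, rfl⟩ := h
    rw [storeVec_apply, hA _ j.2]
  · rw [storeVec_eq_zero _ fun j hj => h ⟨j, hj⟩]
    exact hA' _ fun v hv ht => h ⟨⟨v, hv⟩, ht⟩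

theorem position_injective (hD : D + 1 ≤ c)
    (h : ((v / (D + 1) * c + v % (D + 1) : ℕ) : ℤ) = ((w / (D + 1) * c + w % (D + 1) : ℕ) : ℤ)) :
    v = w := by
  have h1 : v % (D + 1) < D + 1 := Nat.mod_lt _ (by omega)
  have h2 : w % (D + 1) < D + 1 := Nat.mod_lt _ (by omega)
  obtain ⟨h3, h4⟩ := rowMajor_injective (c := c) (h1.trans_le hD) (h2.trans_le hD)
    (j := v / (D + 1)) (j' := w / (D + 1)) (mod_cast h)
  rw [← Nat.div_add_mod v (D + 1), ← Nat.div_add_mod w (D + 1), h3, h4]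

theorem XExpr.HoldsFamily.congr {I : ℕ} (h : HoldsFamily k q σ I G) (ha : σ'.arr 1 = σ.arr 1) :
    HoldsFamily k q σ' I G := by
  intro z hz
  rw [ha]
  exact h z hz

theorem Writes.eq_update {M' : ℕ → ℤ → ℤ} {i : ℤ}
    (h : Writes M M' a 1 (fun _ => i) fun _ => z) : M' a = update (M a) i z := by
  funext j
  rw [update_apply]
  split_ifs with hj
  · rw [hj]; exact h.2.1 0 one_pos
  · exact h.2.2 j fun _ _ => hj

/-- Load the instance for the family of clauses and the block of assignments that registers `20` and
`23` refer to. -/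
def Prog.loadInstance (k : ℕ) : Prog :=
  .seq .prepare
  (.seq (.putSim 0 (.const 0) (.var 10))
  (.seq (.putSim 0 (.const 1) (.var 24))
  (.seq (.putSim 0 (.const 2) (.var 25))
  (.seq (.set 31 (.mul (.var 10) (.var 16)))
  (.seq (.fillSim 2 30 31 XExpr.position (XExpr.weightEntry k))
  (.seq (.set 31 (.mul (.var 24) (.var 16)))
  (.seq (.fillSim 3 30 31 XExpr.position (XExpr.exampleEntry k))
    (.fillSim 4 30 24 (.var 30) (.const 1)))))))))

theorem Loading.setup {mm dd : ℕ} {σ₀ : Memory} (h : Loading L P σ₀ σ mm dd M) (hs : Setup k N P σ₀)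
    (hr : ∀ x < scratch, x ≠ 30 → σ'.reg x = σ.reg x)
    (ha : ∀ a < ownArrays, σ'.arr a = σ.arr a) : Setup k N P σ' := by
  refine hs.congr (fun x h1 h2 => ?_) ((ha 2 (by decide)).trans (h.own 2 (by decide)))
  rw [hr x (by unfold scratch; omega) (by omega)]
  refine h.reg x (by unfold scratch; omega) ?_
  grind

/-- The instance that is loaded. -/
noncomputable def Params.instance (P : Params) (N k : ℕ) (G : Finset (Multiset ℕ)) (e₀ mm dd : ℕ) :
    Instance P.n mm dd :=
  searchInstance P.n mm dd P.D (fun i => e₀ + i < P.E)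
    (fun i => ClauseFails (2 * N + 1) k G (RightTrue P.v₀ (e₀ + i)))
    (fun j => ClauseFails (2 * N + 1) k G (LeftTrue P.v₀ j))

theorem Ter.loadInstance (k : ℕ) : ∃ w, ∀ {L X N γ I e₀ mm dd : ℕ} {P : Params} {σ : Memory}
    {G : Finset (Multiset ℕ)}, σ.Good L → Setup k N P σ → HoldsFamily k (2 * N) σ I G →
    Bounded k (2 * N) G → σ.Stamped → σ.reg 20 = I → σ.reg 22 = γ → σ.reg 23 = e₀ →
    mm = P.w + γ / P.range → dd = P.D + 1 + γ % P.range →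
    1 ≤ X → P.n ≤ X → mm ≤ X → P.D + 1 ≤ L → bits (mm : ℤ) ≤ L → bits (dd : ℤ) ≤ L →
    bits (σ.reg stampReg + 1) ≤ L → bits ((P.n * (P.D + 1) : ℕ) : ℤ) ≤ L →
    bits ((mm * (P.D + 1) : ℕ) : ℤ) ≤ L →
    Ter (.loadInstance k) σ (X * L ^ w) fun σ' => ∃ M, Loading L P σ σ' mm dd M ∧
      σ'.Simulates (P.instance N k G e₀ mm dd).input := by
  obtain ⟨w₀, hprep⟩ := Ter.prepare
  apply Exists.intro
  intro L X N γ I e₀ mm dd P σ₀ G hσ hs hG hb hst h20 h22 h23 hmm hdd hX hn hmX hD hb1 hb2 hb3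
    hb4 hb5
  have hL := hσ.two_le
  have hone : ∀ {T : ℕ}, T ≤ X * T := fun {T} => Nat.le_mul_of_pos_left _ hX
  have hcount : ∀ {c d : ℕ}, c ≤ X * L → (c + 1) * L ^ d ≤ X * L ^ (d + 2) := fun {c d} hc => by
    have h1 : 1 ≤ X * L := Nat.mul_pos hX (by omega)
    calc (c + 1) * L ^ d ≤ (X * L * L) * L ^ d := Nat.mul_le_mul_right _ (by nlinarith)
      _ = X * L ^ (d + 2) := by rw [pow_add]; ring
  have hdD : P.D + 1 ≤ dd := by omega
  have w30 : (XExpr.var 30).WF := by simp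
  have w10 : (XExpr.var 10).WF := by simp
  have w24 : (XExpr.var 24).WF := by simp
  have w25 : (XExpr.var 25).WF := by simp
  have wm1 : (XExpr.mul (.var 10) (.var 16)).WF := by simp
  have wm2 : (XExpr.mul (.var 24) (.var 16)).WF := by simp
  have hreg : ∀ {σ M}, Loading L P σ₀ σ mm dd M → ∀ x < scratch, x ∉ loadRegs →
    σ.reg x = σ₀.reg x := fun h => h.reg
  have hfam : ∀ {σ σ' M}, Loading L P σ₀ σ mm dd M → (∀ a < ownArrays, σ'.arr a = σ.arr a) →
      HoldsFamily k (2 * N) σ' I G := fun h ha =>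
    hG.congr ((ha 1 (by decide)).trans (h.own 1 (by decide)))
  apply Ter.seq_pow hL (hmm ▸ hdd ▸ hprep hσ hs hst h22 hX hn (hmm ▸ hb1) (hdd ▸ hb2) hb3)
  rintro σ₁ h₁
  apply Ter.seq_pow hL ((h₁.putSim (a := 0) (i := .const 0) (by decide) (by decide) trivial w10).mono_left hone)
  rintro σ₂ ⟨M₂, wr₂, h₂⟩
  apply Ter.seq_pow hL ((h₂.putSim (a := 0) (i := .const 1) (by decide) (by decide) trivial w24).mono_left hone)
  rintro σ₃ ⟨M₃, wr₃, h₃⟩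
  apply Ter.seq_pow hL ((h₃.putSim (a := 0) (i := .const 2) (by decide) (by decide) trivial w25).mono_left hone)
  rintro σ₄ ⟨M₄, wr₄, h₄⟩
  have e₁ : (XExpr.var 10).val σ₁ = P.n := (h₁.reg 10 (by decide) (by decide)).trans hs.n
  have e₂ : (XExpr.var 24).val σ₂ = mm := h₂.rows
  have e₃ : (XExpr.var 25).val σ₃ = dd := h₃.cols
  have c₁ : (XExpr.mul (.var 10) (.var 16)).val σ₄ = (P.n * (P.D + 1) : ℕ) := by
    refine (((Is.var ((h₄.reg 10 (by decide) (by decide)).trans hs.n)).mul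
      (Is.var ((h₄.reg 16 (by decide) (by decide)).trans hs.D))).val_eq (n := 0)).trans ?_
    push_cast
    rfl
  apply Ter.seq_pow hL ((h₄.set wm1 (by rw [c₁]; exact hb4)).mono_left hone)
  rintro σ₅ ⟨r₅, h₅⟩
  rw [c₁] at r₅
  apply Ter.seq_pow hL ((h₅.fillSim (by decide) (by decide) (by decide) (by decide)
    XExpr.wf_position (XExpr.wf_weightEntry k) r₅
    (fun v => ((v / (P.D + 1) * dd + v % (P.D + 1) : ℕ) : ℤ))
    (fun v => entry 1 (-2) P.D
        (ClauseFails (2 * N + 1) k G (LeftTrue P.v₀ (v / (P.D + 1)))) (v % (P.D + 1)))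
    (fun v _ w _ h => position_injective hdD h) fun v hv σ' hr h30 ha => by
      have hs' := h₅.setup hs hr ha
      exact ⟨(is_position (n := 4) hs' h30 ((hr 25 (by decide) (by decide)).trans h₅.cols)).val_eq,
        (is_weightEntry hs' (hfam h₅ ha) hb ((hr 20 (by decide) (by decide)).trans
          ((h₅.reg 20 (by decide) (by decide)).trans h20)) h30).val_eq⟩).mono_left
    (hcount (Nat.mul_le_mul hn hD)))
  rintro σ₆ ⟨M₆, wr₆, h₆⟩
  have c₂ : (XExpr.mul (.var 24) (.var 16)).val σ₆ = (mm * (P.D + 1) : ℕ) := by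
    refine (((Is.var h₆.rows).mul
      (Is.var ((h₆.reg 16 (by decide) (by decide)).trans hs.D))).val_eq (n := 0)).trans ?_
    push_cast
    rfl
  apply Ter.seq_pow hL ((h₆.set wm2 (by rw [c₂]; exact hb5)).mono_left hone)
  rintro σ₇ ⟨r₇, h₇⟩
  rw [c₂] at r₇
  apply Ter.seq_pow hL ((h₇.fillSim (by decide) (by decide) (by decide) (by decide)
    XExpr.wf_position (XExpr.wf_exampleEntry k) r₇
    (fun v => ((v / (P.D + 1) * dd + v % (P.D + 1) : ℕ) : ℤ))
    (fun v => entry (bit (e₀ + v / (P.D + 1) < P.E)) 1 P.D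
      (ClauseFails (2 * N + 1) k G (RightTrue P.v₀ (e₀ + v / (P.D + 1)))) (v % (P.D + 1)))
    (fun v _ w _ h => position_injective hdD h) fun v hv σ' hr h30 ha => by
      have hs' := h₇.setup hs hr ha
      exact ⟨(is_position (n := 4) hs' h30 ((hr 25 (by decide) (by decide)).trans h₇.cols)).val_eq,
        (is_exampleEntry hs' (hfam h₇ ha) hb ((hr 20 (by decide) (by decide)).trans
          ((h₇.reg 20 (by decide) (by decide)).trans h20)) h30
          ((hr 23 (by decide) (by decide)).trans
          ((h₇.reg 23 (by decide) (by decide)).trans h23))).val_eq⟩).mono_left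
    (hcount (Nat.mul_le_mul hmX hD)))
  rintro σ₈ ⟨M₈, wr₈, h₈⟩
  refine (h₈.fillSim (by decide) (by decide) (by decide) (by decide) w30 trivial h₈.rows
    (fun v => (v : ℤ)) (fun _ => 1) (fun v _ w _ h => mod_cast h)
    (i := .var 30) (e := .const 1)
    fun v hv σ' hr h30 ha => ⟨h30, rfl⟩).mono
      (hcount (hmX.trans (Nat.le_mul_of_pos_right _ (by omega)))) ?_
  rintro σ₉ ⟨M₉, wr₉, h₉⟩
  refine ⟨M₉, h₉, h₉.sim.simulates (fun x => ?_) fun a t => ?_⟩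
  · rw [wr₉.1 0 (by decide), wr₈.1 0 (by decide), wr₆.1 0 (by decide), wr₄.eq_update,
      wr₃.eq_update, wr₂.eq_update, e₁, e₂, e₃]
    simp only [XExpr.val, XExpr.eval]
    match x with
    | 0 => rfl
    | 1 => rfl
    | 2 => rfl
    | x + 3 =>
      rw [update_of_ne (by push_cast; omega), update_of_ne (by push_cast; omega),
        update_of_ne (by push_cast; omega)]
      rfl
  · match a with
    | 0 =>
      rw [wr₉.1 1 (by decide), wr₈.1 1 (by decide), wr₆.1 1 (by decide), wr₄.1 1 (by decide),
        wr₃.1 1 (by decide), wr₂.1 1 (by decide)]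
      change (0 : ℤ) = ∑ j : Fin P.n, if t = (j : ℤ) then (0 : ℤ) else 0
      simp
    | 1 =>
      rw [wr₉.1 2 (by decide), wr₈.1 2 (by decide)]
      refine storeMat_of_writes hdD (fun j k' => entry 1 (-2) P.D
        (ClauseFails (2 * N + 1) k G (LeftTrue P.v₀ j)) k') (fun j k' hk => ?_) wr₆.2.1
        (fun t ht => ?_) t
      · unfold entry
        omega
      · rw [wr₆.2.2 t ht, wr₄.1 2 (by decide), wr₃.1 2 (by decide), wr₂.1 2 (by decide)]
    | 2 =>
      rw [wr₉.1 3 (by decide)]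
      refine storeMat_of_writes hdD (fun i k' => entry (bit (e₀ + i < P.E)) 1 P.D
        (ClauseFails (2 * N + 1) k G (RightTrue P.v₀ (e₀ + i))) k') (fun j k' hk => ?_) wr₈.2.1
        (fun t ht => ?_) t
      · unfold entry
        omega
      · rw [wr₈.2.2 t ht, wr₆.1 3 (by decide), wr₄.1 3 (by decide), wr₃.1 3 (by decide),
          wr₂.1 3 (by decide)]
    | 3 =>
      refine storeVec_of_writes 1 wr₉.2.1 (fun t ht => ?_) t
      rw [wr₉.2.2 t ht, wr₈.1 4 (by decide), wr₆.1 4 (by decide), wr₄.1 4 (by decide),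
        wr₃.1 4 (by decide), wr₂.1 4 (by decide)]
    | a + 4 =>
      rw [wr₉.1 _ (by omega), wr₈.1 _ (by omega), wr₆.1 _ (by omega), wr₄.1 _ (by omega),
        wr₃.1 _ (by omega), wr₂.1 _ (by omega)]
      rfl

/-! ### Running the simulation and reading its output -/

/-- The effect of a simulation of `p` from memory `m` with `F` units of fuel, in time `T`. -/
structure Simulated (p : Prog) (m : Memory) (n F T : ℕ) (σ σ' : Memory) : Prop where
  own : ∀ a < ownArrays, σ'.arr a = σ.arr a
  reg : ∀ x < scratch, x ≠ fuelReg → σ'.reg x = σ.reg x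
  stamped : σ'.Stamped
  num : ∑ j ∈ range n, bits (σ'.arr (simVal 5) (j : ℤ)) ≤ n + T
  den : ∑ j ∈ range n, bits (σ'.arr (simVal 6) (j : ℤ)) ≤ n + T
  fuel : ∃ F' : ℕ, F' ≤ F ∧ σ'.reg fuelReg = F' ∧
    ((0 < F' ∧ ∃ t m', Runs p m t m' ∧ σ'.Simulates m') ∨
      (F' = 0 ∧ ∀ t m', Runs p m t m' → F ≤ 4 * t))

theorem Ter.meter (p : Prog) : ∃ K, ∀ {σ m : Memory} {V L F n : ℕ}, Prog.Ready σ m V L F →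
    V * (4 * p.weight + 1) < 2 ^ L → p.weight ≤ L →
    (∀ j < n, σ.arr (simVal 5) ((j : ℕ) : ℤ) = 0) →
    (∀ j < n, σ.arr (simVal 6) ((j : ℕ) : ℤ) = 0) →
    Ter p.meter σ (K * (L * (V + F + 1)))
      (Simulated p m n F (K * (L * (V + F + 1))) σ) := by
  obtain ⟨K, hK⟩ := p.exists_metered_meter
  refine ⟨K, fun {σ m V L F n} hr hV hw h5 h6 s hs => ?_⟩
  have hr' : Prog.Ready s m V L F := ⟨hr.sim.congr hs.1 (hs.2 _ (by decide)),
    (hs.2 _ (by decide)).trans hr.fuel, hr.pos, hr.bitsLE, hr.le, by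
      rw [hs.2 stampReg (by decide)]; exact hr.stamp⟩
  obtain ⟨t, s', F', run, ho, hreg, hst, hfuel, hF, h⟩ := hK V L F s m hr' hV hw
  have ht : t ≤ K * (L * (V + F + 1)) := by
    rcases h with ⟨-, t₀, m', -, -, -, -, ht⟩ | ⟨-, -, ht⟩
    · refine ht.trans ?_
      rw [← mul_add, show L + L * (F - F') = L * (F - F' + 1) by ring]
      exact Nat.mul_le_mul_left _ (Nat.mul_le_mul_left _ (by omega))
    · grind
  have hsum : ∀ a, (∀ j < n, σ.arr a ((j : ℕ) : ℤ) = 0) →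
      ∑ j ∈ range n, bits (s'.arr a (j : ℤ)) ≤ n + K * (L * (V + F + 1)) := by
    intro a ha
    have h1 := run.sum_range_bits_le a n
    have h2 : ∑ j ∈ range n, bits (s.arr a (j : ℤ)) = n := by
      rw [sum_congr rfl fun j hj => by rw [hs.1, ha j (mem_range.1 hj), bits_zero]]
      simp
    omega
  refine ⟨t, s', s', run, ht, .refl s', fun a ha => by rw [ho a ha, hs.1], fun x hx hx' => by
    rw [hreg x hx hx', hs.2 x hx], hst, hsum _ h5, hsum _ h6, F', hF, hfuel, ?_⟩
  grind

/-- Write `1` to register `27` if an entry of the computed gradient is not close to zero. -/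
def Prog.scan : Prog :=
  .seq (.assign 30 (.const 0)) (.while (.sub (.var 10) (.var 30))
    (.seq (.assign 40 (.var 30)) (.seq (loadProg 5 40) (.seq (.assign 41 (.var 30))
      (.seq (loadProg 6 41) (.seq
        (.ite (.sub (.mul (.const 16) (.mul (.var 40) (.var 40))) (.mul (.var 41) (.var 41)))
          (.assign 27 (.const 1)) .skip)
        (.assign 30 (.add (.var 30) (.const 1)))))))))

/-- The test of `Prog.scan` succeeds for entry `j`. -/
def Memory.Large (s : Memory) (j : ℕ) : Prop :=
  0 < 16 * (s.rd 5 (j : ℤ) * s.rd 5 (j : ℤ)) - s.rd 6 (j : ℤ) * s.rd 6 (j : ℤ)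

theorem bits_rd_le (s : Memory) (a : ℕ) (i : ℤ) : bits (s.rd a i) ≤ bits (s.arr (simVal a) i) := by
  unfold rd
  split_ifs
  · exact le_rfl
  · rw [bits_zero]; exact bits_pos _

theorem exists_runs_scan (hL : 2 ≤ L) (hst : s.Stamped)
    (hstamp : bits (s.reg stampReg) ≤ L) (hn : s.reg 10 = n) (hb : bits (n : ℤ) ≤ L) :
    ∃ t s', Runs .scan s t s' ∧ s'.arr = s.arr ∧
      (∀ x < scratch, x ≠ 27 → x ≠ 30 → s'.reg x = s.reg x) ∧ s'.reg 30 = n ∧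
      (s'.reg 27 = 1 ∧ (∃ j < n, s.Large j) ∨
        s'.reg 27 = s.reg 27 ∧ ¬ ∃ j < n, s.Large j) ∧
      t ≤ ∑ j ∈ range n, (10 * (bits (s.arr (simVal 5) (j : ℤ)) +
        bits (s.arr (simVal 6) (j : ℤ))) + 80 * L) + 80 * L := by
  let I : ℕ → Memory → Prop := fun v s' => v ≤ n ∧ s'.arr = s.arr ∧
    (∀ x < scratch, x ≠ 27 → x ≠ 30 → s'.reg x = s.reg x) ∧ s'.reg 30 = v ∧
      (s'.reg 27 = 1 ∧ (∃ j < v, s.Large j) ∨ s'.reg 27 = s.reg 27 ∧ ¬ ∃ j < v, s.Large j)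
  have hbv : ∀ v ≤ n, bits (v : ℤ) ≤ L := fun v hv => (bits_mono (by omega)).trans hb
  have htest : ∀ v, ∀ s' : Memory, I v s' →
      (Expr.sub (.var 10) (.var 30)).val s' = (n : ℤ) - v ∧
        (Expr.sub (.var 10) (.var 30)).cost s' + 1 ≤ 5 * L := by
    rintro v s' ⟨hv, -, hr, h30, -⟩
    have h10 : s'.reg 10 = n := (hr 10 (by decide) (by decide) (by decide)).trans hn
    have h1 := hbv v hv
    have h2 := bits_sub (n : ℤ) v
    simp only [Expr.val, Expr.cost, h10, h30]
    exact ⟨trivial, by omega⟩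
  have hpos : ∀ v < n, ∀ s', I v s' → 0 < (Expr.sub (.var 10) (.var 30)).val s' ∧
      (Expr.sub (.var 10) (.var 30)).cost s' + 1 ≤ 5 * L ∧
      ∃ t s'', Runs (.seq (.assign 40 (.var 30)) (.seq (loadProg 5 40) (.seq (.assign 41 (.var 30))
      (.seq (loadProg 6 41) (.seq
        (.ite (.sub (.mul (.const 16) (.mul (.var 40) (.var 40))) (.mul (.var 41) (.var 41)))
          (.assign 27 (.const 1)) .skip)
        (.assign 30 (.add (.var 30) (.const 1)))))))) s' t s'' ∧
      t ≤ 10 * (bits (s.arr (simVal 5) (v : ℤ)) + bits (s.arr (simVal 6) (v : ℤ))) + 75 * L ∧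
      I (v + 1) s'' := by
    intro v hv s' hI
    obtain ⟨h1, h2⟩ := htest v s' hI
    obtain ⟨-, ha, hr, h30, hflag⟩ := hI
    refine ⟨by rw [h1]; omega, h2, ?_⟩
    have hb1 := hbv v hv.le
    have hb1' := hbv (v + 1) hv
    set s₁ := s'.setReg 40 (v : ℤ) with hs₁
    have hrun₁ : Runs (.assign 40 (.var 30)) s' (bits (v : ℤ) + 1) s₁ := by
      have := Runs.assign s' 40 (.var 30)
      simp only [Expr.cost, Expr.val, h30] at this
      exact this
    have hrd : ∀ (s' : Memory) (a : ℕ) (i : ℤ), s'.arr = s.arr → s'.reg stampReg = s.reg stampReg →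
        s'.rd a i = s.rd a i := fun s' a i h h' => by unfold rd; rw [h, h']
    have hstd : ∀ (s' : Memory), s'.arr = s.arr → s'.reg stampReg = s.reg stampReg →
        s'.Stamped := fun s' h h' a i => by rw [h, h']; exact hst a i
    have r₁ : ∀ x, x ≠ 40 → s₁.reg x = s'.reg x := fun x hx => by
      rw [hs₁, setReg_reg, update_of_ne hx]
    have st' := hr stampReg (by decide) (by decide) (by decide)
    have st₁ : s₁.reg stampReg = s.reg stampReg := (r₁ _ (by decide)).trans st'
    have e₁ : s₁.reg 40 = v := by rw [hs₁, setReg_self]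
    obtain ⟨t₂, s₂, hrun₂, ht₂, ha₂, r₂, e₂⟩ := exists_runs_loadProg (τ := 40) 5
      (hstd s₁ ha st₁) (st₁ ▸ hstamp)
    rw [e₁, hrd s₁ _ _ ha st₁] at ht₂ e₂
    have ha₂' : s₂.arr = s.arr := ha₂.trans ha
    set s₃ := s₂.setReg 41 (v : ℤ) with hs₃
    have e30 : s₂.reg 30 = v := by rw [r₂ 30 (by decide), r₁ 30 (by decide), h30]
    have hrun₃ : Runs (.assign 41 (.var 30)) s₂ (bits (v : ℤ) + 1) s₃ := by
      have := Runs.assign s₂ 41 (.var 30)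
      simp only [Expr.cost, Expr.val, e30] at this
      exact this
    have r₃ : ∀ x, x ≠ 41 → s₃.reg x = s₂.reg x := fun x hx => by
      rw [hs₃, setReg_reg, update_of_ne hx]
    have st₃ : s₃.reg stampReg = s.reg stampReg := by rw [r₃ _ (by decide), r₂ _ (by decide), st₁]
    have e₃ : s₃.reg 41 = v := by rw [hs₃, setReg_self]
    obtain ⟨t₄, s₄, hrun₄, ht₄, ha₄, r₄, e₄⟩ := exists_runs_loadProg (τ := 41) 6
      (hstd s₃ ha₂' st₃) (st₃ ▸ hstamp)
    rw [e₃, hrd s₃ _ _ ha₂' st₃] at ht₄ e₄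
    have ha₄' : s₄.arr = s.arr := ha₄.trans ha₂'
    have e40 : s₄.reg 40 = s.rd 5 v := by rw [r₄ 40 (by decide), r₃ 40 (by decide), e₂]
    have hold : ∀ x < scratch, s₄.reg x = s'.reg x := fun x hx => by
      unfold scratch at hx
      rw [r₄ x (by omega), r₃ x (by omega), r₂ x (by omega), r₁ x (by omega)]
    have hv4 : (Expr.sub (.mul (.const 16) (.mul (.var 40) (.var 40)))
        (.mul (.var 41) (.var 41))).val s₄ =
        16 * (s.rd 5 (v : ℤ) * s.rd 5 (v : ℤ)) - s.rd 6 (v : ℤ) * s.rd 6 (v : ℤ) := by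
      simp only [Expr.val, e40, e₄]
    have b5 := bits_rd_le s 5 v
    have b6 := bits_rd_le s 6 v
    have b16 : bits 16 = 6 := by decide
    have hc4 : (Expr.sub (.mul (.const 16) (.mul (.var 40) (.var 40)))
        (.mul (.var 41) (.var 41))).cost s₄ ≤ 8 * bits (s.rd 5 (v : ℤ)) +
          6 * bits (s.rd 6 (v : ℤ)) + 18 := by
      have q1 := bits_mul (s.rd 5 (v : ℤ)) (s.rd 5 (v : ℤ))
      have q2 := bits_mul (s.rd 6 (v : ℤ)) (s.rd 6 (v : ℤ))
      have q3 := bits_mul 16 (s.rd 5 (v : ℤ) * s.rd 5 (v : ℤ))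
      have q4 := bits_sub (16 * (s.rd 5 (v : ℤ) * s.rd 5 (v : ℤ)))
        (s.rd 6 (v : ℤ) * s.rd 6 (v : ℤ))
      simp only [Expr.cost, Expr.val, e40, e₄]
      omega
    have hfinal : ∃ t₅ s₅, Runs (.ite (.sub (.mul (.const 16) (.mul (.var 40) (.var 40)))
        (.mul (.var 41) (.var 41))) (.assign 27 (.const 1)) .skip) s₄ t₅ s₅ ∧
        t₅ ≤ 8 * bits (s.rd 5 (v : ℤ)) + 6 * bits (s.rd 6 (v : ℤ)) + 22 ∧ s₅.arr = s.arr ∧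
        (∀ x < scratch, x ≠ 27 → s₅.reg x = s'.reg x) ∧
        (s₅.reg 27 = 1 ∧ s.Large v ∨ s₅.reg 27 = s'.reg 27 ∧ ¬ s.Large v) := by
      by_cases hlarge : s.Large v
      · refine ⟨_, _, .ite_pos (by rw [hv4]; exact hlarge) (.assign _ _ _), ?_, ha₄',
          fun x hx hx' => ?_, Or.inl ⟨?_, hlarge⟩⟩
        · have : (Expr.const 1).cost s₄ = 2 := bits_one
          omega
        · rw [setReg_reg, update_of_ne hx', hold x hx]
        · rw [setReg_self]; rfl
      · exact ⟨_, _, .ite_neg (by rw [hv4]; exact hlarge) (.skip _), by omega, ha₄',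
          fun x hx _ => hold x hx, Or.inr ⟨hold 27 (by decide), hlarge⟩⟩
    obtain ⟨t₅, s₅, hrun₅, ht₅, ha₅, r₅, hflag₅⟩ := hfinal
    have h30' : s₅.reg 30 = v := (r₅ 30 (by decide) (by decide)).trans h30
    refine ⟨_, _, .seq hrun₁ (.seq hrun₂ (.seq hrun₃ (.seq hrun₄ (.seq hrun₅
      (.assign s₅ 30 (.add (.var 30) (.const 1))))))), ?_, hv, ha₅, fun x h1 h2 h3 => ?_, ?_, ?_⟩
    · simp only [Expr.cost, Expr.val, h30', bits_one]
      push_cast at hb1'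
      omega
    · rw [setReg_reg, update_of_ne h3, r₅ x h1 h2, hr x h1 h2 h3]
    · rw [setReg_self]
      simp only [Expr.val, h30']
      push_cast
      rfl
    · rw [setReg_of_ne (by decide)]
      rcases hflag₅ with ⟨f1, f2⟩ | ⟨f1, f2⟩
      · exact Or.inl ⟨f1, v, by omega, f2⟩
      · rw [f1]
        rcases hflag with ⟨f3, j, hj, f4⟩ | ⟨f3, f4⟩
        · exact Or.inl ⟨f3, j, by omega, f4⟩
        · refine Or.inr ⟨f3, ?_⟩
          rintro ⟨j, hj, hlj⟩
          rcases Nat.lt_succ_iff_lt_or_eq.1 hj with h | rfl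
          · exact f4 ⟨j, h, hlj⟩
          · exact f2 hlj
  have hneg : ∀ s', I n s' → ¬ 0 < (Expr.sub (.var 10) (.var 30)).val s' ∧
      (Expr.sub (.var 10) (.var 30)).cost s' + 1 ≤ 5 * L := by
    intro s' hI
    obtain ⟨h1, h2⟩ := htest n s' hI
    exact ⟨by rw [h1]; omega, h2⟩
  obtain ⟨t, s', run, ht, hI⟩ := Runs.exists_while (e := .sub (.var 10) (.var 30)) I n
    (fun j => 10 * (bits (s.arr (simVal 5) (j : ℤ)) + bits (s.arr (simVal 6) (j : ℤ))) + 75 * L)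
    (5 * L) hpos hneg (s.setReg 30 0) ⟨Nat.zero_le _, rfl,
      fun x _ _ hx => by rw [setReg_reg, update_of_ne hx], by
        rw [setReg_self]; rfl, Or.inr ⟨rfl, by simp⟩⟩
  refine ⟨_, s', .seq (.assign _ _ _) run, hI.2.1, hI.2.2.1, hI.2.2.2.1, hI.2.2.2.2, ?_⟩
  have h1 : ∀ j ∈ range n, 10 * (bits (s.arr (simVal 5) (j : ℤ)) +
      bits (s.arr (simVal 6) (j : ℤ))) + 75 * L + 5 * L ≤ 10 * (bits (s.arr (simVal 5) (j : ℤ)) +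
      bits (s.arr (simVal 6) (j : ℤ))) + 80 * L := fun j _ => by omega
  have h2 := sum_le_sum h1
  simp only [Expr.cost, bits_zero]
  omega

/-! ### A call of the gradient program -/

theorem Ter.scan {S : ℕ} (hσ : σ.Good L) (hst : σ.Stamped) (hn : σ.reg 10 = n)
    (h5 : ∑ j ∈ range n, bits (σ.arr (simVal 5) (j : ℤ)) ≤ S)
    (h6 : ∑ j ∈ range n, bits (σ.arr (simVal 6) (j : ℤ)) ≤ S) :
    Ter .scan σ (20 * S + 80 * L * (n + 1)) fun σ' => σ'.arr = σ.arr ∧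
      (∀ x < scratch, x ≠ 27 → x ≠ 30 → σ'.reg x = σ.reg x) ∧ σ'.reg 30 = n ∧
      (σ'.reg 27 = 1 ∧ (∃ j < n, σ.Large j) ∨
        σ'.reg 27 = σ.reg 27 ∧ ¬ ∃ j < n, σ.Large j) := by
  intro s hs
  have hb : bits (n : ℤ) ≤ L := hn ▸ hσ.reg 10 (by decide)
  have hst' : s.reg stampReg = σ.reg stampReg := hs.2 _ (by decide)
  obtain ⟨t, s', run, h1, h2, h3, h4, ht⟩ := exists_runs_scan (s := s) (n := n) hσ.two_le
    (fun a i => by rw [hs.1, hst']; exact hst a i)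
    (by rw [hst']; exact hσ.reg stampReg (by decide)) ((hs.2 10 (by decide)).trans hn) hb
  have hlarge : ∀ j, s.Large j ↔ σ.Large j := fun j => by
    unfold Memory.Large rd
    rw [hs.1, hst']
  simp only [hlarge] at h4
  rw [hs.2 27 (by decide)] at h4
  refine ⟨t, s', s', run, ht.trans ?_, .refl s', h1.trans hs.1, fun x hx hx1 hx2 =>
    (h2 x hx hx1 hx2).trans (hs.2 x hx), h3, h4⟩
  rw [sum_add_distrib, ← mul_sum, sum_add_distrib, hs.1, sum_const,
    card_range, smul_eq_mul]
  nlinarith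

theorem bits_storeVec_le {v : Fin r → ℤ} (hv : ∀ j, bits (v j) ≤ B) (hB : 1 ≤ B)
    (t : ℤ) : bits (storeVec v t) ≤ B := by
  by_cases h : ∃ j : Fin r, t = (j : ℤ)
  · obtain ⟨j, rfl⟩ := h
    rw [storeVec_apply]
    exact hv j
  · rw [storeVec_eq_zero _ fun j hj => h ⟨j, hj⟩, bits_zero]
    exact hB

theorem bits_storeMat_le {X : Fin r → Fin c → ℤ} (hX : ∀ j k, bits (X j k) ≤ B)
    (hB : 1 ≤ B) (t : ℤ) : bits (storeMat X t) ≤ B := by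
  by_cases h : ∃ (j : Fin r) (k : Fin c), t = (j : ℤ) * c + k
  · obtain ⟨j, k, rfl⟩ := h
    rw [storeMat_apply]
    exact hX j k
  · rw [storeMat_eq_zero _ fun j k hjk => h ⟨j, k, hjk⟩, bits_zero]
    exact hB

theorem Instance.bitsLE_input {I : Instance n m d} (hI : I.EntriesLE 2)
    (hn : bits (n : ℤ) ≤ B) (hm : bits (m : ℤ) ≤ B) (hd : bits (d : ℤ) ≤ B) (hB : 3 ≤ B) :
    I.input.BitsLE B := by
  have h2 : ∀ z : ℤ, |z| ≤ (2 : ℕ) → bits z ≤ B := fun z hz => by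
    have h3 : bits 2 = 3 := by decide
    have : bits z ≤ bits 2 := bits_mono (by have := abs_le.1 hz; omega)
    omega
  have h0 : bits 0 ≤ B := by rw [bits_zero]; omega
  refine ⟨fun x => ?_, fun a t => ?_⟩
  · match x with
    | 0 => exact hn
    | 1 => exact hm
    | 2 => exact hd
    | x + 3 => exact h0
  · match a with
    | 0 => exact bits_storeVec_le (fun j => h2 _ (hI.1 j)) (by omega) t
    | 1 => exact bits_storeMat_le (fun j k => h2 _ (hI.2.1 j k)) (by omega) t
    | 2 => exact bits_storeMat_le (fun j k => h2 _ (hI.2.2 j k)) (by omega) t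
    | 3 =>
      refine bits_storeVec_le (fun j => h2 _ ?_) (by omega) t
      rcases I.label j with h | h <;> rw [h] <;> simp
    | a + 4 => exact h0

/-- Run `p` on the instance for a family of clauses and a block of assignments; if the fuel does not
suffice, try the next size. -/
noncomputable def Prog.call (p : Prog) (k : ℕ) : Prog :=
  .seq (.loadInstance k) (.seq (.set fuelReg (.add (.mul (.var 14) (.var 24)) (.const 1)))
    (.seq p.meter (.cond (.var fuelReg) (.seq .scan (.set 23 (.add (.var 23) (.var 24))))
      (.set 22 (.add (.var 22) (.const 1))))))

/-- The registers that change in a call. -/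
abbrev callRegs : List ℕ := [22, 23, 24, 25, 27, 30, 31, 38, 39]

/-- Own arrays and registers outside `callRegs` have not changed. -/
structure Memory.Kept (σ σ' : Memory) : Prop where
  own : ∀ a < ownArrays, σ'.arr a = σ.arr a
  reg : ∀ x < scratch, x ∉ callRegs → σ'.reg x = σ.reg x

theorem Memory.Kept.trans {σ'' : Memory} (h : σ.Kept σ') (h' : σ'.Kept σ'') : σ.Kept σ'' :=
  ⟨fun a ha => (h'.own a ha).trans (h.own a ha),
    fun x hx hx' => (h'.reg x hx hx').trans (h.reg x hx hx')⟩

theorem Memory.Kept.setReg (h : σ.Kept σ') (hx : x ∈ callRegs) (z : ℤ) :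
    σ.Kept (σ'.setReg x z) :=
  ⟨h.own, fun y hy hy' => by
    rw [setReg_of_ne (by rintro rfl; exact hy' hx)]
    exact h.reg y hy hy'⟩

/-- The bounds on the sizes in a call with `mm` examples of dimension `dd` that make every number in
it have at most `L` bits, and its cost proportional to `X`. -/
structure CallBounds (p : Prog) (L X : ℕ) (P : Params) (γ e₀ mm dd : ℕ) (stamp : ℤ) : Prop where
  rows : mm = P.w + γ / P.range
  cols : dd = P.D + 1 + γ % P.range
  units_le : P.n ≤ X
  rows_le : mm ≤ X
  fuel_le : P.fuel * mm + 1 ≤ X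
  dim : P.D + 1 ≤ L
  bits_rows : bits (mm : ℤ) ≤ L
  bits_cols : bits (dd : ℤ) ≤ L
  bits_stamp : bits (stamp + 1) ≤ L
  bits_weights : bits ((P.n * (P.D + 1) : ℕ) : ℤ) ≤ L
  bits_examples : bits ((mm * (P.D + 1) : ℕ) : ℤ) ≤ L
  bits_fuel : bits ((P.fuel * mm + 1 : ℕ) : ℤ) ≤ L
  bits_next : bits ((e₀ + mm : ℕ) : ℤ) ≤ L
  bits_size : bits ((γ + 1 : ℕ) : ℤ) ≤ L
  space : (X + L) * (4 * p.weight + 1) < 2 ^ L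
  weight : p.weight ≤ L

theorem Ter.call {c : ℝ} (hp : Detects l K δ c p) (k : ℕ) :
    ∃ w, ∀ {L X N γ I e₀ mm dd : ℕ} {P : Params} {σ : Memory} {G : Finset (Multiset ℕ)},
    σ.Good L → Setup k N P σ → HoldsFamily k (2 * N) σ I G →
    Bounded k (2 * N) G → (minimals G).card ≤ P.D → σ.Stamped →
    σ.reg 20 = I → σ.reg 22 = γ → σ.reg 23 = e₀ →
    CallBounds p L X P γ e₀ mm dd (σ.reg stampReg) →
    Ter (p.call k) σ (X * L ^ w) fun σ' => σ'.Good L ∧ σ'.Stamped ∧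
      σ'.reg stampReg = σ.reg stampReg + 1 ∧ σ.Kept σ' ∧
      ((σ'.reg 22 = γ ∧ σ'.reg 23 = (e₀ + mm : ℕ) ∧
        (σ'.reg 27 = 1 ∧
          (∃ j < P.n, ∃ i < mm, e₀ + i < P.E ∧ Satisfies (LitTrue P.v₀ j (e₀ + i)) G) ∨
        σ'.reg 27 = σ.reg 27 ∧
          ¬ ∃ j < P.n, ∃ i < mm, e₀ + i < P.E ∧ Satisfies (LitTrue P.v₀ j (e₀ + i)) G)) ∨
      (σ'.reg 22 = (γ + 1 : ℕ) ∧ σ'.reg 23 = e₀ ∧ σ'.reg 27 = σ.reg 27 ∧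
        ∃ (J : Instance P.n mm dd) (g : EuclideanSpace ℝ (Fin P.n)) (t : ℕ) (s : Memory),
          J.EntriesLE K ∧ J.IsGradient l g ∧ Runs p J.input t s ∧ P.fuel * mm + 1 ≤ 4 * t)) := by
  obtain ⟨w₀, hload⟩ := Ter.loadInstance k
  obtain ⟨C, hmeter⟩ := Ter.meter p
  refine ⟨w₀ + ((XExpr.add (.mul (.var 14) (.var 24)) (.const 1)).deg + 2 + (C + 4 +
    (4 + (C + 12 + ((XExpr.add (.var 23) (.var 24)).deg + 2) +
      ((XExpr.add (.var 22) (.const 1)).deg + 2) + 1) + 1) + 1) + 1) + 1, ?_⟩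
  intro L X N γ I e₀ mm dd P σ₀ G hσ hs hG hb hD hst h20 h22 h23 B
  have hL := hσ.two_le
  have hX : 1 ≤ X := by have := B.fuel_le; omega
  have hone : ∀ {T : ℕ}, T ≤ X * T := fun {T} => Nat.le_mul_of_pos_left _ hX
  have wf1 : (XExpr.add (.mul (.var 14) (.var 24)) (.const 1)).WF := by simp
  have wf2 : (XExpr.add (.var 23) (.var 24)).WF := by simp
  have wf3 : (XExpr.add (.var 22) (.const 1)).WF := by simp
  have wf4 : (XExpr.var fuelReg).WF := by simp [fuelReg]
  refine Ter.seq_pow hL (hload hσ hs hG hb hst h20 h22 h23 B.rows B.cols hX B.units_le B.rows_le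
    B.dim B.bits_rows B.bits_cols B.bits_stamp B.bits_weights B.bits_examples) ?_
  rintro σ₁ ⟨M, h₁, hsim⟩
  have hfuel : (XExpr.add (.mul (.var 14) (.var 24)) (.const 1)).val σ₁ =
      (P.fuel * mm + 1 : ℕ) := by
    refine ((((Is.var ((h₁.reg 14 (by decide) (by decide)).trans hs.fuel)).mul
      (Is.var h₁.rows)).add (Is.const 1)).val_eq (n := 0)).trans ?_
    push_cast
    rfl
  set F := P.fuel * mm + 1 with hF
  set σ₂ := σ₁.setReg fuelReg (F : ℤ) with hσ₂
  refine Ter.set_seq_pow h₁.good wf1 hX hfuel ?_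
  have g₂ : σ₂.Good L := h₁.good.setReg B.bits_fuel
  have k₁ : σ₀.Kept σ₁ :=
    ⟨h₁.own, fun x hx hx' => h₁.reg x hx fun h => hx' ((by decide : loadRegs ⊆ callRegs) h)⟩
  have k₂ : σ₀.Kept σ₂ := k₁.setReg (by decide) _
  set J := P.instance N k G e₀ mm dd with hJ
  have hent : ∀ K, 2 ≤ K → J.EntriesLE K := fun K hK => entriesLE_searchInstance hK _ _ _
  have hbn : bits (P.n : ℤ) ≤ L := hs.n ▸ hσ.reg 10 (by decide)
  have hready : Prog.Ready σ₂ J.input (X + L) L F := by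
    refine ⟨hsim.congr rfl ?_, ?_, by omega, Instance.bitsLE_input (hent 2 le_rfl)
      (by omega) (by have := B.bits_rows; omega) (by have := B.bits_cols; omega) (by omega), ?_,
      g₂.reg stampReg (by decide)⟩
    · rw [hσ₂, setReg_of_ne (by decide)]
    · rw [hσ₂, setReg_self]
    · have := B.fuel_le; omega
  set T := C * (L * (X + L + F + 1)) with hT
  have hTle : T ≤ X * L ^ (C + 4) := by
    have h1 : C ≤ L ^ C := (Nat.lt_two_pow_self).le.trans (Nat.pow_le_pow_left hL _)
    have h2 : X + L + F + 1 ≤ X * L ^ 3 := by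
      have h3 := B.fuel_le
      have h4 : L + 3 ≤ L ^ 3 := by
        have : 4 * L ≤ L ^ 3 := by
          have := pow_four_le (d := 1) hL
          rwa [pow_one] at this
        omega
      nlinarith [Nat.mul_le_mul_left X h4]
    calc T ≤ L ^ C * (L * (X * L ^ 3)) :=
        Nat.mul_le_mul h1 (Nat.mul_le_mul_left _ h2)
      _ = X * L ^ (C + 4) := by rw [pow_add]; ring
  refine Ter.seq_pow hL ((hmeter (n := P.n) hready B.space B.weight (fun j hj => h₁.num j hj)
    fun j hj => h₁.den j hj).mono_left hTle) ?_
  rintro σ₃ h₃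
  have k₃ : σ₀.Kept σ₃ := ⟨fun a ha => (h₃.own a ha).trans (k₂.own a ha), fun x hx hx' => by
    rw [h₃.reg x hx (by rintro rfl; exact absurd hx' (by decide))]
    exact k₂.reg x hx hx'⟩
  obtain ⟨F', hF', hfuel', hcase⟩ := h₃.fuel
  have g₃ : σ₃.Good L := by
    refine ⟨hL, fun x hx => ?_, fun a ha i => by rw [h₃.own a ha]; exact g₂.arr a ha i,
      fun r hr => ?_⟩
    · by_cases h : x = fuelReg
      · rw [h, hfuel']
        exact (bits_mono (by omega)).trans B.bits_fuel
      · rw [h₃.reg x hx h]; exact g₂.reg x hx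
    · rw [h₃.reg r (hr.trans boundRegs_lt) (by unfold boundRegs at hr; unfold fuelReg; omega)]
      exact g₂.bound r hr
  have old : ∀ x < scratch, x ≠ fuelReg → σ₃.reg x = σ₁.reg x := fun x hx hx' => by
    rw [h₃.reg x hx hx', hσ₂, setReg_reg, update_of_ne hx']
  have o20 : ∀ x ∈ [22, 23, 27], σ₃.reg x = σ₀.reg x := by
    intro x hx
    simp at hx
    rcases hx with rfl | rfl | rfl <;>
      exact (old _ (by decide) (by decide)).trans (h₁.reg _ (by decide) (by decide))
  have o39 : σ₃.reg stampReg = σ₀.reg stampReg + 1 := (old _ (by decide) (by decide)).trans h₁.stamp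
  have o24 : σ₃.reg 24 = mm := (old _ (by decide) (by decide)).trans h₁.rows
  have o22 := (o20 22 (by simp)).trans h22
  have o23 := (o20 23 (by simp)).trans h23
  have hgrad := exists_gradient_searchInstance hp.hasDerivAt hp.lt (n := P.n) (m := mm) (d := dd) (D := P.D)
    (by have := B.cols; omega) (fun i => e₀ + i < P.E)
    (fun i => ClauseFails (2 * N + 1) k G (RightTrue P.v₀ (e₀ + i)))
    (fun j => ClauseFails (2 * N + 1) k G (LeftTrue P.v₀ j))
  obtain ⟨g, hg, htest⟩ := hgrad
  obtain ⟨t, s, hrun, happ⟩ := hp.computes P.n mm dd J g (hent K hp.two_le) hg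
  refine (Ter.cond g₃ wf4 (T := X * L ^ (C + 12 + ((XExpr.add (.var 23) (.var 24)).deg + 2) +
      ((XExpr.add (.var 22) (.const 1)).deg + 2) + 1)) (fun hpos => ?_) fun hneg => ?_).mono_left ?_
  · rw [show (XExpr.var fuelReg).val σ₃ = F' from hfuel'] at hpos
    rcases hcase with ⟨-, t', m', hrun', hsim'⟩ | ⟨h0, -⟩
    swap
    · omega
    obtain rfl : s = m' := (hrun.deterministic hrun').2
    have hlarge : (∃ j < P.n, σ₃.Large j) ↔
        ∃ j < P.n, ∃ i < mm, e₀ + i < P.E ∧ Satisfies (LitTrue P.v₀ j (e₀ + i)) G := by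
      refine exists_congr fun j => and_congr_right fun hj => ?_
      unfold Memory.Large
      rw [hsim'.arr 4 j, hsim'.arr 5 j, htest s δ hp.le happ j hj]
      refine exists_congr fun i => and_congr_right fun _ => and_congr_right fun _ => ?_
      rw [satisfies_iff_not_clauseFails hb hD fun l => (litTrue_iff P.v₀ j (e₀ + i) l).trans or_comm]
    refine (Ter.seq_pow hL (b := (XExpr.add (.var 23) (.var 24)).deg + 2) ((Ter.scan g₃ h₃.stamped ((k₃.reg 10 (by decide) (by decide)).trans hs.n)
      h₃.num h₃.den).mono_left (?_ : _ ≤ X * L ^ (C + 12))) ?_).mono_left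
        (Nat.mul_le_mul_left _ (Nat.pow_le_pow_right (by omega) (by omega)))
    · have h1 : 1 ≤ L ^ (C + 4) := Nat.one_le_pow _ _ (by omega)
      have h2 : L ≤ L ^ (C + 4) := Nat.le_self_pow (by omega) _
      have h3 : 200 ≤ L ^ 8 := (by norm_num : 200 ≤ 2 ^ 8).trans (Nat.pow_le_pow_left hL 8)
      have h4 := B.units_le
      calc 20 * (P.n + T) + 80 * L * (P.n + 1)
          ≤ 20 * (X * L ^ (C + 4) + X * L ^ (C + 4)) + 80 * L ^ (C + 4) * (X + X) := by
            have h5 : P.n ≤ X * L ^ (C + 4) := h4.trans (Nat.le_mul_of_pos_right _ h1)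
            gcongr
        _ = X * (200 * L ^ (C + 4)) := by ring
        _ ≤ X * (L ^ 8 * L ^ (C + 4)) := by gcongr
        _ = X * L ^ (C + 12) := by rw [← pow_add]; congr 2; omega
    · rintro σ₄ ⟨ha, hr, h30, hflag⟩
      have g₄ : σ₄.Good L := by
        refine ⟨hL, fun x hx => ?_, fun a ha' i => by rw [ha]; exact g₃.arr a ha' i,
          fun r hr' => ?_⟩
        · by_cases h27 : x = 27
          · rcases hflag with ⟨h, -⟩ | ⟨h, -⟩
            · rw [h27, h, bits_one]; exact hL
            · rw [h27, h]; exact g₃.reg 27 (by decide)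
          · by_cases h30' : x = 30
            · rw [h30', h30]; exact hbn
            · rw [hr x hx h27 h30']; exact g₃.reg x hx
        · unfold boundRegs at hr'
          rw [hr r (by unfold scratch; omega) (by omega) (by omega)]
          exact g₃.bound r hr'
      have hval : (XExpr.add (.var 23) (.var 24)).val σ₄ = (e₀ + mm : ℕ) := by
        refine (((Is.var ((hr 23 (by decide) (by decide) (by decide)).trans o23)).add
          (Is.var ((hr 24 (by decide) (by decide) (by decide)).trans o24))).val_eq
            (n := 0)).trans ?_
        push_cast
        rfl
      refine (Ter.set g₄ wf2 ?_).mono_left hone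
      rw [hval]
      have hst₄ : σ₄.reg stampReg = σ₃.reg stampReg :=
        hr _ (by decide) (by decide) (by decide)
      have k₄ : σ₀.Kept σ₄ := k₃.trans ⟨fun a _ => by rw [ha], fun x hx hx' =>
        hr x hx (by rintro rfl; simp at hx') (by rintro rfl; simp at hx')⟩
      refine ⟨g₄.setReg B.bits_next, fun a i => ?_, hst₄.trans o39, k₄.setReg (by decide) _,
        Or.inl ⟨(hr 22 (by decide) (by decide) (by decide)).trans o22, rfl, ?_⟩⟩
      · have := h₃.stamped a i
        rwa [← ha, ← hst₄] at this
      · rw [← hlarge, ← o20 27 (by simp)]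
        exact hflag
  · rw [show (XExpr.var fuelReg).val σ₃ = F' from hfuel'] at hneg
    have hval : (XExpr.add (.var 22) (.const 1)).val σ₃ = (γ + 1 : ℕ) := by
      refine (((Is.var o22).add (Is.const 1)).val_eq (n := 0)).trans ?_
      push_cast
      rfl
    refine ((Ter.set g₃ wf3 ?_).mono_left hone).mono_left
      (Nat.mul_le_mul_left _ (Nat.pow_le_pow_right (by omega) (by omega)))
    rw [hval]
    refine ⟨g₃.setReg B.bits_size, h₃.stamped, o39, k₃.setReg (by decide) _,
      Or.inr ⟨rfl, o23, o20 27 (by simp), J, g, t, s, hent K hp.two_le, hg, hrun, ?_⟩⟩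
    rcases hcase with ⟨h0, -⟩ | ⟨-, h⟩
    · omega
    · exact h t s hrun
  · refine (Nat.add_le_add_right hone _).trans ?_
    rw [← mul_add]
    exact Nat.mul_le_mul_left _ (pow_add_pow_le hL)

/-! ### Searching all assignments for one family of clauses -/

/-- The sizes that can occur when the gradient program is fast on instances with `mS` examples of
dimension `dS`: every number is at most `Z`. -/
structure Scale (p : Prog) (l : ℝ → ℝ) (K L U Z mS dS : ℕ) (P : Params) : Prop where
  rows : P.w ≤ mS
  rows_pos : 1 ≤ P.w
  cols : P.D + 1 ≤ dS
  cols_lt : dS - (P.D + 1) < P.range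
  units_le : P.n ≤ U * P.w
  fuel_lt : P.fuel + 1 ≤ U
  dim : P.D + 1 ≤ L
  weight : p.weight ≤ L
  space : (U * mS + L) * (4 * p.weight + 1) < 2 ^ L
  lt : Z < 2 ^ (L - 1)
  sum_le : (U + P.D + P.E + mS + P.range + 2) * (mS + P.range + P.D + P.n + 2) ≤ Z
  fast : ∀ (J : Instance P.n mS dS) (g : EuclideanSpace ℝ (Fin P.n)) (t : ℕ) (s : Memory),
    J.EntriesLE K → J.IsGradient l g → Runs p J.input t s → 4 * t ≤ P.fuel * mS

/-- The last size that is tried. -/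
def Params.last (P : Params) (mS dS : ℕ) : ℕ := (mS - P.w) * P.range + (dS - (P.D + 1))

theorem bits_le_of_le {Z : ℕ} (h : Z < 2 ^ (L - 1)) (hL : 2 ≤ L) (h0 : 0 ≤ z)
    (hz : z ≤ Z) : bits z ≤ L := by
  have h1 := bits_natCast_le Z (L - 1) h
  have h2 : bits z ≤ bits (Z : ℤ) := bits_mono (by omega)
  omega

section

variable {p : Prog} {l : ℝ → ℝ} {K L U Z mS dS : ℕ} {P : Params}

theorem Scale.last_le (h : Scale p l K L U Z mS dS P) :
    P.last mS dS + 1 ≤ Z := by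
  have h1 := h.cols_lt
  have h2 := h.sum_le
  have h3 : (mS - P.w) * P.range ≤ mS * P.range := Nat.mul_le_mul_right _ (Nat.sub_le _ _)
  unfold Params.last
  grind

theorem Scale.callBounds (h : Scale p l K L U Z mS dS P) (hL : 2 ≤ L) {γ e₀ : ℕ}
    (hγ : γ ≤ P.last mS dS) (he : e₀ ≤ P.E) {stamp : ℤ} (h0 : 0 ≤ stamp) (hst : stamp + 1 ≤ Z) :
    CallBounds p L (U * (P.w + γ / P.range)) P γ e₀ (P.w + γ / P.range)
        (P.D + 1 + γ % P.range) stamp ∧ P.w + γ / P.range ≤ mS := by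
  have hr : 0 < P.range := by have := h.cols_lt; omega
  have hmm : P.w + γ / P.range ≤ mS := by
    have h1 : γ / P.range ≤ mS - P.w := by
      refine Nat.lt_succ_iff.1 (Nat.div_lt_of_lt_mul ?_)
      have h1 := h.cols_lt
      unfold Params.last at hγ
      calc γ < (mS - P.w) * P.range + P.range := by omega
        _ = P.range * (mS - P.w).succ := by rw [Nat.succ_eq_add_one]; ring
    have := h.rows
    omega
  have hdd : γ % P.range < P.range := Nat.mod_lt _ hr
  obtain ⟨mm, hmm'⟩ : ∃ mm, mm = P.w + γ / P.range := ⟨_, rfl⟩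
  have hw' : P.w ≤ mm := hmm' ▸ Nat.le_add_right _ _
  rw [← hmm'] at hmm ⊢
  have hU := h.fuel_lt
  have hw := h.rows_pos
  have hsum := h.sum_le
  have hmm1 : 1 ≤ mm := by omega
  have hfuel : P.fuel * mm + 1 ≤ U * mm := by nlinarith
  have hfuel' : U * mm ≤ U * mS := Nat.mul_le_mul_left _ hmm
  have e1 : P.n * (P.D + 1) ≤ Z := by
    refine le_trans ?_ hsum
    rw [mul_comm]
    exact Nat.mul_le_mul (by omega) (by omega)
  have e2 : mm * (P.D + 1) ≤ Z := by
    refine le_trans ?_ hsum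
    rw [mul_comm]
    exact Nat.mul_le_mul (by omega) (by omega)
  have e3 : U * mS ≤ Z := le_trans (Nat.mul_le_mul (by omega) (by omega)) hsum
  have e4 : P.E + mS + P.D + P.range + 2 ≤ Z := by nlinarith
  have e5 := h.last_le
  have hb : ∀ {z : ℤ}, 0 ≤ z → z ≤ Z → bits z ≤ L := bits_le_of_le h.lt hL
  refine ⟨⟨hmm', rfl, ?_, ?_, hfuel, h.dim, hb (by positivity) (by omega),
    hb (by positivity) (by omega), hb (by omega) hst, hb (by positivity) (mod_cast e1),
    hb (by positivity) (mod_cast e2), hb (by positivity) (mod_cast by omega),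
    hb (by positivity) (mod_cast by omega),
    hb (by positivity) (mod_cast by omega), ?_, h.weight⟩, hmm⟩
  · exact h.units_le.trans (Nat.mul_le_mul_left _ (by omega))
  · exact Nat.le_mul_of_pos_left _ (by omega)
  · exact lt_of_le_of_lt (Nat.mul_le_mul_right _ (by omega)) h.space

end

/-- Search all assignments for the family of clauses that register `20` refers to. -/
noncomputable def Prog.leaf (p : Prog) (k : ℕ) : Prog :=
  .seq (.set 22 (.const 0)) (.seq (.set 23 (.const 0))
    (.while (.sub (.var 11) (.var 23)) (p.call k)))

/-- The assignment that consists of the bits of some `j < n` and `e < E` satisfies the family. -/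
def Params.Sat (P : Params) (G : Finset (Multiset ℕ)) : Prop :=
  ∃ j < P.n, ∃ e < P.E, Satisfies (LitTrue P.v₀ j e) G

theorem Memory.Kept.refl (σ : Memory) : σ.Kept σ := ⟨fun _ _ => rfl, fun _ _ _ => rfl⟩

theorem Memory.Kept.setup (h : σ.Kept σ')
    (hs : Setup k N P σ) : Setup k N P σ' := by
  refine hs.congr (fun x h1 h2 => h.reg x (by unfold scratch; omega) ?_) (h.own 2 (by decide))
  simp
  omega

/-- The time for `Prog.leaf`. -/
def leafTime (L U w E mS last : ℕ) : ℕ := (U * L ^ w + L ^ 4) * (E + mS + mS * last + 2)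

theorem Ter.leaf {c : ℝ} (hp : Detects l K δ c p) (k : ℕ) :
    ∃ w, ∀ {L N U Z I mS dS : ℕ} {P : Params} {σ : Memory} {G : Finset (Multiset ℕ)},
    Scale p l K L U Z mS dS P → σ.Good L → Setup k N P σ →
    HoldsFamily k (2 * N) σ I G →
    Bounded k (2 * N) G → (minimals G).card ≤ P.D → σ.Stamped → σ.reg 20 = I →
    σ.reg stampReg + leafTime L U w P.E mS (P.last mS dS) ≤ Z →
    Ter (p.leaf k) σ (leafTime L U w P.E mS (P.last mS dS)) fun σ' => σ'.Good L ∧ σ'.Stamped ∧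
      σ'.reg stampReg ≤ σ.reg stampReg + leafTime L U w P.E mS (P.last mS dS) ∧ σ.Kept σ' ∧
      (0 < σ'.reg 27 ↔ 0 < σ.reg 27 ∨ P.Sat G) := by
  obtain ⟨w, hcall⟩ := Ter.call hp k
  refine ⟨w, fun {L N U Z I mS dS P σ₀ G} S hσ hs hG hb hD hst h20 hZ => ?_⟩
  have hL := hσ.two_le
  set last := P.last mS dS with hlast
  set V := U * L ^ w + L ^ 4 with hV
  let I' : Memory → ℕ → Prop := fun σ b => ∃ γ e₀ : ℕ, γ ≤ last ∧ e₀ ≤ P.E + mS ∧ σ.Good L ∧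
    σ.Stamped ∧ σ.reg stampReg + b ≤ σ₀.reg stampReg + V * (P.E + mS + mS * last + 1) ∧
    σ₀.Kept σ ∧ σ.reg 22 = γ ∧ σ.reg 23 = e₀ ∧
    (0 < σ.reg 27 ↔ 0 < σ₀.reg 27 ∨
      ∃ j < P.n, ∃ e < e₀, e < P.E ∧ Satisfies (LitTrue P.v₀ j e) G) ∧
    b = V * ((P.E + mS - e₀) + mS * (last - γ) + 1)
  have hL4 := four_mul_add_one_le_pow hL
  have hsplit : leafTime L U w P.E mS last = V * (P.E + mS + mS * last + 1) + V := by
    unfold leafTime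
    rw [← hV]
    ring
  have hVL : L ^ 4 ≤ V := by omega
  have hV3 : 2 * L ^ 3 ≤ V := by
    refine le_trans ?_ hVL
    calc 2 * L ^ 3 ≤ L * L ^ 3 := Nat.mul_le_mul_right _ hL
      _ = L ^ 4 := by ring
  have hloop : ∀ σ, I' σ (V * (P.E + mS + mS * last + 1)) →
      Ter (.while (.sub (.var 11) (.var 23)) (p.call k)) σ (V * (P.E + mS + mS * last + 1))
      fun σ' => σ'.Good L ∧ σ'.Stamped ∧
        σ'.reg stampReg ≤ σ₀.reg stampReg + leafTime L U w P.E mS last ∧ σ₀.Kept σ' ∧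
        (0 < σ'.reg 27 ↔ 0 < σ₀.reg 27 ∨ P.Sat G) := by
    intro σ hI
    refine Ter.while_lt (by decide) (by decide) I' (L ^ 4) ?_ ?_ ?_ hI
    · rintro σ b ⟨γ, e₀, -, -, hg, -⟩
      have h1 := hg.reg 11 (by decide)
      have h2 := hg.reg 23 (by decide)
      omega
    · rintro σ b ⟨γ, e₀, hγ, he, hg, hst', hstamp, hk, h22, h23, hflag, rfl⟩ hlt
      have hE : σ.reg 11 = P.E := (hk.reg 11 (by decide) (by decide)).trans hs.E
      rw [hE, h23] at hlt
      have hlt' : e₀ < P.E := mod_cast hlt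
      have h0 : 0 ≤ σ.reg stampReg := (hst' 0 0).1.trans (hst' 0 0).2
      have hstZ : σ.reg stampReg + 1 ≤ Z := by
        have h1 : 1 ≤ V * (P.E + mS - e₀ + mS * (last - γ) + 1) :=
          Nat.mul_pos (by omega) (by omega)
        rw [hsplit] at hZ
        push_cast at hZ hstamp ⊢
        have h2 : (1 : ℤ) ≤ V * ((P.E + mS - e₀ : ℕ) + mS * (last - γ : ℕ) + 1) := by
          exact_mod_cast h1
        have h3 : (0 : ℤ) ≤ V := by positivity
        linarith
      obtain ⟨hcb, hmm⟩ := S.callBounds hL hγ hlt'.le h0 hstZ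
      obtain ⟨mm, hmm'⟩ : ∃ mm, mm = P.w + γ / P.range := ⟨_, rfl⟩
      rw [← hmm'] at hcb hmm
      have hmm1 : 1 ≤ mm := S.rows_pos.trans (hmm' ▸ Nat.le_add_right _ _)
      have hcost : U * mm * L ^ w + L ^ 4 ≤ V * mm := by
        calc U * mm * L ^ w + L ^ 4 ≤ U * mm * L ^ w + L ^ 4 * mm :=
            Nat.add_le_add_left (Nat.le_mul_of_pos_right _ hmm1) _
          _ = V * mm := by rw [hV]; ring
      refine ⟨U * mm * L ^ w, ?_, ?_⟩
      · refine hcost.trans (Nat.mul_le_mul_left _ ?_)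
        omega
      · have hG' : HoldsFamily k (2 * N) σ I G := hG.congr (hk.own 1 (by decide))
        refine (hcall hg (hk.setup hs) hG' hb hD hst'
          ((hk.reg 20 (by decide) (by decide)).trans h20) h22 h23 hcb).mono le_rfl ?_
        rintro σ' ⟨g1, g2, g3, g4, h | h⟩
        · obtain ⟨r22, r23, hf⟩ := h
          have hbud : V * (P.E + mS - (e₀ + mm) + mS * (last - γ) + 1) + V * mm =
              V * (P.E + mS - e₀ + mS * (last - γ) + 1) := by
            rw [← mul_add]
            congr 1
            omega
          refine ⟨V * (P.E + mS - (e₀ + mm) + mS * (last - γ) + 1), by omega, γ, e₀ + mm, hγ,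
            by omega, g1, g2, ?_, hk.trans g4, r22, r23, ?_, rfl⟩
          · rw [g3]
            omega
          · have hsplit' : (∃ j < P.n, ∃ e < e₀ + mm, e < P.E ∧ Satisfies (LitTrue P.v₀ j e) G) ↔
                (∃ j < P.n, ∃ e < e₀, e < P.E ∧ Satisfies (LitTrue P.v₀ j e) G) ∨
                ∃ j < P.n, ∃ i < mm, e₀ + i < P.E ∧ Satisfies (LitTrue P.v₀ j (e₀ + i)) G := by
              constructor
              · rintro ⟨j, hj, e, he', h⟩
                by_cases hlt : e < e₀
                · exact Or.inl ⟨j, hj, e, hlt, h⟩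
                · refine Or.inr ⟨j, hj, e - e₀, by omega, ?_⟩
                  rwa [Nat.add_sub_cancel' (by omega)]
              · rintro (⟨j, hj, e, he', h⟩ | ⟨j, hj, i, hi, h⟩)
                · exact ⟨j, hj, e, by omega, h⟩
                · exact ⟨j, hj, e₀ + i, by omega, h⟩
            rw [hsplit', ← or_assoc, ← hflag]
            rcases hf with ⟨f1, f2⟩ | ⟨f1, f2⟩
            · rw [f1]
              exact iff_of_true one_pos (Or.inr f2)
            · rw [f1]
              exact ⟨Or.inl, fun h => h.resolve_right f2⟩
        · obtain ⟨r22, r23, r27, J, g, t, s, hJ1, hJ2, hJ3, hJ4⟩ := h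
          have hne : γ ≠ last := by
            intro hγ'
            have hr : 0 < P.range := by have := S.cols_lt; omega
            have e1 : mm = mS := by
              rw [hmm', hγ', hlast, Params.last, mul_comm, Nat.mul_add_div hr,
                Nat.div_eq_of_lt S.cols_lt]
              have := S.rows
              omega
            have e2 : P.D + 1 + γ % P.range = dS := by
              rw [hγ', hlast, Params.last, mul_comm, Nat.mul_add_mod, Nat.mod_eq_of_lt S.cols_lt]
              have := S.cols
              omega
            have hfast : ∀ a b, a = mS → b = dS → ∀ (J : Instance P.n a b)
                (g : EuclideanSpace ℝ (Fin P.n)) (t : ℕ) (s : Memory), J.EntriesLE K →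
                J.IsGradient l g → Runs p J.input t s → 4 * t ≤ P.fuel * a := by
              rintro a b rfl rfl
              exact S.fast
            have := hfast _ _ e1 e2 J g t s hJ1 hJ2 hJ3
            omega
          have hbud : V * (P.E + mS - e₀ + mS * (last - (γ + 1)) + 1) + V * mS =
              V * (P.E + mS - e₀ + mS * (last - γ) + 1) := by
            rw [← mul_add, show last - γ = last - (γ + 1) + 1 by omega]
            ring
          have hcost' : V * mm ≤ V * mS := Nat.mul_le_mul_left _ hmm
          refine ⟨V * (P.E + mS - e₀ + mS * (last - (γ + 1)) + 1), by omega, γ + 1, e₀,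
            by omega, he, g1, g2, ?_, hk.trans g4, r22, r23, ?_, rfl⟩
          · rw [g3]
            omega
          · rw [r27, hflag]
    · rintro σ b ⟨γ, e₀, hγ, he, hg, hst', hstamp, hk, h22, h23, hflag, rfl⟩ hle
      have hE : σ.reg 11 = P.E := (hk.reg 11 (by decide) (by decide)).trans hs.E
      rw [hE, h23] at hle
      have hle' : P.E ≤ e₀ := mod_cast hle
      refine ⟨⟨hg, hst', ?_, hk, ?_⟩, ?_⟩
      · grind
      · rw [hflag]
        refine or_congr_right (exists_congr fun j => and_congr_right fun _ =>
          exists_congr fun e => ⟨fun h => h.2, fun h => ⟨h.1.trans_le hle', h⟩⟩)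
      grind
  have hzero : bits 0 ≤ L := by rw [bits_zero]; omega
  rw [hsplit]
  refine Ter.mono_left (T := L ^ 3 + (L ^ 3 + V * (P.E + mS + mS * last + 1))) ?_ (by omega)
  refine Ter.set_seq hσ trivial rfl ?_
  have g1 : (σ₀.setReg 22 0).Good L := hσ.setReg hzero
  refine Ter.set_seq g1 trivial rfl ?_
  rw [hsplit] at hloop
  refine hloop _ ⟨0, 0, Nat.zero_le _, Nat.zero_le _,
    g1.setReg hzero, fun a i => hst a i, le_rfl,
    ((Kept.refl σ₀).setReg (by decide) 0).setReg (by decide) 0, rfl, rfl, ?_, ?_⟩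
  · refine ⟨Or.inl, fun h => h.resolve_right ?_⟩
    omega
  · rw [Nat.sub_zero, Nat.sub_zero]

/-! ### Branching on flowers -/

/-- Write a family of clauses to the place with index `s`. -/
def Prog.addFamily (s e : XExpr) : Prog := .fill 1 30 3 (.add (.mul s (.var 3)) (.var 30)) e

theorem Ter.addFamily {J : ℕ} (hσ : σ.Good L) (ht : Tables k q σ)
    {s : XExpr} (hs : s.WF) (he : e.WF) (p : ℕ → Prop)
    (hval : ∀ z < (q + 1) ^ k, ∀ σ' : Memory, (∀ x, x ≠ 30 → σ'.reg x = σ.reg x) →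
      σ'.reg 30 = z → (∀ t : ℤ, t < J * (q + 1) ^ k → σ'.arr 1 t = σ.arr 1 t) →
      (∀ b, b ≠ 1 → σ'.arr b = σ.arr b) →
      s.val σ' = J ∧ e.val σ' = bit (p z)) :
    Ter (.addFamily s e) σ (L ^ (fillDeg (.add (.mul s (.var 3)) (.var 30)) e + 2))
      fun σ' => σ'.Good L ∧ (∀ x, x ≠ 30 → σ'.reg x = σ.reg x) ∧
        (∀ t : ℤ, t < J * (q + 1) ^ k → σ'.arr 1 t = σ.arr 1 t) ∧
        (∀ b, b ≠ 1 → σ'.arr b = σ.arr b) ∧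
        ∀ z < (q + 1) ^ k, σ'.arr 1 ((J * (q + 1) ^ k + z : ℕ) : ℤ) = bit (p z) := by
  have hL := hσ.two_le
  have hP : σ.reg 3 = ((q + 1) ^ k : ℕ) := ht.codes
  have hPL : (q + 1) ^ k ≤ L := by
    have := hσ.bound 3 (by decide)
    rw [hP] at this
    exact_mod_cast this
  have hwf : (XExpr.add (.mul s (.var 3)) (.var 30)).WF :=
    ⟨⟨hs, by simp⟩, by simp⟩
  have hbit : ∀ p : Prop, bits (bit p) ≤ L := fun p => (bits_bit_le p).trans hL
  refine (Ter.fill (x := 30) (r := 3) (a := 1) hσ (by decide) (by decide) (by decide) (by decide)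
    hwf he hP (fun v => ((J * (q + 1) ^ k + v : ℕ) : ℤ)) (fun v => bit (p v))
    (fun v _ w _ h => ?_) (fun _ v _ => hbit _) (fun v hv A hA hA' => ?_)
    fun A hA hA' => ⟨?_, fun x hx => ?_, fun t ht' => ?_, fun b hb => ?_, fun z hz => ?_⟩).mono_left ?_
  · omega
  · obtain ⟨h1, h2⟩ := hval v hv ((σ.setReg 30 (v : ℤ)).setArr 1 A)
      (fun x hx => by rw [setArr_reg, setReg_reg, update_of_ne hx])
      (by rw [setArr_reg, setReg_self])
      (fun t ht' => by
        rw [setArr_arr, update_self]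
        grind)
      (fun b hb => by rw [setArr_arr, update_of_ne hb]; rfl)
    refine ⟨?_, h2⟩
    have h3 : (XExpr.add (.mul s (.var 3)) (.var 30)).val ((σ.setReg 30 (v : ℤ)).setArr 1 A) =
        s.val ((σ.setReg 30 (v : ℤ)).setArr 1 A) * σ.reg 3 + v := rfl
    rw [h3, h1, hP]
    push_cast
    rfl
  · rw [pow_add, mul_comm]
    refine Nat.mul_le_mul_left _ ?_
    nlinarith
  · refine Good.setArr (hσ.setReg (hP ▸ hσ.reg 3 (by decide)))
      fun _ j => ?_
    by_cases hj : ∀ w < (q + 1) ^ k, j ≠ ((J * (q + 1) ^ k + w : ℕ) : ℤ)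
    · rw [hA' j hj]
      exact hσ.arr 1 (by decide) j
    · push Not at hj
      obtain ⟨w, hw, rfl⟩ := hj
      rw [hA w hw]
      exact hbit _
  · rw [setArr_reg, setReg_reg, update_of_ne hx]
  · rw [setArr_arr, update_self]
    grind
  · rw [setArr_arr, update_of_ne hb]
    rfl
  · rw [setArr_arr, update_self]
    exact hA z hz

namespace XExpr

/-- Disjunction. -/
def or (e f : XExpr) : XExpr := .ind (.add e f)

theorem Is.or {p q : Prop}
    (he : Is σ n e ε (bit p)) (hf : Is σ n f ε (bit q)) : Is σ n (e.or f) ε (bit (p ∨ q)) :=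
  (he.add hf).ind.congr (bit_congr (by
    unfold bit
    grind))

/-- Membership of the clause with code `z` in the family with index `i`, together with the heart of
the flower `f`. -/
def withHeart (k : ℕ) (i z f : XExpr) : XExpr := (fam i z).or (same k z (flowerHeart f))

/-- Membership of the clause with code `z` in the family with index `i`, together with the petals of
the flower `f`. -/
def withPetals (k : ℕ) (i z f : XExpr) : XExpr :=
  (fam i z).or (.ex 2 3 (.mul (.mul (minimal k i (.lv 2)) ((size k (.lv 2)).eq (flowerSize k f)))
    (join k z (flowerHeart f) (.lv 2))))

theorem wf_withHeart (k : ℕ) {z : XExpr} (hi : i.WF) (hz : z.WF) (hf : f.WF) :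
    (withHeart k i z f).WF :=
  ⟨hi.fam hz, hz.same k (hf.flower k).2.2⟩

theorem wf_withPetals (k : ℕ) {z : XExpr} (hi : i.WF) (hz : z.WF) (hf : f.WF) :
    (withPetals k i z f).WF := by
  have h2 : (XExpr.lv 2).WF := trivial
  obtain ⟨h3, -, h4⟩ := hf.flower k
  simp only [withPetals, XExpr.or, ex, XExpr.WF, XExpr.eq, XExpr.le, hi.fam hz, hi.minimal k h2,
    h2.size k, h3, hz.join k h4 h2]
  decide

variable {σ : Memory} {k q n I z h c j : ℕ} {i e f : XExpr} {ε : ℕ → ℤ}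
  {G : Finset (Multiset ℕ)}

theorem Is.withHeart (ht : Tables k q σ) (hn : 0 < n) (hG : HoldsFamily k q σ I G) (hj : j ≤ k)
    (hh : h < (q + 1) ^ k) (hi : Is σ n i ε (I : ℕ)) (he : Is σ n e ε (z : ℕ))
    (hz : z < (q + 1) ^ k) (hf : Is σ n f ε (flowerCode k q c j h : ℕ)) :
    Is σ n (XExpr.withHeart k i e f) ε
      (bit (clause (q + 1) k z ∈ G ∪ {clause (q + 1) k h})) :=
  ((hi.fam ht hG he hz).or (Is.same ht hn he (hf.flower ht hj hh).2.2)).congr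
    (bit_congr (by rw [mem_union, mem_singleton]))

theorem Is.withPetals (ht : Tables k q σ) (hn : 2 < n) (hG : HoldsFamily k q σ I G)
    (hb : Bounded k q G) (hj : j ≤ k)
    (hh : h < (q + 1) ^ k) (hi : Is σ n i ε (I : ℕ)) (he : Is σ n e ε (z : ℕ))
    (hz : z < (q + 1) ^ k) (hf : Is σ n f ε (flowerCode k q c j h : ℕ)) :
    Is σ n (XExpr.withPetals k i e f) ε
      (bit (clause (q + 1) k z ∈ G ∪ petals G c (clause (q + 1) k h))) := by
  refine ((hi.fam ht hG he hz).or (q := ∃ w < (q + 1) ^ k, (clause (q + 1) k w ∈ minimals G ∧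
    (clause (q + 1) k w).card = c) ∧
    clause (q + 1) k z + clause (q + 1) k h = clause (q + 1) k w) fun ε' h' => ?_).congr
    (bit_congr ?_)
  · refine (Is.ex ht.codes fun w hw => ?_).eval_eq
    have hw2 : Is σ 2 (.lv 2) (update ε' 2 (w : ℤ)) (w : ℕ) := Is.lv 2 (w : ℤ)
    obtain ⟨h1, -, h3⟩ := hf.flower ht hj hh
    exact ((Is.minimal ht one_lt_two hG hb (hi.bound hn h' _) hw2 hw).and
      (((Is.size ht k hw2).eq (h1.bound hn h' _)).congr (bit_congr (by norm_cast)))).and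
      (Is.join ht two_pos (he.bound hn h' _) (h3.bound hn h' _) hw2)
  · rw [mem_union]
    refine or_congr_right ?_
    unfold petals
    rw [mem_image]
    constructor
    · rintro ⟨w, hw, ⟨h1, h2⟩, h3⟩
      refine ⟨clause (q + 1) k w, mem_filter.2 ⟨h1, h2, ?_⟩, ?_⟩
      · rw [← h3]; exact Multiset.le_add_left _ _
      · rw [← h3, add_tsub_cancel_right]
    · rintro ⟨C, hC, hCz⟩
      obtain ⟨h1, h2, h3⟩ := mem_filter.1 hC
      obtain ⟨h4, h5⟩ := hb C (mem_minimals.1 h1).1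
      obtain ⟨w, hw, rfl⟩ := exists_clause h4 h5
      exact ⟨w, hw, ⟨h1, h2⟩, by rw [← hCz, tsub_add_cancel_of_le h3]⟩

end XExpr

/-- Replace the family with index `cur` by two families at the end of the list. -/
def Prog.expand (k : ℕ) : Prog :=
  .seq (.addFamily (.var 21) (XExpr.withHeart k (.var 20) (.var 30) (.var 26)))
  (.seq (.addFamily (.add (.var 21) (.const 1))
      (XExpr.withPetals k (.var 20) (.var 30) (.var 26)))
    (.set 21 (.add (.var 21) (.const 2))))

/-- The list of families that are still to be treated: those with indices from `cur` to `cnt`. -/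
structure Queue (θ : ℕ → ℕ) (k N L : ℕ) (P : Params) (σ : Memory) (cur cnt : ℕ)
    (G : ℕ → Finset (Multiset ℕ)) (X Y : ℕ → ℕ) : Prop where
  good : σ.Good L
  setup : Setup k N P σ
  stamped : σ.Stamped
  head : σ.reg 20 = cur
  tail : σ.reg 21 = cnt
  node : ∀ i, cur ≤ i → i < cnt → Node θ k (2 * N) (G i) (X i) (Y i)
  family : ∀ i, cur ≤ i → i < cnt → HoldsFamily k (2 * N) σ i (G i)

/-- One of the families is satisfied by one of the assignments. -/
def Params.SomeSat (P : Params) (cur cnt : ℕ) (G : ℕ → Finset (Multiset ℕ)) : Prop :=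
  ∃ i, cur ≤ i ∧ i < cnt ∧ P.Sat (G i)

theorem XExpr.HoldsFamily.congr_lt {i J : ℕ} (h : HoldsFamily k q σ i G) (hi : i < J)
    (ha : ∀ t : ℤ, t < J * (q + 1) ^ k → σ'.arr 1 t = σ.arr 1 t) :
    HoldsFamily k q σ' i G := by
  intro z hz
  rw [ha, h z hz]
  have h1 : (i + 1) * (q + 1) ^ k ≤ J * (q + 1) ^ k := Nat.mul_le_mul_right _ hi
  have h2 : i * (q + 1) ^ k + z < J * (q + 1) ^ k := by
    calc _ < i * (q + 1) ^ k + (q + 1) ^ k := by omega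
      _ = (i + 1) * (q + 1) ^ k := by ring
      _ ≤ _ := h1
  exact_mod_cast h2

theorem Ter.expand (k : ℕ) : ∃ d, ∀ {N L cur cnt j h c : ℕ} {P : Params} {σ : Memory}
    {G : ℕ → Finset (Multiset ℕ)} {X Y : ℕ → ℕ}, Queue θ k N L P σ cur cnt G X Y → cur < cnt →
    j ≤ k → h < (2 * N + 1) ^ k → σ.reg 26 = XExpr.flowerCode k (2 * N) c j h →
    bits ((cnt + 2 : ℕ) : ℤ) ≤ L →
    Ter (.expand k) σ (L ^ d) fun σ' => σ'.Good L ∧ Setup k N P σ' ∧ σ'.Stamped ∧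
      σ'.reg 20 = cur ∧ σ'.reg 21 = (cnt + 2 : ℕ) ∧ σ'.reg 27 = σ.reg 27 ∧
      σ'.reg stampReg = σ.reg stampReg ∧
      (∀ i, i < cnt → HoldsFamily k (2 * N) σ i (G i) → HoldsFamily k (2 * N) σ' i (G i)) ∧
      HoldsFamily k (2 * N) σ' cnt (G cur ∪ {clause (2 * N + 1) k h}) ∧
      HoldsFamily k (2 * N) σ' (cnt + 1)
        (G cur ∪ petals (G cur) c (clause (2 * N + 1) k h)) := by
  apply Exists.intro
  intro N L cur cnt j h c P σ G X Y Q hlt hj hh h26 hb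
  have hL := Q.good.two_le
  have hG := Q.family cur le_rfl hlt
  have hbd := (Q.node cur le_rfl hlt).1
  have w20 : (XExpr.var 20).WF := by simp
  have w21 : (XExpr.var 21).WF := by simp
  have w26 : (XExpr.var 26).WF := by simp
  have w30 : (XExpr.var 30).WF := by simp
  have hone : ∀ {T : ℕ}, 1 * T = T := fun {T} => one_mul T
  have hset : ∀ σ' : Memory, (∀ x, x ≠ 30 → σ'.reg x = σ.reg x) →
      (∀ b, b ≠ 1 → σ'.arr b = σ.arr b) → Setup k N P σ' := fun σ' hr ha =>
    Q.setup.congr (fun x h1 h2 => hr x (by omega)) (ha 2 (by decide))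
  rw [← one_mul (_ ^ _)]
  apply Ter.seq_pow hL ((Ter.addFamily (J := cnt) (s := .var 21) Q.good Q.setup.tables w21
    (XExpr.wf_withHeart k w20 w30 w26)
    (fun z => clause (2 * N + 1) k z ∈ G cur ∪ {clause (2 * N + 1) k h})
    fun z hz σ' hr h30 ha1 ha => ⟨(hr 21 (by decide)).trans Q.tail,
      (Is.withHeart (hset σ' hr ha).tables (n := 1) one_pos (hG.congr_lt hlt ha1) hj hh
        (Is.var ((hr 20 (by decide)).trans Q.head)) (Is.var h30) hz
        (Is.var ((hr 26 (by decide)).trans h26))).val_eq⟩).mono_left hone.ge)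
  rintro σ₁ ⟨g₁, hr₁, ha₁, hb₁, hf₁⟩
  have hr₂ : ∀ {σ' : Memory}, (∀ x, x ≠ 30 → σ'.reg x = σ₁.reg x) →
    ∀ x, x ≠ 30 → σ'.reg x = σ.reg x := fun hr x hx => (hr x hx).trans (hr₁ x hx)
  apply Ter.seq_pow hL ((Ter.addFamily (J := cnt + 1) (s := .add (.var 21) (.const 1)) g₁
    (hset σ₁ hr₁ hb₁).tables ⟨w21, trivial⟩ (XExpr.wf_withPetals k w20 w30 w26)
    (fun z => clause (2 * N + 1) k z ∈ G cur ∪ petals (G cur) c (clause (2 * N + 1) k h))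
    fun z hz σ' hr h30 ha1 ha => ⟨((Is.var ((hr₂ hr 21 (by decide)).trans Q.tail)).add
        (Is.const 1)).val_eq (n := 0),
      (Is.withPetals
        (hset σ' (hr₂ hr) fun b hb => (ha b hb).trans (hb₁ b hb)).tables (n := 3) (by norm_num)
        ((hG.congr_lt hlt ha₁).congr_lt (hlt.trans (Nat.lt_succ_self _)) ha1) hbd hj hh
        (Is.var ((hr₂ hr 20 (by decide)).trans Q.head)) (Is.var h30) hz
        (Is.var ((hr₂ hr 26 (by decide)).trans h26))).val_eq⟩).mono_left hone.ge)
  rintro σ₂ ⟨g₂, hr₃, ha₂, hb₂, hf₂⟩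
  have hr' := hr₂ hr₃
  have hb' : ∀ b, b ≠ 1 → σ₂.arr b = σ.arr b := fun b hb => (hb₂ b hb).trans (hb₁ b hb)
  have hval : (XExpr.add (.var 21) (.const 2)).val σ₂ = (cnt + 2 : ℕ) :=
    ((Is.var ((hr' 21 (by decide)).trans Q.tail)).add (Is.const 2)).val_eq (n := 0)
  refine (Ter.set (e := .add (.var 21) (.const 2)) g₂ ⟨w21, trivial⟩ ?_).mono_left hone.ge
  rw [hval]
  refine ⟨g₂.setReg hb, (hset σ₂ hr' hb').congr (fun x h1 h2 => ?_) rfl, fun a i => ?_,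
    (hr' 20 (by decide)).trans Q.head, rfl, hr' 27 (by decide), hr' stampReg (by decide),
    fun i hi h => ((h.congr_lt hi ha₁).congr_lt (hi.trans (Nat.lt_succ_self _)) ha₂).congr rfl,
    (HoldsFamily.congr_lt hf₁ (Nat.lt_succ_self _) ha₂).congr rfl,
    HoldsFamily.congr (σ := σ₂) hf₂ rfl⟩
  · rw [setReg_of_ne (by omega)]
  · rw [setReg_of_ne (by decide), setReg_arr, hr' stampReg (by decide),
      hb' _ (by unfold simStamp; omega)]
    exact Q.stamped a i

/-! ### The search through all families -/

/-- Treat the family with index `cur`. -/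
noncomputable def Prog.step (p : Prog) (θ : ℕ → ℕ) (k : ℕ) : Prog :=
  .seq (.set 26 (XExpr.firstFlower θ k (.var 20)))
  (.seq (.cond (.sub (.var 4) (.var 26)) (.expand k) (.leaf p k))
    (.set 20 (.add (.var 20) (.const 1))))

/-- The exponent of the time bound for `Prog.step`, apart from `Prog.leaf`, if the one for
`Prog.expand` is `d`. -/
def stepDeg (θ : ℕ → ℕ) (k d : ℕ) : ℕ :=
  (XExpr.firstFlower θ k (.var 20)).deg + 2 +
    ((XExpr.sub (.var 4) (.var 26)).deg + 2 + (d +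
      ((XExpr.add (.var 20) (.const 1)).deg + 2) + 1) + 1) + 1

theorem Memory.Kept.queue (h : σ.Kept σ') {G : ℕ → Finset (Multiset ℕ)} {X Y : ℕ → ℕ}
    (Q : Queue θ k N L P σ cur cnt G X Y) (hg : σ'.Good L) (hst : σ'.Stamped) :
    Queue θ k N L P σ' cur cnt G X Y :=
  ⟨hg, h.setup Q.setup, hst, (h.reg 20 (by decide) (by decide)).trans Q.head,
    (h.reg 21 (by decide) (by decide)).trans Q.tail, Q.node,
    fun i h1 h2 => (Q.family i h1 h2).congr (h.own 1 (by decide))⟩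

theorem Queue.setReg {G : ℕ → Finset (Multiset ℕ)} {X Y : ℕ → ℕ}
    (Q : Queue θ k N L P σ cur cnt G X Y) (hx : 22 ≤ x) (hx' : x ≠ stampReg) (hz : bits z ≤ L) : Queue θ k N L P (σ.setReg x z) cur cnt G X Y := by
  have hr : ∀ y, y ≠ x → (σ.setReg x z).reg y = σ.reg y := fun y hy => by
    rw [setReg_reg, update_of_ne hy]
  refine ⟨Q.good.setReg hz fun h => absurd h (by unfold boundRegs; omega),
    Q.setup.congr (fun y _ _ => hr y (by omega)) rfl, fun a i => ?_,
    (hr 20 (by omega)).trans Q.head, (hr 21 (by omega)).trans Q.tail, Q.node,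
    fun i h1 h2 => (Q.family i h1 h2).congr rfl⟩
  rw [hr _ hx'.symm]
  exact Q.stamped a i

theorem Queue.tail_step {G : ℕ → Finset (Multiset ℕ)} {X Y : ℕ → ℕ}
    (Q : Queue θ k N L P σ cur cnt G X Y) (hb : bits ((cur + 1 : ℕ) : ℤ) ≤ L) :
    Queue θ k N L P (σ.setReg 20 (cur + 1 : ℕ)) (cur + 1) cnt G X Y := 
  ⟨Q.good.setReg hb, Q.setup.congr (fun y _ _ => setReg_of_ne (by omega)) rfl, Q.stamped, rfl,
    Q.tail, fun i h1 h2 => Q.node i (by omega) h2,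
    fun i h1 h2 => (Q.family i (by omega) h2).congr rfl⟩

theorem Ter.step {c : ℝ} (hp : Detects l K δ c p) (hθ : ∀ i, 1 ≤ θ i) (k : ℕ) :
    ∃ w d, ∀ {L N U Z mS dS cur cnt T : ℕ} {P : Params} {σ : Memory} {φ : ℕ → ℕ → ℝ}
    {G : ℕ → Finset (Multiset ℕ)} {X Y : ℕ → ℕ}, Scale p l K L U Z mS dS P →
    1 + 2 * N * (1 + ∑ i ∈ range k, θ i) ≤ P.D →
    (∀ X Y, φ (X + 1) Y + φ X (Y + 1) + 1 ≤ φ X Y) →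
    (∀ G X Y, Node θ k (2 * N) G X Y → 1 ≤ φ X Y) →
    Queue θ k N L P σ cur cnt G X Y → cur < cnt → bits ((cnt + 2 : ℕ) : ℤ) ≤ L →
    T = leafTime L U w P.E mS (P.last mS dS) → σ.reg stampReg + T ≤ Z →
    Ter (p.step θ k) σ (L ^ stepDeg θ k d + T) fun σ' => ∃ cnt' G' X' Y',
      Queue θ k N L P σ' (cur + 1) cnt' G' X' Y' ∧ cur + 1 ≤ cnt' ∧ cnt' ≤ cnt + 2 ∧
      σ'.reg stampReg ≤ σ.reg stampReg + T ∧
      (0 < σ'.reg 27 ∨ P.SomeSat (cur + 1) cnt' G' ↔ 0 < σ.reg 27 ∨ P.SomeSat cur cnt G) ∧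
      (∑ i ∈ Ico (cur + 1) cnt', φ (X' i) (Y' i)) + 1 ≤
        ∑ i ∈ Ico cur cnt, φ (X i) (Y i) := by
  obtain ⟨w, hleaf⟩ := Ter.leaf hp k
  obtain ⟨d, hexpand⟩ := Ter.expand k
  refine ⟨w, d, ?_⟩
  intro L N U Z mS dS cur cnt T P σ φ G X Y S hD hφ hφ1 Q hlt hb hT hZ
  have hL := Q.good.two_le
  have hG := Q.family cur le_rfl hlt
  have hnode := Q.node cur le_rfl hlt
  have w20 : (XExpr.var 20).WF := by simp
  have w4 : (XExpr.sub (.var 4) (.var 26)).WF := by simp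
  have wn : (XExpr.add (.var 20) (.const 1)).WF := by simp
  obtain ⟨F, hF, hcase⟩ := Is.firstFlower (n := 5) (ε := fun _ => σ.reg 0) hθ
    Q.setup.tables (by norm_num) hG hnode.1 (Is.var Q.head)
  have hFval := hF.val_eq
  have hFb : bits (F : ℤ) ≤ L := by
    have h4 : σ.reg 4 = ((k + 1) * (k + 1) * (2 * N + 1) ^ k : ℕ) := Q.setup.tables.flowers
    have h5 := Q.good.reg 4 (by decide)
    rw [h4] at h5
    refine (bits_mono ?_).trans h5
    rcases hcase with ⟨h, -⟩ | ⟨_, -, _, -, _, -, -, h, -⟩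
    · rw [h]
    · omega
  set σ₁ := σ.setReg 26 (F : ℤ) with hσ₁
  have Q₁ : Queue θ k N L P σ₁ cur cnt G X Y := Q.setReg (by norm_num) (by decide) hFb
  have e27 : σ₁.reg 27 = σ.reg 27 := by rw [hσ₁, setReg_of_ne (by decide)]
  have e39 : σ₁.reg stampReg = σ.reg stampReg := by rw [hσ₁, setReg_of_ne (by decide)]
  have e26 : σ₁.reg 26 = F := by rw [hσ₁, setReg_self]
  have e4 : σ₁.reg 4 = ((k + 1) * (k + 1) * (2 * N + 1) ^ k : ℕ) := Q₁.setup.tables.flowers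
  have htest : (XExpr.sub (.var 4) (.var 26)).val σ₁ =
      ((k + 1) * (k + 1) * (2 * N + 1) ^ k : ℕ) - (F : ℤ) := by rw [← e4, ← e26]; rfl
  have hbc : bits ((cur + 1 : ℕ) : ℤ) ≤ L := (bits_mono (by omega)).trans hb
  have hφsum : ∑ i ∈ Ico cur cnt, φ (X i) (Y i) =
      φ (X cur) (Y cur) + ∑ i ∈ Ico (cur + 1) cnt, φ (X i) (Y i) :=
    sum_eq_sum_Ico_succ_bot hlt _
  have hsat : P.SomeSat cur cnt G ↔ P.Sat (G cur) ∨ P.SomeSat (cur + 1) cnt G := by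
    constructor
    · rintro ⟨i, h1, h2, h3⟩
      rcases h1.eq_or_lt with rfl | h
      · exact Or.inl h3
      · exact Or.inr ⟨i, h, h2, h3⟩
    · rintro (h | ⟨i, h1, h2, h3⟩)
      · exact ⟨cur, le_rfl, hlt, h⟩
      · exact ⟨i, by omega, h2, h3⟩
  let R : ℕ → Memory → Prop := fun c' σ' => ∃ cnt' G' X' Y', Queue θ k N L P σ' c' cnt' G' X' Y' ∧
    cur + 1 ≤ cnt' ∧ cnt' ≤ cnt + 2 ∧ σ'.reg stampReg ≤ σ.reg stampReg + T ∧
    (0 < σ'.reg 27 ∨ P.SomeSat (cur + 1) cnt' G' ↔ 0 < σ.reg 27 ∨ P.SomeSat cur cnt G) ∧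
    (∑ i ∈ Ico (cur + 1) cnt', φ (X' i) (Y' i)) + 1 ≤ ∑ i ∈ Ico cur cnt, φ (X i) (Y i)
  have hlast : ∀ σ₂, R cur σ₂ → Ter (.set 20 (.add (.var 20) (.const 1))) σ₂
      (L ^ ((XExpr.add (.var 20) (.const 1)).deg + 2)) (R (cur + 1)) := by
    rintro σ₂ ⟨cnt', G', X', Y', Q₂, h⟩
    have hval : (XExpr.add (.var 20) (.const 1)).val σ₂ = (cur + 1 : ℕ) :=
      ((Is.var Q₂.head).add (Is.const 1)).val_eq (n := 0)
    refine Ter.set Q₂.good wn ?_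
    rw [hval]
    exact ⟨cnt', G', X', Y', Q₂.tail_step hbc, h⟩
  refine Ter.mono_left (T := L ^ ((XExpr.firstFlower θ k (.var 20)).deg + 2) +
    ((L ^ ((XExpr.sub (.var 4) (.var 26)).deg + 2) + (L ^ d + T)) +
      L ^ ((XExpr.add (.var 20) (.const 1)).deg + 2))) ?_ ?_
  · refine Ter.set_seq Q.good (w20.firstFlower θ k) hFval ?_
    refine Ter.seq (R := R cur) (Ter.cond Q₁.good w4 (fun hpos => ?_) fun hneg => ?_) hlast
    · rw [htest] at hpos
      rcases hcase with ⟨h, -⟩ | ⟨c', hc', j, hj, h, hh, hFeq, hFlt, hheavy, hfirst⟩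
      · rw [h] at hpos
        simp at hpos
      refine (hexpand Q₁ hlt hj hh (e26.trans (by rw [hFeq])) hb).mono
        (Nat.le_add_right _ _) ?_
      rintro σ₂ ⟨g₂, s₂, st₂, r20, r21, r27, r39, hold, hnew1, hnew2⟩
      set H := clause (2 * N + 1) k h with hH
      have hne : cnt + 1 ≠ cnt := by omega
      refine ⟨cnt + 2,
        fun i => if i = cnt then G cur ∪ {H} else if i = cnt + 1 then G cur ∪ petals (G cur) c' H
          else G i,
        fun i => if i = cnt then X cur + 1 else if i = cnt + 1 then X cur else X i,
        fun i => if i = cnt then Y cur else if i = cnt + 1 then Y cur + 1 else Y i,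
        ⟨g₂, s₂, st₂, r20, r21, fun i h1 h2 => ?_, fun i h1 h2 => ?_⟩, by omega, le_rfl, ?_, ?_, ?_⟩
      · rcases (by omega : i = cnt ∨ i = cnt + 1 ∨ i < cnt) with rfl | rfl | hi
        · simp only [if_true]
          exact hnode.heart hθ hheavy hfirst
        · simp only [hne, if_false, if_true]
          exact hnode.petals hθ hheavy hfirst
        · have hi' : i ≠ cnt + 1 := by omega
          simp only [hi.ne, hi', if_false]
          exact Q.node i h1 hi
      · rcases (by omega : i = cnt ∨ i = cnt + 1 ∨ i < cnt) with rfl | rfl | hi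
        · simp only [if_true]
          exact hnew1
        · grind
        · have hi' : i ≠ cnt + 1 := by omega
          simp only [hi.ne, hi', if_false]
          exact hold i hi (Q₁.family i h1 hi)
      · omega
      · rw [r27, e27, hsat]
        refine or_congr_right ?_
        have hbr : P.Sat (G cur) ↔ P.Sat (G cur ∪ {H}) ∨ P.Sat (G cur ∪ petals (G cur) c' H) := by
          unfold Params.Sat
          simp only [satisfies_branch (G := G cur) (c := c') (H := H), ← exists_or, ← and_or_left]
        rw [hbr]
        constructor
        · rintro ⟨i, h1, h2, h3⟩
          rcases (by omega : i = cnt ∨ i = cnt + 1 ∨ i < cnt) with rfl | rfl | hi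
          · grind
          · grind
          · have hi' : i ≠ cnt + 1 := by omega
            simp only [hi.ne, hi', if_false] at h3
            exact Or.inr ⟨i, h1, hi, h3⟩
        · rintro ((h3 | h3) | ⟨i, h1, h2, h3⟩)
          · exact ⟨cnt, hlt, by omega, by simpa only [if_true] using h3⟩
          · exact ⟨cnt + 1, by omega, by omega, by simpa only [hne, if_false, if_true] using h3⟩
          · refine ⟨i, h1, by omega, ?_⟩
            have hi' : i ≠ cnt + 1 := by omega
            simpa only [h2.ne, hi', if_false] using h3
      · rw [sum_Ico_succ_top (by omega), sum_Ico_succ_top (by omega), hφsum]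
        simp only [hne, if_false, if_true]
        have h1 : ∑ i ∈ Ico (cur + 1) cnt,
            φ (if i = cnt then X cur + 1 else if i = cnt + 1 then X cur else X i)
              (if i = cnt then Y cur else if i = cnt + 1 then Y cur + 1 else Y i) =
            ∑ i ∈ Ico (cur + 1) cnt, φ (X i) (Y i) := by
          refine sum_congr rfl fun i hi => ?_
          have := (mem_Ico.1 hi).2
          have hi' : i ≠ cnt + 1 := by omega
          simp only [this.ne, hi', if_false]
        grind
    · rw [htest] at hneg
      rcases hcase with ⟨-, hno⟩ | ⟨c', hc', j, hj, h, hh, hFeq, hFlt, -, -⟩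
      swap
      · exact absurd (sub_pos.2 (mod_cast hFlt)) hneg
      refine (hleaf S Q₁.good Q₁.setup (Q₁.family cur le_rfl hlt) hnode.1
        ((card_minimals_le hnode.1 hno).trans hD) Q₁.stamped Q₁.head (by rw [e39, ← hT]; exact hZ)).mono
          (hT ▸ Nat.le_add_left _ _) ?_
      rintro σ₂ ⟨g₂, st₂, r39, hk, r27⟩
      refine ⟨cnt, G, X, Y, hk.queue Q₁ g₂ st₂, hlt, by omega, ?_, ?_, ?_⟩
      · rw [← e39, hT]; exact r39
      · rw [r27, e27, hsat, or_assoc]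
      · grind
  · have h1 := pow_add_pow_le (a := d)
      (b := (XExpr.add (.var 20) (.const 1)).deg + 2) hL
    have h2 := pow_add_pow_le (a := (XExpr.sub (.var 4) (.var 26)).deg + 2)
      (b := d + ((XExpr.add (.var 20) (.const 1)).deg + 2) + 1) hL
    have h3 := pow_add_pow_le (a := (XExpr.firstFlower θ k (.var 20)).deg + 2)
      (b := (XExpr.sub (.var 4) (.var 26)).deg + 2 + (d +
      ((XExpr.add (.var 20) (.const 1)).deg + 2) + 1) + 1) hL
    unfold stepDeg
    omega

/-- Search through all families that arise from the family with index `0`. -/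
noncomputable def Prog.search (p : Prog) (θ : ℕ → ℕ) (k : ℕ) : Prog :=
  .seq (.set 20 (.const 0)) (.seq (.set 21 (.const 1))
    (.while (.sub (.var 21) (.var 20)) (p.step θ k)))

theorem Ter.search {c : ℝ} (hp : Detects l K δ c p) (hθ : ∀ i, 1 ≤ θ i) (k : ℕ) :
    ∃ w d, ∀ {L N U Z mS dS R T : ℕ} {P : Params} {σ : Memory} {φ : ℕ → ℕ → ℝ}
    {G : Finset (Multiset ℕ)}, Scale p l K L U Z mS dS P →
    1 + 2 * N * (1 + ∑ i ∈ range k, θ i) ≤ P.D →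
    (∀ X Y, φ (X + 1) Y + φ X (Y + 1) + 1 ≤ φ X Y) →
    (∀ G X Y, Node θ k (2 * N) G X Y → 1 ≤ φ X Y) → φ 0 0 ≤ R →
    σ.Good L → Setup k N P σ → σ.Stamped → HoldsFamily k (2 * N) σ 0 G →
    Bounded k (2 * N) G → σ.reg 27 = 0 →
    T = leafTime L U w P.E mS (P.last mS dS) + L ^ d →
    σ.reg stampReg + (R + 1) * T ≤ Z → 2 * R + 3 ≤ Z →
    Ter (p.search θ k) σ ((R + 1) * T) fun σ' => (0 < σ'.reg 27 ↔ P.Sat G) ∧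
      bits (σ'.reg 27) ≤ L := by
  obtain ⟨w, d, hstep⟩ := Ter.step hp hθ k
  refine ⟨w, stepDeg θ k d + 4 + 1, ?_⟩
  intro L N U Z mS dS R T P σ₀ φ G S hD hφ hφ1 hφR hσ hs hst hG hb h27 hT hZ hRZ
  have hL := hσ.two_le
  set T₀ := leafTime L U w P.E mS (P.last mS dS) with hT₀
  have hTdeg : T₀ + (L ^ stepDeg θ k d + L ^ 4) ≤ T := by
    rw [hT]
    exact Nat.add_le_add_left (pow_add_pow_le hL) _
  have hb2 : ∀ z : ℕ, z ≤ 2 * R + 3 → bits (z : ℤ) ≤ L := fun z hz =>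
    bits_le_of_le S.lt hL (by positivity) (mod_cast hz.trans hRZ)
  have hL4 := four_mul_add_one_le_pow hL
  have hL3 : 2 * L ^ 4 ≤ T := by
    have h1 : L * L ^ 4 ≤ L ^ (stepDeg θ k d + 4 + 1) := by
      calc L * L ^ 4 = L ^ 5 := by ring
        _ ≤ _ := Nat.pow_le_pow_right (by omega) (by omega)
    have h2 : 2 * L ^ 4 ≤ L * L ^ 4 := Nat.mul_le_mul_right _ hL
    omega
  let I' : Memory → ℕ → Prop := fun σ b => ∃ cur cnt G' X Y, Queue θ k N L P σ cur cnt G' X Y ∧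
    cur ≤ cnt ∧ cnt ≤ 2 * cur + 1 ∧ σ.reg stampReg + b ≤ σ₀.reg stampReg + (R + 1) * T ∧
    (0 < σ.reg 27 ∨ P.SomeSat cur cnt G' ↔ P.Sat G) ∧
    (∑ i ∈ Ico cur cnt, φ (X i) (Y i)) + cur ≤ R ∧ b = (R - cur) * T + L ^ 4
  have hloop : ∀ σ, I' σ (R * T + L ^ 4) →
      Ter (.while (.sub (.var 21) (.var 20)) (p.step θ k)) σ (R * T + L ^ 4) fun σ' =>
        (0 < σ'.reg 27 ↔ P.Sat G) ∧ bits (σ'.reg 27) ≤ L := by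
    intro σ hI
    refine Ter.while_lt (by decide) (by decide) I' (L ^ 4) ?_ ?_ ?_ hI
    · rintro σ b ⟨cur, cnt, G', X, Y, Q, -⟩
      have h1 := Q.good.reg 21 (by decide)
      have h2 := Q.good.reg 20 (by decide)
      omega
    · rintro σ b ⟨cur, cnt, G', X, Y, Q, hle, hcnt, hstamp, hsat, hsum, rfl⟩ hlt
      rw [Q.head, Q.tail] at hlt
      have hlt' : cur < cnt := mod_cast hlt
      have hcur : cur + 1 ≤ R := by
        have h1 : φ (X cur) (Y cur) ≤ ∑ i ∈ Ico cur cnt, φ (X i) (Y i) :=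
          single_le_sum (f := fun i => φ (X i) (Y i)) (fun i hi => by
            have := hφ1 _ _ _ (Q.node i (mem_Ico.1 hi).1 (mem_Ico.1 hi).2)
            linarith) (mem_Ico.2 ⟨le_rfl, hlt'⟩)
        have h2 := hφ1 _ _ _ (Q.node cur le_rfl hlt')
        have h3 : (cur : ℝ) + 1 ≤ R := by linarith
        exact_mod_cast h3
      have hRT : (R - cur) * T = (R - (cur + 1)) * T + T := by
        rw [show R - cur = R - (cur + 1) + 1 by omega]
        ring
      refine ⟨L ^ stepDeg θ k d + T₀, by omega, ?_⟩
      refine (hstep S hD hφ hφ1 Q hlt' (hb2 _ (by omega)) hT₀ ?_).mono le_rfl ?_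
      · omega
      · rintro σ' ⟨cnt', G'', X', Y', Q', h1, h2, h3, h4, h5⟩
        refine ⟨(R - (cur + 1)) * T + L ^ 4, by omega, cur + 1, cnt', G'', X', Y', Q', h1, by omega,
          ?_, h4.trans hsat, ?_, rfl⟩
        · omega
        · push_cast
          linarith
    · rintro σ b ⟨cur, cnt, G', X, Y, Q, hle, hcnt, hstamp, hsat, hsum, rfl⟩ hge
      rw [Q.head, Q.tail] at hge
      have hge' : cnt ≤ cur := mod_cast hge
      refine ⟨⟨?_, Q.good.reg 27 (by decide)⟩, by omega⟩
      rw [← hsat]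
      refine ⟨Or.inl, fun h => h.resolve_right ?_⟩
      rintro ⟨i, h1, h2, -⟩
      omega
  have hzero : bits 0 ≤ L := by rw [bits_zero]; omega
  have hone : bits 1 ≤ L := by rw [bits_one]; omega
  refine Ter.mono_left (T := L ^ 3 + (L ^ 4 + (R * T + L ^ 4))) ?_ ?_
  · refine Ter.set_seq (z := 0) hσ trivial rfl ?_
    have g1 : (σ₀.setReg 20 0).Good L := hσ.setReg hzero
    refine Ter.set_seq (z := 1) g1 trivial rfl ?_
    have hr : ∀ x, x ≠ 20 → x ≠ 21 → ((σ₀.setReg 20 0).setReg 21 1).reg x = σ₀.reg x :=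
      fun x h1 h2 => by
        rw [setReg_reg, update_of_ne h2, setReg_reg,
          update_of_ne h1]
    refine hloop _ ⟨0, 1, fun _ => G, fun _ => 0, fun _ => 0,
      ⟨g1.setReg hone,
        hs.congr (fun x h1 h2 => hr x (by omega) (by omega)) rfl, fun a i => ?_, rfl, rfl,
        fun i _ _ => Node.root hb, fun i h1 h2 => ?_⟩, by omega, by omega, ?_, ?_, ?_, by simp⟩
    · rw [hr stampReg (by decide) (by decide)]
      exact hst a i
    · obtain rfl : i = 0 := by omega
      exact hG.congr rfl
    · grind
    · rw [hr 27 (by decide) (by decide), h27]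
      refine ⟨fun h => ?_, fun h => Or.inr ⟨0, le_rfl, one_pos, h⟩⟩
      rcases h with h | ⟨i, -, -, h⟩
      · omega
      · exact h
    · simpa using hφR
  · have h1 : L ^ 3 + (L ^ 4 + L ^ 4) ≤ T := by
      have h2 : L ^ 3 ≤ L ^ 4 := Nat.pow_le_pow_right (by omega) (by omega)
      have h3 : 4 * L ^ 4 ≤ L ^ (stepDeg θ k d + 4 + 1) := by
        calc 4 * L ^ 4 ≤ L ^ (4 + 2) := pow_four_le hL
          _ ≤ _ := Nat.pow_le_pow_right (by omega) (by unfold stepDeg; omega)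
      omega
    grind

/-! ### Reading a formula -/

/-- The literals of a formula as numbers. -/
def literalCode (p : Fin N × Bool) : ℕ := 2 * p.1 + p.2.toNat

/-- The encoding of a literal in terms of its number. -/
def encodeCode (l : ℕ) : ℤ := (2 * ((l % 2 : ℕ) : ℤ) - 1) * ((l / 2 : ℕ) + 1)

theorem encodeLit_eq (p : Fin N × Bool) : encodeLit p = encodeCode (literalCode p) := by
  obtain ⟨v, b⟩ := p
  unfold encodeLit encodeCode literalCode
  cases b
  · grind
  grind

theorem encodeCode_injective {l l' : ℕ} (h : encodeCode l = encodeCode l') : l = l' := by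
  unfold encodeCode at h
  have h1 := Nat.mod_two_eq_zero_or_one l
  have h2 := Nat.mod_two_eq_zero_or_one l'
  rcases h1 with h1 | h1 <;> rcases h2 with h2 | h2 <;> rw [h1, h2] at h <;> push_cast at h <;>
    omega

namespace KCNF

variable {k : ℕ}

/-- A clause as a multiset of literals. -/
def clauseAt (ψ : KCNF k) (i : Fin ψ.M) : Multiset ℕ := ∑ j : Fin k, {literalCode (ψ.lit i j)}

/-- The family of clauses of a formula. -/
def clauses (ψ : KCNF k) : Finset (Multiset ℕ) := Finset.univ.image ψ.clauseAt

theorem mem_clauseAt {ψ : KCNF k} {i : Fin ψ.M} {l : ℕ} :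
    l ∈ ψ.clauseAt i ↔ ∃ j, literalCode (ψ.lit i j) = l := by
  unfold clauseAt
  simp [Multiset.mem_sum, eq_comm]

theorem bounded_clauses (ψ : KCNF k) : Bounded k (2 * ψ.N) ψ.clauses := by
  intro C hC
  obtain ⟨i, -, rfl⟩ := mem_image.1 hC
  refine ⟨?_, fun l hl => ?_⟩
  · simp [clauseAt]
  · obtain ⟨j, rfl⟩ := mem_clauseAt.1 hl
    have h1 := (ψ.lit i j).1.2
    have h2 := Bool.toNat_le (ψ.lit i j).2
    unfold literalCode
    omega

theorem satisfies_clauses (ψ : KCNF k) (x : ℕ → Prop) : Satisfies x ψ.clauses ↔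
    ∀ i, ∃ j, x (literalCode (ψ.lit i j)) := by
  constructor
  · intro h i
    obtain ⟨l, hl, hx⟩ := h _ (mem_image_of_mem _ (mem_univ i))
    obtain ⟨j, rfl⟩ := mem_clauseAt.1 hl
    exact ⟨j, hx⟩
  · intro h C hC
    obtain ⟨i, -, rfl⟩ := mem_image.1 hC
    obtain ⟨j, hj⟩ := h i
    exact ⟨_, mem_clauseAt.2 ⟨j, rfl⟩, hj⟩

theorem litTrue_literalCode {v₀ e : ℕ} (p : Fin N × Bool) :
    LitTrue v₀ j e (literalCode p) ↔
      (if (p.1 : ℕ) < v₀ then j.testBit p.1 else e.testBit (p.1 - v₀)) = p.2 := by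
  obtain ⟨v, b⟩ := p
  have h1 : literalCode (v, b) / 2 = v := by
    unfold literalCode
    have := Bool.toNat_lt b
    simp only
    omega
  have h2 : literalCode (v, b) % 2 = b.toNat := by
    unfold literalCode
    have := Bool.toNat_lt b
    simp only
    omega
  have key : ∀ a i : ℕ, (a / 2 ^ i % 2 = b.toNat ↔ a.testBit i = b) := by
    intro a i
    rw [Nat.testBit_eq_decide_div_mod_eq]
    rcases Nat.mod_two_eq_zero_or_one (a / 2 ^ i) with h | h <;> cases b <;> simp [h]
  unfold LitTrue
  grind

theorem satisfiable_iff {ψ : KCNF k} (hn : P.n = 2 ^ P.v₀)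
    (hE : P.E = 2 ^ (ψ.N - P.v₀)) : ψ.Satisfiable ↔ P.Sat ψ.clauses := by
  unfold Params.Sat Satisfiable
  simp only [satisfies_clauses, litTrue_literalCode]
  constructor
  · rintro ⟨x, hx⟩
    set y : ℕ → Bool := fun v => if h : v < ψ.N then x ⟨v, h⟩ else false with hy
    refine ⟨Nat.ofBits fun v : Fin P.v₀ => y v, hn ▸ Nat.ofBits_lt_two_pow _,
      Nat.ofBits fun v : Fin (ψ.N - P.v₀) => y (P.v₀ + v), hE ▸ Nat.ofBits_lt_two_pow _,
      fun i => ?_⟩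
    obtain ⟨j, hj⟩ := hx i
    refine ⟨j, ?_⟩
    have hv := (ψ.lit i j).1.2
    have hyv : y (ψ.lit i j).1 = x (ψ.lit i j).1 := by simp [hy]
    rw [← hj, ← hyv]
    split_ifs with h
    · rw [Nat.testBit_ofBits_lt _ _ h]
    · rw [Nat.testBit_ofBits_lt _ _ (by omega)]
      grind
  · rintro ⟨j, -, e, -, h⟩
    exact ⟨fun v => if (v : ℕ) < P.v₀ then j.testBit v else e.testBit (v - P.v₀), h⟩

theorem arr_input (ψ : KCNF k) (i : Fin ψ.M) (j : Fin k) :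
    ψ.input.arr 0 ((i : ℕ) * k + (j : ℕ) : ℕ) = encodeCode (literalCode (ψ.lit i j)) := by
  rw [← encodeLit_eq]
  have := storeMat_apply (fun i j => encodeLit (ψ.lit i j)) i j
  rw [← this]
  push_cast
  rfl

theorem bits_arr_input_le (ψ : KCNF k) (hL : ψ.N + 2 ≤ L) (a : ℕ) (t : ℤ) :
    bits (ψ.input.arr a t) ≤ L := by
  match a with
  | 0 =>
    refine bits_storeMat_le (fun i j => ?_) (by omega) t
    refine le_trans (bits_mono (z := (ψ.N : ℤ)) ?_) ((bits_natCast_le_self _).trans (by omega))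
    have := (ψ.lit i j).1.2
    unfold encodeLit
    split_ifs <;> omega
  | a + 1 =>
    show bits 0 ≤ L
    rw [bits_zero]
    omega

end KCNF

namespace XExpr

/-- Powers with constant exponent. -/
def pow (e : XExpr) : ℕ → XExpr
  | 0 => .const 1
  | n + 1 => .mul (pow e n) e

theorem WF.pow (he : e.WF) (n : ℕ) : (XExpr.pow e n).WF := by
  induction n with
  | zero => trivial
  | succ n ih => exact ⟨ih, he⟩

theorem Is.pow {a : ℤ} (he : Is σ n e ε a) (m : ℕ) :
    Is σ n (XExpr.pow e m) ε (a ^ m) := by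
  induction m with
  | zero => exact (Is.const 1).congr (by simp)
  | succ m ih => exact (ih.mul he).congr (by rw [pow_succ])

/-- The encoding of the literal with a given number. -/
def encode (l : XExpr) : XExpr :=
  .mul (.sub (.mul (.const 2) (.sub l (.mul (.const 2) (.div l (.const 2))))) (.const 1))
    (.add (.div l (.const 2)) (.const 1))

/-- The number of occurrences of the literal `l` among `m` literals of the formula. -/
def occurrences (l i : XExpr) : ℕ → XExpr
  | 0 => .const 0
  | m + 1 => .add (occurrences l i m) ((XExpr.cell 0 (.add i (.const m))).eq (encode l))

/-- Some clause of the formula has the code in register `30`. -/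
def inFormula (k : ℕ) : XExpr :=
  .ex 1 1 (.all 0 2 ((count (.lv 0) k (.var 30)).eq
    (occurrences (.lv 0) (.mul (.lv 1) (.const k)) k)))

theorem WF.encode {l : XExpr} (h : l.WF) : (XExpr.encode l).WF := by
  simp only [XExpr.encode, XExpr.WF, h]
  trivial

theorem WF.occurrences {l : XExpr} (h : l.WF) (hi : i.WF) (m : ℕ) :
    (XExpr.occurrences l i m).WF := by
  induction m with
  | zero => trivial
  | succ m ih =>
    simp only [XExpr.occurrences, XExpr.WF, XExpr.eq, XExpr.le, ih, hi, h.encode]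
    decide

theorem wf_inFormula (k : ℕ) : (inFormula k).WF := by
  have h0 : (XExpr.lv 0).WF := trivial
  have h1 : (XExpr.mul (.lv 1) (.const k)).WF := ⟨trivial, trivial⟩
  have h30 : (XExpr.var 30).WF := by simp
  simp only [inFormula, ex, all, neg, XExpr.WF, XExpr.eq, XExpr.le, h0.count k h30,
    h0.occurrences h1]
  decide

variable {σ : Memory} {n : ℕ} {e f i : XExpr} {ε : ℕ → ℤ} {l v : ℕ}

theorem Is.encode (he : Is σ n e ε (l : ℕ)) : Is σ n (XExpr.encode e) ε (encodeCode l) := by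
  refine ((((Is.const 2).mul (he.sub ((Is.const 2).mul (he.div (Is.const 2))))).sub
    (Is.const 1)).mul ((he.div (Is.const 2)).add (Is.const 1))).congr ?_
  unfold encodeCode
  push_cast
  rw [Int.emod_def]

theorem Is.occurrences (he : Is σ n e ε (l : ℕ)) (hi : Is σ n i ε (v : ℕ)) (m : ℕ) :
    Is σ n (XExpr.occurrences e i m) ε
      (∑ j ∈ range m, bit (σ.arr 0 ((v + j : ℕ) : ℤ) = encodeCode l)) := by
  induction m with
  | zero => exact (Is.const 0).congr (by simp)
  | succ m ih =>
    rw [sum_range_succ]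
    exact ih.add ((Is.cell (hi.add (Is.const (m : ℤ))) (by push_cast; rfl)).eq he.encode)

theorem Is.inFormula {z : ℕ} {ψ : KCNF k} (ht : Tables k (2 * ψ.N) σ) (hM : σ.reg 1 = ψ.M)
    (ha : σ.arr 0 = ψ.input.arr 0) (h30 : σ.reg 30 = z) :
    Is σ n (XExpr.inFormula k) ε (bit (clause (2 * ψ.N + 1) k z ∈ ψ.clauses)) := by
  intro ε' h'
  refine (Is.ex (N := ψ.M) (p := fun i => ∀ l < 2 * ψ.N,
    (((clause (2 * ψ.N + 1) k z).count l : ℕ) : ℤ) =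
      ∑ j ∈ range k, bit (σ.arr 0 ((i * k + j : ℕ) : ℤ) = encodeCode l)) hM fun i _ => ?_).eval_eq.trans
      (bit_congr ?_)
  · refine Is.all (N := 2 * ψ.N) ht.literals fun l _ => ?_
    have h0 : Is σ 0 (.lv 0) (update (update ε' 1 (i : ℤ)) 0 (l : ℤ)) (l : ℕ) :=
      Is.lv 0 (l : ℤ)
    have h1 : Is σ 1 (.lv 1) (update ε' 1 (i : ℤ)) (i : ℕ) := Is.lv 1 (i : ℤ)
    refine (Is.count ht h0 k (Is.var h30)).eq (Is.occurrences h0 ?_ k)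
    exact ((h1.bound one_pos (fun _ _ => rfl) _).mul (Is.const (k : ℤ))).congr (by push_cast; rfl)
  · have key : ∀ i : Fin ψ.M, (∀ l < 2 * ψ.N, (((clause (2 * ψ.N + 1) k z).count l : ℕ) : ℤ) =
        ∑ j ∈ range k, bit (σ.arr 0 (((i : ℕ) * k + j : ℕ) : ℤ) = encodeCode l)) ↔
        ψ.clauseAt i = clause (2 * ψ.N + 1) k z := by
      intro i
      have hcount : ∀ l, ∑ j ∈ range k, bit (σ.arr 0 (((i : ℕ) * k + j : ℕ) : ℤ) =
          encodeCode l) = (((ψ.clauseAt i).count l : ℕ) : ℤ) := by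
        intro l
        rw [sum_range, KCNF.clauseAt, Multiset.count_sum', Nat.cast_sum]
        refine sum_congr rfl fun j _ => ?_
        rw [ha, ψ.arr_input, Multiset.count_singleton, bit_eq_ite]
        by_cases h : l = literalCode (ψ.lit i j)
        · grind
        · rw [if_neg h, if_neg fun h' => h (encodeCode_injective h').symm]
          rfl
      simp only [hcount]
      rw [eq_comm, ← clause_ext (q := 2 * ψ.N) (fun l => lt_of_mem_clause)
        fun l hl => (ψ.bounded_clauses _ (mem_image_of_mem _ (mem_univ i))).2 l hl]
      exact forall_congr' fun l => forall_congr' fun _ => by norm_cast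
    unfold KCNF.clauses
    rw [mem_image]
    constructor
    · rintro ⟨i, hi, h⟩
      exact ⟨⟨i, hi⟩, mem_univ _, (key ⟨i, hi⟩).1 h⟩
    · rintro ⟨i, -, h⟩
      exact ⟨i, i.2, (key i).2 h⟩

end XExpr

/-! ### Preparing the search -/

theorem Ter.seq_le {q : Prog} {R : Memory → Prop} (hL : 2 ≤ L)
    (h : Ter p σ (L ^ a) R) (h' : ∀ σ', R σ' → Ter q σ' (L ^ b) Q) :
    Ter (.seq p q) σ (L ^ (a + b + 1)) Q :=
  (h.seq h').mono_left (pow_add_pow_le hL)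

/-- Assign values of expressions to registers one after the other, then continue with `q`. -/
def Prog.sets : List (ℕ × XExpr) → Prog → Prog
  | [], q => q
  | (x, e) :: l, q => .seq (.set x e) (sets l q)

/-- The exponent of the time bound for `Prog.sets`. -/
def setsDeg : List (ℕ × XExpr) → ℕ → ℕ
  | [], d => d
  | (_, e) :: l, d => e.deg + 2 + setsDeg l d + 1

theorem Ter.sets_cons {l : List (ℕ × XExpr)} {q : Prog} (hσ : σ.Good L) (z : ℤ) (he : e.WF) (hz : e.val σ = z)
    (hb : bits z ≤ L ∧ (x < boundRegs → z ≤ L))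
    (h : (σ.setReg x z).Good L → Ter (.sets l q) (σ.setReg x z) (L ^ setsDeg l d) Q) :
    Ter (.sets ((x, e) :: l) q) σ (L ^ setsDeg ((x, e) :: l) d) Q :=
  (Ter.set_seq hσ he hz (h (hσ.setReg hb.1 hb.2))).mono_left (pow_add_pow_le hσ.two_le)

/-- The parameters for formulas with `N` variables: `2 ^ (κ h)` units, one for each assignment of
the first `κ h` variables. -/
def Params.ofVars (κ C s N h : ℕ) : Params where
  n := 2 ^ (κ * h)
  E := 2 ^ (N - κ * h)
  w := 2 ^ h
  fuel := 4 * C * 2 ^ ((κ - 1) * h)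
  range := C * 2 ^ (κ * h) + 1
  D := 1 + 2 * N * s
  v₀ := κ * h

/-- The sizes of the tables. -/
def sizeRegs (κ r h₀ k : ℕ) : List (ℕ × XExpr) :=
  [(2, .mul (.const 2) (.var 0)), (5, .add (.var 2) (.const 1)), (3, .pow (.var 5) k),
    (4, .mul (.const ((k + 1) * (k + 1) : ℕ)) (.var 3)),
    (19, .add (.div (.var 0) (.const r)) (.const h₀)), (17, .mul (.const κ) (.var 19)),
    (18, .add (.add (.var 0) (.var 17)) (.const 1))]

/-- The next power of two. -/
def nextPower : XExpr :=
  .add (.ind (.sub (.const 1) (.var 30)))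
    (.mul (.const 2) (.cell 2 (.sub (.var 30) (.const 1))))

/-- The parameters of the search. -/
def paramRegs (κ C s : ℕ) : List (ℕ × XExpr) :=
  [(10, .cell 2 (.var 17)), (12, .cell 2 (.var 19)),
    (14, .mul (.const (4 * C : ℕ)) (.cell 2 (.mul (.const (κ - 1 : ℕ)) (.var 19)))),
    (15, .add (.mul (.const C) (.var 10)) (.const 1)),
    (16, .add (.const 2) (.mul (.const s) (.var 2))),
    (11, .cell 2 (.mul (.sub (.var 0) (.var 17)) (.ind (.sub (.var 0) (.var 17)))))]

/-- Compute the constants of the search and the family of clauses of the formula. -/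
def Prog.setUp (κ C s r h₀ k : ℕ) : Prog :=
  .sets (sizeRegs κ r h₀ k) (.seq (.fill 2 30 18 (.var 30) nextPower)
    (.sets (paramRegs κ C s) (.addFamily (.const 0) (.inFormula k))))

/-- The exponent of the time bound for `Prog.setUp`. -/
def setUpDeg (κ C s r h₀ k : ℕ) : ℕ :=
  setsDeg (sizeRegs κ r h₀ k) (fillDeg (.var 30) nextPower + 2 + setsDeg (paramRegs κ C s)
    (fillDeg (.add (.mul (.const 0) (.var 3)) (.var 30)) (.inFormula k) + 2) + 1)

section

variable {κ C s r h₀ k L Z h : ℕ} {ψ : KCNF k}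

theorem KCNF.good_input (hL : 2 ≤ L) (h1 : ψ.N + ψ.M + 2 ≤ L) : ψ.input.Good L := by
  have hreg : ∀ x, 0 ≤ ψ.input.reg x ∧ ψ.input.reg x ≤ (ψ.N + ψ.M : ℕ) := by
    intro x
    match x with
    | 0 => exact ⟨Int.natCast_nonneg _, show (ψ.N : ℤ) ≤ _ by push_cast; omega⟩
    | 1 => exact ⟨Int.natCast_nonneg _, show (ψ.M : ℤ) ≤ _ by push_cast; omega⟩
    | x + 2 => exact ⟨le_rfl, show (0 : ℤ) ≤ _ by positivity⟩
  refine ⟨hL, fun x _ => ?_, fun a _ t => ψ.bits_arr_input_le (by omega) a t, fun x _ => ?_⟩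
  · have := hreg x
    exact (bits_mono (z := (ψ.N + ψ.M : ℕ)) (by omega)).trans
      ((bits_natCast_le_self _).trans (by omega))
  · have := hreg x
    omega

theorem Ter.setUp (hκ : 1 ≤ κ) (hC : 1 ≤ C) (hs : 1 ≤ s) (hh : h = ψ.N / r + h₀) (hL : 2 ≤ L)
    (h1 : ψ.N + ψ.M + κ * h + 4 ≤ L) (h2 : (k + 1) * (k + 1) * (2 * ψ.N + 1) ^ k ≤ L)
    (h3 : 2 + 2 * ψ.N * s ≤ L) (hZ : Z < 2 ^ (L - 1)) (h4 : 4 * C * 2 ^ (ψ.N + κ * h) + 1 ≤ Z) :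
    Ter (.setUp κ C s r h₀ k) ψ.input (L ^ setUpDeg κ C s r h₀ k) fun σ => σ.Good L ∧
      Setup k ψ.N (.ofVars κ C s ψ.N h) σ ∧ σ.Stamped ∧
      HoldsFamily k (2 * ψ.N) σ 0 ψ.clauses ∧ σ.reg 27 = 0 ∧ σ.reg stampReg = 0 := by
  have hLL : L < 2 ^ (L - 1) := by
    have h5 : L - 2 < 2 ^ (L - 2) := Nat.lt_two_pow_self
    have h6 : 2 ^ (L - 1) = 2 * 2 ^ (L - 2) := by rw [← pow_succ']; congr 1; omega
    omega
  have hb : ∀ {z : ℤ}, 0 ≤ z → z ≤ L → bits z ≤ L := fun h h' =>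
    bits_le_of_le hLL hL h h'
  have hbZ : ∀ {z : ℕ}, z ≤ Z → bits (z : ℤ) ≤ L := fun h' =>
    bits_le_of_le hZ hL (by positivity) (mod_cast h')
  have hP : (2 * ψ.N + 1) ^ k ≤ L := le_trans (Nat.le_mul_of_pos_left _ (by positivity)) h2
  have hpowZ : ∀ v ≤ ψ.N + κ * h, C * 2 ^ v ≤ Z ∧ 4 * C * 2 ^ v + 1 ≤ Z := by
    intro v hv
    have h5 : C * 2 ^ v ≤ C * 2 ^ (ψ.N + κ * h) :=
      Nat.mul_le_mul_left _ (Nat.pow_le_pow_right (by norm_num) hv)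
    rw [mul_assoc] at h4 ⊢
    omega
  have hwf := @XExpr.wf_var
  have hN : 2 * ψ.N + 2 ≤ L := by
    have : ψ.N ≤ ψ.N * s := Nat.le_mul_of_pos_right _ hs
    rw [mul_assoc] at h3
    omega
  have hh' : h ≤ κ * h := Nat.le_mul_of_pos_left _ hκ
  have g₀ := ψ.good_input hL (by omega)
  have r0 : ψ.input.reg 0 = ψ.N := rfl
  have hbL : ∀ {z : ℕ} {x : ℕ}, z ≤ L → bits (z : ℤ) ≤ L ∧ (x < boundRegs → (z : ℤ) ≤ L) :=
    fun h => ⟨hb (by positivity) (mod_cast h), fun _ => mod_cast h⟩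
  unfold Prog.setUp setUpDeg sizeRegs
  refine Ter.sets_cons g₀ (2 * ψ.N : ℕ) ⟨trivial, hwf (by decide)⟩
    (by simp [XExpr.val, XExpr.eval, r0]) (hbL (by omega)) fun g => ?_
  refine Ter.sets_cons g (2 * ψ.N + 1 : ℕ) ⟨hwf (by decide), trivial⟩
    (by simp [XExpr.val, XExpr.eval]) (hbL (by omega)) fun g => ?_
  refine Ter.sets_cons g ((2 * ψ.N + 1) ^ k : ℕ) ((hwf (by decide)).pow _)
    ((Is.pow (Is.var (n := 0) (a := (2 * ψ.N + 1 : ℕ)) (by simp))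
      k).val_eq.trans (by push_cast; rfl)) (hbL hP) fun g => ?_
  refine Ter.sets_cons g ((k + 1) * (k + 1) * (2 * ψ.N + 1) ^ k : ℕ) ⟨trivial, hwf (by decide)⟩
    (by simp [XExpr.val, XExpr.eval]) (hbL h2) fun g => ?_
  refine Ter.sets_cons g (h : ℕ) ⟨⟨hwf (by decide), trivial⟩, trivial⟩
    (by simp [XExpr.val, XExpr.eval, r0, hh]) (hbL (by omega))
    fun g => ?_
  refine Ter.sets_cons g (κ * h : ℕ) ⟨trivial, hwf (by decide)⟩
    (by simp [XExpr.val, XExpr.eval]) (hbL (by omega)) fun g => ?_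
  refine Ter.sets_cons g (ψ.N + κ * h + 1 : ℕ) ⟨⟨hwf (by decide), hwf (by decide)⟩, trivial⟩
    (by simp [XExpr.val, XExpr.eval, r0]) (hbL (by omega)) fun g => ?_
  set σ := (((((((ψ.input.setReg 2 (2 * ψ.N : ℕ)).setReg 5 (2 * ψ.N + 1 : ℕ)).setReg 3
    ((2 * ψ.N + 1) ^ k : ℕ)).setReg 4 ((k + 1) * (k + 1) * (2 * ψ.N + 1) ^ k : ℕ)).setReg 19
    (h : ℕ)).setReg 17 (κ * h : ℕ)).setReg 18 (ψ.N + κ * h + 1 : ℕ)) with hσ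
  have hσr : ∀ x, σ.reg x = update (update (update (update
      (update (update (update ψ.input.reg 2 (2 * ψ.N : ℕ)) 5
      (2 * ψ.N + 1 : ℕ)) 3 ((2 * ψ.N + 1) ^ k : ℕ)) 4
      ((k + 1) * (k + 1) * (2 * ψ.N + 1) ^ k : ℕ)) 19 (h : ℕ)) 17 (κ * h : ℕ)) 18
      (ψ.N + κ * h + 1 : ℕ) x := fun _ => rfl
  have hσa : σ.arr = ψ.input.arr := rfl
  clear_value σ
  have q0 : σ.reg 0 = ψ.N := by rw [hσr]; rfl
  have q1 : σ.reg 1 = ψ.M := by rw [hσr]; rfl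
  have q2 : σ.reg 2 = (2 * ψ.N : ℕ) := by rw [hσr]; rfl
  have q3 : σ.reg 3 = ((2 * ψ.N + 1) ^ k : ℕ) := by rw [hσr]; rfl
  have q4 : σ.reg 4 = ((k + 1) * (k + 1) * (2 * ψ.N + 1) ^ k : ℕ) := by rw [hσr]; rfl
  have q5 : σ.reg 5 = (2 * ψ.N + 1 : ℕ) := by rw [hσr]; rfl
  have q19 : σ.reg 19 = h := by rw [hσr]; rfl
  have q17 : σ.reg 17 = (κ * h : ℕ) := by rw [hσr]; rfl
  have q18 : σ.reg 18 = (ψ.N + κ * h + 1 : ℕ) := by rw [hσr]; rfl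
  have q27 : σ.reg 27 = 0 := by rw [hσr]; rfl
  have q39 : σ.reg 39 = 0 := by rw [hσr]; rfl
  clear hσr
  refine Ter.seq_le hL (Ter.fill (a := 2) (x := 30) (r := 18) (i := .var 30) (e := nextPower) g
    (by decide) (by decide) (by decide) (by decide) (hwf (by decide))
    (by simp only [nextPower, XExpr.WF]; decide) q18 (fun v => (v : ℤ)) (fun v => (2 ^ v : ℕ))
    (fun v _ w _ h => mod_cast h) (fun _ v hv => hbZ ?_) (fun v hv A hA hA' => ⟨?_, ?_⟩)
    (Q := fun σ' => ∃ A : ℤ → ℤ, (∀ v : ℕ, v ≤ ψ.N + κ * h → A v = (2 ^ v : ℕ)) ∧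
      (∀ j, bits (A j) ≤ L) ∧ σ' = (σ.setReg 30 (ψ.N + κ * h + 1 : ℕ)).setArr 2 A)
    (fun A hA hA' => ⟨A, fun v hv => hA v (by omega), fun j => ?_, rfl⟩) |>.mono_left ?_) ?_
  · exact (Nat.le_mul_of_pos_left _ hC).trans (hpowZ v (by omega)).1
  · simp [XExpr.val, XExpr.eval, setArr_reg]
  · simp only [XExpr.val, XExpr.eval, nextPower, setReg_reg, setArr_reg,
      setArr_arr, update_self]
    rcases v with _ | v
    · rw [hA' _ fun w _ => by omega, hσa]
      rfl
    · rw [if_neg (by push_cast; omega), show ((v + 1 : ℕ) : ℤ) - 1 = v by push_cast; ring,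
        hA v (Nat.lt_succ_self v)]
      push_cast
      ring
  · by_cases hj : ∃ w < ψ.N + κ * h + 1, j = (w : ℤ)
    · obtain ⟨w, hw, rfl⟩ := hj
      rw [hA w hw]
      exact hbZ ((Nat.le_mul_of_pos_left _ hC).trans (hpowZ w (by omega)).1)
    · push Not at hj
      rw [hA' j hj]
      exact g.arr 2 (by decide) j
  · rw [pow_add, mul_comm]
    exact Nat.mul_le_mul_left _ ((show _ ≤ L by omega).trans (Nat.le_self_pow (by norm_num) L))
  rintro _ ⟨A, hA, hAb, rfl⟩
  have g' : ((σ.setReg 30 (ψ.N + κ * h + 1 : ℕ)).setArr 2 A).Good L :=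
    (g.setReg (hbL (x := 30) (by omega)).1 (hbL (by omega)).2).setArr fun _ => hAb
  clear g
  unfold paramRegs
  have hbP : ∀ {z x : ℕ}, z ≤ Z → boundRegs ≤ x →
      bits (z : ℤ) ≤ L ∧ (x < boundRegs → (z : ℤ) ≤ L) :=
    fun h h' => ⟨hbZ h, fun h'' => absurd h'' (by omega)⟩
  have hκh : (κ - 1) * h ≤ ψ.N + κ * h :=
    (Nat.mul_le_mul_right _ (Nat.sub_le _ _)).trans (Nat.le_add_left _ _)
  have hpow1 : ∀ v ≤ ψ.N + κ * h, 2 ^ v ≤ Z := fun v hv =>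
    (Nat.le_mul_of_pos_left _ hC).trans (hpowZ v hv).1
  have hA1 := hA (κ * h) (by omega)
  have hA2 := hA h (by omega)
  have hA3 := hA ((κ - 1) * h) hκh
  push_cast at hA1 hA2 hA3
  refine Ter.sets_cons g' (2 ^ (κ * h) : ℕ) ⟨by decide, hwf (by decide)⟩
    (by simp [XExpr.val, XExpr.eval, setArr_reg, setArr_arr,
      q17, hA1]) (hbP (hpow1 _ (by omega)) (by decide)) fun g => ?_
  refine Ter.sets_cons g (2 ^ h : ℕ) ⟨by decide, hwf (by decide)⟩
    (by simp [XExpr.val, XExpr.eval, setReg_arr, setArr_reg,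
      setArr_arr, q19, hA2]) (hbP (hpow1 _ (by omega)) (by decide)) fun g => ?_
  refine Ter.sets_cons g (4 * C * 2 ^ ((κ - 1) * h) : ℕ)
    ⟨trivial, by decide, trivial, hwf (by decide)⟩
    (by simp [XExpr.val, XExpr.eval, setReg_arr, setArr_reg,
      setArr_arr, q19, hA3]) (hbP (Nat.le_of_succ_le (hpowZ _ hκh).2) (by decide))
    fun g => ?_
  refine Ter.sets_cons g (C * 2 ^ (κ * h) + 1 : ℕ) ⟨⟨trivial, hwf (by decide)⟩, trivial⟩
    (by simp [XExpr.val, XExpr.eval])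
    (hbP (le_trans (by rw [mul_assoc]; omega) (hpowZ (κ * h) (by omega)).2) (by decide)) fun g => ?_
  refine Ter.sets_cons g (1 + 2 * ψ.N * s + 1 : ℕ) ⟨trivial, trivial, hwf (by decide)⟩
    (by simp [XExpr.val, XExpr.eval, setArr_reg, q2]; ring)
    ⟨(hbL (x := 16) (by omega)).1, fun h => absurd h (by decide)⟩ fun g => ?_
  have hE : ((ψ.N : ℤ) - (κ * h : ℕ)) * (if 0 < (ψ.N : ℤ) - (κ * h : ℕ) then 1 else 0) =
      (ψ.N - κ * h : ℕ) := by split_ifs <;> omega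
  have hA4 := hA (ψ.N - κ * h) (by omega)
  refine Ter.sets_cons g (2 ^ (ψ.N - κ * h) : ℕ)
    ⟨by decide, ⟨hwf (by decide), hwf (by decide)⟩, hwf (by decide), hwf (by decide)⟩
    ?_ (hbP (hpow1 _ (by omega)) (by decide)) fun g => ?_
  · rw [← hA4, ← hE, ← q0, ← q17]
    rfl
  set τ := ((((((((σ.setReg 30 (ψ.N + κ * h + 1 : ℕ)).setArr 2 A).setReg 10
    (2 ^ (κ * h) : ℕ)).setReg 12 (2 ^ h : ℕ)).setReg 14 (4 * C * 2 ^ ((κ - 1) * h) : ℕ)).setReg 15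
    (C * 2 ^ (κ * h) + 1 : ℕ)).setReg 16 (1 + 2 * ψ.N * s + 1 : ℕ)).setReg 11
    (2 ^ (ψ.N - κ * h) : ℕ)) with hτ
  have hS : Setup k ψ.N (.ofVars κ C s ψ.N h) τ :=
    ⟨⟨q2, q3, q4, q5⟩, rfl, rfl, rfl, rfl, rfl, rfl, q17, fun v hv => (hA v (by
      rcases hv with hv | hv
      · omega
      · exact le_trans hv.le (Nat.le_add_left _ _))).trans (by push_cast; rfl)⟩
  have hτa : ∀ a, a ≠ 2 → τ.arr a = ψ.input.arr a := fun a ha => by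
    rw [← hσa]
    exact update_of_ne ha _ _
  have hτ1 : τ.reg 1 = ψ.M := q1
  have hτ27 : τ.reg 27 = 0 := q27
  have hτ39 : τ.reg 39 = 0 := q39
  clear_value τ
  refine (Ter.addFamily (J := 0) g hS.tables (s := .const 0) trivial (XExpr.wf_inFormula k)
    (fun z => clause (2 * ψ.N + 1) k z ∈ ψ.clauses) fun z hz σ' hr h30 _ ha => ⟨rfl, ?_⟩).mono le_rfl ?_
  · refine Is.val_eq (n := 2) (Is.inFormula ⟨?_, ?_, ?_, ?_⟩ ?_ ?_ h30)
    any_goals rw [hr _ (by norm_num)]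
    · exact hS.tables.literals
    · exact hS.tables.codes
    · exact hS.tables.flowers
    · exact hS.tables.base
    · exact hτ1
    grind
  · rintro σ' ⟨g1, hr, -, ha, hF⟩
    refine ⟨g1, hS.congr (fun x _ hx => hr x (by omega)) (ha 2 (by norm_num)), fun a i => ?_, hF,
      by rw [hr _ (by norm_num), hτ27], by rw [hr _ (by norm_num), hτ39]⟩
    obtain ⟨b, hb⟩ : ∃ b, simStamp a = b + 3 := ⟨1 + 2 * a, by show 4 + 2 * a = _; ring⟩
    rw [hr _ (by norm_num), hτ39, hb, ha _ (by omega), hτa _ (by omega)]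
    exact ⟨le_rfl, le_rfl⟩

end

/-! ### Deciding satisfiability with a gradient program -/

/-- Decide satisfiability of formulas with `k` literals per clause by means of the gradient
program `p`. -/
noncomputable def Prog.solve (p : Prog) (θ : ℕ → ℕ) (κ C s r h₀ k : ℕ) : Prog :=
  .seq (.setUp κ C s r h₀ k) (.seq (p.search θ k) (.assign 0 (.var 27)))

/-- The time for `Prog.solve`. -/
def solveTime (L U w d E mS last R : ℕ) : ℕ := (R + 1) * (leafTime L U w E mS last + L ^ d)

theorem exists_runs_solve {c : ℝ} (hp : Detects l K δ c p) (hθ : ∀ i, 1 ≤ θ i) {s : ℕ} (hκ : 1 ≤ κ) (hC : 1 ≤ C) (r h₀ k : ℕ)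
    (hs : s = 1 + ∑ i ∈ range k, θ i) :
    ∃ w d, ∀ {ψ : KCNF k} {L U Z mS dS R h : ℕ} {φ : ℕ → ℕ → ℝ},
    Scale p l K L U Z mS dS (.ofVars κ C s ψ.N h) →
    (∀ X Y, φ (X + 1) Y + φ X (Y + 1) + 1 ≤ φ X Y) →
    (∀ G X Y, Node θ k (2 * ψ.N) G X Y → 1 ≤ φ X Y) → φ 0 0 ≤ R →
    h = ψ.N / r + h₀ → ψ.N + ψ.M + κ * h + 4 ≤ L →
    (k + 1) * (k + 1) * (2 * ψ.N + 1) ^ k ≤ L → 4 * C * 2 ^ (ψ.N + κ * h) + 1 ≤ Z →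
    solveTime L U w d (2 ^ (ψ.N - κ * h)) mS ((Params.ofVars κ C s ψ.N h).last mS dS) R ≤ Z →
    ∃ t s', Runs (p.solve θ κ C s r h₀ k) ψ.input t s' ∧ (0 < s'.reg 0 ↔ ψ.Satisfiable) ∧
      t ≤ solveTime L U w d (2 ^ (ψ.N - κ * h)) mS ((Params.ofVars κ C s ψ.N h).last mS dS) R := by
  obtain ⟨w, d, H⟩ := Ter.search hp hθ k
  refine ⟨w, d + setUpDeg κ C s r h₀ k + 1 + 2 + 1, ?_⟩
  intro ψ L U Z mS dS R h φ S hφ hφ1 hφR hh h1 h2 h4 hZ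
  have hL : 2 ≤ L := by omega
  obtain ⟨T, hT⟩ : ∃ T, T = leafTime L U w (Params.ofVars κ C s ψ.N h).E mS
    ((Params.ofVars κ C s ψ.N h).last mS dS) + L ^ d := ⟨_, rfl⟩
  have hLT : L + 1 ≤ L ^ 2 := by nlinarith
  have hT1 : (R + 1) * T + L ^ setUpDeg κ C s r h₀ k + (L + 1) ≤ solveTime L U w
      (d + setUpDeg κ C s r h₀ k + 1 + 2 + 1) (2 ^ (ψ.N - κ * h)) mS
      ((Params.ofVars κ C s ψ.N h).last mS dS) R := by
    have h5 := pow_add_pow_le (a := d) (b := setUpDeg κ C s r h₀ k) hL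
    have h6 := pow_add_pow_le (a := d + setUpDeg κ C s r h₀ k + 1) (b := 2) hL
    have h7 : (R + 1) * T + (R + 1) * (L ^ setUpDeg κ C s r h₀ k + (L + 1)) ≤ _ :=
      (mul_add _ _ _).symm.le.trans (Nat.mul_le_mul_left (R + 1) (show _ ≤ leafTime L U w
        (2 ^ (ψ.N - κ * h)) mS ((Params.ofVars κ C s ψ.N h).last mS dS) +
        L ^ (d + setUpDeg κ C s r h₀ k + 1 + 2 + 1) from by
        have h8 : (Params.ofVars κ C s ψ.N h).E = 2 ^ (ψ.N - κ * h) := rfl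
        rw [hT, h8]
        omega))
    have h8 : L ^ setUpDeg κ C s r h₀ k + (L + 1) ≤
      (R + 1) * (L ^ setUpDeg κ C s r h₀ k + (L + 1)) := Nat.le_mul_of_pos_left _ (by omega)
    unfold solveTime
    omega
  have hRT : 2 * R + 3 ≤ Z := by
    have h5 : 4 ≤ T := by
      have h6 : 2 ^ 4 ≤ L ^ 4 := Nat.pow_le_pow_left hL 4
      have h7 : L ^ 4 * 1 ≤ leafTime L U w (Params.ofVars κ C s ψ.N h).E mS
        ((Params.ofVars κ C s ψ.N h).last mS dS) := Nat.mul_le_mul (Nat.le_add_left _ _) (by omega)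
      omega
    have h6 : (R + 1) * 4 ≤ (R + 1) * T := Nat.mul_le_mul_left _ h5
    omega
  have hset := Ter.setUp (s := s) (r := r) (h₀ := h₀) hκ hC (by omega) hh hL h1 h2 (by
    have := S.dim
    change 1 + 2 * ψ.N * s + 1 ≤ L at this
    omega) S.lt h4
  have hrun := hset.seq (T' := (R + 1) * T) (q := p.search θ k)
    (Q := fun σ' => (0 < σ'.reg 27 ↔ (Params.ofVars κ C s ψ.N h).Sat ψ.clauses) ∧
      bits (σ'.reg 27) ≤ L) (by
    rintro σ ⟨g, hS, hst, hF, h27, h39⟩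
    refine H S ?_ hφ hφ1 hφR g hS hst hF ψ.bounded_clauses h27 hT ?_ hRT
    · rw [← hs]
      rfl
    grind)
  obtain ⟨t, s', σ', hr, ht, he, hsat, hbits⟩ := hrun ψ.input (Memory.Equiv.refl _)
  obtain ⟨t₁, t₂, s₁, hr₁, hr₂, rfl⟩ : ∃ t₁ t₂ s₁, Runs (.setUp κ C s r h₀ k) ψ.input t₁ s₁ ∧
      Runs (p.search θ k) s₁ t₂ s' ∧ t = t₁ + t₂ := by
    cases hr with
    | seq h h' => exact ⟨_, _, _, h, h', rfl⟩
  refine ⟨_, _, .seq hr₁ (.seq hr₂ (.assign _ _ _)), ?_, ?_⟩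
  · rw [KCNF.satisfiable_iff (P := .ofVars κ C s ψ.N h) rfl rfl, ← hsat, ← he.2 27 (by decide)]
    simp [Expr.val]
  · rw [← he.2 27 (by decide)] at hbits
    simp only [Expr.cost]
    omega

/-! ### Fast gradient programs -/

theorem exists_fast_of_not_needsAlmostProductTime {m d : ℕ → ℕ}
    (hm : ∀ n, 1 ≤ m n) (h : ¬ NeedsAlmostProductTime l K m d p) :
    ∃ κ C n₀ : ℕ, 2 ≤ κ ∧ 1 ≤ C ∧ ∀ n ≥ n₀, ∀ (I : Instance n (m n) (d n))
      (g : EuclideanSpace ℝ (Fin n)) (t : ℕ) (s : Memory), I.EntriesLE K → I.IsGradient l g →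
      Runs p I.input t s → t ^ κ ≤ C ^ κ * (n * m n) ^ (κ - 1) := by
  unfold NeedsAlmostProductTime at h
  push Not at h
  obtain ⟨ε, hε, C, h⟩ := h
  obtain ⟨n₀, h⟩ := eventually_atTop.1 h
  refine ⟨max 2 ⌈1 / ε⌉₊, max 1 ⌈C⌉₊, max 1 n₀, le_max_left _ _, le_max_left _ _, ?_⟩
  intro n hn I g t s hI hg hr
  set κ := max 2 ⌈1 / ε⌉₊ with hκ
  have hκ2 : (2 : ℝ) ≤ κ := mod_cast le_max_left _ _
  have hκε : 1 / (κ : ℝ) ≤ ε := by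
    rw [div_le_comm₀ (by linarith) hε]
    exact (Nat.le_ceil _).trans (mod_cast le_max_right _ _)
  have hx : (1 : ℝ) ≤ (n : ℝ) * m n := by
    have : 1 ≤ n * m n := Nat.mul_pos ((le_max_left _ _).trans hn) (hm n)
    exact_mod_cast this
  have h1 : (t : ℝ) ≤ (max 1 ⌈C⌉₊ : ℕ) * ((n : ℝ) * m n) ^ (1 - 1 / (κ : ℝ)) := by
    refine (h n ((le_max_right _ _).trans hn) I g t s hI hg hr).trans ?_
    refine mul_le_mul ((Nat.le_ceil C).trans (mod_cast le_max_right _ _))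
      (Real.rpow_le_rpow_of_exponent_le hx (by linarith)) (by positivity) (by positivity)
  have h2 : (t : ℝ) ^ κ ≤ ((max 1 ⌈C⌉₊ : ℕ) : ℝ) ^ κ * ((n : ℝ) * m n) ^ (κ - 1) := by
    refine (pow_le_pow_left₀ (by positivity) h1 κ).trans_eq ?_
    rw [mul_pow, ← Real.rpow_mul_natCast (by positivity), ← Real.rpow_natCast (_ * _) (κ - 1)]
    congr 2
    rw [Nat.cast_sub (by omega), sub_mul, div_mul_cancel₀ _ (by linarith)]
    simp
  exact_mod_cast h2

theorem le_of_pow_le {H : ℕ} (hκ : 2 ≤ κ) (hm : 1 ≤ m)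
    (ht : t ^ κ ≤ C ^ κ * (H ^ κ * m) ^ (κ - 1)) : t ≤ C * H ^ (κ - 1) * m := by
  obtain ⟨j, rfl⟩ : ∃ j, κ = j + 1 := ⟨κ - 1, by omega⟩
  rw [Nat.add_sub_cancel] at *
  refine (Nat.pow_le_pow_iff_left (n := j + 1) (by omega)).1 (ht.trans ?_)
  calc C ^ (j + 1) * (H ^ (j + 1) * m) ^ j = (C * H ^ j) ^ (j + 1) * m ^ j := by
        rw [mul_pow, mul_pow, ← pow_mul, ← pow_mul, mul_comm (j + 1) j]; ring
    _ ≤ (C * H ^ j) ^ (j + 1) * m ^ (j + 1) :=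
        Nat.mul_le_mul_left _ (Nat.pow_le_pow_right hm (by omega))
    _ = _ := by rw [← mul_pow]

/-- A program that is fast on instances with `H ^ κ` units, although there are slow ones, is
run on many examples and in small dimension. -/
theorem bounds_of_fast {H : ℕ} (hκ : 2 ≤ κ) (hC : 1 ≤ C) (hm : 1 ≤ m) (hd : 1 ≤ d)
    (hH : C ^ κ ≤ H) (ht : t ^ κ ≤ C ^ κ * (H ^ κ * m) ^ (κ - 1)) (h1 : H ^ κ ≤ t)
    (h2 : m * d ≤ t) : H ≤ m ∧ d ≤ C * H ^ (κ - 1) ∧ m ≤ C ^ κ * H ^ (κ * (κ - 1)) := by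
  have hH1 : 1 ≤ H := (Nat.one_le_pow _ _ hC).trans hH
  obtain ⟨j, rfl⟩ : ∃ j, κ = j + 1 := ⟨κ - 1, by omega⟩
  rw [Nat.add_sub_cancel] at *
  have hpos : 0 < (H ^ (j + 1)) ^ j := by positivity
  refine ⟨?_, ?_, ?_⟩
  · have h3 : (H ^ (j + 1)) ^ j * H ^ (j + 1) ≤ (H ^ (j + 1)) ^ j * (C ^ (j + 1) * m ^ j) := by
      calc _ = (H ^ (j + 1)) ^ (j + 1) := (pow_succ _ _).symm
        _ ≤ t ^ (j + 1) := Nat.pow_le_pow_left h1 _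
        _ ≤ _ := ht.trans_eq (by rw [mul_pow]; ring)
    have h4 : H ^ j * H ≤ m ^ j * H := by
      rw [← pow_succ]
      refine (Nat.le_of_mul_le_mul_left h3 hpos).trans ?_
      rw [mul_comm]
      exact Nat.mul_le_mul_left _ hH
    exact (Nat.pow_le_pow_iff_left (by omega)).1 (Nat.le_of_mul_le_mul_right h4 hH1)
  · have h3 := le_of_pow_le hκ hm ht
    rw [Nat.add_sub_cancel] at h3
    exact Nat.le_of_mul_le_mul_left ((h2.trans h3).trans_eq (mul_comm _ _)) hm
  · have h3 : m ^ j * m ≤ m ^ j * (C ^ (j + 1) * H ^ ((j + 1) * j)) := by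
      calc _ = m ^ (j + 1) := (pow_succ _ _).symm
        _ ≤ t ^ (j + 1) := Nat.pow_le_pow_left ((Nat.le_mul_of_pos_right _ hd).trans h2) _
        _ ≤ _ := ht.trans_eq (by rw [mul_pow, ← pow_mul]; ring)
    exact Nat.le_of_mul_le_mul_left h3 (by positivity)

theorem exists_two_pow_mul_pow_lt (b : ℕ) :
    ∃ L₀, ∀ L ≥ L₀, ∀ x, 2 * x ≤ L → 2 ^ x * L ^ b < 2 ^ (L - 1) := by
  have h := tendsto_pow_const_div_const_pow_of_one_lt (2 * b) (by norm_num : (1 : ℝ) < 2)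
  obtain ⟨L₀, h⟩ := eventually_atTop.1 (h.eventually_lt_const (by norm_num : (0 : ℝ) < 1 / 4))
  refine ⟨max 1 L₀, fun L hL x hx => ?_⟩
  have h1 := h L ((le_max_right _ _).trans hL)
  rw [div_lt_iff₀ (by positivity)] at h1
  have h2 : 4 * L ^ (2 * b) < 2 ^ L := by
    have : (4 : ℝ) * (L : ℝ) ^ (2 * b) < 2 ^ L := by linarith
    exact_mod_cast this
  have h3 : 2 ^ L = 2 * 2 ^ (L - 1) := by
    rw [← pow_succ']
    congr 1
    have := (le_max_left _ _).trans hL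
    omega
  refine lt_of_pow_lt_pow_left₀ 2 (by positivity) ?_
  have h4 : 2 ^ (2 * x) ≤ 2 ^ L := Nat.pow_le_pow_right (by norm_num) hx
  have h5 : (2 ^ x * L ^ b) ^ 2 = 2 ^ (2 * x) * L ^ (2 * b) := by
    rw [mul_pow, ← pow_mul, ← pow_mul, mul_comm x, mul_comm b]
  rw [h5]
  have h6 : 2 ^ (2 * x) * L ^ (2 * b) ≤ 2 ^ L * L ^ (2 * b) := Nat.mul_le_mul_right _ h4
  have h7 : 2 ^ L * (4 * L ^ (2 * b)) < 2 ^ L * 2 ^ L := Nat.mul_lt_mul_of_pos_left h2 (by positivity)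
  rw [h3] at h6 h7
  nlinarith

/-! ### The time of the search -/

theorem leafTime_le {dS last : ℕ} (hκ : 2 ≤ κ) (hC : 1 ≤ C) (hm : 1 ≤ m)
    (hL : 1 ≤ L) (hmle : m ≤ C ^ κ * (2 ^ h) ^ (κ * (κ - 1))) (hd : dS ≤ C * (2 ^ h) ^ (κ - 1))
    (hlast : last ≤ m * (C * (2 ^ h) ^ κ + 1) + dS) :
    leafTime L (4 * C * (2 ^ h) ^ (κ - 1) + 1) w (2 ^ (N - κ * h)) m last + L ^ d ≤
      71 * C ^ (2 * κ + 2) * L ^ (w + d + 4) * (2 ^ (N - h) + (2 ^ h) ^ (2 * κ ^ 2)) := by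
  obtain ⟨j, rfl⟩ : ∃ j, κ = j + 1 := ⟨κ - 1, by omega⟩
  rw [Nat.add_sub_cancel] at *
  have e1 : (2 ^ h) ^ j * 2 ^ (N - (j + 1) * h) ≤ 2 ^ (N - h) + (2 ^ h) ^ (2 * (j + 1) ^ 2) := by
    rcases le_total ((j + 1) * h) N with hN | hN
    · refine le_trans (le_of_eq ?_) (Nat.le_add_right _ _)
      rw [← pow_mul, ← pow_add]
      grind
    · rw [Nat.sub_eq_zero_of_le hN, pow_zero, mul_one]
      exact (Nat.pow_le_pow_right (by positivity) (by nlinarith)).trans (Nat.le_add_left _ _)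
  obtain ⟨E, hE⟩ : ∃ E, E = 2 ^ (N - (j + 1) * h) := ⟨_, rfl⟩
  obtain ⟨Y, hY⟩ : ∃ Y, Y = 2 ^ (N - h) := ⟨_, rfl⟩
  obtain ⟨H, hH⟩ : ∃ H, H = 2 ^ h := ⟨_, rfl⟩
  have hH1 : 1 ≤ H := hH ▸ Nat.one_le_two_pow
  simp only [← hE, ← hY, ← hH] at e1 hmle hd hlast ⊢
  clear hE hY hH
  have e2 : H ^ j ≤ H ^ (2 * (j + 1) ^ 2) := Nat.pow_le_pow_right hH1 (by nlinarith)
  have e3 : H ^ j * (H ^ (j + 1) * m * m) ≤ C ^ (2 * j + 2) * H ^ (2 * (j + 1) ^ 2) := by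
    calc H ^ j * (H ^ (j + 1) * m * m)
        ≤ H ^ j * (H ^ (j + 1) * (C ^ (j + 1) * H ^ ((j + 1) * j)) *
          (C ^ (j + 1) * H ^ ((j + 1) * j))) := by gcongr
      _ = C ^ (2 * j + 2) * H ^ (j + (j + 1) + 2 * ((j + 1) * j)) := by ring
      _ ≤ _ := Nat.mul_le_mul_left _ (Nat.pow_le_pow_right hH1 (by nlinarith))
  obtain ⟨X, hX⟩ : ∃ X, X = H ^ (2 * (j + 1) ^ 2) := ⟨_, rfl⟩
  obtain ⟨a, ha⟩ : ∃ a, a = H ^ j := ⟨_, rfl⟩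
  have ha1 : 1 ≤ a := ha ▸ Nat.one_le_pow _ _ hH1
  have hq1 : 1 ≤ C * H ^ (j + 1) := Nat.mul_pos hC (Nat.one_le_pow _ _ hH1)
  have hd' : dS ≤ C * H ^ (j + 1) :=
    hd.trans (Nat.mul_le_mul_left _ (Nat.pow_le_pow_right hH1 (by omega)))
  simp only [← hX, ← ha] at e1 e2 e3 hd ⊢
  have hU : 4 * C * a + 1 ≤ 5 * C * a := by nlinarith [Nat.mul_pos hC ha1]
  have hS : E + m + m * last + 2 ≤ E + 2 + 4 * C * (H ^ (j + 1) * m * m) := by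
    have h1 : 1 + last ≤ m * (4 * (C * H ^ (j + 1))) := by
      nlinarith [Nat.mul_le_mul hm hq1, Nat.le_mul_of_pos_left (C * H ^ (j + 1)) hm,
        Nat.le_mul_of_pos_right m hq1]
    nlinarith [Nat.mul_le_mul_left m h1]
  have hCp : C ≤ C ^ (2 * j + 4) := Nat.le_self_pow (by omega) C
  have hUS : (4 * C * a + 1) * (E + m + m * last + 2) ≤ 35 * C ^ (2 * j + 4) * (Y + X) := by
    calc _ ≤ 5 * C * a * (E + 2 + 4 * C * (H ^ (j + 1) * m * m)) := Nat.mul_le_mul hU hS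
      _ = 5 * (C * (a * E)) + 10 * (C * a) + 20 * (C * C * (a * (H ^ (j + 1) * m * m))) := by ring
      _ ≤ 5 * (C ^ (2 * j + 4) * (Y + X)) + 10 * (C ^ (2 * j + 4) * X) +
          20 * (C * C * (C ^ (2 * j + 2) * X)) := by gcongr
      _ = 35 * C ^ (2 * j + 4) * X + 5 * C ^ (2 * j + 4) * Y := by ring
      _ ≤ _ := by grind
  have hYX : 1 ≤ Y + X := (ha1.trans e2).trans (Nat.le_add_left _ _)
  have hLw : L ^ w ≤ L ^ (w + d + 4) := Nat.pow_le_pow_right hL (by omega)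
  have hL4 : L ^ 4 ≤ L ^ (w + d + 4) := Nat.pow_le_pow_right hL (by omega)
  have hLd : L ^ d ≤ L ^ (w + d + 4) := Nat.pow_le_pow_right hL (by omega)
  have hC1 : 1 ≤ C ^ (2 * j + 4) := Nat.one_le_pow _ _ hC
  calc leafTime L (4 * C * a + 1) w E m last + L ^ d
      ≤ ((4 * C * a + 1) * L ^ (w + d + 4) + (4 * C * a + 1) * L ^ (w + d + 4)) *
        (E + m + m * last + 2) + L ^ (w + d + 4) * (1 * 1) := by
        unfold leafTime
        rw [mul_one, mul_one]
        gcongr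
        grind
    _ = L ^ (w + d + 4) * (2 * ((4 * C * a + 1) * (E + m + m * last + 2)) + 1 * 1) := by ring
    _ ≤ L ^ (w + d + 4) * (2 * (35 * C ^ (2 * j + 4) * (Y + X)) + C ^ (2 * j + 4) * (Y + X)) := by
        gcongr
    _ = _ := by ring

theorem solveTime_le {h₀ dS last : ℕ} (hκ : 2 ≤ κ) (hC : 1 ≤ C) (hm : 1 ≤ m)
    (hL : 1 ≤ L) (hmle : m ≤ C ^ κ * (2 ^ h) ^ (κ * (κ - 1))) (hd : dS ≤ C * (2 ^ h) ^ (κ - 1))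
    (hlast : last ≤ m * (C * (2 ^ h) ^ κ + 1) + dS) (hr : r = 4 * κ ^ 2) (hh : h = N / r + h₀)
    (hh₀ : 1 ≤ h₀) (hR : (R : ℝ) + 1 ≤ 4 * 2 ^ ((N : ℝ) / (2 * r))) :
    (solveTime L (4 * C * (2 ^ h) ^ (κ - 1) + 1) w d (2 ^ (N - κ * h)) m last R : ℝ) ≤
      568 * (C : ℝ) ^ (2 * κ + 2) * 2 ^ (2 * κ ^ 2 * h₀) * 2 ^ ((1 - 1 / (2 * (r : ℝ))) * N) *
        (L : ℝ) ^ (w + d + 4) := by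
  have hr0 : 0 < r := by rw [hr]; positivity
  have hr1 : (0 : ℝ) < r := mod_cast hr0
  have hrκ : (r : ℝ) = 4 * (κ : ℝ) ^ 2 := by rw [hr]; push_cast; ring
  have hr2 : (2 : ℝ) ≤ r := by
    have : 2 ≤ r := by rw [hr]; nlinarith
    exact_mod_cast this
  have hNr : (N : ℝ) / r ≤ h := by
    rw [div_le_iff₀ hr1]
    have h1 : N < r * (N / r + 1) := Nat.lt_mul_div_succ N hr0
    have h2 : N ≤ h * r := by
      rw [hh, mul_comm]
      exact h1.le.trans (Nat.mul_le_mul_left _ (by omega))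
    exact_mod_cast h2
  have hhle : (h : ℝ) ≤ (N : ℝ) / r + h₀ := by
    rw [hh]
    push_cast
    gcongr
    exact Nat.cast_div_le
  have hN0 : (0 : ℝ) ≤ N := by positivity
  have hhalf : (N : ℝ) / r ≤ N / 2 := by gcongr
  have e1 : ((2 ^ (N - h) : ℕ) : ℝ) ≤ 2 ^ ((N : ℝ) - N / r) := by
    push_cast
    rw [← Real.rpow_natCast]
    refine Real.rpow_le_rpow_of_exponent_le (by norm_num) ?_
    rcases le_total h N with h1 | h1
    · rw [Nat.cast_sub h1]
      linarith
    · rw [Nat.sub_eq_zero_of_le h1, Nat.cast_zero]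
      linarith
  have e2 : (((2 ^ h) ^ (2 * κ ^ 2) : ℕ) : ℝ) ≤ 2 ^ (2 * κ ^ 2 * h₀) * 2 ^ ((N : ℝ) - N / r) := by
    push_cast
    rw [← pow_mul, ← Real.rpow_natCast, ← Real.rpow_natCast 2 (2 * κ ^ 2 * h₀),
      ← Real.rpow_add (by norm_num)]
    refine Real.rpow_le_rpow_of_exponent_le (by norm_num) ?_
    push_cast
    have h1 : (h : ℝ) * (2 * (κ : ℝ) ^ 2) ≤ (N / r + h₀) * (2 * (κ : ℝ) ^ 2) := by gcongr
    have h2 : (N : ℝ) / r * (2 * (κ : ℝ) ^ 2) = N / 2 := by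
      rw [hrκ]
      have : (κ : ℝ) ≠ 0 := by positivity
      field_simp
      norm_num
    nlinarith
  have e3 : (1 : ℝ) ≤ 2 ^ (2 * κ ^ 2 * h₀) := one_le_pow₀ (by norm_num)
  have e4 : (2 : ℝ) ^ ((1 - 1 / (2 * (r : ℝ))) * N) =
      2 ^ ((N : ℝ) / (2 * r)) * 2 ^ ((N : ℝ) - N / r) := by
    rw [← Real.rpow_add (by norm_num)]
    congr 1
    field_simp
    ring
  have e5 : ((2 ^ (N - h) : ℕ) : ℝ) + ((2 ^ h) ^ (2 * κ ^ 2) : ℕ) ≤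
      2 * 2 ^ (2 * κ ^ 2 * h₀) * 2 ^ ((N : ℝ) - N / r) := by
    have : (0 : ℝ) ≤ (2 : ℝ) ^ ((N : ℝ) - N / r) := by positivity
    nlinarith
  have hT := leafTime_le (N := N) (w := w) (d := d) hκ hC hm hL hmle hd hlast
  unfold solveTime
  rw [e4, Nat.cast_mul]
  calc ((R + 1 : ℕ) : ℝ) * ((leafTime L (4 * C * (2 ^ h) ^ (κ - 1) + 1) w (2 ^ (N - κ * h)) m last +
        L ^ d : ℕ) : ℝ)
      ≤ (4 * 2 ^ ((N : ℝ) / (2 * r))) * ((71 * C ^ (2 * κ + 2) * L ^ (w + d + 4) *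
        (2 ^ (N - h) + (2 ^ h) ^ (2 * κ ^ 2)) : ℕ) : ℝ) := by
        gcongr
        push_cast
        exact hR
    _ ≤ (4 * 2 ^ ((N : ℝ) / (2 * r))) * (71 * C ^ (2 * κ + 2) * L ^ (w + d + 4) *
        (2 * 2 ^ (2 * κ ^ 2 * h₀) * 2 ^ ((N : ℝ) - N / r))) := by
        rw [Nat.cast_mul, Nat.cast_add]
        push_cast at e5 ⊢
        gcongr
    _ = _ := by ring

theorem exists_size (k b a W : ℕ) : ∃ c₁, 1 ≤ c₁ ∧ ∀ N M L : ℕ, L = c₁ * (N + M + 1) ^ (k + 1) →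
    a * (N + M + 1) ≤ L ∧ (k + 1) * (k + 1) * (2 * N + 1) ^ k ≤ L ∧ W ≤ L ∧
      ∀ x ≤ a * (N + 1), 2 ^ x * L ^ b < 2 ^ (L - 1) := by
  obtain ⟨L₀, h⟩ := exists_two_pow_mul_pow_lt b
  refine ⟨2 * a + (k + 1) * (k + 1) * 2 ^ k + W + L₀ + 1, by omega, ?_⟩
  rintro N M L rfl
  obtain ⟨B, hB⟩ : ∃ B, B = (N + M + 1) ^ (k + 1) := ⟨_, rfl⟩
  have h1 : N + M + 1 ≤ B := hB ▸ Nat.le_self_pow (by omega) _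
  have h2 : (2 * N + 1) ^ k ≤ 2 ^ k * B := by
    calc (2 * N + 1) ^ k ≤ (2 * (N + M + 1)) ^ k := Nat.pow_le_pow_left (by omega) k
      _ = 2 ^ k * (N + M + 1) ^ k := mul_pow _ _ _
      _ ≤ _ := Nat.mul_le_mul_left _ (hB ▸ Nat.pow_le_pow_right (by omega) (by omega))
  have h3 : a * (N + M + 1) ≤ a * B := Nat.mul_le_mul_left _ h1
  have h4 : (k + 1) * (k + 1) * (2 * N + 1) ^ k ≤ (k + 1) * (k + 1) * 2 ^ k * B := by
    rw [mul_assoc _ (2 ^ k)]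
    exact Nat.mul_le_mul_left _ h2
  have h5 : W ≤ W * B := Nat.le_mul_of_pos_right _ (by omega)
  have h6 : L₀ ≤ L₀ * B := Nat.le_mul_of_pos_right _ (by omega)
  have h7 : a * (N + 1) ≤ a * (N + M + 1) := Nat.mul_le_mul_left _ (by omega)
  rw [← hB]
  have h8 : (2 * a + (k + 1) * (k + 1) * 2 ^ k + W + L₀ + 1) * B =
    2 * (a * B) + (k + 1) * (k + 1) * 2 ^ k * B + W * B + L₀ * B + B := by ring
  rw [h8]
  exact ⟨by omega, by omega, by omega, fun x hx => h _ (by omega) x (by omega)⟩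

/-- The sizes are small if `L` is large. -/
theorem scale_bounds {W : ℕ} (hκ : 2 ≤ κ) (hC : 1 ≤ C) (hD : D + 1 ≤ L)
    (hW : W ≤ L) (hmle : m ≤ C ^ κ * (2 ^ h) ^ (κ * (κ - 1)))
    (hx : 2 ^ (2 * (N + κ ^ 2 * h) + 2 * (12 * C ^ κ) + 4) * L ^ 2 < 2 ^ (L - 1)) :
    ((4 * C * (2 ^ h) ^ (κ - 1) + 1) * m + L) * (4 * W + 1) < 2 ^ (L - 1) ∧
    ((4 * C * (2 ^ h) ^ (κ - 1) + 1) + D + 2 ^ (N - κ * h) + m + (C * 2 ^ (κ * h) + 1) + 2) *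
      (m + (C * 2 ^ (κ * h) + 1) + D + 2 ^ (κ * h) + 2) < 2 ^ (L - 1) ∧
    4 * C * 2 ^ (N + κ * h) + 1 < 2 ^ (L - 1) := by
  obtain ⟨B, hB⟩ : ∃ B, B = 2 ^ (N + κ ^ 2 * h) := ⟨_, rfl⟩
  have hpow : ∀ y ≤ N + κ ^ 2 * h, 2 ^ y ≤ B := fun y hy =>
    hB ▸ Nat.pow_le_pow_right (by norm_num) hy
  have hκh : κ * h ≤ κ ^ 2 * h := Nat.mul_le_mul_right _ (by nlinarith)
  have hκ1 : (κ - 1) * h ≤ κ * h := Nat.mul_le_mul_right _ (Nat.sub_le _ _)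
  have hκ2 : κ * (κ - 1) * h ≤ κ ^ 2 * h :=
    Nat.mul_le_mul_right _ (by rw [sq]; exact Nat.mul_le_mul_left _ (Nat.sub_le _ _))
  have hCκ : C ≤ C ^ κ := Nat.le_self_pow (by omega) C
  rw [← pow_mul, mul_comm h] at hmle
  rw [← pow_mul, mul_comm h]
  obtain ⟨V, hV⟩ : ∃ V, V = C ^ κ := ⟨_, rfl⟩
  have hm : m ≤ V * B := hmle.trans (hV ▸ Nat.mul_le_mul_left _ (hpow _ (by omega)))
  rw [← hV] at hCκ hx
  have p1 : C * 2 ^ ((κ - 1) * h) ≤ V * B := Nat.mul_le_mul hCκ (hpow _ (by omega))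
  have p2 : C * 2 ^ (κ * h) ≤ V * B := Nat.mul_le_mul hCκ (hpow _ (by omega))
  have p3 : C * 2 ^ (N + κ * h) ≤ V * B := Nat.mul_le_mul hCκ (hpow _ (by omega))
  have hVB : B ≤ V * B := Nat.le_mul_of_pos_left _ (by omega)
  have p4 : 2 ^ (N - κ * h) ≤ V * B := (hpow _ (by omega)).trans hVB
  have p5 : 2 ^ (κ * h) ≤ V * B := (hpow _ (by omega)).trans hVB
  have hB1 : 1 ≤ B := hB ▸ Nat.one_le_two_pow
  obtain ⟨G, hG⟩ : ∃ G, G = 12 * (V * B) := ⟨_, rfl⟩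
  have hkey : G * G * 16 * L ^ 2 < 2 ^ (L - 1) := by
    refine lt_of_le_of_lt (Nat.mul_le_mul_right _ ?_) hx
    have h1 : G ≤ 2 ^ (12 * V) * B := by
      rw [hG, ← mul_assoc]
      exact Nat.mul_le_mul_right _ Nat.lt_two_pow_self.le
    calc G * G * 16 ≤ (2 ^ (12 * V) * B) * (2 ^ (12 * V) * B) * 16 := by gcongr
      _ = _ := by rw [hB]; ring
  have hL : 1 ≤ L := by omega
  have hG1 : 1 ≤ G := by omega
  have hGL : G ≤ G * L := Nat.le_mul_of_pos_right _ hL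
  have hLG : L ≤ G * L := Nat.le_mul_of_pos_left _ hG1
  have hGGL : G * L ≤ G * G * L := by
    rw [mul_assoc]
    exact Nat.le_mul_of_pos_left _ hG1
  obtain ⟨U, hU⟩ : ∃ U, U = 4 * C * 2 ^ ((κ - 1) * h) + 1 := ⟨_, rfl⟩
  rw [← hU]
  rw [mul_assoc] at hU
  refine ⟨lt_of_le_of_lt ?_ hkey, lt_of_le_of_lt ?_ hkey, lt_of_le_of_lt ?_ hkey⟩
  · have h1 : U * m ≤ G * G := Nat.mul_le_mul (by omega) (by omega)
    calc (U * m + L) * (4 * W + 1) ≤ (G * G * L + G * G * L) * (5 * L) :=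
          Nat.mul_le_mul (Nat.add_le_add (h1.trans (Nat.le_mul_of_pos_right _ hL)) (by omega))
            (by omega)
      _ = G * G * 10 * L ^ 2 := by ring
      _ ≤ _ := by gcongr; norm_num
  · calc _ ≤ (2 * (G * L)) * (2 * (G * L)) := Nat.mul_le_mul (by omega) (by omega)
      _ = G * G * 4 * L ^ 2 := by ring
      _ ≤ _ := by gcongr; norm_num
  · calc _ ≤ G * 1 * 1 * 1 := by rw [mul_assoc]; omega
      _ ≤ G * G * 16 * L ^ 2 := by
        gcongr
        · norm_num
        · exact Nat.one_le_pow _ _ hL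

theorem scale_ofVars {s : ℕ} (hκ : 2 ≤ κ) (hC : 1 ≤ C)
    (h1 : 2 ^ h ≤ m) (h2 : 1 + 2 * N * s + 1 ≤ d) (h3 : d ≤ C * (2 ^ h) ^ (κ - 1))
    (h4 : 1 + 2 * N * s + 1 ≤ L) (h5 : p.weight ≤ L)
    (h6 : ((4 * C * (2 ^ h) ^ (κ - 1) + 1) * m + L) * (4 * p.weight + 1) < 2 ^ (L - 1))
    (h7 : ((4 * C * (2 ^ h) ^ (κ - 1) + 1) + (1 + 2 * N * s) + 2 ^ (N - κ * h) + m +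
      (C * 2 ^ (κ * h) + 1) + 2) *
      (m + (C * 2 ^ (κ * h) + 1) + (1 + 2 * N * s) + 2 ^ (κ * h) + 2) < 2 ^ (L - 1))
    (h8 : ∀ (J : Instance (2 ^ (κ * h)) m d) (g : EuclideanSpace ℝ (Fin (2 ^ (κ * h)))) (t : ℕ)
      (s : Memory), J.EntriesLE K → J.IsGradient l g → Runs p J.input t s →
      t ≤ C * (2 ^ h) ^ (κ - 1) * m) :
    Scale p l K L (4 * C * 2 ^ ((κ - 1) * h) + 1) (2 ^ (L - 1) - 1) m d (.ofVars κ C s N h) := by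
  have hpow : ∀ j, 2 ^ (j * h) = (2 ^ h) ^ j := fun j => by rw [← pow_mul, mul_comm]
  have hκ1 : (2 ^ h) ^ κ = (2 ^ h) ^ (κ - 1) * 2 ^ h := by
    rw [← pow_succ, Nat.sub_add_cancel (by omega)]
  refine ⟨h1, Nat.one_le_two_pow, h2, ?_, ?_, le_rfl, h4, h5, ?_,
    Nat.sub_lt (by positivity) one_pos, ?_, fun J g t s' hJ hg hr => ?_⟩
  · change d - _ < C * 2 ^ (κ * h) + 1
    have h9 : C * (2 ^ h) ^ (κ - 1) ≤ C * 2 ^ (κ * h) := by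
      rw [hpow]
      exact Nat.mul_le_mul_left _ (Nat.pow_le_pow_right Nat.one_le_two_pow (Nat.sub_le _ _))
    omega
  · change 2 ^ (κ * h) ≤ _ * 2 ^ h
    rw [hpow, hpow, hκ1]
    have h9 := Nat.le_mul_of_pos_left ((2 ^ h) ^ (κ - 1)) hC
    refine Nat.mul_le_mul_right _ ?_
    rw [mul_assoc]
    omega
  · rw [hpow]
    exact h6.trans_le (Nat.pow_le_pow_right (by norm_num) (Nat.sub_le _ _))
  · rw [hpow]
    exact Nat.le_sub_one_of_lt h7
  · change 4 * t ≤ 4 * C * 2 ^ ((κ - 1) * h) * m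
    rw [hpow, mul_assoc 4, mul_assoc 4]
    exact Nat.mul_le_mul_left _ (h8 J g t s' hJ hg hr)

set_option maxHeartbeats 1000000 in
theorem needsAlmostProductTime_of_seth {c : ℝ} (hp : Detects l K δ c p) (hS : SETH) {m d : ℕ → ℕ} (hm : ∀ n, 1 ≤ m n)
    (hd : Tendsto (fun n : ℕ => (d n : ℝ) / Real.log n) atTop atTop) :
    NeedsAlmostProductTime l K m d p := by
  by_contra hn
  obtain ⟨κ, C, n₀, hκ, hC, hfast⟩ := exists_fast_of_not_needsAlmostProductTime hm hn
  obtain ⟨r, hr⟩ : ∃ r, r = 4 * κ ^ 2 := ⟨_, rfl⟩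
  have hr0 : 0 < r := by rw [hr]; positivity
  have hr1 : (0 : ℝ) < r := mod_cast hr0
  obtain ⟨k, hk⟩ := hS (1 - 1 / (2 * (r : ℝ))) (by
    have : (0 : ℝ) < 1 / (2 * (r : ℝ)) := by positivity
    linarith)
  refine hk ?_
  obtain ⟨θ, hθ, hφ⟩ := exists_thresholds k (4 * r) (by omega)
  obtain ⟨s, hs⟩ : ∃ s, s = 1 + ∑ i ∈ range k, θ i := ⟨_, rfl⟩
  have hlog2 : 0 < Real.log 2 := Real.log_pos (by norm_num)
  obtain ⟨n₁, hn₁⟩ := eventually_atTop.1 (hd.eventually_ge_atTop ((2 + 2 * s) * r / Real.log 2))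
  obtain ⟨h₀, hh₀⟩ : ∃ h₀, h₀ = n₀ + n₁ + C ^ κ + 1 := ⟨_, rfl⟩
  obtain ⟨w, e, hrun⟩ := exists_runs_solve hp hθ (s := s) (show 1 ≤ κ by omega) hC r h₀
    k hs
  obtain ⟨A, hA⟩ : ∃ A, A = 568 * C ^ (2 * κ + 2) * 2 ^ (2 * κ ^ 2 * h₀) := ⟨_, rfl⟩
  obtain ⟨a, ha⟩ : ∃ a, a = (2 + 2 * κ ^ 2 + 2 * (κ ^ 2 * h₀) + 2 * (12 * C ^ κ) + 4) + (2 + A) +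
    (4 + κ + κ * h₀) + (2 + 2 * s) := ⟨_, rfl⟩
  obtain ⟨c₁, hc₁, hsize⟩ := exists_size k (w + e + 4) a p.weight
  refine ⟨p.solve θ κ C s r h₀ k, A * c₁ ^ (w + e + 4), (k + 1) * (w + e + 4), fun ψ => ?_⟩
  obtain ⟨L, hL⟩ : ∃ L, L = c₁ * (ψ.N + ψ.M + 1) ^ (k + 1) := ⟨_, rfl⟩
  obtain ⟨h, hh⟩ : ∃ h, h = ψ.N / r + h₀ := ⟨_, rfl⟩
  obtain ⟨s1, s2, s3, s4⟩ := hsize ψ.N ψ.M L hL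
  have hh2 : h₀ ≤ h := hh ▸ Nat.le_add_left _ _
  have hh3 : h ≤ ψ.N + h₀ := hh ▸ Nat.add_le_add_right (Nat.div_le_self _ _) _
  have hlt : h < 2 ^ h := Nat.lt_two_pow_self
  obtain ⟨n, hn⟩ : ∃ n, n = 2 ^ (κ * h) := ⟨_, rfl⟩
  have hpow : ∀ j, 2 ^ (j * h) = (2 ^ h) ^ j := fun j => by rw [← pow_mul, mul_comm]
  have hnH : n = (2 ^ h) ^ κ := hn.trans (hpow κ)
  have hhn : h ≤ n := hlt.le.trans (hnH ▸ Nat.le_self_pow (by omega) _)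
  have hn1 : 1 ≤ n := hn ▸ Nat.one_le_two_pow
  have hdn : 1 + 2 * ψ.N * s + 1 ≤ d n := by
    have h1 := hn₁ n (by omega)
    have hlogn : Real.log n = κ * h * Real.log 2 := by
      rw [hn]
      push_cast
      rw [Real.log_pow]
      push_cast
      ring
    have hh4 : 0 < h := by omega
    rw [hlogn, div_le_div_iff₀ hlog2 (by positivity), ← mul_assoc] at h1
    have h2 := le_of_mul_le_mul_right h1 hlog2
    have h3 : ψ.N + 1 ≤ r * h := by
      have h4 : ψ.N < r * (ψ.N / r + 1) := Nat.lt_mul_div_succ _ hr0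
      exact h4.trans_le (Nat.mul_le_mul_left _ (by rw [hh]; omega))
    have h4 : (2 + 2 * s) * r * (κ * h) ≤ d n := mod_cast h2
    have h5 : r * h ≤ r * (κ * h) := Nat.mul_le_mul_left _ (Nat.le_mul_of_pos_left _ (by omega))
    have h6 : (2 + 2 * s) * (ψ.N + 1) ≤ (2 + 2 * s) * (r * (κ * h)) :=
      Nat.mul_le_mul_left _ (h3.trans h5)
    have h7 : (2 + 2 * s) * (ψ.N + 1) = 1 + 2 * ψ.N * s + 1 + (2 * ψ.N + 2 * s) := by ring
    rw [mul_assoc (2 + 2 * s) r] at h4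
    omega
  obtain ⟨I, g, t, σ, hI, hg, hr', ht1, ht2⟩ := exists_slow_instance (m := m n) (d := d n) hp hn1
  have ht := hfast n (by omega) I g t σ hI hg hr'
  obtain ⟨b1, b2, b3⟩ := bounds_of_fast hκ hC (hm n) (by omega) (show C ^ κ ≤ 2 ^ h by omega)
    (hnH ▸ ht) (hnH ▸ ht1) ht2
  have hdim : 1 + 2 * ψ.N * s + 1 ≤ L := by
    refine le_trans ?_ ((Nat.mul_le_mul_right _ (show 2 + 2 * s ≤ a by omega)).trans s1)
    have h1 : (2 + 2 * s) * (ψ.N + ψ.M + 1) =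
      1 + 2 * ψ.N * s + 1 + (2 * ψ.N + 2 * ψ.M + 2 * s * ψ.M + 2 * s) := by ring
    omega
  have hL1 : 1 ≤ L := by omega
  have hLmono : L ^ 2 ≤ L ^ (w + e + 4) := Nat.pow_le_pow_right hL1 (by omega)
  have hexps : 2 * (ψ.N + κ ^ 2 * h) + 2 * (12 * C ^ κ) + 4 ≤ a * (ψ.N + 1) := by
    refine le_trans ?_ (Nat.mul_le_mul_right _
      (show 2 + 2 * κ ^ 2 + 2 * (κ ^ 2 * h₀) + 2 * (12 * C ^ κ) + 4 ≤ a by omega))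
    have h1 : κ ^ 2 * h ≤ κ ^ 2 * (ψ.N + h₀) := Nat.mul_le_mul_left _ hh3
    rw [mul_add] at h1
    have h2 : (2 + 2 * κ ^ 2 + 2 * (κ ^ 2 * h₀) + 2 * (12 * C ^ κ) + 4) * (ψ.N + 1) =
      2 * ψ.N + 2 * (κ ^ 2 * ψ.N) + 2 * (κ ^ 2 * h₀) + 2 * (12 * C ^ κ) + 4 + (2 + 2 * κ ^ 2 +
        (2 * (κ ^ 2 * h₀) + 2 * (12 * C ^ κ) + 4) * ψ.N) := by ring
    omega
  obtain ⟨z1, z2, z3⟩ := scale_bounds hκ hC hdim s3 b3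
    (lt_of_le_of_lt (Nat.mul_le_mul_left _ hLmono) (s4 _ hexps))
  have hlast : (Params.ofVars κ C s ψ.N h).last (m n) (d n) ≤
      m n * (C * (2 ^ h) ^ κ + 1) + d n := by
    rw [← hpow]
    exact Nat.add_le_add (Nat.mul_le_mul_right _ (Nat.sub_le _ _)) (Nat.sub_le _ _)
  obtain ⟨φ, f1, f2, f3⟩ := hφ (2 * ψ.N)
  obtain ⟨R, hR⟩ : ∃ R, R = ⌈(2 : ℝ) * 2 ^ (((2 * ψ.N : ℕ) : ℝ) / ((4 * r : ℕ) : ℝ))⌉₊ := ⟨_, rfl⟩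
  have hexp : ((2 * ψ.N : ℕ) : ℝ) / ((4 * r : ℕ) : ℝ) = (ψ.N : ℝ) / (2 * r) := by
    push_cast
    field_simp
    ring
  have hRle : (R : ℝ) + 1 ≤ 4 * 2 ^ ((ψ.N : ℝ) / (2 * r)) := by
    have h1 : (1 : ℝ) ≤ 2 ^ ((ψ.N : ℝ) / (2 * r)) :=
      Real.one_le_rpow (by norm_num) (by positivity)
    have h2 := Nat.ceil_lt_add_one (a := (2 : ℝ) * 2 ^ ((ψ.N : ℝ) / (2 * r))) (by positivity)
    rw [hR, hexp]
    linarith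
  have htime := solveTime_le (N := ψ.N) (w := w) (d := e) hκ hC (hm n) hL1 b3 b2 hlast hr hh
    (by omega) hRle
  rw [← hpow] at htime
  have hAcast : 568 * (C : ℝ) ^ (2 * κ + 2) * 2 ^ (2 * κ ^ 2 * h₀) = A := by
    rw [hA]
    push_cast
    rfl
  rw [hAcast] at htime
  have htimeZ : solveTime L (4 * C * 2 ^ ((κ - 1) * h) + 1) w e (2 ^ (ψ.N - κ * h)) (m n)
      ((Params.ofVars κ C s ψ.N h).last (m n) (d n)) R ≤ 2 ^ (L - 1) - 1 := by
    have h1 : (2 : ℝ) ^ ((1 - 1 / (2 * (r : ℝ))) * ψ.N) ≤ 2 ^ (ψ.N : ℝ) := by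
      refine Real.rpow_le_rpow_of_exponent_le (by norm_num) ?_
      have : 0 ≤ 1 / (2 * (r : ℝ)) * ψ.N := by positivity
      linarith
    rw [Real.rpow_natCast] at h1
    have h2 : (A : ℝ) * 2 ^ ((1 - 1 / (2 * (r : ℝ))) * ψ.N) * (L : ℝ) ^ (w + e + 4) ≤
        A * 2 ^ ψ.N * (L : ℝ) ^ (w + e + 4) := by gcongr
    have h3 := htime.trans h2
    have h4 : solveTime L (4 * C * 2 ^ ((κ - 1) * h) + 1) w e (2 ^ (ψ.N - κ * h)) (m n)
      ((Params.ofVars κ C s ψ.N h).last (m n) (d n)) R ≤ A * 2 ^ ψ.N * L ^ (w + e + 4) := by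
      exact_mod_cast h3
    have h5 : A * 2 ^ ψ.N * L ^ (w + e + 4) ≤ 2 ^ (A + ψ.N) * L ^ (w + e + 4) := by
      rw [pow_add 2 A]
      exact Nat.mul_le_mul_right _ (Nat.mul_le_mul_right _ Nat.lt_two_pow_self.le)
    have h6 := s4 (A + ψ.N) (le_trans (by
      have h7 : (2 + A) * (ψ.N + 1) = A + ψ.N + (ψ.N + A * ψ.N + 2) := by ring
      omega) (Nat.mul_le_mul_right _ (show 2 + A ≤ a by omega)))
    omega
  have S : Scale p l K L (4 * C * 2 ^ ((κ - 1) * h) + 1) (2 ^ (L - 1) - 1) (m n) (d n)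
      (.ofVars κ C s ψ.N h) := by
    subst hn
    exact scale_ofVars hκ hC b1 hdn b2 hdim s3 z1 z2 fun J g t s' hJ hg hr =>
      le_of_pow_le (H := 2 ^ h) hκ (hm _) (hnH ▸ hfast _ (by omega) J g t s' hJ hg hr)
  obtain ⟨t', σ', hrun', hsat, ht'⟩ := hrun S f1 f2 (f3.trans (hR ▸ Nat.le_ceil _)) hh (by
      refine le_trans ?_ ((Nat.mul_le_mul_right _ (show 4 + κ + κ * h₀ ≤ a by omega)).trans s1)
      have h1 : κ * h ≤ κ * (ψ.N + h₀) := Nat.mul_le_mul_left _ hh3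
      rw [mul_add] at h1
      have h2 : (4 + κ + κ * h₀) * (ψ.N + ψ.M + 1) = ψ.N + ψ.M + (κ * ψ.N + κ * h₀) + 4 +
        (3 * ψ.N + 3 * ψ.M + κ * ψ.M + κ + κ * h₀ * (ψ.N + ψ.M)) := by ring
      omega) s2 (by omega) htimeZ
  refine ⟨t', σ', hrun', hsat, ((Nat.cast_le.2 ht').trans htime).trans_eq ?_⟩
  rw [hL, pow_mul]
  push_cast
  rw [mul_pow]
  ring

end FineGrained

open FineGrained

theorem theorem5 (l : ℝ → ℝ) (hl : l = logisticLoss ∨ l = hingeLoss) :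
    (SETH →
      ∀ m d : ℕ → ℕ, (∀ n, 1 ≤ m n) →
        Tendsto (fun n : ℕ => (d n : ℝ) / Real.log n) atTop atTop →
        ∀ K : ℕ, 2 ≤ K → ∀ δ : ℝ, 0 ≤ δ → δ ≤ 1 / 4 →
          ∀ p : Prog, ComputesGradient l K δ p → NeedsAlmostProductTime l K m d p) ∧
    (DifferentiableAt ℝ l 0 ∧ deriv l 0 ≠ 0 ∧
      ∀ (n m d : ℕ) (A : Fin m → Fin d → Bool) (B : Fin n → Fin d → Bool),
        ∃ g : EuclideanSpace ℝ (Fin n), (ovInstance A B).IsGradient l g ∧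
          ∑ j, g j = deriv l 0 * orthogonalPairs A B) := by
  obtain ⟨c, hc, hc'⟩ := exists_hasDerivAt_loss hl
  refine ⟨fun hS m d hm hd K hK δ _ hδ p hp =>
    needsAlmostProductTime_of_seth ⟨hc, hc', hK, hδ, hp⟩ hS hm hd, hc.differentiableAt, ?_, ?_⟩
  · rw [hc.deriv]
    linarith
  · intro n m d A B
    rw [hc.deriv]
    exact sum_gradient_ovInstance hc A B
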